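/- **Setting.** Let $\mathbb X$ be $\mathbb R$ or a subinterval of it. A lattice $\mathcal L=\bigcup_{k\in\mathbb Z}\mathcal L_k$ consists of generations $\mathcal L_k$; each generation is a collection of disjoint bounded non-trivial intervals $[a,b)$ covering $\mathbb X$, and each $I\in\mathcal L_k$ is a finite union of intervals of $\mathcal L_{k+1}$ (possibly $I\in\mathcal L_{k+1}$). If $k$ is the largest integer with $I\in\mathcal L_k$, the children of $I$ are the intervals of $\mathcal L_{k+1}$ contained in $I$ (there are none if no largest $k$ exists). Put $\langle f\rangle_I=|I|^{-1}\int_I f$, $\mathbb E_If=\langle f\rangle_I\mathbf 1_I$ and $\Delta_If=\sum_{J\in\mathrm{child}(I)}\mathbb E_Jf-\mathbb E_If$ ($\Delta_I f=0$ if $I$ has no children). Let $\mathcal T$ be the set of all unions $\bigcup_kI_k$ of finite length, where $I_k\in\mathcal L_k$ and $I_k\subset I_{k-1}$ for all $k$. A martingale difference sequence is a family $b=\{\Delta_Ib\}_{I\in\mathcal L}$ of functions such that $\Delta_Ib$ is supported on $I$, constant on each child of $I$, of integral $0$ (and is $0$ if $I$ has no children). Functions are scalar (real or complex) and measurable with respect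 to the $\sigma$-algebra generated by $\mathcal L$. For a family consisting of differences $\Delta_I f$, $I\in\mathcal L$, and terms $\mathbb E_Tf$, $T\in\mathcal T$, put $$\|f\|_{\widetilde{\mathcal H}^p_q}=\Bigl\|\Bigl(\sum_{I\in\mathcal L}|\Delta_If|^q+\sum_{T\in\mathcal T}|\mathbb E_Tf|^q\Bigr)^{1/q}\Bigr\|_{L^p(\mathbb X)} .$$ $\mathcal H^p_q$ is the space of formal decompositions of finite norm with all $\mathbb E_Tf=0$. For $1\le p<\infty$, $\widetilde H^p$ is the space of $f\in L^p$ with $\|f\|_{\widetilde H^p}:=\|f\|_{\widetilde{\mathcal H}^p_2}<\infty$. The paraproduct $\pi_bf$ is the formal decomposition with $\Delta_I(\pi_bf)=(\mathbb E_If)(\Delta_Ib)$ and $\mathbb E_T(\pi_bf)=0$; the extended paraproduct is $\pi^{(*)}_bf=\sum_{I\in\mathcal L}(\Delta_Ib)(\Delta_If)$, boundedness on $\widetilde H^p$ meaning that for every $f\in\widetilde H^p$ the series converges unconditionally in $\widetilde H^p$ and the norm of the sum is at most a constant times $\|f\|_{\widetilde H^p}$. Finally $b\in\mathcal{BMO}=\mathcal{BMO}_2$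 means that $$\|b\|_{\mathcal{BMO}}=\sup_{J\in\mathcal L}\Bigl(\frac1{|J|}\int_J\sum_{I\in\mathcal L,\,I\subset J}|x_I|^2\mathbf 1_I\,dx\Bigr)^{1/2}<\infty ,$$ where $x_I$ is the value of $\Delta_Pb$ on $I$ if $I$ is a child of $P$, and $x_I=0$ if $I$ is nobody's child. **Theorem.** Let $b=\{\Delta_Ib\}_{I\in\mathcal L}$ be a martingale difference sequence. 1. Let $p\in[1,\infty)$, $q\in(1,\infty)$. The paraproduct $\pi_b$ is bounded from $\widetilde H^p$ to $\mathcal H^p_q$ if and only if $$\sup_{I\in\mathcal L}\frac1{|I|}\int_I\Bigl(\sum_{J\in\mathcal L,\,J\subset I}|\Delta_Jb(x)|^q\Bigr)^{p/q}dx=:K^p<\infty .$$ Moreover $K\le c\,\|\pi_b\|_{\widetilde H^p\to\mathcal H^p_q}\le c\,C\,K$ with positive constants $c=c(p)$ and $C=C(p,q)$. If $p>1$ and the domain is given the $L^p$ norm instead, then $K\le\|\pi_b\|_{L^p\to\mathcal H^p_q}$. 2. Let $p\in(1,\infty)$. The extended paraproduct $\pi^{(*)}_b$ is bounded on $\widetilde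 H^p$ if and only if $b\in\mathcal{BMO}$, and $\frac1C\|b\|_{\mathcal{BMO}}\le\|\pi^{(*)}_b\|_{\widetilde H^p\to\widetilde H^p}\le C\|b\|_{\mathcal{BMO}}$ with $C=C(p)>0$. 3. If $b\in\mathcal{BMO}$, then $\pi_b$ is bounded from $\widetilde H^p$ to $\mathcal H^p_2$ for every $p\in[1,\infty)$. This is not necessary: call $\mathcal L$ homogeneous if for some $r,R<\infty$ every $I\in\mathcal L_k$ contains at most $r$ intervals $J\in\mathcal L_{k+1}$ and $|I|\le R|J|$ for each of them; in every non-homogeneous lattice there is a martingale difference sequence $b\notin\mathcal{BMO}$ such that $\pi_b$ is bounded from $\widetilde H^p$ to $\mathcal H^p_2$ for every $p\in[1,\infty)$. -/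

import Mathlib

open MeasureTheory Set Filter Topology
open scoped ENNReal NNReal

noncomputable section

/-- A lattice of half-open intervals of an interval `carrier ⊆ ℝ`: for every `k : ℤ` the
generation `gen k` consists of disjoint bounded non-trivial intervals `[a, b)` covering the
carrier, and `gen (k + 1)` is a finite refinement of `gen k` (an interval of `gen k` is allowed
to belong to `gen (k + 1)` again). -/
structure IntervalLattice where
  carrier : Set ℝ
  ordConnected : carrier.OrdConnected
  gen : ℤ → Set (Set ℝ)
  isInterval : ∀ k, ∀ I ∈ gen k, ∃ a b : ℝ, a < b ∧ I = Set.Ico a b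
  disjoint : ∀ k, (gen k).PairwiseDisjoint id
  cover : ∀ k, ⋃₀ gen k = carrier
  refinement : ∀ k, ∀ I ∈ gen k,
    ∃ F : Set (Set ℝ), F.Finite ∧ F ⊆ gen (k + 1) ∧ ⋃₀ F = I

namespace IntervalLattice

/-- All intervals of the lattice. -/
def intervals (L : IntervalLattice) : Set (Set ℝ) := ⋃ k, L.gen k

/-- `k` is the largest integer with `I ∈ gen k`. -/
def IsRank (L : IntervalLattice) (I : Set ℝ) (k : ℤ) : Prop :=
  I ∈ L.gen k ∧ ∀ m, I ∈ L.gen m → m ≤ k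

/-- The children of `I`: the intervals of generation `rk I + 1` contained in `I`. There are none
if `I` has no rank, i.e. if `I` is never subdivided. -/
def child (L : IntervalLattice) (I : Set ℝ) : Set (Set ℝ) :=
  {J | ∃ k, L.IsRank I k ∧ J ∈ L.gen (k + 1) ∧ J ⊆ I}

/-- The unions of full chains `⋯ ⊆ I (k + 1) ⊆ I k ⊆ I (k - 1) ⊆ ⋯`, `I k ∈ gen k`, that have
finite length. -/
def finTops (L : IntervalLattice) : Set (Set ℝ) :=
  {T | (∃ I : ℤ → Set ℝ, (∀ k, I k ∈ L.gen k) ∧ (∀ k, I k ⊆ I (k - 1)) ∧ T = ⋃ k, I k) ∧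
    volume T < ∞}

/-- The σ-algebra generated by all the intervals of the lattice. -/
abbrev sigmaInf (L : IntervalLattice) : MeasurableSpace ℝ :=
  MeasurableSpace.generateFrom L.intervals

/-- Lebesgue measure on the carrier. -/
def vol (L : IntervalLattice) : Measure ℝ := volume.restrict L.carrier

/-- The lattice is homogeneous: every interval of `gen k` contains at most `r` intervals of
`gen (k + 1)`, and the lengths of those are comparable with its length. -/
def IsHomogeneous (L : IntervalLattice) : Prop :=
  (∃ r : ℕ, ∀ k, ∀ I ∈ L.gen k, {J | J ∈ L.gen (k + 1) ∧ J ⊆ I}.encard ≤ r) ∧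
  ∃ K : ℝ≥0, ∀ k, ∀ I ∈ L.gen k, ∀ J ∈ L.gen (k + 1), J ⊆ I → volume I ≤ K * volume J

variable {𝕜 : Type*} [RCLike 𝕜]

/-- The averaging operator `E_I f = ⟨f⟩_I 1_I`. -/
def avg (I : Set ℝ) (f : ℝ → 𝕜) : ℝ → 𝕜 :=
  I.indicator fun _ => ⨍ y in I, f y

open Classical in
/-- The martingale difference `Δ_I f = ∑_{J ∈ child I} E_J f - E_I f`; it is zero if `I` is never
subdivided. -/
def mdiff (L : IntervalLattice) (I : Set ℝ) (f : ℝ → 𝕜) : ℝ → 𝕜 := fun x =>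
  if (L.child I).Nonempty then (∑ᶠ J ∈ L.child I, avg J f x) - avg I f x else 0

/-- A formal martingale difference sequence `b = {Δ_I b}`: `b I` lives on `I`, is constant on
the children of `I` and has integral zero (in particular `b I = 0` if `I` has no children). -/
def IsMartDiffSeq (L : IntervalLattice) (b : L.intervals → ℝ → 𝕜) : Prop :=
  ∀ I : L.intervals,
    (∀ x, x ∉ ⋃₀ L.child I → b I x = 0) ∧
    (∀ J ∈ L.child I, ∀ x ∈ J, ∀ y ∈ J, b I x = b I y) ∧
    ∫ x, b I x = 0

/-- The norm of a formal martingale difference decomposition in the extended space `H̃^p_q`: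
`h I` plays the role of `Δ_I f` and `e T` the role of `E_T f`. On families with `e = 0` it is the
norm of `H^p_q`. -/
def hardyENorm (L : IntervalLattice) (p q : ℝ) (h : L.intervals → ℝ → 𝕜)
    (e : L.finTops → ℝ → 𝕜) : ℝ≥0∞ :=
  (∫⁻ x, (((∑' I : L.intervals, ‖h I x‖ₑ ^ q) + ∑' T : L.finTops, ‖e T x‖ₑ ^ q) ^ (1 / q)) ^ p
    ∂L.vol) ^ (1 / p)

/-- The norm of a function in the extended martingale Hardy space `H̃^p`: the `L^p` norm of the
extended square function. -/
def hardyENormFun (L : IntervalLattice) (p : ℝ) (f : ℝ → 𝕜) : ℝ≥0∞ :=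
  L.hardyENorm p 2 (fun I => L.mdiff I f) (fun T => avg (T : Set ℝ) f)

/-- `f` is a function of `L^p` on the carrier, measurable (modulo null sets) with respect to the
σ-algebra of the lattice. -/
def MemLpLattice (L : IntervalLattice) (p : ℝ) (f : ℝ → 𝕜) : Prop :=
  AEStronglyMeasurable[L.sigmaInf] f L.vol ∧ MemLp f (ENNReal.ofReal p) L.vol

/-- `f` belongs to the extended martingale Hardy space `H̃^p`. -/
def MemHardy (L : IntervalLattice) (p : ℝ) (f : ℝ → 𝕜) : Prop :=
  L.MemLpLattice p f ∧ L.hardyENormFun p f < ∞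

/-- The paraproduct `π_b f = ∑_I ⟨f⟩_I Δ_I b`, as the formal martingale difference decomposition
`Δ_I (π_b f) = (E_I f) (Δ_I b)`. -/
def para (L : IntervalLattice) (b : L.intervals → ℝ → 𝕜) (f : ℝ → 𝕜) : L.intervals → ℝ → 𝕜 :=
  fun I x => avg (I : Set ℝ) f x * b I x

/-- The norm of `π_b f` in `H^p_q`. -/
def paraENorm (L : IntervalLattice) (p q : ℝ) (b : L.intervals → ℝ → 𝕜) (f : ℝ → 𝕜) : ℝ≥0∞ :=
  L.hardyENorm p q (L.para b f) (fun _ _ => 0)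

/-- `‖π_b f‖_{H^p_q} ≤ A ‖f‖_{H̃^p}` for all `f ∈ H̃^p`. -/
def ParaBoundedBy (L : IntervalLattice) (p q : ℝ) (b : L.intervals → ℝ → 𝕜) (A : ℝ≥0) : Prop :=
  ∀ f : ℝ → 𝕜, L.MemHardy p f → L.paraENorm p q b f ≤ A * L.hardyENormFun p f

/-- The norm of `π_b : H̃^p → H^p_q` (infinite if `π_b` is unbounded). -/
def paraOpNorm (L : IntervalLattice) (p q : ℝ) (b : L.intervals → ℝ → 𝕜) : ℝ≥0∞ :=
  ⨅ (A : ℝ≥0) (_ : L.ParaBoundedBy p q b A), (A : ℝ≥0∞)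

/-- `‖π_b f‖_{H^p_q} ≤ A ‖f‖_{L^p}` for all `f ∈ L^p`. -/
def ParaLpBoundedBy (L : IntervalLattice) (p q : ℝ) (b : L.intervals → ℝ → 𝕜) (A : ℝ≥0) : Prop :=
  ∀ f : ℝ → 𝕜, L.MemLpLattice p f →
    L.paraENorm p q b f ≤ A * eLpNorm f (ENNReal.ofReal p) L.vol

/-- The norm of `π_b : L^p → H^p_q` (infinite if `π_b` is unbounded). -/
def paraLpOpNorm (L : IntervalLattice) (p q : ℝ) (b : L.intervals → ℝ → 𝕜) : ℝ≥0∞ :=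
  ⨅ (A : ℝ≥0) (_ : L.ParaLpBoundedBy p q b A), (A : ℝ≥0∞)

open Classical in
/-- The testing constant `K`,
`K ^ p = sup_I ⨍_I (∑_{J ⊆ I} |Δ_J b| ^ q) ^ (p / q)`. -/
def testConst (L : IntervalLattice) (p q : ℝ) (b : L.intervals → ℝ → 𝕜) : ℝ≥0∞ :=
  (⨆ I : L.intervals, laverage (volume.restrict (I : Set ℝ)) fun x =>
    (∑' J : L.intervals, if (J : Set ℝ) ⊆ I then ‖b J x‖ₑ ^ q else 0) ^ (p / q)) ^ (1 / p)

/-- `g = π_b^{(*)} f = ∑_I (Δ_I b) (Δ_I f)`: the series converges unconditionally to `g` in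
`H̃^p`. -/
def IsExtPara (L : IntervalLattice) (p : ℝ) (b : L.intervals → ℝ → 𝕜) (f g : ℝ → 𝕜) : Prop :=
  L.MemHardy p g ∧
  Tendsto (fun F : Finset L.intervals =>
    L.hardyENormFun p (fun x => g x - ∑ I ∈ F, b I x * L.mdiff I f x)) atTop (𝓝 0)

/-- For all `f ∈ H̃^p`, `π_b^{(*)} f` is defined in `H̃^p` and `‖π_b^{(*)} f‖ ≤ A ‖f‖`. -/
def ExtParaBoundedBy (L : IntervalLattice) (p : ℝ) (b : L.intervals → ℝ → 𝕜) (A : ℝ≥0) : Prop :=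
  ∀ f : ℝ → 𝕜, L.MemHardy p f →
    ∃ g, L.IsExtPara p b f g ∧ L.hardyENormFun p g ≤ A * L.hardyENormFun p f

/-- The norm of `π_b^{(*)}` on `H̃^p` (infinite if `π_b^{(*)}` is unbounded). -/
def extParaOpNorm (L : IntervalLattice) (p : ℝ) (b : L.intervals → ℝ → 𝕜) : ℝ≥0∞ :=
  ⨅ (A : ℝ≥0) (_ : L.ExtParaBoundedBy p b A), (A : ℝ≥0∞)

open Classical in
/-- The `BMO_q` norm of a formal martingale difference sequence,
`sup_J (⨍_J ∑_{I ⊆ J} |x_I| ^ q 1_I) ^ (1 / q)`, where for `I ∈ child P` the number `x_I` is the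
value of `Δ_P b` on `I`. Intervals that are nobody's child do not contribute. For `I = J` the
parent `P` is larger than `J`, so the norm also controls the jumps `‖Δ_P b‖_∞`. -/
def bmoENorm (L : IntervalLattice) (q : ℝ) (b : L.intervals → ℝ → 𝕜) : ℝ≥0∞ :=
  ⨆ J : L.intervals, (laverage (volume.restrict (J : Set ℝ)) fun x =>
    ∑' P : L.intervals, ∑' I : L.child P,
      if (I : Set ℝ) ⊆ J then (I : Set ℝ).indicator (fun y => ‖b P y‖ₑ ^ q) x else 0) ^ (1 / q)

end IntervalLattice

end

noncomputable section

/-! ### Elementary inequalities for powers of nonnegative reals -/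

/-! The theorem reduces to martingale inequalities. The intervals containing a point `x` of the
carrier form one chain indexed by the generations, so sums over intervals become sums over `k` of
`term b k x`, `expect k f x` and `diff k f x`; an interval repeated in several generations counts
once, because only at its rank can a difference be nonzero (`tsum_intervals`). Inside an interval of
a coarse generation, a function constant on the intervals of a finer one is a function on a finite
weighted set, and its integral is a finite sum. The inequalities are proved there, with conditional
expectations replaced by testing against nonnegative adapted `ψ` (`CondLE`), and extended to all
generations by Fatou's lemma over the windows `-m, …, m`.

Paraproduct, upper bound. Let `Φ` be the `q`-th power of the running maximum of `|E_k f|` and `β`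
that of `|Δ_k b|`. Abel summation of `∑ Φ β` against the increasing adapted `Φ` brings in the tails
of `β`, which the testing condition controls. This is `carleson`, valid for every exponent `r = p /
q`; it bounds `π_b f` by `K` times the maximal function, and Davis' inequality
`lintegral_iSup_expect_le` bounds the latter by the extended square function even for `p = 1`.
Davis' inequality rests on pathwise inequalities with a predictable integrand, made conditional and
raised to the power `p` by Garsia's lemma.

Paraproduct, lower bound. If `f = 1` on `I`, then `π_b f` has the differences of `b` below `I`. The
question is the price of such an `f` in `H̃^p`: `exists_testFun` gives one with `‖f‖ ^ p ≤ (2 * 3 ^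
p + 1) |I|`, a bound that does not involve `q`. In `L^p` the indicator of `I` does it with constant
one.

Extended paraproduct. With a bounded mean oscillation `b`, Cauchy–Schwarz against `Z ^ (p - 1)`,
where `Z` is the partial sum of `∑ |b_n d_n|`, and a Carleson embedding with the dual exponent bound
this absolute sum in `L^p` (`sum_mul_rpow_le`); since `p > 1`, Burkholder's inequality
`lintegral_sqFun_le` returns from `L^p` to `H̃^p`. Conversely, testing on the finite sums of the
conjugates of `Δ_P b`, `P ⊆ J`, turns the output into `∑ |Δ_P b| ^ 2`, and the resulting inequality
bootstraps to the square sum part of the BMO norm. The single jump into `J` from its parent is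
tested separately, on a function with one nonzero difference.

Comparison. BMO controls sums of weights that are adapted to the children, and for adapted weights a
first moment test controls all moments (`adapted_carleson`); hence BMO gives the testing condition
for all `p`. In a non-homogeneous lattice some children are arbitrarily short compared with their
parents, so jumps of height `2 ^ n` can be put on children so short that every testing constant
stays finite, while BMO sees the heights (`ShortChildSeq`). -/

theorem Real.add_rpow_le_add_mul {a c r : ℝ} (ha : 0 ≤ a) (hc : 0 ≤ c) (hr : 1 ≤ r) :
    (a + c) ^ r ≤ a ^ r + r * (c * (a + c) ^ (r - 1)) := by
  rcases (add_nonneg ha hc).eq_or_lt with h0 | ht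
  · have ha0 : a = 0 := by linarith
    have hc0 : c = 0 := by linarith
    subst ha0 hc0
    simp
  · have h1 : -1 ≤ a / (a + c) - 1 := by
      have : 0 ≤ a / (a + c) := by positivity
      linarith
    have h2 := one_add_mul_self_le_rpow_one_add h1 hr
    rw [add_sub_cancel, Real.div_rpow ha ht.le] at h2
    have hp : 0 < (a + c) ^ r := Real.rpow_pos_of_pos ht r
    have h3 : (a + c) ^ (r - 1) = (a + c) ^ r / (a + c) := by
      rw [Real.rpow_sub_one ht.ne']
    rw [le_div_iff₀ hp] at h2
    rw [h3]
    have h4 : (1 + r * (a / (a + c) - 1)) * (a + c) ^ r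
        = (a + c) ^ r - r * (c * ((a + c) ^ r / (a + c))) := by
      field_simp
      ring
    linarith

/-- The discrete form of `X ^ r = r ∫ X ^ (r - 1) dX`, by telescoping the tangent inequality. The
factor `X ^ (r - 1)` includes the current term, because the tangent is taken at the right end point.
-/
theorem Real.rpow_sum_le_mul_sum {r : ℝ} (hr : 1 ≤ r) (c : ℕ → ℝ) (hc : ∀ n, 0 ≤ c n) (M : ℕ) :
    (∑ i ∈ Finset.range M, c i) ^ r
      ≤ r * ∑ i ∈ Finset.range M, c i * (∑ j ∈ Finset.range (i + 1), c j) ^ (r - 1) := by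
  induction M with
  | zero => simp [Real.zero_rpow (by linarith : r ≠ 0)]
  | succ M ih =>
    have h := Real.add_rpow_le_add_mul
      (Finset.sum_nonneg fun i _ => hc i : 0 ≤ ∑ i ∈ Finset.range M, c i) (hc M) hr
    rw [Finset.sum_range_succ (fun i => c i * _), mul_add, Finset.sum_range_succ c M]
    linarith

/-- Young's inequality in absorbing form: after summation the term `x ^ r / 2` is moved to the
left-hand side. Either `x ≤ 2a`, or `a` is at most `x / 2`. -/
theorem Real.mul_rpow_sub_one_le {a x r : ℝ} (ha : 0 ≤ a) (hx : 0 ≤ x) (hr : 1 ≤ r) :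
    a * x ^ (r - 1) ≤ x ^ r / 2 + (2 * a) ^ r := by
  have key : ∀ t : ℝ, 0 ≤ t → t * t ^ (r - 1) = t ^ r := by
    intro t ht
    rcases ht.eq_or_lt with h | h
    · rw [← h, zero_mul, Real.zero_rpow (by linarith)]
    · rw [Real.rpow_sub_one h.ne']
      field_simp
  have hxr : 0 ≤ x ^ r := Real.rpow_nonneg hx r
  rcases le_total x (2 * a) with h | h
  · have h1 : x ^ (r - 1) ≤ (2 * a) ^ (r - 1) := Real.rpow_le_rpow hx h (by linarith)
    have h2 := key (2 * a) (by linarith)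
    have h3 : 0 ≤ (2 * a) ^ (r - 1) := Real.rpow_nonneg (by linarith) _
    nlinarith
  · have h1 := key x hx
    have h3 : 0 ≤ x ^ (r - 1) := Real.rpow_nonneg hx _
    have h4 : 0 ≤ (2 * a) ^ r := Real.rpow_nonneg (by linarith) _
    nlinarith

theorem Real.add_rpow_le_two_rpow_mul {a b s : ℝ} (ha : 0 ≤ a) (hb : 0 ≤ b) (hs : 0 ≤ s) :
    (a + b) ^ s ≤ 2 ^ s * (a ^ s + b ^ s) := by
  have h : a + b ≤ 2 * max a b := by
    have := le_max_left a b
    have := le_max_right a b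
    linarith
  calc (a + b) ^ s ≤ (2 * max a b) ^ s := Real.rpow_le_rpow (by positivity) h hs
    _ = 2 ^ s * (max a b) ^ s := Real.mul_rpow (by norm_num) (le_max_of_le_left ha)
    _ ≤ 2 ^ s * (a ^ s + b ^ s) := by
      have h1 := Real.rpow_nonneg ha s
      have h2 := Real.rpow_nonneg hb s
      gcongr
      rcases max_choice a b with h | h <;> rw [h] <;> linarith

theorem Real.rpow_add_le_add_rpow_of_le_one {a b r : ℝ} (ha : 0 ≤ a) (hb : 0 ≤ b) (hr : 0 ≤ r)
    (hr1 : r ≤ 1) : (a + b) ^ r ≤ a ^ r + b ^ r := by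
  have := NNReal.rpow_add_le_add_rpow (⟨a, ha⟩ : ℝ≥0) ⟨b, hb⟩ hr hr1
  exact_mod_cast this

theorem Real.rpow_sum_le_sum_rpow {ι : Type*} (s : Finset ι) (f : ι → ℝ) (hf : ∀ i, 0 ≤ f i)
    {r : ℝ} (hr : 0 < r) (hr1 : r ≤ 1) : (∑ i ∈ s, f i) ^ r ≤ ∑ i ∈ s, f i ^ r := by
  classical
  induction s using Finset.induction_on with
  | empty => simp [Real.zero_rpow hr.ne']
  | insert a s ha ih =>
    rw [Finset.sum_insert ha, Finset.sum_insert ha]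
    have := Real.rpow_add_le_add_rpow_of_le_one (hf a)
      (Finset.sum_nonneg fun i _ => hf i : 0 ≤ ∑ i ∈ s, f i) hr.le hr1
    linarith

theorem Real.sum_rpow_le_rpow_sum {ι : Type*} (s : Finset ι) (f : ι → ℝ) (hf : ∀ i, 0 ≤ f i)
    {r : ℝ} (hr : 1 ≤ r) : ∑ i ∈ s, f i ^ r ≤ (∑ i ∈ s, f i) ^ r := by
  classical
  induction s using Finset.induction_on with
  | empty => simp [Real.zero_rpow (by linarith : r ≠ 0)]
  | insert a s ha ih =>
    rw [Finset.sum_insert ha, Finset.sum_insert ha]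
    have := NNReal.add_rpow_le_rpow_add (⟨f a, hf a⟩ : ℝ≥0)
      ⟨∑ i ∈ s, f i, Finset.sum_nonneg fun i _ => hf i⟩ hr
    have h' : f a ^ r + (∑ i ∈ s, f i) ^ r ≤ (f a + ∑ i ∈ s, f i) ^ r := by exact_mod_cast this
    linarith

/-- A weak form of Young's inequality: `Z` is controlled by a constant and `Z ^ r`. -/
theorem Real.le_add_rpow_mul {Z B r : ℝ} (hZ : 0 ≤ Z) (hB : 0 < B) (hr : 1 ≤ r) :
    Z ≤ B + B ^ (1 - r) * Z ^ r := by
  have h0 : 0 ≤ B ^ (1 - r) * Z ^ r :=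
    mul_nonneg (Real.rpow_nonneg hB.le _) (Real.rpow_nonneg hZ _)
  rcases le_total Z B with h | h
  · linarith
  · have hZ' : 0 < Z := hB.trans_le h
    have h1 : Z ^ (1 - r) ≤ B ^ (1 - r) := Real.rpow_le_rpow_of_nonpos hB h (by linarith)
    have h2 : Z = Z ^ (1 - r) * Z ^ r := by
      rw [← Real.rpow_add hZ']
      simp
    have h3 : Z ^ (1 - r) * Z ^ r ≤ B ^ (1 - r) * Z ^ r := by
      gcongr
    linarith

/-- Converts a first moment test into an `r`-th moment test when `r ≤ 1`; compare `Z` with the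
threshold `B`. -/
theorem Real.rpow_le_add_mul {Z B r : ℝ} (hZ : 0 ≤ Z) (hB : 0 < B) (hr : 0 < r) (hr1 : r ≤ 1) :
    Z ^ r ≤ B ^ r + B ^ (r - 1) * Z := by
  have h0 : 0 ≤ B ^ (r - 1) * Z := mul_nonneg (Real.rpow_nonneg hB.le _) hZ
  have hBr := Real.rpow_nonneg hB.le r
  rcases le_total Z B with h | h
  · have : Z ^ r ≤ B ^ r := Real.rpow_le_rpow hZ h hr.le
    linarith
  · have hZ' : 0 < Z := hB.trans_le h
    have h1 : Z ^ (r - 1) ≤ B ^ (r - 1) := Real.rpow_le_rpow_of_nonpos hB h (by linarith)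
    have h2 : Z ^ r = Z ^ (r - 1) * Z := by
      rw [Real.rpow_sub_one hZ'.ne']
      field_simp
    have h3 : Z ^ (r - 1) * Z ≤ B ^ (r - 1) * Z := by gcongr
    linarith

/-! ### Finite filtered measure spaces -/

variable {Ω : Type*} {R : ℕ → Ω → Ω → Prop}

/-- `ψ` is constant on the classes of the `n`-th relation. -/
def AdaptedTo (R : ℕ → Ω → Ω → Prop) (n : ℕ) (ψ : Ω → ℝ) : Prop :=
  ∀ ω ω', R n ω ω' → ψ ω = ψ ω'

theorem AdaptedTo.mono (hR : ∀ n ω ω', R (n + 1) ω ω' → R n ω ω')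
    {m n : ℕ} (hmn : m ≤ n) {ψ : Ω → ℝ} (h : AdaptedTo R m ψ) : AdaptedTo R n ψ := by
  induction n, hmn using Nat.le_induction with
  | base => exact h
  | succ n _ ih => exact fun ω ω' hω => ih ω ω' (hR n ω ω' hω)

/-- Abel summation with the convention `φ (-1) = 0`. It replaces single weights by their tails from
`k` on, the quantity that a testing condition at time `k` bounds. -/
theorem sum_Ico_mul_eq_sum_sub_mul (φ β : ℕ → ℝ) (M : ℕ) :
    ∑ n ∈ Finset.range (M + 1), φ n * β n
      = ∑ k ∈ Finset.range (M + 1), (φ k - if k = 0 then 0 else φ (k - 1)) *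
          ∑ n ∈ Finset.Ico k (M + 1), β n := by
  have hφ : ∀ n, φ n = ∑ k ∈ Finset.range (n + 1), (φ k - if k = 0 then 0 else φ (k - 1)) := by
    intro n
    induction n with
    | zero => simp
    | succ n ih =>
      rw [Finset.sum_range_succ, ← ih]
      simp
  calc ∑ n ∈ Finset.range (M + 1), φ n * β n
      = ∑ n ∈ Finset.Ico 0 (M + 1), ∑ k ∈ Finset.Ico 0 (n + 1),
          (φ k - if k = 0 then 0 else φ (k - 1)) * β n := by
        rw [Finset.range_eq_Ico]
        refine Finset.sum_congr rfl fun n _ => ?_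
        rw [← Finset.sum_mul, ← Finset.range_eq_Ico, ← hφ n]
    _ = ∑ k ∈ Finset.Ico 0 (M + 1), ∑ n ∈ Finset.Ico k (M + 1),
          (φ k - if k = 0 then 0 else φ (k - 1)) * β n := by
        refine Finset.sum_comm' ?_
        intro n k
        simp only [Finset.mem_Ico]
        omega
    _ = _ := by
        rw [Finset.range_eq_Ico]
        exact Finset.sum_congr rfl fun k _ => (Finset.mul_sum _ _ _).symm

theorem AdaptedTo.increment (hR : ∀ n ω ω', R (n + 1) ω ω' → R n ω ω') {Φ : ℕ → Ω → ℝ}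
    (hΦ : ∀ n, AdaptedTo R n (Φ n)) (k : ℕ) :
    AdaptedTo R k (fun ω => Φ k ω - if k = 0 then 0 else Φ (k - 1) ω) := by
  intro ω ω' h
  rcases k with _ | k
  · simp [hΦ 0 ω ω' h]
  · simp [hΦ (k + 1) ω ω' h, hΦ k ω ω' (hR k ω ω' h)]

theorem increment_nonneg {Φ : ℕ → Ω → ℝ} (hΦ0 : ∀ n ω, 0 ≤ Φ n ω)
    (hΦm : ∀ n ω, Φ n ω ≤ Φ (n + 1) ω) (k : ℕ) (ω : Ω) :
    0 ≤ Φ k ω - if k = 0 then 0 else Φ (k - 1) ω := by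
  rcases k with _ | k
  · simpa using hΦ0 0 ω
  · simpa using hΦm k ω

theorem sum_increment (φ : ℕ → ℝ) (M : ℕ) :
    ∑ k ∈ Finset.range (M + 1), (φ k - if k = 0 then 0 else φ (k - 1)) = φ M := by
  induction M with
  | zero => simp
  | succ n ih =>
    rw [Finset.sum_range_succ, ih]
    simp

theorem AdaptedTo.sum_range (hR : ∀ n ω ω', R (n + 1) ω ω' → R n ω ω') {c : ℕ → Ω → ℝ}
    (hc : ∀ n, AdaptedTo R n (c n)) (n : ℕ) :
    AdaptedTo R n (fun ω => ∑ i ∈ Finset.range (n + 1), c i ω) := by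
  intro ω ω' h
  refine Finset.sum_congr rfl fun i hi => ?_
  exact (hc i).mono hR (by simpa [Nat.lt_succ_iff] using hi) ω ω' h

/-- A process between `Φ / 2` and `Φ` that at least doubles whenever it changes. -/
def slowProcess (Φ : ℕ → ℝ) : ℕ → ℝ
  | 0 => Φ 0
  | n + 1 => if Φ (n + 1) ≤ 2 * slowProcess Φ n then slowProcess Φ n else Φ (n + 1)

theorem slowProcess_le {Φ : ℕ → ℝ} (hm : ∀ n, Φ n ≤ Φ (n + 1)) (n : ℕ) :
    slowProcess Φ n ≤ Φ n := by
  induction n with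
  | zero => exact le_rfl
  | succ n ih =>
    rw [slowProcess]
    split_ifs
    · exact ih.trans (hm n)
    · exact le_rfl

theorem slowProcess_nonneg {Φ : ℕ → ℝ} (h0 : ∀ n, 0 ≤ Φ n) (n : ℕ) : 0 ≤ slowProcess Φ n := by
  induction n with
  | zero => exact h0 0
  | succ n ih =>
    rw [slowProcess]
    split_ifs
    exacts [ih, h0 _]

theorem le_two_mul_slowProcess {Φ : ℕ → ℝ} (h0 : ∀ n, 0 ≤ Φ n) (n : ℕ) :
    Φ n ≤ 2 * slowProcess Φ n := by
  cases n with
  | zero =>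
    have := h0 0
    rw [slowProcess]
    linarith
  | succ n =>
    rw [slowProcess]
    split_ifs with h
    · exact h
    · linarith [h0 (n + 1)]

theorem slowProcess_le_succ {Φ : ℕ → ℝ} (h0 : ∀ n, 0 ≤ Φ n) (n : ℕ) :
    slowProcess Φ n ≤ slowProcess Φ (n + 1) := by
  have := slowProcess_nonneg h0 n
  rw [slowProcess]
  split_ifs with h
  · exact le_rfl
  · linarith

/-- For `r < 1` the `r`-th powers of increments need not sum to the order of the final value. For
the slow process they do: its values at least double at each change, so the sum is dominated by a
geometric series. -/
theorem sum_increment_slowProcess_rpow_le {Φ : ℕ → ℝ} (h0 : ∀ n, 0 ≤ Φ n) {r : ℝ} (hr : 0 < r)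
    (M : ℕ) :
    ∑ k ∈ Finset.range (M + 1),
        (slowProcess Φ k - if k = 0 then 0 else slowProcess Φ (k - 1)) ^ r
      ≤ (1 - (2 : ℝ) ^ (-r))⁻¹ * slowProcess Φ M ^ r := by
  have hρ : (2 : ℝ) ^ (-r) < 1 := Real.rpow_lt_one_of_one_lt_of_neg (by norm_num) (by linarith)
  have hρ0 : (0 : ℝ) < 2 ^ (-r) := by positivity
  set C := (1 - (2 : ℝ) ^ (-r))⁻¹ with hC
  -- The geometric constant is the fixed point that closes the induction: a doubling multiplies the
  -- old bound by at most `2 ^ (-r)` and adds one new term.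
  have hC1 : C * 2 ^ (-r) + 1 = C := by
    have : 1 - (2 : ℝ) ^ (-r) ≠ 0 := by linarith
    rw [hC]
    field_simp
    ring
  have hCpos : 0 < C := by
    rw [hC]
    exact inv_pos.mpr (by linarith)
  induction M with
  | zero =>
    have : 0 ≤ slowProcess Φ 0 ^ r := Real.rpow_nonneg (slowProcess_nonneg h0 0) r
    have hC1' : 1 ≤ C := by
      have : 0 < C * 2 ^ (-r) := by positivity
      linarith
    simp only [zero_add, Finset.range_one, Finset.sum_singleton, if_true, sub_zero]
    nlinarith
  | succ M ih =>
    rw [Finset.sum_range_succ]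
    have hV0 := slowProcess_nonneg h0 M
    have hV1 := slowProcess_nonneg h0 (M + 1)
    by_cases h : Φ (M + 1) ≤ 2 * slowProcess Φ M
    · have e : slowProcess Φ (M + 1) = slowProcess Φ M := by
        rw [slowProcess, if_pos h]
      simp only [Nat.add_eq_zero_iff, one_ne_zero, and_false, if_false, Nat.add_sub_cancel]
      rw [e, sub_self, Real.zero_rpow hr.ne', add_zero]
      exact ih
    · have e : 2 * slowProcess Φ M ≤ slowProcess Φ (M + 1) := by
        rw [slowProcess, if_neg h]
        linarith
      simp only [Nat.add_eq_zero_iff, one_ne_zero, and_false, if_false, Nat.add_sub_cancel]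
      have h1 : (slowProcess Φ (M + 1) - slowProcess Φ M) ^ r ≤ slowProcess Φ (M + 1) ^ r :=
        Real.rpow_le_rpow (by linarith) (by linarith) hr.le
      have h2 : slowProcess Φ M ^ r ≤ 2 ^ (-r) * slowProcess Φ (M + 1) ^ r := by
        have : (2 * slowProcess Φ M) ^ r ≤ slowProcess Φ (M + 1) ^ r :=
          Real.rpow_le_rpow (by linarith) e hr.le
        rw [Real.mul_rpow (by norm_num) hV0] at this
        rw [Real.rpow_neg (by norm_num), ← div_eq_inv_mul, le_div_iff₀ (by positivity)]
        linarith
      calc _ ≤ C * (2 ^ (-r) * slowProcess Φ (M + 1) ^ r) + slowProcess Φ (M + 1) ^ r :=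
            add_le_add (ih.trans (mul_le_mul_of_nonneg_left h2 hCpos.le)) h1
        _ = (C * 2 ^ (-r) + 1) * slowProcess Φ (M + 1) ^ r := by ring
        _ = _ := by rw [hC1]

theorem AdaptedTo.slowProcess (hR : ∀ n ω ω', R (n + 1) ω ω' → R n ω ω') {Φ : ℕ → Ω → ℝ}
    (hΦ : ∀ n, AdaptedTo R n (Φ n)) (n : ℕ) :
    AdaptedTo R n (fun ω => _root_.slowProcess (fun n => Φ n ω) n) := by
  induction n with
  | zero => exact hΦ 0
  | succ n ih =>
    intro ω ω' h
    have h1 := ih ω ω' (hR n ω ω' h)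
    have h2 := hΦ (n + 1) ω ω' h
    simp only at h1
    simp only [_root_.slowProcess, h1, h2]

variable [Fintype Ω] {w : Ω → ℝ}

/-- The conditional expectation of `G` at time `k` is at most that of `Y`, in weak form. -/
def CondLE (w : Ω → ℝ) (R : ℕ → Ω → Ω → Prop) (k : ℕ) (G Y : Ω → ℝ) : Prop :=
  ∀ ψ, AdaptedTo R k ψ → (∀ ω, 0 ≤ ψ ω) → ∑ ω, w ω * (ψ ω * G ω) ≤ ∑ ω, w ω * (ψ ω * Y ω)

/-- `x` is a martingale up to time `M`, in weak form. -/
def IsFinMartingale (w : Ω → ℝ) (R : ℕ → Ω → Ω → Prop) (M : ℕ) (x : ℕ → Ω → ℝ) : Prop :=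
  (∀ n, AdaptedTo R n (x n)) ∧ ∀ n < M, ∀ ψ, AdaptedTo R n ψ →
    ∑ ω, w ω * (ψ ω * (x (n + 1) ω - x n ω)) = 0

theorem CondLE.mono (hw : ∀ ω, 0 ≤ w ω) {k : ℕ}
    {G G' Y Y' : Ω → ℝ} (h : CondLE w R k G Y) (hG : ∀ ω, G' ω ≤ G ω) (hY : ∀ ω, Y ω ≤ Y' ω) :
    CondLE w R k G' Y' := by
  intro ψ hψ h0
  calc ∑ ω, w ω * (ψ ω * G' ω) ≤ ∑ ω, w ω * (ψ ω * G ω) :=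
        Finset.sum_le_sum fun ω _ =>
          mul_le_mul_of_nonneg_left (mul_le_mul_of_nonneg_left (hG ω) (h0 ω)) (hw ω)
    _ ≤ ∑ ω, w ω * (ψ ω * Y ω) := h ψ hψ h0
    _ ≤ _ := Finset.sum_le_sum fun ω _ =>
          mul_le_mul_of_nonneg_left (mul_le_mul_of_nonneg_left (hY ω) (h0 ω)) (hw ω)

/-- Abel summation against an increasing adapted process. -/
theorem sum_increasing_mul_le (hR : ∀ n ω ω', R (n + 1) ω ω' → R n ω ω')
    {M : ℕ} {Φ β : ℕ → Ω → ℝ} {Y : Ω → ℝ} (hΦ : ∀ n, AdaptedTo R n (Φ n))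
    (hΦ0 : ∀ n ω, 0 ≤ Φ n ω) (hΦm : ∀ n ω, Φ n ω ≤ Φ (n + 1) ω)
    (h : ∀ k ≤ M, CondLE w R k (fun ω => ∑ n ∈ Finset.Ico k (M + 1), β n ω) Y) :
    ∑ ω, w ω * ∑ n ∈ Finset.range (M + 1), Φ n ω * β n ω ≤ ∑ ω, w ω * (Φ M ω * Y ω) := by
  have e1 : ∀ ω, w ω * ∑ n ∈ Finset.range (M + 1), Φ n ω * β n ω
      = ∑ k ∈ Finset.range (M + 1), w ω * ((Φ k ω - if k = 0 then 0 else Φ (k - 1) ω) *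
          ∑ n ∈ Finset.Ico k (M + 1), β n ω) := by
    intro ω
    rw [sum_Ico_mul_eq_sum_sub_mul (fun n => Φ n ω) (fun n => β n ω) M, Finset.mul_sum]
  have e2 : ∀ ω, w ω * (Φ M ω * Y ω)
      = ∑ k ∈ Finset.range (M + 1), w ω * ((Φ k ω - if k = 0 then 0 else Φ (k - 1) ω) * Y ω) := by
    intro ω
    rw [← Finset.mul_sum, ← Finset.sum_mul, sum_increment (fun n => Φ n ω) M]
  simp_rw [e1, e2]
  rw [Finset.sum_comm, Finset.sum_comm (s := Finset.univ)]
  refine Finset.sum_le_sum fun k hk => ?_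
  exact h k (by simpa [Nat.lt_succ_iff] using hk) _ (AdaptedTo.increment hR hΦ k)
    (fun ω => increment_nonneg hΦ0 hΦm k ω)

/-! ### Carleson embedding theorems on a finite filtered space -/

/-- Expanding the power gives `r ∑ (Φ X ^ (r - 1)) β`, where `X` is the partial sum of `Φ β`. The
product `Φ X ^ (r - 1)` is again increasing and adapted, so Abel summation and the test give `r Φ_M
X_M ^ (r - 1) Y`, and Young's inequality absorbs the factor `X_M`. -/
theorem adapted_carleson_of_one_le (hw : ∀ ω, 0 ≤ w ω)
    (hR : ∀ n ω ω', R (n + 1) ω ω' → R n ω ω') {r : ℝ} (hr : 1 ≤ r)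
    {M : ℕ} {Φ β : ℕ → Ω → ℝ} {Y : Ω → ℝ} (hΦ : ∀ n, AdaptedTo R n (Φ n))
    (hΦ0 : ∀ n ω, 0 ≤ Φ n ω) (hΦm : ∀ n ω, Φ n ω ≤ Φ (n + 1) ω)
    (hβ : ∀ n, AdaptedTo R n (β n)) (hβ0 : ∀ n ω, 0 ≤ β n ω) (hY : ∀ ω, 0 ≤ Y ω)
    (h : ∀ k ≤ M, CondLE w R k (fun ω => ∑ n ∈ Finset.Ico k (M + 1), β n ω) Y) :
    ∑ ω, w ω * (∑ n ∈ Finset.range (M + 1), Φ n ω * β n ω) ^ r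
      ≤ 2 * (2 * r) ^ r * ∑ ω, w ω * (Φ M ω * Y ω) ^ r := by
  have hc0 : ∀ n ω, 0 ≤ Φ n ω * β n ω := fun n ω => mul_nonneg (hΦ0 n ω) (hβ0 n ω)
  -- The partial sum includes the `n`-th term; this is adapted since `β n` is known at time `n`.
  set X : ℕ → Ω → ℝ := fun n ω => ∑ i ∈ Finset.range (n + 1), Φ i ω * β i ω with hX
  have hX0 : ∀ n ω, 0 ≤ X n ω := fun n ω => Finset.sum_nonneg fun i _ => hc0 i ω
  have hXm : ∀ n ω, X n ω ≤ X (n + 1) ω := by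
    intro n ω
    simp only [hX]
    rw [Finset.sum_range_succ _ (n + 1)]
    linarith [hc0 (n + 1) ω]
  have hXa : ∀ n, AdaptedTo R n (X n) := AdaptedTo.sum_range hR
    (c := fun n ω => Φ n ω * β n ω) (fun n ω ω' hω => by simp only [hΦ n ω ω' hω, hβ n ω ω' hω])
  have hXp : ∀ n ω, 0 ≤ X n ω ^ (r - 1) := fun n ω => Real.rpow_nonneg (hX0 n ω) _
  have step1 : ∑ ω, w ω * (X M ω) ^ r
      ≤ r * ∑ ω, w ω * ∑ n ∈ Finset.range (M + 1), (Φ n ω * X n ω ^ (r - 1)) * β n ω := by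
    rw [Finset.mul_sum]
    refine Finset.sum_le_sum fun ω _ => ?_
    have := Real.rpow_sum_le_mul_sum hr (fun n => Φ n ω * β n ω) (fun n => hc0 n ω) (M + 1)
    calc w ω * (X M ω) ^ r ≤ w ω * (r * ∑ i ∈ Finset.range (M + 1), Φ i ω * β i ω *
          (X i ω) ^ (r - 1)) := mul_le_mul_of_nonneg_left this (hw ω)
      _ = _ := by
        rw [mul_left_comm]
        congr 2
        exact Finset.sum_congr rfl fun i _ => by ring
  have step2 := sum_increasing_mul_le (w := w) hR (M := M)
    (Φ := fun n ω => Φ n ω * X n ω ^ (r - 1)) (β := β) (Y := Y)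
    (fun n ω ω' hω => by simp only [hΦ n ω ω' hω, hXa n ω ω' hω])
    (fun n ω => mul_nonneg (hΦ0 n ω) (hXp n ω))
    (fun n ω => mul_le_mul (hΦm n ω) (Real.rpow_le_rpow (hX0 n ω) (hXm n ω) (by linarith))
      (hXp n ω) (hΦ0 (n + 1) ω)) h
  have step3 : r * ∑ ω, w ω * (Φ M ω * X M ω ^ (r - 1) * Y ω)
      ≤ (∑ ω, w ω * (X M ω) ^ r) / 2 + (2 * r) ^ r * ∑ ω, w ω * (Φ M ω * Y ω) ^ r := by
    rw [Finset.mul_sum, Finset.mul_sum, Finset.sum_div, ← Finset.sum_add_distrib]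
    refine Finset.sum_le_sum fun ω _ => ?_
    have hΦY : 0 ≤ Φ M ω * Y ω := mul_nonneg (hΦ0 M ω) (hY ω)
    have := Real.mul_rpow_sub_one_le (a := r * (Φ M ω * Y ω)) (x := X M ω) (r := r)
      (by positivity) (hX0 M ω) hr
    rw [← mul_assoc 2 r, Real.mul_rpow (by linarith) hΦY] at this
    have := mul_le_mul_of_nonneg_left this (hw ω)
    linarith
  have := mul_le_mul_of_nonneg_left step2 (by linarith : (0 : ℝ) ≤ r)
  change ∑ ω, w ω * (X M ω) ^ r ≤ _
  linarith

/-- The scheme of `adapted_carleson_of_one_le`, but `β n` is known only at time `n + 1`, so the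
partial sum including the current term is not an admissible multiplier. The power is split into the
strict past, treated as before, and the diagonal terms `(Φ β) ^ r`, treated by a second Abel
summation with `Φ ^ r` and `β ^ r`. This is why the test must control the `r`-th moment. -/
theorem carleson_of_one_le (hw : ∀ ω, 0 ≤ w ω)
    (hR : ∀ n ω ω', R (n + 1) ω ω' → R n ω ω') {r : ℝ} (hr : 1 ≤ r)
    {M : ℕ} {Φ β : ℕ → Ω → ℝ} {B : ℝ} (hB : 0 < B) (hΦ : ∀ n, AdaptedTo R n (Φ n))
    (hΦ0 : ∀ n ω, 0 ≤ Φ n ω) (hΦm : ∀ n ω, Φ n ω ≤ Φ (n + 1) ω)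
    (hβ : ∀ n, AdaptedTo R (n + 1) (β n)) (hβ0 : ∀ n ω, 0 ≤ β n ω)
    (h : ∀ k ≤ M, CondLE w R k (fun ω => (∑ n ∈ Finset.Ico k (M + 1), β n ω) ^ r)
      fun _ => B ^ r) :
    ∑ ω, w ω * (∑ n ∈ Finset.range (M + 1), Φ n ω * β n ω) ^ r
      ≤ (2 * (r * 2 ^ r + (4 * (r * 2 ^ r)) ^ r)) * 2 ^ r * B ^ r * ∑ ω, w ω * (Φ M ω) ^ r := by
  have hr0 : (0 : ℝ) ≤ r := by linarith
  have hBr : (0 : ℝ) < B ^ r := Real.rpow_pos_of_pos hB r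
  have hc0 : ∀ n ω, 0 ≤ Φ n ω * β n ω := fun n ω => mul_nonneg (hΦ0 n ω) (hβ0 n ω)
  -- First moments from `r`-th moments: `Z ≤ B + B ^ (1 - r) Z ^ r`, and each summand costs `B`.
  have h1 : ∀ k ≤ M, CondLE w R k (fun ω => ∑ n ∈ Finset.Ico k (M + 1), β n ω)
      fun _ => 2 * B := by
    intro k hk ψ hψ hψ0
    have e : B ^ (1 - r) * B ^ r = B := by
      rw [← Real.rpow_add hB]
      simp
    calc ∑ ω, w ω * (ψ ω * ∑ n ∈ Finset.Ico k (M + 1), β n ω)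
        ≤ ∑ ω, w ω * (ψ ω * (B + B ^ (1 - r) * (∑ n ∈ Finset.Ico k (M + 1), β n ω) ^ r)) := by
          refine Finset.sum_le_sum fun ω _ => mul_le_mul_of_nonneg_left
            (mul_le_mul_of_nonneg_left ?_ (hψ0 ω)) (hw ω)
          exact Real.le_add_rpow_mul (Finset.sum_nonneg fun i _ => hβ0 i ω) hB hr
      _ = ∑ ω, w ω * (ψ ω * B) + B ^ (1 - r) *
            ∑ ω, w ω * (ψ ω * (∑ n ∈ Finset.Ico k (M + 1), β n ω) ^ r) := by
          rw [Finset.mul_sum, ← Finset.sum_add_distrib]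
          exact Finset.sum_congr rfl fun ω _ => by ring
      _ ≤ ∑ ω, w ω * (ψ ω * B) + B ^ (1 - r) * ∑ ω, w ω * (ψ ω * B ^ r) := by
          have := h k hk ψ hψ hψ0
          have hp : 0 ≤ B ^ (1 - r) := Real.rpow_nonneg hB.le _
          gcongr
      _ = ∑ ω, w ω * (ψ ω * (2 * B)) := by
          rw [Finset.mul_sum, ← Finset.sum_add_distrib]
          refine Finset.sum_congr rfl fun ω _ => ?_
          linear_combination (w ω * ψ ω) * e
  have h2 : ∀ k ≤ M, CondLE w R k (fun ω => ∑ n ∈ Finset.Ico k (M + 1), β n ω ^ r)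
      fun _ => B ^ r := fun k hk => (h k hk).mono hw
        (fun ω => Real.sum_rpow_le_rpow_sum _ _ (fun i => hβ0 i ω) hr) (fun _ => le_rfl)
  -- Strict past: `range n` and not `range (n + 1)`, so that `X n` is known at time `n`.
  set X : ℕ → Ω → ℝ := fun n ω => ∑ i ∈ Finset.range n, Φ i ω * β i ω with hX
  have hX0 : ∀ n ω, 0 ≤ X n ω := fun n ω => Finset.sum_nonneg fun i _ => hc0 i ω
  have hXm : ∀ n ω, X n ω ≤ X (n + 1) ω := by
    intro n ω
    simp only [hX]
    rw [Finset.sum_range_succ]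
    linarith [hc0 n ω]
  have hXa : ∀ n, AdaptedTo R n (X n) := by
    intro n ω ω' hω
    refine Finset.sum_congr rfl fun i hi => ?_
    have hi' : i + 1 ≤ n := by simpa using hi
    rw [((hΦ i).mono hR (by omega : i ≤ n)) ω ω' hω, (hβ i).mono hR hi' ω ω' hω]
  have hXp : ∀ n ω, 0 ≤ X n ω ^ (r - 1) := fun n ω => Real.rpow_nonneg (hX0 n ω) _
  set D : ℝ := r * 2 ^ r with hD
  have hD0 : 0 ≤ D := by positivity
  have step1 : ∑ ω, w ω * (X (M + 1) ω) ^ r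
      ≤ D * ∑ ω, w ω * ∑ n ∈ Finset.range (M + 1), (Φ n ω * X n ω ^ (r - 1)) * β n ω
        + D * ∑ ω, w ω * ∑ n ∈ Finset.range (M + 1), Φ n ω ^ r * β n ω ^ r := by
    rw [← mul_add, ← Finset.sum_add_distrib, Finset.mul_sum]
    refine Finset.sum_le_sum fun ω _ => ?_
    have := Real.rpow_sum_le_mul_sum hr (fun n => Φ n ω * β n ω) (fun n => hc0 n ω) (M + 1)
    have h3 : ∑ i ∈ Finset.range (M + 1), Φ i ω * β i ω * (X (i + 1) ω) ^ (r - 1)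
        ≤ 2 ^ r * (∑ n ∈ Finset.range (M + 1), (Φ n ω * X n ω ^ (r - 1)) * β n ω
          + ∑ n ∈ Finset.range (M + 1), Φ n ω ^ r * β n ω ^ r) := by
      rw [← Finset.sum_add_distrib, Finset.mul_sum]
      refine Finset.sum_le_sum fun i _ => ?_
      have hXs : X (i + 1) ω = X i ω + Φ i ω * β i ω := by
        simp only [hX]
        rw [Finset.sum_range_succ]
      rw [hXs]
      have h4 := Real.add_rpow_le_two_rpow_mul (hX0 i ω) (hc0 i ω) (by linarith : 0 ≤ r - 1)
      have h5 : (2 : ℝ) ^ (r - 1) ≤ 2 ^ r :=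
        Real.rpow_le_rpow_of_exponent_le (by norm_num) (by linarith)
      have h6 : (Φ i ω * β i ω) * (Φ i ω * β i ω) ^ (r - 1) = Φ i ω ^ r * β i ω ^ r := by
        rw [← Real.mul_rpow (hΦ0 i ω) (hβ0 i ω)]
        rcases (hc0 i ω).eq_or_lt with h | h
        · rw [← h, zero_mul, Real.zero_rpow (by linarith)]
        · rw [Real.rpow_sub_one h.ne']
          field_simp
          exact div_self h.ne'
      have h7 : 0 ≤ X i ω ^ (r - 1) + (Φ i ω * β i ω) ^ (r - 1) :=
        add_nonneg (hXp i ω) (Real.rpow_nonneg (hc0 i ω) _)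
      calc Φ i ω * β i ω * (X i ω + Φ i ω * β i ω) ^ (r - 1)
          ≤ Φ i ω * β i ω * (2 ^ r * (X i ω ^ (r - 1) + (Φ i ω * β i ω) ^ (r - 1))) := by
            refine mul_le_mul_of_nonneg_left (h4.trans ?_) (hc0 i ω)
            gcongr
        _ = 2 ^ r * (Φ i ω * X i ω ^ (r - 1) * β i ω + Φ i ω ^ r * β i ω ^ r) := by
            rw [← h6]
            ring
    calc w ω * (X (M + 1) ω) ^ r ≤ w ω * (r * _) := mul_le_mul_of_nonneg_left this (hw ω)
      _ ≤ w ω * (r * (2 ^ r * (∑ n ∈ Finset.range (M + 1), (Φ n ω * X n ω ^ (r - 1)) * β n ω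
          + ∑ n ∈ Finset.range (M + 1), Φ n ω ^ r * β n ω ^ r))) :=
          mul_le_mul_of_nonneg_left (mul_le_mul_of_nonneg_left h3 hr0) (hw ω)
      _ = _ := by
          rw [hD]
          ring
  have step2 := sum_increasing_mul_le (w := w) hR (M := M)
    (Φ := fun n ω => Φ n ω * X n ω ^ (r - 1)) (β := β) (Y := fun _ => 2 * B)
    (fun n ω ω' hω => by simp only [hΦ n ω ω' hω, hXa n ω ω' hω])
    (fun n ω => mul_nonneg (hΦ0 n ω) (hXp n ω))
    (fun n ω => mul_le_mul (hΦm n ω) (Real.rpow_le_rpow (hX0 n ω) (hXm n ω) (by linarith))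
      (hXp n ω) (hΦ0 (n + 1) ω)) h1
  have step2' := sum_increasing_mul_le (w := w) hR (M := M)
    (Φ := fun n ω => Φ n ω ^ r) (β := fun n ω => β n ω ^ r) (Y := fun _ => B ^ r)
    (fun n ω ω' hω => by simp only [hΦ n ω ω' hω])
    (fun n ω => Real.rpow_nonneg (hΦ0 n ω) _)
    (fun n ω => Real.rpow_le_rpow (hΦ0 n ω) (hΦm n ω) hr0) h2
  have step3 : D * ∑ ω, w ω * (Φ M ω * X M ω ^ (r - 1) * (2 * B))
      ≤ (∑ ω, w ω * (X (M + 1) ω) ^ r) / 2 + (4 * D) ^ r * B ^ r * ∑ ω, w ω * (Φ M ω) ^ r := by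
    rw [Finset.mul_sum, Finset.mul_sum, Finset.sum_div, ← Finset.sum_add_distrib]
    refine Finset.sum_le_sum fun ω _ => ?_
    have h3 := Real.mul_rpow_sub_one_le (a := 2 * D * B * Φ M ω) (x := X M ω) (r := r)
      (mul_nonneg (by positivity) (hΦ0 M ω)) (hX0 M ω) hr
    have h4 : (2 * (2 * D * B * Φ M ω)) ^ r = (4 * D) ^ r * B ^ r * Φ M ω ^ r := by
      rw [← Real.mul_rpow (by positivity) hB.le, ← Real.mul_rpow (by positivity) (hΦ0 M ω)]
      congr 1
      ring
    rw [h4] at h3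
    have h5 : X M ω ^ r ≤ X (M + 1) ω ^ r := Real.rpow_le_rpow (hX0 M ω) (hXm M ω) hr0
    have h6 := mul_le_mul_of_nonneg_left (h3.trans (add_le_add_left
      (div_le_div_of_nonneg_right h5 (by norm_num : (0 : ℝ) ≤ 2)) _)) (hw ω)
    linarith
  have hS0 : 0 ≤ ∑ ω, w ω * (Φ M ω) ^ r :=
    Finset.sum_nonneg fun ω _ => mul_nonneg (hw ω) (Real.rpow_nonneg (hΦ0 M ω) _)
  have e3 : ∑ ω, w ω * (Φ M ω ^ r * B ^ r) = B ^ r * ∑ ω, w ω * (Φ M ω) ^ r := by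
    rw [Finset.mul_sum]
    exact Finset.sum_congr rfl fun ω _ => by ring
  have h8 := mul_le_mul_of_nonneg_left step2 hD0
  have h9 := mul_le_mul_of_nonneg_left step2' hD0
  rw [e3] at h9
  change ∑ ω, w ω * (X (M + 1) ω) ^ r ≤ _
  have h10 : ∑ ω, w ω * (X (M + 1) ω) ^ r
      ≤ 2 * (D + (4 * D) ^ r) * (B ^ r * ∑ ω, w ω * (Φ M ω) ^ r) := by linarith
  refine h10.trans ?_
  have h11 : (1 : ℝ) ≤ 2 ^ r := Real.one_le_rpow (by norm_num) hr0
  have h12 : 0 ≤ 2 * (D + (4 * D) ^ r) * (B ^ r * ∑ ω, w ω * (Φ M ω) ^ r) := by positivity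
  nlinarith

/-- For `r ≤ 1` the function `t ^ r` is subadditive, so the Abel sum splits into `∑ Γ_k ^ r (tail of
β) ^ r`, and each summand is tested at time `k`. What remains is `∑ Γ_k ^ r`; to keep it comparable
with `Φ_M ^ r` the process `Φ` is first replaced by its slow version, at the price of a factor two.
-/
theorem carleson_of_le_one (hw : ∀ ω, 0 ≤ w ω)
    (hR : ∀ n ω ω', R (n + 1) ω ω' → R n ω ω') {r : ℝ} (hr : 0 < r) (hr1 : r ≤ 1)
    {M : ℕ} {Φ β : ℕ → Ω → ℝ} {B : ℝ} (hB : 0 < B) (hΦ : ∀ n, AdaptedTo R n (Φ n))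
    (hΦ0 : ∀ n ω, 0 ≤ Φ n ω) (hΦm : ∀ n ω, Φ n ω ≤ Φ (n + 1) ω)
    (hβ0 : ∀ n ω, 0 ≤ β n ω)
    (h : ∀ k ≤ M, CondLE w R k (fun ω => (∑ n ∈ Finset.Ico k (M + 1), β n ω) ^ r)
      fun _ => B ^ r) :
    ∑ ω, w ω * (∑ n ∈ Finset.range (M + 1), Φ n ω * β n ω) ^ r
      ≤ 2 ^ r * (1 - (2 : ℝ) ^ (-r))⁻¹ * B ^ r * ∑ ω, w ω * (Φ M ω) ^ r := by
  set V : ℕ → Ω → ℝ := fun n ω => slowProcess (fun n => Φ n ω) n with hV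
  have hVa : ∀ n, AdaptedTo R n (V n) := AdaptedTo.slowProcess hR hΦ
  have hV0 : ∀ n ω, 0 ≤ V n ω := fun n ω => slowProcess_nonneg (fun n => hΦ0 n ω) n
  have hVm : ∀ n ω, V n ω ≤ V (n + 1) ω := fun n ω => slowProcess_le_succ (fun n => hΦ0 n ω) n
  set Γ : ℕ → Ω → ℝ := fun k ω => V k ω - if k = 0 then 0 else V (k - 1) ω with hΓ
  have hΓa : ∀ k, AdaptedTo R k (Γ k) := AdaptedTo.increment hR hVa
  have hΓ0 : ∀ k ω, 0 ≤ Γ k ω := increment_nonneg hV0 hVm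
  have hρ : (2 : ℝ) ^ (-r) < 1 := Real.rpow_lt_one_of_one_lt_of_neg (by norm_num) (by linarith)
  have hCpos : 0 < (1 - (2 : ℝ) ^ (-r))⁻¹ := inv_pos.mpr (by linarith)
  have hBr : (0 : ℝ) < B ^ r := Real.rpow_pos_of_pos hB r
  have p1 : ∀ ω, (∑ n ∈ Finset.range (M + 1), Φ n ω * β n ω) ^ r
      ≤ 2 ^ r * ∑ k ∈ Finset.range (M + 1),
          Γ k ω ^ r * (∑ n ∈ Finset.Ico k (M + 1), β n ω) ^ r := by
    intro ω
    have hs0 : 0 ≤ ∑ n ∈ Finset.range (M + 1), V n ω * β n ω :=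
      Finset.sum_nonneg fun i _ => mul_nonneg (hV0 i ω) (hβ0 i ω)
    calc (∑ n ∈ Finset.range (M + 1), Φ n ω * β n ω) ^ r
        ≤ (2 * ∑ n ∈ Finset.range (M + 1), V n ω * β n ω) ^ r := by
          refine Real.rpow_le_rpow
            (Finset.sum_nonneg fun i _ => mul_nonneg (hΦ0 i ω) (hβ0 i ω)) ?_ hr.le
          rw [Finset.mul_sum]
          refine Finset.sum_le_sum fun n _ => ?_
          rw [← mul_assoc]
          exact mul_le_mul_of_nonneg_right (le_two_mul_slowProcess (fun n => hΦ0 n ω) n) (hβ0 n ω)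
      _ = 2 ^ r * (∑ n ∈ Finset.range (M + 1), V n ω * β n ω) ^ r :=
          Real.mul_rpow (by norm_num) hs0
      _ ≤ _ := by
          rw [sum_Ico_mul_eq_sum_sub_mul (fun n => V n ω) (fun n => β n ω) M]
          refine mul_le_mul_of_nonneg_left ?_ (by positivity)
          refine (Real.rpow_sum_le_sum_rpow _ (fun k => Γ k ω * ∑ n ∈ Finset.Ico k (M + 1), β n ω)
            (fun k => mul_nonneg (hΓ0 k ω) (Finset.sum_nonneg fun i _ => hβ0 i ω)) hr hr1).trans ?_
          refine Finset.sum_le_sum fun k _ => ?_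
          rw [Real.mul_rpow (hΓ0 k ω) (Finset.sum_nonneg fun i _ => hβ0 i ω)]
  calc ∑ ω, w ω * (∑ n ∈ Finset.range (M + 1), Φ n ω * β n ω) ^ r
      ≤ ∑ ω, w ω * (2 ^ r * ∑ k ∈ Finset.range (M + 1),
          Γ k ω ^ r * (∑ n ∈ Finset.Ico k (M + 1), β n ω) ^ r) :=
        Finset.sum_le_sum fun ω _ => mul_le_mul_of_nonneg_left (p1 ω) (hw ω)
    _ = 2 ^ r * ∑ k ∈ Finset.range (M + 1), ∑ ω, w ω * (Γ k ω ^ r *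
          (∑ n ∈ Finset.Ico k (M + 1), β n ω) ^ r) := by
        rw [Finset.sum_comm, Finset.mul_sum]
        refine Finset.sum_congr rfl fun ω _ => ?_
        rw [Finset.mul_sum, Finset.mul_sum, Finset.mul_sum]
        exact Finset.sum_congr rfl fun k _ => by ring
    _ ≤ 2 ^ r * ∑ k ∈ Finset.range (M + 1), ∑ ω, w ω * (Γ k ω ^ r * B ^ r) := by
        refine mul_le_mul_of_nonneg_left ?_ (by positivity)
        refine Finset.sum_le_sum fun k hk => ?_
        exact h k (by simpa [Nat.lt_succ_iff] using hk) (fun ω => Γ k ω ^ r)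
          (fun ω ω' hω => by simp only [hΓa k ω ω' hω]) (fun ω => Real.rpow_nonneg (hΓ0 k ω) r)
    _ = 2 ^ r * B ^ r * ∑ ω, w ω * ∑ k ∈ Finset.range (M + 1), Γ k ω ^ r := by
        rw [Finset.sum_comm, mul_assoc, Finset.mul_sum (a := B ^ r)]
        congr 1
        refine Finset.sum_congr rfl fun ω _ => ?_
        rw [Finset.mul_sum, Finset.mul_sum]
        exact Finset.sum_congr rfl fun k _ => by ring
    _ ≤ 2 ^ r * B ^ r * ∑ ω, w ω * ((1 - (2 : ℝ) ^ (-r))⁻¹ * Φ M ω ^ r) := by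
        refine mul_le_mul_of_nonneg_left ?_ (by positivity)
        refine Finset.sum_le_sum fun ω _ => mul_le_mul_of_nonneg_left ?_ (hw ω)
        refine (sum_increment_slowProcess_rpow_le (fun n => hΦ0 n ω) hr M).trans ?_
        exact mul_le_mul_of_nonneg_left (Real.rpow_le_rpow (hV0 M ω)
          (slowProcess_le (fun n => hΦm n ω) M) hr.le) hCpos.le
    _ = _ := by
        rw [Finset.mul_sum, Finset.mul_sum]
        exact Finset.sum_congr rfl fun ω _ => by ring

/-- The constant in the Carleson embedding theorem `carleson`. -/
def carlesonConst (r : ℝ) : ℝ :=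
  (2 * (r * 2 ^ r + (4 * (r * 2 ^ r)) ^ r)) * 2 ^ r + 2 ^ r * |(1 - (2 : ℝ) ^ (-r))⁻¹| + 1

theorem carlesonConst_pos {r : ℝ} (hr : 0 < r) : 0 < carlesonConst r := by
  unfold carlesonConst
  positivity

/-- Carleson embedding: weights that are known one step later. -/
theorem carleson (hw : ∀ ω, 0 ≤ w ω)
    (hR : ∀ n ω ω', R (n + 1) ω ω' → R n ω ω') {r : ℝ} (hr : 0 < r)
    {M : ℕ} {Φ β : ℕ → Ω → ℝ} {B : ℝ} (hB : 0 < B) (hΦ : ∀ n, AdaptedTo R n (Φ n))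
    (hΦ0 : ∀ n ω, 0 ≤ Φ n ω) (hΦm : ∀ n ω, Φ n ω ≤ Φ (n + 1) ω)
    (hβ : ∀ n, AdaptedTo R (n + 1) (β n)) (hβ0 : ∀ n ω, 0 ≤ β n ω)
    (h : ∀ k ≤ M, CondLE w R k (fun ω => (∑ n ∈ Finset.Ico k (M + 1), β n ω) ^ r)
      fun _ => B ^ r) :
    ∑ ω, w ω * (∑ n ∈ Finset.range (M + 1), Φ n ω * β n ω) ^ r
      ≤ carlesonConst r * B ^ r * ∑ ω, w ω * (Φ M ω) ^ r := by
  have hBr : (0 : ℝ) < B ^ r := Real.rpow_pos_of_pos hB r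
  have hS0 : 0 ≤ ∑ ω, w ω * (Φ M ω) ^ r :=
    Finset.sum_nonneg fun ω _ => mul_nonneg (hw ω) (Real.rpow_nonneg (hΦ0 M ω) _)
  rcases le_total r 1 with hr1 | hr1
  · refine (carleson_of_le_one hw hR hr hr1 hB hΦ hΦ0 hΦm hβ0 h).trans ?_
    have : 2 ^ r * (1 - (2 : ℝ) ^ (-r))⁻¹ ≤ carlesonConst r := by
      unfold carlesonConst
      have h1 : 2 ^ r * (1 - (2 : ℝ) ^ (-r))⁻¹ ≤ 2 ^ r * |(1 - (2 : ℝ) ^ (-r))⁻¹| :=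
        mul_le_mul_of_nonneg_left (le_abs_self _) (by positivity)
      have h2 : 0 ≤ (2 * (r * 2 ^ r + (4 * (r * 2 ^ r)) ^ r)) * (2 : ℝ) ^ r := by positivity
      linarith
    gcongr
  · refine (carleson_of_one_le hw hR hr1 hB hΦ hΦ0 hΦm hβ hβ0 h).trans ?_
    have : (2 * (r * 2 ^ r + (4 * (r * 2 ^ r)) ^ r)) * 2 ^ r ≤ carlesonConst r := by
      unfold carlesonConst
      have h1 : 0 ≤ 2 ^ r * |(1 - (2 : ℝ) ^ (-r))⁻¹| := by positivity
      linarith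
    gcongr

/-- Carleson embedding for adapted weights: one testing condition serves all exponents. -/
theorem adapted_carleson (hw : ∀ ω, 0 ≤ w ω)
    (hR : ∀ n ω ω', R (n + 1) ω ω' → R n ω ω') {r : ℝ} (hr : 0 < r)
    {M : ℕ} {Φ β : ℕ → Ω → ℝ} {B : ℝ} (hB : 0 < B) (hΦ : ∀ n, AdaptedTo R n (Φ n))
    (hΦ0 : ∀ n ω, 0 ≤ Φ n ω) (hΦm : ∀ n ω, Φ n ω ≤ Φ (n + 1) ω)
    (hβ : ∀ n, AdaptedTo R n (β n)) (hβ0 : ∀ n ω, 0 ≤ β n ω)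
    (h : ∀ k ≤ M, CondLE w R k (fun ω => ∑ n ∈ Finset.Ico k (M + 1), β n ω) fun _ => B) :
    ∑ ω, w ω * (∑ n ∈ Finset.range (M + 1), Φ n ω * β n ω) ^ r
      ≤ (2 * (2 * r) ^ r + 2 * carlesonConst r) * B ^ r * ∑ ω, w ω * (Φ M ω) ^ r := by
  have hBr : (0 : ℝ) < B ^ r := Real.rpow_pos_of_pos hB r
  have hS0 : 0 ≤ ∑ ω, w ω * (Φ M ω) ^ r :=
    Finset.sum_nonneg fun ω _ => mul_nonneg (hw ω) (Real.rpow_nonneg (hΦ0 M ω) _)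
  have hC := carlesonConst_pos hr
  rcases le_total r 1 with hr1 | hr1
  -- With this testing constant `B' ^ r = 2 * B ^ r`, which accommodates both terms of
  -- `Real.rpow_le_add_mul`.
  · have hB' : 0 < 2 ^ (1 / r) * B := by positivity
    have e : (2 ^ (1 / r) * B) ^ r = 2 * B ^ r := by
      rw [Real.mul_rpow (by positivity) hB.le, ← Real.rpow_mul (by norm_num),
        one_div_mul_cancel hr.ne', Real.rpow_one]
    have e' : B ^ (r - 1) * B = B ^ r := by
      rw [Real.rpow_sub_one hB.ne']
      field_simp
    have := carleson hw hR hr (M := M) (β := β) hB' hΦ hΦ0 hΦm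
      (fun n => (hβ n).mono hR (Nat.le_succ n)) hβ0 ?_
    · rw [e] at this
      refine this.trans ?_
      have h1 : 0 ≤ 2 * (2 * r) ^ r * B ^ r * ∑ ω, w ω * (Φ M ω) ^ r := by positivity
      linarith
    · intro k hk ψ hψ hψ0
      rw [e]
      calc ∑ ω, w ω * (ψ ω * (∑ n ∈ Finset.Ico k (M + 1), β n ω) ^ r)
          ≤ ∑ ω, w ω * (ψ ω * (B ^ r + B ^ (r - 1) * ∑ n ∈ Finset.Ico k (M + 1), β n ω)) := by
            refine Finset.sum_le_sum fun ω _ => mul_le_mul_of_nonneg_left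
              (mul_le_mul_of_nonneg_left ?_ (hψ0 ω)) (hw ω)
            exact Real.rpow_le_add_mul (Finset.sum_nonneg fun i _ => hβ0 i ω) hB hr hr1
        _ = ∑ ω, w ω * (ψ ω * B ^ r) + B ^ (r - 1) *
              ∑ ω, w ω * (ψ ω * ∑ n ∈ Finset.Ico k (M + 1), β n ω) := by
            rw [Finset.mul_sum, ← Finset.sum_add_distrib]
            exact Finset.sum_congr rfl fun ω _ => by ring
        _ ≤ ∑ ω, w ω * (ψ ω * B ^ r) + B ^ (r - 1) * ∑ ω, w ω * (ψ ω * B) := by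
            have := h k hk ψ hψ hψ0
            have hp : 0 ≤ B ^ (r - 1) := Real.rpow_nonneg hB.le _
            gcongr
        _ = ∑ ω, w ω * (ψ ω * (2 * B ^ r)) := by
            rw [Finset.mul_sum, ← Finset.sum_add_distrib]
            refine Finset.sum_congr rfl fun ω _ => ?_
            linear_combination (w ω * ψ ω) * e'
  · refine (adapted_carleson_of_one_le hw hR hr1 hΦ hΦ0 hΦm hβ hβ0 (fun _ => hB.le) h).trans ?_
    have e : ∑ ω, w ω * (Φ M ω * B) ^ r = B ^ r * ∑ ω, w ω * (Φ M ω) ^ r := by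
      rw [Finset.mul_sum]
      refine Finset.sum_congr rfl fun ω _ => ?_
      rw [Real.mul_rpow (hΦ0 M ω) hB.le]
      ring
    rw [e]
    have h1 : 0 ≤ 2 * carlesonConst r * B ^ r * ∑ ω, w ω * (Φ M ω) ^ r := by positivity
    linarith

end

noncomputable section

/-! ### Pathwise Davis inequalities -/

/-- The square bracket of a real sequence. -/
def bracket (y : ℕ → ℝ) (n : ℕ) : ℝ := y 0 ^ 2 + ∑ i ∈ Finset.range n, (y (i + 1) - y i) ^ 2

/-- The running maximum of the absolute values of a real sequence. -/
def runMax (y : ℕ → ℝ) (n : ℕ) : ℝ := partialSups (fun i => |y i|) n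

/-- The predictable integrand of the pathwise Davis inequalities. -/
def davisWeight (c : ℝ) (y : ℕ → ℝ) (n : ℕ) : ℝ :=
  y n / Real.sqrt (bracket y n + c * runMax y n ^ 2)

theorem bracket_nonneg (y : ℕ → ℝ) (n : ℕ) : 0 ≤ bracket y n :=
  add_nonneg (sq_nonneg _) (Finset.sum_nonneg fun _ _ => sq_nonneg _)

theorem bracket_succ (y : ℕ → ℝ) (n : ℕ) :
    bracket y (n + 1) = bracket y n + (y (n + 1) - y n) ^ 2 := by
  rw [bracket, bracket, Finset.sum_range_succ]
  ring

theorem runMax_succ (y : ℕ → ℝ) (n : ℕ) : runMax y (n + 1) = max (runMax y n) |y (n + 1)| :=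
  partialSups_add_one _ n

theorem runMax_zero (y : ℕ → ℝ) : runMax y 0 = |y 0| := partialSups_zero _

theorem abs_le_runMax (y : ℕ → ℝ) {i n : ℕ} (h : i ≤ n) : |y i| ≤ runMax y n :=
  le_partialSups_of_le (fun i => |y i|) h

theorem runMax_le {y : ℕ → ℝ} {n : ℕ} {a : ℝ} (h : ∀ i ≤ n, |y i| ≤ a) : runMax y n ≤ a :=
  partialSups_le _ _ _ h

theorem runMax_nonneg (y : ℕ → ℝ) (n : ℕ) : 0 ≤ runMax y n :=
  (abs_nonneg _).trans (abs_le_runMax y (Nat.zero_le n))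

theorem runMax_mono (y : ℕ → ℝ) {m n : ℕ} (h : m ≤ n) : runMax y m ≤ runMax y n :=
  (partialSups _).monotone h

theorem runMax_congr {y z : ℕ → ℝ} {n : ℕ} (h : ∀ i ≤ n, y i = z i) : runMax y n = runMax z n :=
  le_antisymm (runMax_le fun i hi => h i hi ▸ abs_le_runMax z hi)
    (runMax_le fun i hi => h i hi ▸ abs_le_runMax y hi)

theorem bracket_congr {y z : ℕ → ℝ} {n : ℕ} (h : ∀ i ≤ n, y i = z i) :
    bracket y n = bracket z n := by
  rw [bracket, bracket, h 0 (Nat.zero_le n)]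
  congr 1
  refine Finset.sum_congr rfl fun i hi => ?_
  have hi' := Finset.mem_range.1 hi
  rw [h i hi'.le, h (i + 1) hi']

theorem davisWeight_congr {c : ℝ} {y z : ℕ → ℝ} {n : ℕ} (h : ∀ i ≤ n, y i = z i) :
    davisWeight c y n = davisWeight c z n := by
  rw [davisWeight, davisWeight, bracket_congr h, runMax_congr h, h n le_rfl]

/-- One step for the potential `V + (x ^ 2 + a) / V` with `V = √(a + m ^ 2)`: its growth is a
transform of the increment `d` up to an error `14 d ^ 2 / V'`. With `δ = V' - V ≤ 2|d|`, three error
terms cost `4 d ^ 2 V` each, and the numerator at the new time contributes the remaining `2 d ^ 2`.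
-/
theorem davis_step_max {a x d m m' V V' : ℝ} (ha : 0 ≤ a) (hxm : |x| ≤ m)
    (hm' : m' = max m |x + d|) (hV0 : 0 ≤ V) (hV0' : 0 ≤ V') (hV : V ^ 2 = a + m ^ 2)
    (hV' : V' ^ 2 = a + d ^ 2 + m' ^ 2) :
    V' + ((x + d) ^ 2 + (a + d ^ 2)) / V' - (V + (x ^ 2 + a) / V) - 14 * (d ^ 2 / V')
      ≤ 2 * (x / V * d) := by
  have hm0 : 0 ≤ m := (abs_nonneg x).trans hxm
  have hmm' : m ≤ m' := hm' ▸ le_max_left _ _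
  have habs : |x + d| ≤ |x| + |d| := abs_add_le x d
  have hd0 := abs_nonneg d
  have hm'd : m' ≤ m + |d| := by
    rw [hm']
    exact max_le (by linarith) (by linarith)
  have hdd : |d| ^ 2 = d ^ 2 := sq_abs d
  have hmV : m ≤ V := by
    refine abs_le_of_sq_le_sq' ?_ hV0 |>.2
    linarith
  have hVV' : V ≤ V' := by
    refine abs_le_of_sq_le_sq' ?_ hV0' |>.2
    nlinarith
  have hδ : V' ≤ V + 2 * |d| := by
    refine abs_le_of_sq_le_sq' ?_ (by linarith) |>.2
    nlinarith
  rcases hV0.eq_or_lt with h0 | hpos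
  · rw [← h0] at hV
    have hm00 : m = 0 := by nlinarith
    have ha0 : a = 0 := by nlinarith
    have hx0 : x = 0 := by
      rw [hm00] at hxm
      exact abs_eq_zero.1 (le_antisymm hxm (abs_nonneg x))
    have hm'1 : m' = |d| := by
      rw [hm', hm00, hx0, zero_add]
      exact max_eq_right hd0
    rw [← h0, ha0, hx0]
    rw [ha0, hm'1, hdd] at hV'
    have e : V' = 2 * (d ^ 2 / V') := by
      rcases hV0'.eq_or_lt with h | h
      · rw [← h]; simp
      · field_simp
        linarith
    have h1 : 0 ≤ d ^ 2 / V' := by positivity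
    have e2 : ((0 + d) ^ 2 + (0 + d ^ 2)) / V' = 2 * (d ^ 2 / V') := by ring
    rw [e2]
    simp only [zero_mul, mul_zero, div_zero, add_zero, sub_zero]
    linarith
  · have hpos' : 0 < V' := hpos.trans_le hVV'
    set δ := V' - V with hδdef
    have hδ0 : 0 ≤ δ := by linarith
    have hδ2 : δ ≤ 2 * |d| := by linarith
    have hxV : |x| ≤ V := hxm.trans hmV
    have h1 : V * δ ^ 2 ≤ 4 * d ^ 2 * V := by
      have : δ ^ 2 ≤ (2 * |d|) ^ 2 := by gcongr
      rw [mul_pow, hdd] at this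
      nlinarith
    have h2 : δ * (-(2 * x * d)) ≤ 4 * d ^ 2 * V := by
      have e : -(2 * x * d) ≤ 2 * (V * |d|) := by
        have := neg_abs_le (x * d)
        rw [abs_mul] at this
        have h := mul_le_mul_of_nonneg_right hxV hd0
        linarith
      calc δ * (-(2 * x * d)) ≤ δ * (2 * (V * |d|)) := mul_le_mul_of_nonneg_left e hδ0
        _ ≤ (2 * |d|) * (2 * (V * |d|)) := by gcongr
        _ = 4 * |d| ^ 2 * V := by ring
        _ = _ := by rw [hdd]
    -- Either the maximum is not renewed, and then `δ` is quadratic in `d`, or it is, and then `m -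
    -- |x| ≤ |d|`.
    have h3 : δ * (m ^ 2 - x ^ 2) ≤ 4 * d ^ 2 * V := by
      have hdV : 0 ≤ d ^ 2 * V := by positivity
      rcases le_total |x + d| m with h | h
      · have hm'1 : m' = m := by rw [hm', max_eq_left h]
        rw [hm'1] at hV'
        have e : δ * (V + V') = d ^ 2 := by
          rw [hδdef]
          linear_combination hV' - hV
        have h4 : δ * V ≤ d ^ 2 := by nlinarith
        have h5 : δ * (m ^ 2 - x ^ 2) ≤ δ * (V * V) := by
          refine mul_le_mul_of_nonneg_left ?_ hδ0
          nlinarith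
        nlinarith
      · have h4 : m - |x| ≤ |d| := by linarith
        have h5 : m ^ 2 - x ^ 2 ≤ |d| * (2 * V) := by
          have e : m ^ 2 - x ^ 2 = (m - |x|) * (m + |x|) := by
            rw [← sq_abs x]
            ring
          rw [e]
          exact mul_le_mul h4 (by linarith) (by have := abs_nonneg x; linarith) hd0
        calc δ * (m ^ 2 - x ^ 2) ≤ (2 * |d|) * (|d| * (2 * V)) := by
              refine (mul_le_mul_of_nonneg_left h5 hδ0).trans ?_
              gcongr
          _ = 4 * |d| ^ 2 * V := by ring
          _ = _ := by rw [hdd]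
    have key : 0 ≤ δ * (2 * x * d + x ^ 2 - m ^ 2 - V * δ) + 12 * d ^ 2 * V := by linarith
    have e : 2 * (x / V * d) - (V' + ((x + d) ^ 2 + (a + d ^ 2)) / V' - (V + (x ^ 2 + a) / V)
        - 14 * (d ^ 2 / V'))
        = (δ * (2 * x * d + x ^ 2 - m ^ 2 - V * δ) + 12 * d ^ 2 * V) / (V * V') := by
      rw [hδdef]
      field_simp
      linear_combination (V - V') * hV
    have := div_nonneg key (by positivity : 0 ≤ V * V')
    linarith

/-- The weight `16` in `V = √(a + 16 m ^ 2)` makes `x` and `d` small compared with `V` and `V'`: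
`|x| ≤ V / 4` and `|d| ≤ V' / 2`. Then `2 x d + x ^ 2 ≤ (5 / 16) V V'`, which leaves `11 / 16` of
the growth of `V`. The growth of the maximum is paid by `8 (m' - m)`. -/
theorem davis_step_square {a x d m m' V V' : ℝ} (ha : 0 ≤ a) (hxm : |x| ≤ m)
    (hm' : m' = max m |x + d|) (hV0 : 0 ≤ V) (hV0' : 0 ≤ V') (hV : V ^ 2 = a + 16 * m ^ 2)
    (hV' : V' ^ 2 = a + d ^ 2 + 16 * m' ^ 2) :
    11 / 16 * (V' - V) - ((x + d) ^ 2 / V' - x ^ 2 / V) - 8 * (m' - m) ≤ -2 * (x / V * d) := by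
  have hm0 : 0 ≤ m := (abs_nonneg x).trans hxm
  have hmm' : m ≤ m' := hm' ▸ le_max_left _ _
  have hdd : |d| ^ 2 = d ^ 2 := sq_abs d
  have hdm : |d| ≤ 2 * m' := by
    have h1 : |x + d| ≤ m' := hm' ▸ le_max_right _ _
    have h2 : |d| ≤ |x + d| + |x| := by
      have := abs_sub (x + d) x
      rwa [add_sub_cancel_left] at this
    linarith
  have hmV : 4 * m ≤ V := by
    refine abs_le_of_sq_le_sq' ?_ hV0 |>.2
    nlinarith
  have hmV' : 4 * m' ≤ V' := by
    refine abs_le_of_sq_le_sq' ?_ hV0' |>.2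
    nlinarith [sq_nonneg d]
  have hVV' : V ≤ V' := by
    refine abs_le_of_sq_le_sq' ?_ hV0' |>.2
    nlinarith [sq_nonneg d]
  rcases hV0.eq_or_lt with h0 | hpos
  · rw [← h0] at hV
    have hm00 : m = 0 := by nlinarith
    have ha0 : a = 0 := by nlinarith
    have hx0 : x = 0 := by
      rw [hm00] at hxm
      exact abs_eq_zero.1 (le_antisymm hxm (abs_nonneg x))
    have hm'1 : m' = |d| := by
      rw [hm', hm00, hx0, zero_add]
      exact max_eq_right (abs_nonneg d)
    have hV5 : V' ≤ 5 * m' := by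
      refine abs_le_of_sq_le_sq' ?_ (by linarith) |>.2
      rw [hV', ha0, ← hdd, hm'1]
      nlinarith [sq_nonneg |d|]
    have h1 : 0 ≤ (x + d) ^ 2 / V' := by positivity
    rw [← h0, hx0, hm00] at *
    simp only [zero_mul, mul_zero, div_zero, sub_zero]
    linarith
  · have hpos' : 0 < V' := hpos.trans_le hVV'
    set δ := V' - V with hδdef
    have hδ0 : 0 ≤ δ := by linarith
    have hx4 : |x| ≤ V / 4 := by linarith
    have hd2 : |d| ≤ V' / 2 := by linarith
    have h1 : 2 * x * d + x ^ 2 ≤ 5 / 16 * (V * V') := by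
      have e1 : x * d ≤ V / 4 * (V' / 2) := by
        refine (le_abs_self _).trans ?_
        rw [abs_mul]
        exact mul_le_mul hx4 hd2 (abs_nonneg d) (by linarith)
      have e2 : x ^ 2 ≤ (V / 4) ^ 2 := by
        rw [← sq_abs x]
        gcongr
      nlinarith
    have h2 : 16 * ((m' - m) * (m' + m)) * V ≤ 8 * (m' - m) * (V * V') := by
      have h3 : 16 * (m' + m) ≤ 8 * V' := by linarith
      have h4 := mul_le_mul_of_nonneg_left h3 (mul_nonneg (sub_nonneg.2 hmm') hpos.le)
      linarith
    have h3 := mul_le_mul_of_nonneg_left h1 hδ0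
    have hd : d ^ 2 = δ * (V' + V) - 16 * ((m' - m) * (m' + m)) := by
      rw [hδdef]
      linear_combination hV - hV'
    have hδV : 0 ≤ δ * V ^ 2 := by positivity
    have key : 0 ≤ -(2 * x * d * δ) - x ^ 2 * δ + d ^ 2 * V - 11 / 16 * δ * (V * V')
        + 8 * (m' - m) * (V * V') := by
      rw [hd]
      nlinarith
    have e : -2 * (x / V * d) - (11 / 16 * δ - ((x + d) ^ 2 / V' - x ^ 2 / V) - 8 * (m' - m))
        = (-(2 * x * d * δ) - x ^ 2 * δ + d ^ 2 * V - 11 / 16 * δ * (V * V')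
        + 8 * (m' - m) * (V * V')) / (V * V') := by
      rw [hδdef]
      field_simp
      ring
    have := div_nonneg key (by positivity : 0 ≤ V * V')
    linarith

/-- Factor `d ^ 2` as a difference of squares of the two roots. The right-hand side telescopes, so
the errors `14 d ^ 2 / V'` add up to at most `28` times the square function. -/
theorem sq_div_sqrt_le {a d V' : ℝ} (ha : 0 ≤ a) (h : Real.sqrt (a + d ^ 2) ≤ V') :
    d ^ 2 / V' ≤ 2 * (Real.sqrt (a + d ^ 2) - Real.sqrt a) := by
  have h0 := Real.sqrt_nonneg a
  have h1 := Real.sq_sqrt ha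
  have h2 := Real.sq_sqrt (by positivity : 0 ≤ a + d ^ 2)
  have h3 : Real.sqrt a ≤ Real.sqrt (a + d ^ 2) := Real.sqrt_le_sqrt (by nlinarith [sq_nonneg d])
  rcases (h0.trans h3).eq_or_lt with h4 | h4
  · have : d ^ 2 = 0 := by
      rw [← h4] at h2
      nlinarith [sq_nonneg d]
    rw [this]
    simp
  · rw [div_le_iff₀ (h4.trans_le h)]
    have h5 : d ^ 2 ≤ 2 * (Real.sqrt (a + d ^ 2) - Real.sqrt a) * Real.sqrt (a + d ^ 2) := by
      nlinarith
    refine h5.trans (mul_le_mul_of_nonneg_left h ?_)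
    linarith

/-- Pathwise Davis inequality: the maximal function is controlled by the square function. -/
theorem runMax_le_sqrt_bracket (y : ℕ → ℝ) (N : ℕ) :
    runMax y N ≤ 28 * Real.sqrt (bracket y N)
      + 2 * ∑ n ∈ Finset.range N, davisWeight 1 y n * (y (n + 1) - y n) := by
  set V : ℕ → ℝ := fun n => Real.sqrt (bracket y n + 1 * runMax y n ^ 2) with hVdef
  have hVsq : ∀ n, V n ^ 2 = bracket y n + runMax y n ^ 2 := by
    intro n
    rw [hVdef]
    simp only
    rw [Real.sq_sqrt (by have := bracket_nonneg y n; positivity), one_mul]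
  have hV0 : ∀ n, 0 ≤ V n := fun n => Real.sqrt_nonneg _
  -- The potential of `davis_step_max` is propagated in time; it dominates `V`, hence the running
  -- maximum.
  have main : ∀ n, V n + (y n ^ 2 + bracket y n) / V n ≤ 28 * Real.sqrt (bracket y n)
      + 2 * ∑ i ∈ Finset.range n, davisWeight 1 y i * (y (i + 1) - y i) := by
    intro n
    induction n with
    | zero =>
      have hb : bracket y 0 = y 0 ^ 2 := by simp [bracket]
      have h1 := hVsq 0
      rw [hb, runMax_zero, sq_abs] at h1
      have h2 : (y 0 ^ 2 + bracket y 0) / V 0 = V 0 := by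
        rw [hb, ← h1]
        rcases (hV0 0).eq_or_lt with h | h
        · rw [← h]; simp
        · field_simp
      have h3 : V 0 ≤ 2 * |y 0| := by
        refine abs_le_of_sq_le_sq' ?_ (by positivity) |>.2
        rw [mul_pow, sq_abs, h1]
        nlinarith [sq_nonneg (y 0)]
      rw [h2, hb, Real.sqrt_sq_eq_abs]
      have := abs_nonneg (y 0)
      simp only [Finset.range_zero, Finset.sum_empty]
      linarith
    | succ n ih =>
      have hs := davis_step_max (a := bracket y n) (x := y n) (d := y (n + 1) - y n)
        (m := runMax y n) (m' := runMax y (n + 1)) (V := V n) (V' := V (n + 1))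
        (bracket_nonneg y n) (abs_le_runMax y le_rfl)
        (by rw [runMax_succ, add_sub_cancel]) (hV0 n) (hV0 (n + 1)) (hVsq n)
        (by rw [hVsq, bracket_succ])
      have hq := sq_div_sqrt_le (a := bracket y n) (d := y (n + 1) - y n) (V' := V (n + 1))
        (bracket_nonneg y n) (by
          rw [← bracket_succ, hVdef]
          exact Real.sqrt_le_sqrt (by nlinarith [sq_nonneg (runMax y (n + 1))]))
      rw [add_sub_cancel, ← bracket_succ] at hs
      rw [← bracket_succ] at hq
      have hw : davisWeight 1 y n = y n / V n := rfl
      rw [Finset.sum_range_succ, hw]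
      linarith
  have h1 : runMax y N ≤ V N := by
    refine abs_le_of_sq_le_sq' ?_ (hV0 N) |>.2
    rw [hVsq]
    linarith [bracket_nonneg y N]
  have h2 : 0 ≤ (y N ^ 2 + bracket y N) / V N :=
    div_nonneg (add_nonneg (sq_nonneg _) (bracket_nonneg y N)) (hV0 N)
  linarith [main N]

/-- Pathwise Davis inequality: the square function is controlled by the maximal function. -/
theorem sqrt_bracket_le_runMax (y : ℕ → ℝ) (N : ℕ) :
    Real.sqrt (bracket y N) ≤ 16 * runMax y N
      - 32 / 11 * ∑ n ∈ Finset.range N, davisWeight 16 y n * (y (n + 1) - y n) := by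
  set V : ℕ → ℝ := fun n => Real.sqrt (bracket y n + 16 * runMax y n ^ 2) with hVdef
  have hVsq : ∀ n, V n ^ 2 = bracket y n + 16 * runMax y n ^ 2 := by
    intro n
    rw [hVdef]
    simp only
    rw [Real.sq_sqrt (by have := bracket_nonneg y n; positivity)]
  have hV0 : ∀ n, 0 ≤ V n := fun n => Real.sqrt_nonneg _
  have main : ∀ n, 11 / 16 * V n - y n ^ 2 / V n - 8 * runMax y n
      ≤ -2 * ∑ i ∈ Finset.range n, davisWeight 16 y i * (y (i + 1) - y i) := by
    intro n
    induction n with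
    | zero =>
      have hb : bracket y 0 = y 0 ^ 2 := by simp [bracket]
      have h1 := hVsq 0
      rw [hb, runMax_zero, sq_abs] at h1
      have h3 : V 0 ≤ 5 * |y 0| := by
        refine abs_le_of_sq_le_sq' ?_ (by positivity) |>.2
        rw [mul_pow, sq_abs, h1]
        nlinarith [sq_nonneg (y 0)]
      have h4 : 0 ≤ y 0 ^ 2 / V 0 := div_nonneg (sq_nonneg _) (hV0 0)
      have := abs_nonneg (y 0)
      rw [runMax_zero]
      simp only [Finset.range_zero, Finset.sum_empty]
      linarith
    | succ n ih =>
      have hs := davis_step_square (a := bracket y n) (x := y n) (d := y (n + 1) - y n)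
        (m := runMax y n) (m' := runMax y (n + 1)) (V := V n) (V' := V (n + 1))
        (bracket_nonneg y n) (abs_le_runMax y le_rfl)
        (by rw [runMax_succ, add_sub_cancel]) (hV0 n) (hV0 (n + 1)) (hVsq n)
        (by rw [hVsq, bracket_succ])
      rw [add_sub_cancel] at hs
      have hw : davisWeight 16 y n = y n / V n := rfl
      rw [Finset.sum_range_succ, hw]
      linarith
  have h1 : 4 * runMax y N ≤ V N := by
    refine abs_le_of_sq_le_sq' ?_ (hV0 N) |>.2
    rw [hVsq]
    linarith [bracket_nonneg y N]
  have h2 : Real.sqrt (bracket y N) ≤ V N :=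
    Real.sqrt_le_sqrt (by nlinarith [sq_nonneg (runMax y N)])
  have h3 : y N ^ 2 / V N ≤ runMax y N := by
    rcases (hV0 N).eq_or_lt with h | h
    · rw [← h, div_zero]
      exact runMax_nonneg y N
    · rw [div_le_iff₀ h, ← sq_abs]
      have h4 := abs_le_runMax y (le_refl N)
      have h5 := abs_nonneg (y N)
      have h6 := runMax_nonneg y N
      nlinarith
  -- Altogether `(11 / 16) √[y] ≤ 9 y* - 2 ∑`. Dividing gives the factor `32 / 11` of the transform,
  -- and `144 / 11 ≤ 16`.
  have := main N
  have := runMax_nonneg y N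
  linarith

/-! ### Maximal function and square function of a finite martingale -/

variable {Ω : Type*} {R : ℕ → Ω → Ω → Prop}

/-- The path of the martingale `x` after time `j`, relative to its value at time `j`. -/
def pathAfter (x : ℕ → Ω → ℝ) (j : ℕ) (ω : Ω) (i : ℕ) : ℝ := x (j + 1 + i) ω - x j ω

/-- The path starts at `x (j + 1) - x j`, so the initial square in `bracket` is the jump from `j` to
`j + 1`. Garsia's lemma conditions at time `j + 1` and needs this jump to be included. -/
theorem bracket_pathAfter (x : ℕ → Ω → ℝ) {j M : ℕ} (hj : j < M) (ω : Ω) :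
    bracket (pathAfter x j ω) (M - j - 1)
      = ∑ i ∈ Finset.Ico j M, (x (i + 1) ω - x i ω) ^ 2 := by
  obtain ⟨N, rfl⟩ : ∃ N, M = j + 1 + N := ⟨M - j - 1, by omega⟩
  rw [show j + 1 + N - j - 1 = N by omega, Finset.sum_eq_sum_Ico_succ_bot hj, bracket]
  congr 1
  rw [Finset.sum_Ico_eq_sum_range, show j + 1 + N - (j + 1) = N by omega]
  refine Finset.sum_congr rfl fun i _ => ?_
  simp only [pathAfter]
  rw [show j + 1 + (i + 1) = j + 1 + i + 1 by omega]
  ring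

variable [Fintype Ω] {w : Ω → ℝ}

theorem sum_Ico_increment (A : ℕ → ℝ) {k M : ℕ} (h : k ≤ M) :
    ∑ n ∈ Finset.Ico k (M + 1), (A n - if n = 0 then 0 else A (n - 1))
      = A M - if k = 0 then 0 else A (k - 1) := by
  induction M, h using Nat.le_induction with
  | base => simp
  | succ n hn ih =>
    rw [Finset.sum_Ico_succ_top (by omega), ih]
    simp

/-- The weight depends on the path up to the current time only. Multiplied by `ψ` it is still
adapted, so it is orthogonal to the next martingale increment. -/
theorem sum_davisWeight_eq_zero (hR : ∀ n ω ω', R (n + 1) ω ω' → R n ω ω') {M : ℕ}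
    {x : ℕ → Ω → ℝ} (hx : IsFinMartingale w R M x) {j : ℕ} (hj : j < M) (c : ℝ) {ψ : Ω → ℝ}
    (hψ : AdaptedTo R (j + 1) ψ) :
    ∑ ω, w ω * (ψ ω * ∑ n ∈ Finset.range (M - j - 1),
      davisWeight c (pathAfter x j ω) n * (pathAfter x j ω (n + 1) - pathAfter x j ω n)) = 0 := by
  simp_rw [Finset.mul_sum]
  rw [Finset.sum_comm]
  refine Finset.sum_eq_zero fun n hn => ?_
  have hn' := Finset.mem_range.1 hn
  have := hx.2 (j + 1 + n) (by omega) (fun ω => ψ ω * davisWeight c (pathAfter x j ω) n) ?_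
  · rw [← this]
    refine Finset.sum_congr rfl fun ω _ => ?_
    simp only [pathAfter]
    rw [show j + 1 + (n + 1) = j + 1 + n + 1 by omega]
    ring
  · intro ω ω' h
    have h1 : ψ ω = ψ ω' := hψ.mono hR (by omega) ω ω' h
    have h2 : davisWeight c (pathAfter x j ω) n = davisWeight c (pathAfter x j ω') n := by
      refine davisWeight_congr fun i hi => ?_
      simp only [pathAfter]
      rw [(hx.1 (j + 1 + i)).mono hR (by omega : j + 1 + i ≤ j + 1 + n) ω ω' h,
        (hx.1 j).mono hR (by omega : j ≤ j + 1 + n) ω ω' h]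
    simp only [h1, h2]

/-- The pathwise Davis inequality is integrated against `ψ`; the predictable transform drops out. -/
theorem condLE_runMax (hw : ∀ ω, 0 ≤ w ω) (hR : ∀ n ω ω', R (n + 1) ω ω' → R n ω ω') {M : ℕ}
    {x : ℕ → Ω → ℝ} (hx : IsFinMartingale w R M x) {j : ℕ} (hj : j < M) :
    CondLE w R (j + 1) (fun ω => runMax (pathAfter x j ω) (M - j - 1))
      (fun ω => 28 * Real.sqrt (∑ i ∈ Finset.Ico j M, (x (i + 1) ω - x i ω) ^ 2)) := by
  intro ψ hψ hψ0
  have h0 := sum_davisWeight_eq_zero hR hx hj 1 hψ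
  calc ∑ ω, w ω * (ψ ω * runMax (pathAfter x j ω) (M - j - 1))
      ≤ ∑ ω, (w ω * (ψ ω * (28 * Real.sqrt (∑ i ∈ Finset.Ico j M, (x (i + 1) ω - x i ω) ^ 2)))
        + 2 * (w ω * (ψ ω * ∑ n ∈ Finset.range (M - j - 1), davisWeight 1 (pathAfter x j ω) n *
          (pathAfter x j ω (n + 1) - pathAfter x j ω n)))) := by
        refine Finset.sum_le_sum fun ω _ => ?_
        have h := runMax_le_sqrt_bracket (pathAfter x j ω) (M - j - 1)
        rw [bracket_pathAfter x hj] at h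
        have := mul_le_mul_of_nonneg_left (mul_le_mul_of_nonneg_left h (hψ0 ω)) (hw ω)
        linarith
    _ = _ := by
        rw [Finset.sum_add_distrib, ← Finset.mul_sum, h0, mul_zero, add_zero]

theorem condLE_sqrt (hw : ∀ ω, 0 ≤ w ω) (hR : ∀ n ω ω', R (n + 1) ω ω' → R n ω ω') {M : ℕ}
    {x : ℕ → Ω → ℝ} (hx : IsFinMartingale w R M x) {j : ℕ} (hj : j < M) :
    CondLE w R (j + 1) (fun ω => Real.sqrt (∑ i ∈ Finset.Ico j M, (x (i + 1) ω - x i ω) ^ 2))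
      (fun ω => 16 * runMax (pathAfter x j ω) (M - j - 1)) := by
  intro ψ hψ hψ0
  have h0 := sum_davisWeight_eq_zero hR hx hj 16 hψ
  calc ∑ ω, w ω * (ψ ω * Real.sqrt (∑ i ∈ Finset.Ico j M, (x (i + 1) ω - x i ω) ^ 2))
      ≤ ∑ ω, (w ω * (ψ ω * (16 * runMax (pathAfter x j ω) (M - j - 1)))
        - 32 / 11 * (w ω * (ψ ω * ∑ n ∈ Finset.range (M - j - 1),
          davisWeight 16 (pathAfter x j ω) n *
          (pathAfter x j ω (n + 1) - pathAfter x j ω n)))) := by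
        refine Finset.sum_le_sum fun ω _ => ?_
        have h := sqrt_bracket_le_runMax (pathAfter x j ω) (M - j - 1)
        rw [bracket_pathAfter x hj] at h
        have := mul_le_mul_of_nonneg_left (mul_le_mul_of_nonneg_left h (hψ0 ω)) (hw ω)
        linarith
    _ = _ := by
        rw [Finset.sum_sub_distrib, ← Finset.mul_sum, h0, mul_zero, sub_zero]

/-- Garsia's lemma for an increasing adapted process. -/
theorem garsia (hw : ∀ ω, 0 ≤ w ω) (hR : ∀ n ω ω', R (n + 1) ω ω' → R n ω ω') {p : ℝ}
    (hp : 1 ≤ p) {M : ℕ} {A : ℕ → Ω → ℝ} {Y : Ω → ℝ} (hA : ∀ n, AdaptedTo R n (A n))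
    (hA0 : ∀ ω, A 0 ω = 0) (hAm : ∀ n ω, A n ω ≤ A (n + 1) ω) (hY : ∀ ω, 0 ≤ Y ω)
    (h : ∀ j < M, CondLE w R (j + 1) (fun ω => A M ω - A j ω) Y) :
    ∑ ω, w ω * A M ω ^ p ≤ 2 * (2 * p) ^ p * ∑ ω, w ω * Y ω ^ p := by
  have hAn : ∀ n ω, 0 ≤ A n ω := by
    intro n ω
    induction n with
    | zero => rw [hA0]
    | succ n ih => exact ih.trans (hAm n ω)
  -- With `Φ = 1` and the increments of `A` as weights, the weights from `k` on add up to `A M - A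
  -- (k - 1)`, and the embedding becomes Garsia's inequality.
  have := adapted_carleson_of_one_le hw hR hp (M := M) (Φ := fun _ _ => 1)
    (β := fun k ω => A k ω - if k = 0 then 0 else A (k - 1) ω) (Y := Y)
    (fun n ω ω' _ => rfl) (fun _ _ => zero_le_one) (fun _ _ => le_rfl)
    (AdaptedTo.increment hR hA) (increment_nonneg hAn hAm) hY ?_
  · simp only [one_mul] at this
    simpa only [sum_increment (fun n => A n _) M] using this
  · intro k hk
    simp only [sum_Ico_increment (fun n => A n _) hk]
    -- At `k = 0` there is no hypothesis at time `-1`. If `M > 0`, the hypothesis at `j = 0` serves: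
    -- `A 0 = 0`, and a multiplier known at time `0` is known at time `1`.
    rcases k with _ | j
    · rcases M with _ | M
      · intro ψ _ hψ0
        simp only [if_true, hA0, sub_zero, mul_zero, Finset.sum_const_zero]
        exact Finset.sum_nonneg fun ω _ => mul_nonneg (hw ω) (mul_nonneg (hψ0 ω) (hY ω))
      · intro ψ hψ hψ0
        have := h 0 (Nat.succ_pos M) ψ (hψ.mono hR (Nat.zero_le _)) hψ0
        simpa [hA0] using this
    · simpa using h j (by omega)

/-- Davis' inequality in `L ^ p`, `p ≥ 1`: the maximal function of a finite martingale is
controlled by its square function. -/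
theorem sum_runMax_rpow_le (hw : ∀ ω, 0 ≤ w ω) (hR : ∀ n ω ω', R (n + 1) ω ω' → R n ω ω')
    {p : ℝ} (hp : 1 ≤ p) {M : ℕ} {x : ℕ → Ω → ℝ} (hx : IsFinMartingale w R M x) :
    ∑ ω, w ω * runMax (fun n => x n ω - x 0 ω) M ^ p
      ≤ 2 * (2 * p) ^ p * 28 ^ p *
        ∑ ω, w ω * Real.sqrt (∑ i ∈ Finset.range M, (x (i + 1) ω - x i ω) ^ 2) ^ p := by
  have := garsia hw hR hp (M := M) (A := fun n ω => runMax (fun n => x n ω - x 0 ω) n)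
    (Y := fun ω => 28 * Real.sqrt (∑ i ∈ Finset.range M, (x (i + 1) ω - x i ω) ^ 2))
    (fun n ω ω' h => runMax_congr fun i hi => by
      rw [(hx.1 i).mono hR hi ω ω' h, (hx.1 0).mono hR (Nat.zero_le n) ω ω' h])
    (fun ω => by simp [runMax_zero]) (fun n ω => runMax_mono _ (Nat.le_succ n))
    (fun ω => by positivity) ?_
  · refine this.trans (le_of_eq ?_)
    rw [mul_assoc _ ((28 : ℝ) ^ p), Finset.mul_sum (a := (28 : ℝ) ^ p)]
    congr 1
    refine Finset.sum_congr rfl fun ω _ => ?_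
    rw [Real.mul_rpow (by norm_num) (Real.sqrt_nonneg _)]
    ring
  · intro j hj
    refine (condLE_runMax hw hR hx hj).mono hw (fun ω => ?_) (fun ω => ?_)
    · rw [sub_le_iff_le_add]
      refine runMax_le fun i hi => ?_
      rcases le_or_gt i j with h | h
      · have h1 := abs_le_runMax (fun n => x n ω - x 0 ω) h
        have h2 := runMax_nonneg (pathAfter x j ω) (M - j - 1)
        linarith
      · obtain ⟨l, rfl⟩ : ∃ l, i = j + 1 + l := ⟨i - j - 1, by omega⟩
        have h1 := abs_le_runMax (pathAfter x j ω) (by omega : l ≤ M - j - 1)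
        have h2 := abs_le_runMax (fun n => x n ω - x 0 ω) (le_refl j)
        have h3 := abs_add_le (x (j + 1 + l) ω - x j ω) (x j ω - x 0 ω)
        rw [sub_add_sub_cancel] at h3
        have h4 : pathAfter x j ω l = x (j + 1 + l) ω - x j ω := rfl
        rw [h4] at h1
        linarith
    · refine mul_le_mul_of_nonneg_left (Real.sqrt_le_sqrt ?_) (by norm_num)
      exact Finset.sum_le_sum_of_subset_of_nonneg
        (fun i hi => by simp only [Finset.mem_Ico, Finset.mem_range] at *; omega)
        (fun _ _ _ => sq_nonneg _)

/-- The square function of a finite martingale is controlled by its maximal function. -/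
theorem sum_sqrt_rpow_le (hw : ∀ ω, 0 ≤ w ω) (hR : ∀ n ω ω', R (n + 1) ω ω' → R n ω ω')
    {p : ℝ} (hp : 1 ≤ p) {M : ℕ} {x : ℕ → Ω → ℝ} (hx : IsFinMartingale w R M x) :
    ∑ ω, w ω * Real.sqrt (∑ i ∈ Finset.range M, (x (i + 1) ω - x i ω) ^ 2) ^ p
      ≤ 2 * (2 * p) ^ p * 32 ^ p * ∑ ω, w ω * runMax (fun n => x n ω) M ^ p := by
  have := garsia hw hR hp (M := M)
    (A := fun n ω => Real.sqrt (∑ i ∈ Finset.range n, (x (i + 1) ω - x i ω) ^ 2))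
    (Y := fun ω => 32 * runMax (fun n => x n ω) M)
    (fun n ω ω' h => ?_) (fun ω => by simp)
    (fun n ω => Real.sqrt_le_sqrt ?_)
    (fun ω => mul_nonneg (by norm_num) (runMax_nonneg _ _)) ?_
  · refine this.trans (le_of_eq ?_)
    rw [mul_assoc _ ((32 : ℝ) ^ p), Finset.mul_sum (a := (32 : ℝ) ^ p)]
    congr 1
    refine Finset.sum_congr rfl fun ω _ => ?_
    rw [Real.mul_rpow (by norm_num) (runMax_nonneg _ _)]
    ring
  · simp only
    congr 1
    refine Finset.sum_congr rfl fun i hi => ?_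
    have hi' := Finset.mem_range.1 hi
    rw [(hx.1 i).mono hR hi'.le ω ω' h, (hx.1 (i + 1)).mono hR hi' ω ω' h]
  · rw [Finset.sum_range_succ]
    linarith [sq_nonneg (x (n + 1) ω - x n ω)]
  · intro j hj
    -- Subadditivity of the square root bounds the growth of the square function after time `j`;
    -- differences of two values of `x` cost twice the maximum, which doubles `16` to `32`.
    refine (condLE_sqrt hw hR hx hj).mono hw (fun ω => ?_) (fun ω => ?_)
    · have h1 : ∑ i ∈ Finset.range M, (x (i + 1) ω - x i ω) ^ 2
          = ∑ i ∈ Finset.range j, (x (i + 1) ω - x i ω) ^ 2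
            + ∑ i ∈ Finset.Ico j M, (x (i + 1) ω - x i ω) ^ 2 :=
        (Finset.sum_range_add_sum_Ico _ hj.le).symm
      rw [h1, sub_le_iff_le_add']
      have h2 := Real.rpow_add_le_add_rpow_of_le_one (r := 1 / 2)
        (Finset.sum_nonneg fun i _ => sq_nonneg (x (i + 1) ω - x i ω) :
          0 ≤ ∑ i ∈ Finset.range j, (x (i + 1) ω - x i ω) ^ 2)
        (Finset.sum_nonneg fun i _ => sq_nonneg (x (i + 1) ω - x i ω) :
          0 ≤ ∑ i ∈ Finset.Ico j M, (x (i + 1) ω - x i ω) ^ 2) (by norm_num) (by norm_num)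
      simpa only [← Real.sqrt_eq_rpow] using h2
    · have h1 : runMax (pathAfter x j ω) (M - j - 1) ≤ 2 * runMax (fun n => x n ω) M := by
        refine runMax_le fun i hi => ?_
        have h2 := abs_le_runMax (fun n => x n ω) (by omega : j + 1 + i ≤ M)
        have h3 := abs_le_runMax (fun n => x n ω) (by omega : j ≤ M)
        have h4 := abs_sub (x (j + 1 + i) ω) (x j ω)
        simp only [pathAfter]
        linarith
      linarith

/-- Doob's maximal inequality for a nonnegative finite martingale. -/
theorem doob_maximal (hw : ∀ ω, 0 ≤ w ω) (hR : ∀ n ω ω', R (n + 1) ω ω' → R n ω ω')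
    {p : ℝ} (hp : 1 < p) {M : ℕ} {x : ℕ → Ω → ℝ} (hx : IsFinMartingale w R M x)
    (hx0 : ∀ n ω, 0 ≤ x n ω) :
    ∑ ω, w ω * runMax (fun n => x n ω) M ^ p
      ≤ 2 * (2 * (p / (p - 1))) ^ p * ∑ ω, w ω * x M ω ^ p := by
  have hp1 : 0 < p - 1 := by linarith
  have hp0 : 0 < p := by linarith
  set A : ℕ → Ω → ℝ := fun n ω => runMax (fun n => x n ω) n with hA
  have hA0 : ∀ n ω, 0 ≤ A n ω := fun n ω => runMax_nonneg _ _
  have hAm : ∀ n ω, A n ω ≤ A (n + 1) ω := fun n ω => runMax_mono _ (Nat.le_succ n)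
  have hAa : ∀ n, AdaptedTo R n (A n) := fun n ω ω' h =>
    runMax_congr fun i hi => (hx.1 i).mono hR hi ω ω' h
  set V : ℕ → Ω → ℝ := fun n ω => A n ω ^ (p - 1) with hV
  have hV0 : ∀ n ω, 0 ≤ V n ω := fun n ω => Real.rpow_nonneg (hA0 n ω) _
  have hVm : ∀ n ω, V n ω ≤ V (n + 1) ω := fun n ω =>
    Real.rpow_le_rpow (hA0 n ω) (hAm n ω) hp1.le
  have hVa : ∀ n, AdaptedTo R n (V n) := fun n ω ω' h => by simp only [hV, hAa n ω ω' h]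
  have hmul : ∀ t : ℝ, 0 ≤ t → t ^ (p - 1) * t = t ^ p := by
    intro t ht
    rcases ht.eq_or_lt with h | h
    · rw [← h, mul_zero, Real.zero_rpow hp0.ne']
    · rw [Real.rpow_sub_one h.ne']
      field_simp
  -- Young's inequality for `c ^ (p - 1) * a` with the exponents `p / (p - 1)` and `p`.
  have hyoung : ∀ a c : ℝ, 0 ≤ a → 0 ≤ c →
      (p - 1) / p * (a ^ p - c ^ p) ≤ (a ^ (p - 1) - c ^ (p - 1)) * a := by
    intro a c ha hc
    have hq : (p / (p - 1)).HolderConjugate p := by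
      have := (Real.HolderConjugate.conjExponent hp).symm
      simpa [Real.conjExponent] using this
    have h1 := Real.young_inequality_of_nonneg (Real.rpow_nonneg hc (p - 1)) ha hq
    rw [← Real.rpow_mul hc, mul_div_cancel₀ _ hp1.ne'] at h1
    have h2 := hmul a ha
    have h3 : (p - 1) / p * (a ^ p - c ^ p) = a ^ p - a ^ p / p - c ^ p / (p / (p - 1)) := by
      field_simp
    rw [h3, sub_mul, h2]
    linarith
  -- A pathwise Doob inequality: `V = A ^ (p - 1)` grows only when the maximum is renewed, and then
  -- `A k = x k`. Since the increments of `V` are adapted, `x k` may afterwards be replaced by the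
  -- final value `x M`.
  have hpath : ∀ ω n, (p - 1) / p * A n ω ^ p ≤ ∑ k ∈ Finset.range (n + 1),
      (V k ω - if k = 0 then 0 else V (k - 1) ω) * x k ω := by
    intro ω n
    induction n with
    | zero =>
      have h1 : A 0 ω = x 0 ω := by
        simp only [hA]
        rw [runMax_zero, abs_of_nonneg (hx0 0 ω)]
      simp only [zero_add, Finset.range_one, Finset.sum_singleton, if_true, sub_zero, hV, h1]
      have := hyoung (x 0 ω) 0 (hx0 0 ω) le_rfl
      rwa [Real.zero_rpow hp0.ne', Real.zero_rpow hp1.ne', sub_zero, sub_zero] at this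
    | succ n ih =>
      rw [Finset.sum_range_succ]
      simp only [Nat.add_eq_zero_iff, one_ne_zero, and_false, if_false, Nat.add_sub_cancel]
      have h1 : A (n + 1) ω = max (A n ω) (x (n + 1) ω) := by
        simp only [hA]
        rw [runMax_succ, abs_of_nonneg (hx0 (n + 1) ω)]
      rcases le_total (x (n + 1) ω) (A n ω) with h | h
      · rw [max_eq_left h] at h1
        simp only [hV, h1, sub_self, zero_mul, add_zero]
        exact ih
      · rw [max_eq_right h] at h1
        have h2 := hyoung (A (n + 1) ω) (A n ω) (hA0 _ ω) (hA0 _ ω)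
        rw [← h1]
        simp only [hV] at ih ⊢
        linarith
  have hmart : ∀ k ≤ M, ∀ ψ, AdaptedTo R k ψ →
      ∑ ω, w ω * (ψ ω * x k ω) = ∑ ω, w ω * (ψ ω * x M ω) := by
    intro k hk ψ hψ
    obtain ⟨l, rfl⟩ : ∃ l, M = k + l := ⟨M - k, by omega⟩
    have : ∀ i ≤ l, ∑ ω, w ω * (ψ ω * x k ω) = ∑ ω, w ω * (ψ ω * x (k + i) ω) := by
      intro i
      induction i with
      | zero => intro _; rfl
      | succ i ih =>
        intro hi
        have h1 := hx.2 (k + i) (by omega) ψ (hψ.mono hR (by omega))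
        rw [ih (by omega), ← sub_eq_zero, ← Finset.sum_sub_distrib, ← neg_eq_zero,
          ← Finset.sum_neg_distrib, ← h1]
        exact Finset.sum_congr rfl fun ω _ => by rw [← add_assoc]; ring
    exact this l le_rfl
  have step1 : (p - 1) / p * ∑ ω, w ω * A M ω ^ p ≤ ∑ ω, w ω * (V M ω * x M ω) := by
    calc (p - 1) / p * ∑ ω, w ω * A M ω ^ p
        ≤ ∑ ω, w ω * ∑ k ∈ Finset.range (M + 1),
            (V k ω - if k = 0 then 0 else V (k - 1) ω) * x k ω := by
          rw [Finset.mul_sum]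
          refine Finset.sum_le_sum fun ω _ => ?_
          have := mul_le_mul_of_nonneg_left (hpath ω M) (hw ω)
          linarith
      _ = ∑ k ∈ Finset.range (M + 1), ∑ ω, w ω *
            ((V k ω - if k = 0 then 0 else V (k - 1) ω) * x k ω) := by
          simp_rw [Finset.mul_sum]
          rw [Finset.sum_comm]
      _ = ∑ k ∈ Finset.range (M + 1), ∑ ω, w ω *
            ((V k ω - if k = 0 then 0 else V (k - 1) ω) * x M ω) := by
          refine Finset.sum_congr rfl fun k hk => ?_
          exact hmart k (by simpa [Nat.lt_succ_iff] using hk) _ (AdaptedTo.increment hR hVa k)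
      _ = _ := by
          rw [Finset.sum_comm]
          refine Finset.sum_congr rfl fun ω _ => ?_
          rw [← Finset.mul_sum, ← Finset.sum_mul, sum_increment (fun n => V n ω) M]
  have hq0 : 0 < p / (p - 1) := by positivity
  have step2 : p / (p - 1) * ∑ ω, w ω * (V M ω * x M ω)
      ≤ (∑ ω, w ω * A M ω ^ p) / 2 + (2 * (p / (p - 1))) ^ p * ∑ ω, w ω * x M ω ^ p := by
    rw [Finset.mul_sum, Finset.mul_sum, Finset.sum_div, ← Finset.sum_add_distrib]
    refine Finset.sum_le_sum fun ω _ => ?_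
    have := Real.mul_rpow_sub_one_le (a := p / (p - 1) * x M ω) (x := A M ω) (r := p)
      (mul_nonneg hq0.le (hx0 M ω)) (hA0 M ω) hp.le
    rw [← mul_assoc 2, Real.mul_rpow (by positivity) (hx0 M ω)] at this
    have := mul_le_mul_of_nonneg_left this (hw ω)
    simp only [hV]
    linarith
  have step3 : ∑ ω, w ω * A M ω ^ p ≤ p / (p - 1) * ∑ ω, w ω * (V M ω * x M ω) := by
    rw [div_mul_eq_mul_div, le_div_iff₀ hp1]
    rw [div_mul_eq_mul_div, div_le_iff₀ hp0] at step1
    linarith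
  change ∑ ω, w ω * A M ω ^ p ≤ _
  linarith

/-- The constant in `sum_mul_rpow_le`. -/
def extConst (p : ℝ) : ℝ :=
  2 * (p * (2 * (2 * (2 * (p / (p - 1) / 2)) ^ (p / (p - 1) / 2)
    + 2 * carlesonConst (p / (p - 1) / 2))) ^ (1 / (p / (p - 1)))) ^ p

/-- The `L ^ p` norm of `∑ b_n d_n` is controlled by the square function `(∑ d_n ^ 2) ^ (1 / 2)`
if `b` has bounded mean oscillation. -/
theorem sum_mul_rpow_le (hw : ∀ ω, 0 ≤ w ω) (hR : ∀ n ω ω', R (n + 1) ω ω' → R n ω ω')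
    {p : ℝ} (hp : 1 < p) {M : ℕ} {b d : ℕ → Ω → ℝ} {B : ℝ} (hB : 0 < B)
    (hb : ∀ n, AdaptedTo R n (b n)) (hd : ∀ n, AdaptedTo R n (d n))
    (hb0 : ∀ n ω, 0 ≤ b n ω) (hd0 : ∀ n ω, 0 ≤ d n ω)
    (h : ∀ k ≤ M, CondLE w R k (fun ω => ∑ n ∈ Finset.Ico k (M + 1), b n ω ^ 2) fun _ => B ^ 2) :
    ∑ ω, w ω * (∑ n ∈ Finset.range (M + 1), b n ω * d n ω) ^ p
      ≤ extConst p * B ^ p *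
        ∑ ω, w ω * Real.sqrt (∑ n ∈ Finset.range (M + 1), d n ω ^ 2) ^ p := by
  have hp1 : 0 < p - 1 := by linarith
  have hp0 : 0 < p := by linarith
  set q := p / (p - 1) with hq
  have hq0 : 0 < q := by positivity
  have hpq : p.HolderConjugate q := by
    have := Real.HolderConjugate.conjExponent hp
    simpa [Real.conjExponent] using this
  set C := 2 * (2 * (q / 2)) ^ (q / 2) + 2 * carlesonConst (q / 2) with hC
  have hC0 : 0 < C := by
    have := carlesonConst_pos (half_pos hq0)
    positivity
  set Z : ℕ → Ω → ℝ := fun n ω => ∑ i ∈ Finset.range (n + 1), b i ω * d i ω with hZ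
  have hc0 : ∀ n ω, 0 ≤ b n ω * d n ω := fun n ω => mul_nonneg (hb0 n ω) (hd0 n ω)
  have hZ0 : ∀ n ω, 0 ≤ Z n ω := fun n ω => Finset.sum_nonneg fun i _ => hc0 i ω
  have hZm : ∀ n ω, Z n ω ≤ Z (n + 1) ω := by
    intro n ω
    simp only [hZ]
    rw [Finset.sum_range_succ _ (n + 1)]
    linarith [hc0 (n + 1) ω]
  have hZa : ∀ n, AdaptedTo R n (Z n) := AdaptedTo.sum_range hR
    (c := fun n ω => b n ω * d n ω) (fun n ω ω' hω => by simp only [hb n ω ω' hω, hd n ω ω' hω])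
  set S : Ω → ℝ := fun ω => Real.sqrt (∑ n ∈ Finset.range (M + 1), d n ω ^ 2) with hS
  set U : Ω → ℝ := fun ω => ∑ n ∈ Finset.range (M + 1), (Z n ω ^ (p - 1)) ^ 2 * b n ω ^ 2 with hU
  have hU0 : ∀ ω, 0 ≤ U ω := fun ω => Finset.sum_nonneg fun i _ => by positivity
  have hS0 : ∀ ω, 0 ≤ S ω := fun ω => Real.sqrt_nonneg _
  have hZp : ∀ n ω, 0 ≤ Z n ω ^ (p - 1) := fun n ω => Real.rpow_nonneg (hZ0 n ω) _
  -- The weights `b ^ 2` satisfy a first moment test, and `adapted_carleson` yields the moment `q /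
  -- 2`; since `q (p - 1) = p`, the multiplier turns into `Z ^ p`.
  have hEU : ∑ ω, w ω * U ω ^ (q / 2) ≤ C * B ^ q * ∑ ω, w ω * Z M ω ^ p := by
    have := adapted_carleson hw hR (half_pos hq0) (M := M) (B := B ^ 2)
      (Φ := fun n ω => (Z n ω ^ (p - 1)) ^ 2) (β := fun n ω => b n ω ^ 2) (by positivity)
      (fun n ω ω' hω => by simp only [hZa n ω ω' hω]) (fun n ω => sq_nonneg _)
      (fun n ω => by
        have := Real.rpow_le_rpow (hZ0 n ω) (hZm n ω) hp1.le
        have := hZp n ω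
        gcongr)
      (fun n ω ω' hω => by simp only [hb n ω ω' hω]) (fun n ω => sq_nonneg _) h
    have e1 : (B ^ 2) ^ (q / 2) = B ^ q := by
      rw [← Real.rpow_natCast, ← Real.rpow_mul hB.le]
      congr 1
      push_cast
      ring
    have e2 : ∀ ω, ((Z M ω ^ (p - 1)) ^ 2) ^ (q / 2) = Z M ω ^ p := by
      intro ω
      rw [← Real.rpow_natCast, ← Real.rpow_mul (hZp M ω), ← Real.rpow_mul (hZ0 M ω)]
      congr 1
      rw [hq]
      push_cast
      field_simp
    simp only [e1, e2] at this
    exact this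
  -- Chosen so that `lam ^ q = 2 C B ^ q`: the `U` term of Young's inequality then costs half of the
  -- left-hand side and is absorbed.
  set lam := (2 * C) ^ (1 / q) * B with hlam
  have hlam0 : 0 < lam := by positivity
  have hpt : ∀ ω, Z M ω ^ p ≤ (p * lam) ^ p * S ω ^ p + (lam ^ q)⁻¹ * U ω ^ (q / 2) := by
    intro ω
    have h1 := Real.rpow_sum_le_mul_sum hp.le (fun n => b n ω * d n ω) (fun n => hc0 n ω) (M + 1)
    have h2 : ∑ i ∈ Finset.range (M + 1), b i ω * d i ω * Z i ω ^ (p - 1)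
        ≤ S ω * Real.sqrt (U ω) := by
      have := Real.sum_mul_le_sqrt_mul_sqrt (Finset.range (M + 1)) (fun n => d n ω)
        (fun n => Z n ω ^ (p - 1) * b n ω)
      refine le_trans (le_of_eq ?_) (this.trans (le_of_eq ?_))
      · exact Finset.sum_congr rfl fun i _ => by ring
      · simp only [hS, hU, mul_pow]
    have h3 := Real.young_inequality_of_nonneg (a := p * lam * S ω)
      (b := lam⁻¹ * Real.sqrt (U ω)) (by have := hS0 ω; positivity) (by positivity) hpq
    have h4 : (lam⁻¹ * Real.sqrt (U ω)) ^ q = (lam ^ q)⁻¹ * U ω ^ (q / 2) := by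
      rw [Real.mul_rpow (by positivity) (Real.sqrt_nonneg _), Real.inv_rpow hlam0.le,
        Real.sqrt_eq_rpow, ← Real.rpow_mul (hU0 ω)]
      congr 2
      ring
    have h5 : (p * lam * S ω) ^ p = (p * lam) ^ p * S ω ^ p :=
      Real.mul_rpow (by positivity) (hS0 ω)
    rw [h4, h5] at h3
    have h6 : p * lam * S ω * (lam⁻¹ * Real.sqrt (U ω)) = p * (S ω * Real.sqrt (U ω)) := by
      field_simp
    have h7 : (p * lam) ^ p * S ω ^ p / p ≤ (p * lam) ^ p * S ω ^ p :=
      div_le_self (mul_nonneg (by positivity) (Real.rpow_nonneg (hS0 ω) _)) hp.le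
    have h8 : (lam ^ q)⁻¹ * U ω ^ (q / 2) / q ≤ (lam ^ q)⁻¹ * U ω ^ (q / 2) :=
      div_le_self (mul_nonneg (by positivity) (Real.rpow_nonneg (hU0 ω) _)) hpq.symm.lt.le
    have h9 := mul_le_mul_of_nonneg_left h2 hp0.le
    calc Z M ω ^ p ≤ p * (S ω * Real.sqrt (U ω)) := h1.trans h9
      _ ≤ _ := by linarith
  have e3 : lam ^ q = 2 * C * B ^ q := by
    rw [hlam, Real.mul_rpow (by positivity) hB.le, ← Real.rpow_mul (by positivity),
      one_div_mul_cancel hq0.ne', Real.rpow_one]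
  have hBq : 0 < B ^ q := by positivity
  have h10 : (lam ^ q)⁻¹ * ∑ ω, w ω * U ω ^ (q / 2) ≤ (∑ ω, w ω * Z M ω ^ p) / 2 := by
    rw [e3, inv_mul_le_iff₀ (by positivity)]
    linarith
  have h11 : ∑ ω, w ω * Z M ω ^ p
      ≤ (p * lam) ^ p * ∑ ω, w ω * S ω ^ p + (lam ^ q)⁻¹ * ∑ ω, w ω * U ω ^ (q / 2) := by
    rw [Finset.mul_sum, Finset.mul_sum, ← Finset.sum_add_distrib]
    refine Finset.sum_le_sum fun ω _ => ?_
    have := mul_le_mul_of_nonneg_left (hpt ω) (hw ω)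
    linarith
  have e4 : 2 * (p * lam) ^ p = extConst p * B ^ p := by
    rw [extConst, hlam, ← mul_assoc, Real.mul_rpow (by positivity) hB.le, mul_assoc]
  rw [← e4]
  change ∑ ω, w ω * Z M ω ^ p ≤ _
  linarith

end

noncomputable section

namespace IntervalLattice

/-! ### The intervals of a lattice -/

variable (L : IntervalLattice)

/-- The interval of generation `k` that contains `x` (empty if `x` is not in the carrier). -/
def atom (k : ℤ) (x : ℝ) : Set ℝ := ⋃₀ {I | I ∈ L.gen k ∧ x ∈ I}

variable {L} {I J Q : Set ℝ} {j k : ℤ} {x y : ℝ}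

theorem atom_eq (hI : I ∈ L.gen k) (hx : x ∈ I) : L.atom k x = I := by
  refine Set.Subset.antisymm ?_ (Set.subset_sUnion_of_mem ⟨hI, hx⟩)
  refine Set.sUnion_subset ?_
  rintro J ⟨hJ, hxJ⟩
  by_contra hne
  have : J ≠ I := fun h => hne h.subset
  exact Set.disjoint_left.1 (L.disjoint k hJ hI this) hxJ hx

theorem exists_mem_gen (hx : x ∈ L.carrier) (k : ℤ) : ∃ I ∈ L.gen k, x ∈ I := by
  rw [← L.cover k] at hx
  exact hx

theorem atom_mem_gen (hx : x ∈ L.carrier) (k : ℤ) : L.atom k x ∈ L.gen k := by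
  obtain ⟨I, hI, hxI⟩ := exists_mem_gen hx k
  rwa [atom_eq hI hxI]

theorem mem_atom (hx : x ∈ L.carrier) (k : ℤ) : x ∈ L.atom k x := by
  obtain ⟨I, hI, hxI⟩ := exists_mem_gen hx k
  rwa [atom_eq hI hxI]

theorem subset_carrier (hI : I ∈ L.gen k) : I ⊆ L.carrier := by
  rw [← L.cover k]
  exact Set.subset_sUnion_of_mem hI

theorem nonempty_of_mem_gen (hI : I ∈ L.gen k) : I.Nonempty := by
  obtain ⟨a, b, hab, rfl⟩ := L.isInterval k I hI
  exact Set.nonempty_Ico.2 hab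

theorem measurableSet_of_mem_gen (hI : I ∈ L.gen k) : MeasurableSet I := by
  obtain ⟨a, b, hab, rfl⟩ := L.isInterval k I hI
  exact measurableSet_Ico

theorem volume_pos_of_mem_gen (hI : I ∈ L.gen k) : 0 < volume I := by
  obtain ⟨a, b, hab, rfl⟩ := L.isInterval k I hI
  simp [hab]

theorem volume_lt_top_of_mem_gen (hI : I ∈ L.gen k) : volume I < ∞ := by
  obtain ⟨a, b, hab, rfl⟩ := L.isInterval k I hI
  simp

theorem gen_countable (k : ℤ) : (L.gen k).Countable := by
  refine (L.disjoint k).countable_of_nonempty_interior ?_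
  intro I hI
  obtain ⟨a, b, hab, rfl⟩ := L.isInterval k I hI
  simp [interior_Ico, hab]

theorem intervals_countable : L.intervals.Countable :=
  Set.countable_iUnion fun k => gen_countable k

instance : Countable L.intervals := intervals_countable.to_subtype

theorem measurableSet_carrier : MeasurableSet L.carrier := by
  rw [← L.cover 0]
  exact MeasurableSet.sUnion (gen_countable 0) fun I hI => measurableSet_of_mem_gen hI

theorem atom_succ_subset (hx : x ∈ L.carrier) (k : ℤ) : L.atom (k + 1) x ⊆ L.atom k x := by
  obtain ⟨F, -, hF, hU⟩ := L.refinement k _ (atom_mem_gen hx k)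
  have : x ∈ ⋃₀ F := hU ▸ mem_atom hx k
  obtain ⟨J, hJ, hxJ⟩ := this
  rw [atom_eq (hF hJ) hxJ, ← hU]
  exact Set.subset_sUnion_of_mem hJ

theorem atom_anti (hx : x ∈ L.carrier) (h : j ≤ k) : L.atom k x ⊆ L.atom j x := by
  induction k, h using Int.leInduction with
  | base => exact Set.Subset.rfl
  | succ n _ ih => exact (atom_succ_subset hx n).trans ih

theorem subset_of_mem_inter (hI : I ∈ L.gen j) (hJ : J ∈ L.gen k) (h : j ≤ k) (hxI : x ∈ I)
    (hxJ : x ∈ J) : J ⊆ I := by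
  rw [← atom_eq hI hxI, ← atom_eq hJ hxJ]
  exact atom_anti (subset_carrier hI hxI) h

theorem atom_subset (hI : I ∈ L.gen j) (h : j ≤ k) (hx : x ∈ I) : L.atom k x ⊆ I := by
  have hxc := subset_carrier hI hx
  exact subset_of_mem_inter hI (atom_mem_gen hxc k) h hx (mem_atom hxc k)

theorem finite_cells (hI : I ∈ L.gen j) (h : j ≤ k) : {J | J ∈ L.gen k ∧ J ⊆ I}.Finite := by
  induction k, h using Int.leInduction with
  | base =>
    refine (Set.finite_singleton I).subset ?_
    rintro J ⟨hJ, hJI⟩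
    obtain ⟨x, hx⟩ := nonempty_of_mem_gen hJ
    rw [Set.mem_singleton_iff, ← atom_eq hJ hx, atom_eq hI (hJI hx)]
  | succ n hn ih =>
    choose! F hfin hF hU using L.refinement n
    refine (ih.biUnion (t := F) fun J hJ => hfin J hJ.1).subset ?_
    rintro J ⟨hJ, hJI⟩
    obtain ⟨x, hx⟩ := nonempty_of_mem_gen hJ
    have hxc := subset_carrier hJ hx
    refine Set.mem_biUnion (x := L.atom n x)
      ⟨atom_mem_gen hxc n, atom_subset hI hn (hJI hx)⟩ ?_
    have : x ∈ ⋃₀ F (L.atom n x) := by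
      rw [hU _ (atom_mem_gen hxc n)]
      exact mem_atom hxc n
    obtain ⟨J', hJ', hxJ'⟩ := this
    have := hF _ (atom_mem_gen hxc n) hJ'
    rwa [← atom_eq hJ hx, atom_eq this hxJ']

/-- An interval occurs in consecutive generations: if `I` is in `gen k` and in a later generation,
the atoms in between are squeezed between `I` and `I`. -/
theorem isRank_iff : L.IsRank I k ↔ I ∈ L.gen k ∧ I ∉ L.gen (k + 1) := by
  constructor
  · rintro ⟨h1, h2⟩
    refine ⟨h1, fun h => ?_⟩
    have := h2 _ h
    omega
  · rintro ⟨h1, h2⟩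
    refine ⟨h1, fun m hm => ?_⟩
    by_contra! hlt
    obtain ⟨x, hx⟩ := nonempty_of_mem_gen h1
    have hxc := subset_carrier h1 hx
    have e1 := atom_eq h1 hx
    have e2 := atom_eq hm hx
    have h3 : L.atom (k + 1) x ⊆ I := e1 ▸ atom_succ_subset hxc k
    have h4 : I ⊆ L.atom (k + 1) x := by
      have := atom_anti hxc (show k + 1 ≤ m by omega)
      rwa [e2] at this
    exact h2 (h3.antisymm h4 ▸ atom_mem_gen hxc (k + 1))

theorem IsRank.unique (h : L.IsRank I j) (h' : L.IsRank I k) : j = k :=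
  le_antisymm (h'.2 j h.1) (h.2 k h'.1)

theorem IsRank.child_eq (h : L.IsRank I k) : L.child I = {J | J ∈ L.gen (k + 1) ∧ J ⊆ I} := by
  ext J
  constructor
  · rintro ⟨m, hm, hJ, hJI⟩
    exact ⟨hm.unique h ▸ hJ, hJI⟩
  · rintro ⟨hJ, hJI⟩
    exact ⟨k, h, hJ, hJI⟩

theorem IsRank.atom_mem_child (h : L.IsRank I k) (hx : x ∈ I) : L.atom (k + 1) x ∈ L.child I := by
  rw [h.child_eq]
  exact ⟨atom_mem_gen (subset_carrier h.1 hx) _, atom_subset h.1 (by omega) hx⟩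

theorem IsRank.child_nonempty (h : L.IsRank I k) : (L.child I).Nonempty := by
  obtain ⟨x, hx⟩ := nonempty_of_mem_gen h.1
  exact ⟨_, h.atom_mem_child hx⟩

theorem IsRank.sUnion_child (h : L.IsRank I k) : ⋃₀ L.child I = I := by
  refine Set.Subset.antisymm (Set.sUnion_subset fun J hJ => ?_) fun x hx => ?_
  · obtain ⟨_, _, _, hJI⟩ := hJ
    exact hJI
  · exact ⟨_, h.atom_mem_child hx, mem_atom (subset_carrier h.1 hx) _⟩

theorem IsRank.finite_child (h : L.IsRank I k) : (L.child I).Finite := by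
  rw [h.child_eq]
  exact finite_cells h.1 (by omega)

theorem atom_succ_eq_of_not_isRank (hx : x ∈ L.carrier) (h : ¬ L.IsRank (L.atom k x) k) :
    L.atom (k + 1) x = L.atom k x := by
  rw [isRank_iff, not_and, not_not] at h
  exact atom_eq (h (atom_mem_gen hx k)) (mem_atom hx k)

theorem mem_intervals (hI : I ∈ L.gen k) : I ∈ L.intervals := Set.mem_iUnion.2 ⟨k, hI⟩

theorem sUnion_child_subset (I : Set ℝ) : ⋃₀ L.child I ⊆ I := by
  refine Set.sUnion_subset fun J hJ => ?_
  obtain ⟨_, _, _, hJI⟩ := hJ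
  exact hJI

/-- Reindexing of a sum over the intervals that contain `x` by the generations. -/
theorem tsum_intervals (F : L.intervals → ℝ≥0∞)
    (hF : ∀ I : L.intervals, F I ≠ 0 → x ∈ (I : Set ℝ) ∧ (L.child I).Nonempty) (G : ℤ → ℝ≥0∞)
    (hG : ∀ k (h : L.IsRank (L.atom k x) k), G k = F ⟨L.atom k x, mem_intervals h.1⟩)
    (hG0 : ∀ k, ¬ L.IsRank (L.atom k x) k → G k = 0) :
    ∑' I : L.intervals, F I = ∑' k : ℤ, G k := by
  have hsupp : ∀ k, G k ≠ 0 → L.IsRank (L.atom k x) k := fun k hk => by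
    by_contra h
    exact hk (hG0 k h)
  symm
  -- An interval in the support is sent to its rank; it is recovered as the atom of `x` in that
  -- generation.
  refine (tsum_eq_tsum_of_ne_zero_bij
    (fun k : Function.support F => Classical.choose (hF k.1 k.2).2.choose_spec) ?_ ?_ ?_).trans rfl
  · intro I I' h
    simp only at h
    have h1 := (Classical.choose_spec (hF I.1 I.2).2.choose_spec).1
    have h2 := (Classical.choose_spec (hF I'.1 I'.2).2.choose_spec).1
    rw [h] at h1
    have e1 := atom_eq h1.1 (hF I.1 I.2).1
    have e2 := atom_eq h2.1 (hF I'.1 I'.2).1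
    exact Subtype.ext (Subtype.ext (e1.symm.trans e2))
  · intro k hk
    have hr := hsupp k hk
    have hne : F ⟨L.atom k x, mem_intervals hr.1⟩ ≠ 0 := by
      rw [← hG k hr]
      exact hk
    refine ⟨⟨_, hne⟩, ?_⟩
    exact (Classical.choose_spec (hF _ hne).2.choose_spec).1.unique hr
  · intro I
    have h1 := (Classical.choose_spec (hF I.1 I.2).2.choose_spec).1
    have e1 := atom_eq h1.1 (hF I.1 I.2).1
    rw [hG _ (by rwa [e1])]
    congr 1
    exact Subtype.ext e1

/-! ### The union of the chain of a point -/

variable (L) in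
/-- The union of all the intervals of the lattice that contain `x`. -/
def top (x : ℝ) : Set ℝ := ⋃ k, L.atom k x

theorem mem_top (hx : x ∈ L.carrier) : x ∈ L.top x := Set.mem_iUnion.2 ⟨0, mem_atom hx 0⟩

theorem top_subset_carrier (hx : x ∈ L.carrier) : L.top x ⊆ L.carrier :=
  Set.iUnion_subset fun k => subset_carrier (atom_mem_gen hx k)

theorem atom_subset_top (k : ℤ) (x : ℝ) : L.atom k x ⊆ L.top x :=
  Set.subset_iUnion (fun k => L.atom k x) k

theorem measurableSet_top (hx : x ∈ L.carrier) : MeasurableSet (L.top x) :=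
  MeasurableSet.iUnion fun k => measurableSet_of_mem_gen (atom_mem_gen hx k)

/-- Two chains whose unions contain `x` agree in all sufficiently coarse generations, and the union
of a decreasing chain depends only on those. -/
theorem mem_finTops_iff {T : Set ℝ} (hx : x ∈ T) :
    T ∈ L.finTops ↔ x ∈ L.carrier ∧ T = L.top x ∧ volume (L.top x) < ∞ := by
  constructor
  · rintro ⟨⟨I, hI, hmono, rfl⟩, hvol⟩
    obtain ⟨k, hk⟩ := Set.mem_iUnion.1 hx
    have hxc := subset_carrier (hI k) hk
    have hanti : ∀ i j, i ≤ j → I j ⊆ I i := by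
      intro i j hij
      induction j, hij using Int.leInduction with
      | base => exact Set.Subset.rfl
      | succ n _ ih =>
        have := hmono (n + 1)
        rw [add_sub_cancel_right] at this
        exact this.trans ih
    have key : ∀ m, m ≤ k → L.atom m x = I m := fun m hm => atom_eq (hI m) (hanti m k hm hk)
    have e : (⋃ k, I k) = L.top x := by
      refine Set.Subset.antisymm (Set.iUnion_subset fun m => ?_) (Set.iUnion_subset fun m => ?_)
      · refine (hanti _ _ (min_le_left m k)).trans ?_
        rw [← key _ (min_le_right m k)]
        exact atom_subset_top _ _
      · refine (atom_anti hxc (min_le_left m k)).trans ?_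
        rw [key _ (min_le_right m k)]
        exact Set.subset_iUnion _ _
    exact ⟨hxc, e, e ▸ hvol⟩
  · rintro ⟨hxc, rfl, hvol⟩
    refine ⟨⟨fun k => L.atom k x, fun k => atom_mem_gen hxc k, fun k => atom_anti hxc (by omega),
      rfl⟩, hvol⟩

/-! ### Averages, differences and the processes of a point -/

variable {𝕜 : Type*} [RCLike 𝕜]

variable (L) in
/-- The average of `f` over the interval of generation `k` that contains `x`. -/
def expect (k : ℤ) (f : ℝ → 𝕜) (x : ℝ) : 𝕜 := ⨍ y in L.atom k x, f y

variable (L) in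
/-- The difference of the averages of two consecutive generations. -/
def diff (k : ℤ) (f : ℝ → 𝕜) (x : ℝ) : 𝕜 := L.expect (k + 1) f x - L.expect k f x

open Classical in
variable (L) in
/-- The `k`-th term at `x` of a formal martingale difference sequence. -/
def term (b : L.intervals → ℝ → 𝕜) (k : ℤ) (x : ℝ) : 𝕜 :=
  if h : L.IsRank (L.atom k x) k then b ⟨L.atom k x, mem_intervals h.1⟩ x else 0

open Classical in
variable (L) in
/-- The average of `f` over the union of the chain of `x`, if that has finite length. -/
def topAvg (f : ℝ → 𝕜) (x : ℝ) : 𝕜 := if volume (L.top x) < ∞ then ⨍ y in L.top x, f y else 0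

theorem avg_of_mem {f : ℝ → 𝕜} (hx : x ∈ I) : avg I f x = ⨍ y in I, f y :=
  Set.indicator_of_mem hx _

theorem avg_of_notMem {f : ℝ → 𝕜} (hx : x ∉ I) : avg I f x = 0 := Set.indicator_of_notMem hx _

theorem mdiff_of_notMem {f : ℝ → 𝕜} (hx : x ∉ I) : L.mdiff I f x = 0 := by
  rw [mdiff]
  split_ifs
  · rw [avg_of_notMem hx, sub_zero]
    refine finsum_mem_eq_zero_of_forall_eq_zero fun J hJ => avg_of_notMem fun h => hx ?_
    obtain ⟨_, _, _, hJI⟩ := hJ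
    exact hJI h
  · rfl

theorem mdiff_of_child_eq_empty {f : ℝ → 𝕜} (h : ¬ (L.child I).Nonempty) : L.mdiff I f x = 0 := by
  rw [mdiff, if_neg h]

theorem IsRank.mdiff_eq {f : ℝ → 𝕜} (h : L.IsRank I k) (hx : x ∈ I) :
    L.mdiff I f x = L.diff k f x := by
  have hxc := subset_carrier h.1 hx
  rw [mdiff, if_pos h.child_nonempty, avg_of_mem hx, diff, expect, expect, atom_eq h.1 hx]
  congr 1
  rw [finsum_mem_eq_sum_of_inter_support_eq (t := {L.atom (k + 1) x}) _ ?_]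
  · rw [Finset.sum_singleton, avg_of_mem (mem_atom hxc _)]
  · ext J
    simp only [Set.mem_inter_iff, Function.mem_support, Finset.coe_singleton,
      Set.mem_singleton_iff]
    constructor
    · rintro ⟨hJ, hne⟩
      rw [h.child_eq] at hJ
      have hxJ : x ∈ J := by
        by_contra hxJ
        exact hne (avg_of_notMem hxJ)
      exact ⟨(atom_eq hJ.1 hxJ).symm, hne⟩
    · rintro ⟨rfl, hne⟩
      exact ⟨h.atom_mem_child hx, hne⟩

theorem diff_eq_zero_of_not_isRank {f : ℝ → 𝕜} (hx : x ∈ L.carrier)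
    (h : ¬ L.IsRank (L.atom k x) k) : L.diff k f x = 0 := by
  rw [diff, expect, expect, atom_succ_eq_of_not_isRank hx h, sub_self]

theorem IsMartDiffSeq.eq_zero {b : L.intervals → ℝ → 𝕜} (hb : L.IsMartDiffSeq b) {I : L.intervals}
    (h : b I x ≠ 0) : x ∈ (I : Set ℝ) ∧ (L.child I).Nonempty := by
  have hx : x ∈ ⋃₀ L.child I := by
    by_contra hx
    exact h ((hb I).1 x hx)
  refine ⟨sUnion_child_subset _ hx, ?_⟩
  obtain ⟨J, hJ, _⟩ := hx
  exact ⟨J, hJ⟩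

theorem tsum_mdiff (f : ℝ → 𝕜) (hx : x ∈ L.carrier) (φ : 𝕜 → ℝ≥0∞) (hφ : φ 0 = 0) :
    ∑' I : L.intervals, φ (L.mdiff I f x) = ∑' k : ℤ, φ (L.diff k f x) := by
  refine tsum_intervals (x := x) _ (fun I hI => ?_) _ (fun k h => ?_) (fun k h => ?_)
  · constructor
    · by_contra h
      exact hI (by rw [mdiff_of_notMem h, hφ])
    · by_contra h
      exact hI (by rw [mdiff_of_child_eq_empty h, hφ])
  · rw [h.mdiff_eq (mem_atom hx k)]
  · rw [diff_eq_zero_of_not_isRank hx h, hφ]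

theorem tsum_term {b : L.intervals → ℝ → 𝕜} (hb : L.IsMartDiffSeq b) (f : ℝ → 𝕜)
    (hx : x ∈ L.carrier) (φ : 𝕜 → 𝕜 → 𝕜 → ℝ≥0∞) (hφ : ∀ a c, φ a c 0 = 0) :
    ∑' I : L.intervals, φ (avg I f x) (L.mdiff I f x) (b I x)
      = ∑' k : ℤ, φ (L.expect k f x) (L.diff k f x) (L.term b k x) := by
  refine tsum_intervals (x := x) _ (fun I hI => ?_) _ (fun k h => ?_) (fun k h => ?_)
  · refine hb.eq_zero (I := I) (x := x) fun h => hI ?_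
    rw [h, hφ]
  · rw [avg_of_mem (mem_atom hx k), h.mdiff_eq (mem_atom hx k), term, dif_pos h]
    rfl
  · rw [term, dif_neg h, hφ]

open Classical in
theorem tsum_term_subset {b : L.intervals → ℝ → 𝕜} (hb : L.IsMartDiffSeq b)
    (φ : 𝕜 → ℝ≥0∞) (hφ : φ 0 = 0) (I : Set ℝ) :
    ∑' J : L.intervals, (if (J : Set ℝ) ⊆ I then φ (b J x) else 0)
      = ∑' k : ℤ, if L.atom k x ⊆ I then φ (L.term b k x) else 0 := by
  refine tsum_intervals (x := x) _ (fun J hJ => ?_) _ (fun k h => ?_) (fun k h => ?_)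
  · refine hb.eq_zero (I := J) (x := x) fun h => hJ ?_
    rw [h, hφ, ite_self]
  · rw [term, dif_pos h]
  · rw [term, dif_neg h, hφ, ite_self]

/-- At most one of the finite tops contains `x`, so the sum has a single term. -/
theorem tsum_finTops (f : ℝ → 𝕜) (hx : x ∈ L.carrier) (φ : 𝕜 → ℝ≥0∞) (hφ : φ 0 = 0) :
    ∑' T : L.finTops, φ (avg (T : Set ℝ) f x) = φ (L.topAvg f x) := by
  have hz : ∀ T : L.finTops, (T : Set ℝ) ≠ L.top x → φ (avg (T : Set ℝ) f x) = 0 := by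
    intro T hT
    rw [avg_of_notMem, hφ]
    intro hxT
    exact hT ((mem_finTops_iff hxT).1 T.2).2.1
  by_cases hv : volume (L.top x) < ∞
  · have hT : L.top x ∈ L.finTops := (mem_finTops_iff (mem_top hx)).2 ⟨hx, rfl, hv⟩
    rw [tsum_eq_single (⟨L.top x, hT⟩ : L.finTops) fun T hne => hz T fun h => hne (Subtype.ext h),
      topAvg, if_pos hv, avg_of_mem (mem_top hx)]
  · rw [topAvg, if_neg hv, hφ, ENNReal.tsum_eq_zero]
    intro T
    refine hz T fun h => hv ?_
    rw [← h]
    exact T.2.2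

theorem hardyENormFun_eq {p : ℝ} (f : ℝ → 𝕜) :
    L.hardyENormFun p f = (∫⁻ x, (((∑' k : ℤ, ‖L.diff k f x‖ₑ ^ (2 : ℝ))
      + ‖L.topAvg f x‖ₑ ^ (2 : ℝ)) ^ (1 / 2 : ℝ)) ^ p ∂L.vol) ^ (1 / p) := by
  rw [hardyENormFun, hardyENorm]
  congr 1
  refine setLIntegral_congr_fun measurableSet_carrier fun x hx => ?_
  rw [tsum_mdiff f hx (fun z => ‖z‖ₑ ^ (2 : ℝ)) (by simp),
    tsum_finTops f hx (fun z => ‖z‖ₑ ^ (2 : ℝ)) (by simp)]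

theorem paraENorm_eq {p q : ℝ} (hq : 0 < q) {b : L.intervals → ℝ → 𝕜} (hb : L.IsMartDiffSeq b)
    (f : ℝ → 𝕜) :
    L.paraENorm p q b f = (∫⁻ x, ((∑' k : ℤ, (‖L.expect k f x‖ₑ * ‖L.term b k x‖ₑ) ^ q)
      ^ (1 / q)) ^ p ∂L.vol) ^ (1 / p) := by
  rw [paraENorm, hardyENorm]
  congr 1
  refine setLIntegral_congr_fun measurableSet_carrier fun x hx => ?_
  have e : ∀ T : L.finTops, ‖(0 : 𝕜)‖ₑ ^ q = 0 := fun T => by simp [hq]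
  simp only [para]
  rw [tsum_congr e, tsum_zero, add_zero]
  have := tsum_term hb f hx (fun a _ c => (‖a‖ₑ * ‖c‖ₑ) ^ q) (by simp [hq])
  simp only [enorm_mul]
  rw [← this]

end IntervalLattice

end

noncomputable section

namespace IntervalLattice

variable {L : IntervalLattice} {I J Q : Set ℝ} {j k N : ℤ} {x y : ℝ} {α : Type*}
  {𝕜 : Type*} [RCLike 𝕜]

/-! ### Functions that are constant on the intervals of a generation -/

variable (L) in
/-- The function `φ` is constant on the intervals of generation `k`. -/
def AtomConst (k : ℤ) (φ : ℝ → α) : Prop := ∀ I ∈ L.gen k, ∀ x ∈ I, ∀ y ∈ I, φ x = φ y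

theorem AtomConst.mono {φ : ℝ → α} (h : L.AtomConst j φ) (hjk : j ≤ k) : L.AtomConst k φ := by
  intro I hI x hx y hy
  have hxc := subset_carrier hI hx
  have hs : I ⊆ L.atom j x := atom_eq hI hx ▸ atom_anti hxc hjk
  exact h _ (atom_mem_gen hxc j) x (hs hx) y (hs hy)

theorem atomConst_atom (k : ℤ) : L.AtomConst k (L.atom k) := by
  intro I hI x hx y hy
  rw [atom_eq hI hx, atom_eq hI hy]

theorem atomConst_expect (k : ℤ) (f : ℝ → 𝕜) : L.AtomConst k (L.expect k f) := by
  intro I hI x hx y hy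
  rw [expect, expect, atomConst_atom k I hI x hx y hy]

theorem atomConst_diff (k : ℤ) (f : ℝ → 𝕜) : L.AtomConst (k + 1) (L.diff k f) := by
  intro I hI x hx y hy
  rw [diff, diff, atomConst_expect (k + 1) f I hI x hx y hy,
    (atomConst_expect k f).mono (by omega) I hI x hx y hy]

theorem atomConst_term {b : L.intervals → ℝ → 𝕜} (hb : L.IsMartDiffSeq b) (k : ℤ) :
    L.AtomConst (k + 1) (L.term b k) := by
  intro I hI x hx y hy
  have hxc := subset_carrier hI hx
  have e : L.atom k y = L.atom k x := (atomConst_atom k).mono (by omega) I hI y hy x hx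
  rw [term, term]
  by_cases h : L.IsRank (L.atom k x) k
  · have h' : L.IsRank (L.atom k y) k := by rwa [e]
    rw [dif_pos h, dif_pos h']
    simp only [e]
    refine (hb ⟨L.atom k x, mem_intervals h.1⟩).2.1 I ?_ x hx y hy
    have := h.atom_mem_child (mem_atom hxc k)
    rwa [atom_eq hI hx] at this
  · rw [dif_neg h, dif_neg (by rwa [e])]

theorem AtomConst.comp {β : Type*} {φ : ℝ → α} (h : L.AtomConst k φ) (F : α → β) :
    L.AtomConst k (fun x => F (φ x)) := fun I hI x hx y hy =>
  congrArg F (h I hI x hx y hy)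

theorem AtomConst.comp₂ {β γ : Type*} {φ : ℝ → α} {ψ : ℝ → β} (h : L.AtomConst k φ)
    (h' : L.AtomConst k ψ) (F : α → β → γ) : L.AtomConst k (fun x => F (φ x) (ψ x)) :=
  fun I hI x hx y hy => congrArg₂ F (h I hI x hx y hy) (h' I hI x hx y hy)

theorem AtomConst.sum {ι : Type*} {s : Finset ι} {φ : ι → ℝ → ℝ}
    (h : ∀ i ∈ s, L.AtomConst k (φ i)) : L.AtomConst k (fun x => ∑ i ∈ s, φ i x) :=
  fun I hI x hx y hy => Finset.sum_congr rfl fun i hi => h i hi I hI x hx y hy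

theorem atomConst_indicator (hI : I ∈ L.gen j) (hjk : j ≤ k) {φ : ℝ → α} [Zero α]
    (h : L.AtomConst k φ) : L.AtomConst k (I.indicator φ) := by
  intro J hJ x hx y hy
  by_cases hxI : x ∈ I
  · have hyI : y ∈ I := subset_of_mem_inter hI hJ hjk hxI hx hy
    rw [Set.indicator_of_mem hxI, Set.indicator_of_mem hyI, h J hJ x hx y hy]
  · have hyI : y ∉ I := fun hyI => hxI (subset_of_mem_inter hI hJ hjk hyI hy hx)
    rw [Set.indicator_of_notMem hxI, Set.indicator_of_notMem hyI]

theorem sigmaInf_le : L.sigmaInf ≤ borel ℝ := by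
  refine MeasurableSpace.generateFrom_le fun I hI => ?_
  obtain ⟨k, hk⟩ := Set.mem_iUnion.1 hI
  have := measurableSet_of_mem_gen hk
  rwa [BorelSpace.measurable_eq (α := ℝ)] at this

theorem measurableSet_sigmaInf (hI : I ∈ L.gen k) : MeasurableSet[L.sigmaInf] I :=
  MeasurableSpace.measurableSet_generateFrom (mem_intervals hI)

theorem measurableSet_sigmaInf_carrier : MeasurableSet[L.sigmaInf] L.carrier := by
  rw [← L.cover 0]
  exact MeasurableSet.sUnion (gen_countable 0) fun I hI => measurableSet_sigmaInf hI

/-- A preimage is a countable union of intervals, together with the complement of the carrier or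
not. The indicator is needed because nothing is known about the function outside the carrier. -/
theorem AtomConst.measurable_indicator [MeasurableSpace α] [Zero α] {φ : ℝ → α}
    (h : L.AtomConst k φ) : Measurable[L.sigmaInf] (L.carrier.indicator φ) := by
  intro s _
  have e : L.carrier.indicator φ ⁻¹' s = (⋃₀ {I | I ∈ L.gen k ∧ ∃ x ∈ I, φ x ∈ s}) ∪
      (L.carrierᶜ ∩ {_x | (0 : α) ∈ s}) := by
    ext x
    by_cases hx : x ∈ L.carrier
    · simp only [Set.mem_preimage, Set.indicator_of_mem hx, Set.mem_union, Set.mem_inter_iff,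
        Set.mem_compl_iff, hx, not_true_eq_false, false_and, or_false, Set.mem_sUnion,
        Set.mem_ofPred_eq]
      constructor
      · exact fun hs => ⟨_, ⟨atom_mem_gen hx k, x, mem_atom hx k, hs⟩, mem_atom hx k⟩
      · rintro ⟨I, ⟨hI, y, hy, hs⟩, hxI⟩
        rwa [h I hI x hxI y hy]
    · simp only [Set.mem_preimage, Set.indicator_of_notMem hx, Set.mem_union, Set.mem_inter_iff,
        Set.mem_compl_iff, hx, not_false_eq_true, true_and, Set.mem_sUnion, Set.mem_ofPred_eq]
      constructor
      · exact fun hs => Or.inr hs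
      · rintro (⟨I, ⟨hI, -⟩, hxI⟩ | hs)
        · exact absurd (subset_carrier hI hxI) hx
        · exact hs
  rw [e]
  refine MeasurableSet.union (MeasurableSet.sUnion ((gen_countable k).mono fun I hI => hI.1)
    fun I hI => measurableSet_sigmaInf hI.1) ?_
  exact measurableSet_sigmaInf_carrier.compl.inter (MeasurableSet.const _)

theorem ae_eq_indicator_carrier [Zero α] (φ : ℝ → α) : φ =ᵐ[L.vol] L.carrier.indicator φ := by
  rw [vol]
  filter_upwards [ae_restrict_mem measurableSet_carrier] with x hx
  rw [Set.indicator_of_mem hx]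

theorem AtomConst.aemeasurable [MeasurableSpace α] [Zero α] {φ : ℝ → α} (h : L.AtomConst k φ) :
    AEMeasurable φ L.vol := by
  refine ⟨L.carrier.indicator φ, ?_, ae_eq_indicator_carrier φ⟩
  have := h.measurable_indicator.mono sigmaInf_le le_rfl
  rwa [← BorelSpace.measurable_eq (α := ℝ)] at this

theorem AtomConst.aestronglyMeasurable {φ : ℝ → 𝕜} (h : L.AtomConst k φ) :
    AEStronglyMeasurable[L.sigmaInf] φ L.vol :=
  ⟨L.carrier.indicator φ, h.measurable_indicator.stronglyMeasurable, ae_eq_indicator_carrier φ⟩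

theorem vol_restrict (hI : I ∈ L.gen k) : L.vol.restrict I = volume.restrict I := by
  rw [vol, Measure.restrict_restrict (measurableSet_of_mem_gen hI),
    Set.inter_eq_left.2 (subset_carrier hI)]

theorem vol_apply (hI : I ∈ L.gen k) : L.vol I = volume I := by
  rw [vol, Measure.restrict_apply (measurableSet_of_mem_gen hI),
    Set.inter_eq_left.2 (subset_carrier hI)]

theorem ae_of_mem_carrier {P : ℝ → Prop} (h : ∀ x ∈ L.carrier, P x) : ∀ᵐ x ∂L.vol, P x :=
  (ae_restrict_mem measurableSet_carrier).mono h

theorem lintegral_vol_mono {g h : ℝ → ℝ≥0∞} (H : ∀ x ∈ L.carrier, g x ≤ h x) :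
    ∫⁻ x, g x ∂L.vol ≤ ∫⁻ x, h x ∂L.vol :=
  lintegral_mono_ae (ae_of_mem_carrier H)

/-! ### Reduction of integrals to finite sums -/

variable (L) in
/-- The intervals of generation `k` inside `Q`. -/
def Cells (Q : Set ℝ) (k : ℤ) : Type := {J : Set ℝ // J ∈ L.gen k ∧ J ⊆ Q}

/-- A point of a cell. -/
def Cells.pt (J : L.Cells Q k) : ℝ := (nonempty_of_mem_gen J.2.1).some

/-- The length of a cell. -/
def Cells.length (J : L.Cells Q k) : ℝ := (volume J.1).toReal

/-- Two cells lie in the same interval of generation `N + n`. -/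
def cellRel (N : ℤ) (n : ℕ) (J J' : L.Cells Q k) : Prop := L.atom (N + n) J.pt = L.atom (N + n) J'.pt

theorem Cells.pt_mem (J : L.Cells Q k) : J.pt ∈ J.1 := (nonempty_of_mem_gen J.2.1).some_mem

theorem Cells.pt_mem_carrier (J : L.Cells Q k) : J.pt ∈ L.carrier :=
  subset_carrier J.2.1 J.pt_mem

theorem Cells.length_nonneg (J : L.Cells Q k) : 0 ≤ J.length := ENNReal.toReal_nonneg

theorem Cells.ofReal_length (J : L.Cells Q k) : ENNReal.ofReal J.length = volume J.1 :=
  ENNReal.ofReal_toReal (volume_lt_top_of_mem_gen J.2.1).ne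

theorem cellRel_of_succ (n : ℕ) (J J' : L.Cells Q k) (h : cellRel N (n + 1) J J') :
    cellRel N n J J' := by
  have h1 : J'.pt ∈ L.atom (N + (n + 1 : ℕ)) J.pt := by
    rw [cellRel] at h
    rw [h]
    exact mem_atom J'.pt_mem_carrier _
  have h2 := atom_anti J.pt_mem_carrier (show N + n ≤ N + (n + 1 : ℕ) by push_cast; omega) h1
  exact (atom_eq (atom_mem_gen J.pt_mem_carrier _) h2).symm

theorem AtomConst.adaptedTo {n : ℕ} {φ : ℝ → ℝ} (h : L.AtomConst (N + n) φ) :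
    AdaptedTo (cellRel (L := L) (Q := Q) (k := k) N) n (fun J => φ J.pt) := by
  intro J J' hJ
  refine h _ (atom_mem_gen J.pt_mem_carrier (N + n)) _ (mem_atom J.pt_mem_carrier _) _ ?_
  rw [cellRel] at hJ
  rw [hJ]
  exact mem_atom J'.pt_mem_carrier _

theorem iUnion_cells (hQ : Q ∈ L.gen j) (hjk : j ≤ k) : ⋃ J : L.Cells Q k, J.1 = Q := by
  refine Set.Subset.antisymm (Set.iUnion_subset fun J => J.2.2) fun x hx => ?_
  have hxc := subset_carrier hQ hx
  exact Set.mem_iUnion.2 ⟨⟨L.atom k x, atom_mem_gen hxc k, atom_subset hQ hjk hx⟩, mem_atom hxc k⟩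

theorem disjoint_cells : Pairwise (Function.onFun Disjoint fun J : L.Cells Q k => J.1) := by
  intro J J' hne
  exact L.disjoint k J.2.1 J'.2.1 fun h => hne (Subtype.ext h)

theorem finite_cells_type (hQ : Q ∈ L.gen j) (hjk : j ≤ k) : Finite (L.Cells Q k) :=
  (finite_cells hQ hjk).to_subtype

theorem lintegral_cells [Fintype (L.Cells Q k)] (hQ : Q ∈ L.gen j) (hjk : j ≤ k)
    {g : ℝ → ℝ} (hg : L.AtomConst k g) (hg0 : ∀ x, 0 ≤ g x) :
    ∫⁻ x in Q, ENNReal.ofReal (g x) = ENNReal.ofReal (∑ J : L.Cells Q k, J.length * g J.pt) := by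
  rw [ENNReal.ofReal_sum_of_nonneg fun J _ => mul_nonneg J.length_nonneg (hg0 _)]
  conv_lhs => rw [← iUnion_cells hQ hjk]
  rw [lintegral_iUnion (fun J => measurableSet_of_mem_gen J.2.1) disjoint_cells, tsum_fintype]
  refine Finset.sum_congr rfl fun J _ => ?_
  rw [ENNReal.ofReal_mul J.length_nonneg, J.ofReal_length, mul_comm,
    setLIntegral_congr_fun (g := fun _ => ENNReal.ofReal (g J.pt))
      (measurableSet_of_mem_gen J.2.1) fun x hx => by
        simp only
        rw [hg J.1 J.2.1 x hx _ J.pt_mem], setLIntegral_const]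

theorem lintegral_gen (k : ℤ) (g : ℝ → ℝ≥0∞) :
    ∫⁻ x, g x ∂L.vol = ∑' I : L.gen k, ∫⁻ x in (I : Set ℝ), g x := by
  have := (gen_countable (L := L) k).to_subtype
  rw [vol, ← L.cover k, Set.sUnion_eq_iUnion, lintegral_iUnion
    (fun I => measurableSet_of_mem_gen I.2)]
  intro I I' hne
  exact L.disjoint k I.2 I'.2 fun h => hne (Subtype.ext h)

/-- Inequalities between integrals of functions that are constant on the intervals of a generation
may be checked on finite sums. -/
theorem lintegral_le_of_cells (hN : N ≤ k) {g h : ℝ → ℝ} (hg : L.AtomConst k g)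
    (hh : L.AtomConst k h) (hg0 : ∀ x, 0 ≤ g x) (hh0 : ∀ x, 0 ≤ h x) {C : ℝ} (hC : 0 ≤ C)
    (H : ∀ Q ∈ L.gen N, ∀ [Fintype (L.Cells Q k)],
      ∑ J : L.Cells Q k, J.length * g J.pt ≤ C * ∑ J : L.Cells Q k, J.length * h J.pt) :
    ∫⁻ x, ENNReal.ofReal (g x) ∂L.vol
      ≤ ENNReal.ofReal C * ∫⁻ x, ENNReal.ofReal (h x) ∂L.vol := by
  rw [lintegral_gen N, lintegral_gen N, ← ENNReal.tsum_mul_left]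
  refine ENNReal.tsum_le_tsum fun Q => ?_
  have := finite_cells_type Q.2 hN
  have := Fintype.ofFinite (L.Cells Q k)
  rw [lintegral_cells Q.2 hN hg hg0, lintegral_cells Q.2 hN hh hh0, ← ENNReal.ofReal_mul hC]
  exact ENNReal.ofReal_le_ofReal (H Q Q.2)

theorem cellRel_iff_mem {n : ℕ} (hI : I ∈ L.gen (N + n)) (J : L.Cells Q k) :
    L.atom (N + n) J.pt = I ↔ J.pt ∈ I :=
  ⟨fun h => h ▸ mem_atom J.pt_mem_carrier _, fun h => atom_eq hI h⟩

open Classical in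
theorem lintegral_subcell [Fintype (L.Cells Q k)] (hQ : Q ∈ L.gen N) (hNk : N ≤ k) {n : ℕ}
    (hn : N + n ≤ k) (hI : I ∈ L.gen (N + n)) (hIQ : I ⊆ Q)
    {g : ℝ → ℝ} (hg : L.AtomConst k g) (hg0 : ∀ x, 0 ≤ g x) :
    ∫⁻ x in I, ENNReal.ofReal (g x)
      = ENNReal.ofReal (∑ J : L.Cells Q k with L.atom (N + n) J.pt = I, J.length * g J.pt) := by
  have e1 : ∫⁻ x in I, ENNReal.ofReal (g x) = ∫⁻ x in Q, ENNReal.ofReal (I.indicator g x) := by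
    have : ∀ x, ENNReal.ofReal (I.indicator g x) = I.indicator (fun x => ENNReal.ofReal (g x)) x := by
      intro x
      by_cases hx : x ∈ I
      · simp [hx]
      · simp [hx]
    simp_rw [this]
    rw [lintegral_indicator (measurableSet_of_mem_gen hI),
      Measure.restrict_restrict (measurableSet_of_mem_gen hI), Set.inter_eq_left.2 hIQ]
  rw [e1, lintegral_cells hQ hNk (atomConst_indicator hI hn hg)
    (fun x => Set.indicator_nonneg (fun x _ => hg0 x) x), Finset.sum_filter]
  congr 1
  refine Finset.sum_congr rfl fun J _ => ?_
  by_cases h : J.pt ∈ I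
  · rw [if_pos ((cellRel_iff_mem hI J).2 h), Set.indicator_of_mem h]
  · rw [if_neg (fun h' => h ((cellRel_iff_mem hI J).1 h')), Set.indicator_of_notMem h, mul_zero]

/-- Transfer of conditional inequalities to finite sums. -/
theorem condLE_of_lintegral [Fintype (L.Cells Q k)] (hQ : Q ∈ L.gen N) (hNk : N ≤ k) {n : ℕ}
    (hn : N + n ≤ k) {g h : ℝ → ℝ} (hg : L.AtomConst k g) (hh : L.AtomConst k h)
    (hg0 : ∀ x, 0 ≤ g x) (hh0 : ∀ x, 0 ≤ h x)
    (H : ∀ I ∈ L.gen (N + n), I ⊆ Q →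
      ∫⁻ x in I, ENNReal.ofReal (g x) ≤ ∫⁻ x in I, ENNReal.ofReal (h x)) :
    CondLE (fun J : L.Cells Q k => J.length) (cellRel N) n (fun J => g J.pt) (fun J => h J.pt) := by
  classical
  intro ψ hψ hψ0
  rw [← Finset.sum_fiberwise_of_maps_to (g := fun J : L.Cells Q k => L.atom (N + n) J.pt)
    (t := Finset.univ.image fun J : L.Cells Q k => L.atom (N + n) J.pt)
    (fun J hJ => Finset.mem_image_of_mem _ hJ),
    ← Finset.sum_fiberwise_of_maps_to (g := fun J : L.Cells Q k => L.atom (N + n) J.pt)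
    (t := Finset.univ.image fun J : L.Cells Q k => L.atom (N + n) J.pt)
    (f := fun J => J.length * (ψ J * h J.pt))
    (fun J hJ => Finset.mem_image_of_mem _ hJ)]
  refine Finset.sum_le_sum fun I hI => ?_
  obtain ⟨J₀, -, rfl⟩ := Finset.mem_image.1 hI
  have e : ∀ u : ℝ → ℝ, ∑ J : L.Cells Q k with L.atom (N + n) J.pt = L.atom (N + n) J₀.pt,
      J.length * (ψ J * u J.pt) = ψ J₀ *
      ∑ J : L.Cells Q k with L.atom (N + n) J.pt = L.atom (N + n) J₀.pt, J.length * u J.pt := by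
    intro u
    rw [Finset.mul_sum]
    refine Finset.sum_congr rfl fun J hJ => ?_
    rw [hψ J J₀ (Finset.mem_filter.1 hJ).2]
    ring
  rw [e g, e h]
  refine mul_le_mul_of_nonneg_left ?_ (hψ0 J₀)
  have hIg := atom_mem_gen J₀.pt_mem_carrier (N + n)
  have hIQ : L.atom (N + n) J₀.pt ⊆ Q :=
    atom_subset hQ (by omega) (J₀.2.2 J₀.pt_mem)
  have := H _ hIg hIQ
  rw [lintegral_subcell hQ hNk hn hIg hIQ hg hg0, lintegral_subcell hQ hNk hn hIg hIQ hh hh0] at this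
  exact (ENNReal.ofReal_le_ofReal_iff
    (Finset.sum_nonneg fun J _ => mul_nonneg J.length_nonneg (hh0 _))).1 this

/-- Tested against a `ψ` of generation `N + n`, the averages of generation `N + n` reproduce the
integrals of `f` over the finest cells. The same holds one generation later, so the tested
difference vanishes. -/
theorem isFinMartingale_expect {M : ℕ} [Fintype (L.Cells Q (N + M))] (hQ : Q ∈ L.gen N)
    {f : ℝ → ℝ} (hf : IntegrableOn f Q) :
    IsFinMartingale (fun J : L.Cells Q (N + M) => J.length) (cellRel N) M
      (fun n J => L.expect (N + n) f J.pt) := by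
  classical
  refine ⟨fun n => (atomConst_expect (N + n) f).adaptedTo, ?_⟩
  have key : ∀ n ≤ M, ∀ ψ : L.Cells Q (N + M) → ℝ, AdaptedTo (cellRel N) n ψ →
      ∑ J : L.Cells Q (N + M), J.length * (ψ J * L.expect (N + n) f J.pt)
        = ∑ J : L.Cells Q (N + M), ψ J * ∫ x in J.1, f x := by
    intro n hn ψ hψ
    rw [← Finset.sum_fiberwise_of_maps_to (g := fun J : L.Cells Q (N + M) => L.atom (N + n) J.pt)
      (t := Finset.univ.image fun J : L.Cells Q (N + M) => L.atom (N + n) J.pt)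
      (fun J hJ => Finset.mem_image_of_mem _ hJ),
      ← Finset.sum_fiberwise_of_maps_to (g := fun J : L.Cells Q (N + M) => L.atom (N + n) J.pt)
      (t := Finset.univ.image fun J : L.Cells Q (N + M) => L.atom (N + n) J.pt)
      (f := fun J => ψ J * ∫ x in J.1, f x)
      (fun J hJ => Finset.mem_image_of_mem _ hJ)]
    refine Finset.sum_congr rfl fun I hI => ?_
    obtain ⟨J₀, -, rfl⟩ := Finset.mem_image.1 hI
    have hIg := atom_mem_gen J₀.pt_mem_carrier (N + n)
    set I := L.atom (N + n) J₀.pt with hIdef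
    have hIQ : I ⊆ Q := atom_subset hQ (by omega) (J₀.2.2 J₀.pt_mem)
    have e1 : ∑ J : L.Cells Q (N + M) with L.atom (N + n) J.pt = I,
        J.length * (ψ J * L.expect (N + n) f J.pt)
        = ψ J₀ * ((∑ J : L.Cells Q (N + M) with L.atom (N + n) J.pt = I, J.length) *
          ⨍ x in I, f x) := by
      rw [Finset.sum_mul, Finset.mul_sum]
      refine Finset.sum_congr rfl fun J hJ => ?_
      have hJ' := (Finset.mem_filter.1 hJ).2
      rw [hψ J J₀ hJ', expect, hJ']
      ring
    have e2 : ∑ J : L.Cells Q (N + M) with L.atom (N + n) J.pt = I, ψ J * ∫ x in J.1, f x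
        = ψ J₀ * ∑ J : L.Cells Q (N + M) with L.atom (N + n) J.pt = I, ∫ x in J.1, f x := by
      rw [Finset.mul_sum]
      refine Finset.sum_congr rfl fun J hJ => ?_
      rw [hψ J J₀ (Finset.mem_filter.1 hJ).2]
    have e3 : ∑ J : L.Cells Q (N + M) with L.atom (N + n) J.pt = I, J.length = volume.real I := by
      have := lintegral_subcell hQ (by omega : N ≤ N + M) (by omega : N + n ≤ N + M) hIg hIQ
        (g := fun _ => 1) (fun _ _ _ _ _ _ => rfl) (fun _ => zero_le_one)
      simp only [ENNReal.ofReal_one, lintegral_const, one_mul, mul_one,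
        Measure.restrict_apply MeasurableSet.univ, Set.univ_inter] at this
      rw [Measure.real, this, ENNReal.toReal_ofReal
        (Finset.sum_nonneg fun J _ => J.length_nonneg)]
    -- The interval is the disjoint union of the cells whose marked point it contains, so the
    -- integral of `f` splits accordingly.
    have hU : I = ⋃ J ∈ Finset.univ.filter fun J : L.Cells Q (N + M) => L.atom (N + n) J.pt = I,
        J.1 := by
      ext x
      simp only [Finset.mem_filter, Finset.mem_univ, true_and, Set.mem_iUnion, exists_prop]
      constructor
      · intro hx
        rw [← iUnion_cells hQ (by omega : N ≤ N + M)] at hIQ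
        obtain ⟨J, hJ⟩ := Set.mem_iUnion.1 (hIQ hx)
        refine ⟨J, ?_, hJ⟩
        exact (cellRel_iff_mem hIg J).2
          (subset_of_mem_inter hIg J.2.1 (by omega) hx hJ J.pt_mem)
      · rintro ⟨J, hJ, hx⟩
        have := (cellRel_iff_mem hIg J).1 hJ
        exact subset_of_mem_inter hIg J.2.1 (by omega) this J.pt_mem hx
    have e4 : ∫ x in I, f x
        = ∑ J : L.Cells Q (N + M) with L.atom (N + n) J.pt = I, ∫ x in J.1, f x := by
      conv_lhs => rw [hU]
      exact integral_biUnion_finset _ (fun J _ => measurableSet_of_mem_gen J.2.1)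
        (fun J _ J' _ hne => disjoint_cells hne) (fun J _ => hf.mono_set J.2.2)
    rw [e1, e2, e3, ← e4, setAverage_eq, smul_eq_mul, ← mul_assoc (volume.real I),
      mul_inv_cancel₀, one_mul]
    rw [Measure.real, ENNReal.toReal_ne_zero]
    exact ⟨(volume_pos_of_mem_gen hIg).ne', (volume_lt_top_of_mem_gen hIg).ne⟩
  intro n hn ψ hψ
  have h1 := key n hn.le ψ hψ
  have h2 := key (n + 1) hn ψ (hψ.mono cellRel_of_succ (Nat.le_succ n))
  rw [← h1] at h2
  simp_rw [mul_sub]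
  rw [Finset.sum_sub_distrib, h2, sub_self]

end IntervalLattice

end

noncomputable section

namespace IntervalLattice

variable {L : IntervalLattice} {I J Q : Set ℝ} {j k N : ℤ} {x y : ℝ} {α : Type*}
  {𝕜 : Type*} [RCLike 𝕜]

/-! ### Carleson embedding, Davis' and Doob's inequalities on windows of generations -/

theorem natCast_add_le {n M : ℕ} (N : ℤ) (h : n ≤ M) : N + (n : ℤ) ≤ N + (M : ℤ) := by
  have : (n : ℤ) ≤ M := by exact_mod_cast h
  omega

theorem lintegral_carleson {r : ℝ} (hr : 0 < r) {M : ℕ} {Φ β : ℕ → ℝ → ℝ} {B : ℝ} (hB : 0 < B)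
    (hΦ : ∀ n : ℕ, L.AtomConst (N + n) (Φ n)) (hΦ0 : ∀ n x, 0 ≤ Φ n x)
    (hΦm : ∀ n x, Φ n x ≤ Φ (n + 1) x) (hβ : ∀ n : ℕ, L.AtomConst (N + (n + 1 : ℕ)) (β n))
    (hβ0 : ∀ n x, 0 ≤ β n x)
    (h : ∀ n ≤ M, ∀ I ∈ L.gen (N + n),
      ∫⁻ x in I, ENNReal.ofReal ((∑ i ∈ Finset.Ico n (M + 1), β i x) ^ r)
        ≤ ENNReal.ofReal (B ^ r) * volume I) :
    ∫⁻ x, ENNReal.ofReal ((∑ n ∈ Finset.range (M + 1), Φ n x * β n x) ^ r) ∂L.vol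
      ≤ ENNReal.ofReal (carlesonConst r * B ^ r) *
        ∫⁻ x, ENNReal.ofReal (Φ M x ^ r) ∂L.vol := by
  have hs : ∀ n, ∀ x, 0 ≤ ∑ i ∈ Finset.Ico n (M + 1), β i x :=
    fun n x => Finset.sum_nonneg fun i _ => hβ0 i x
  -- The cells are those of generation `N + M + 1`, because the last weight `β M` is constant only
  -- there.
  refine lintegral_le_of_cells (N := N) (k := N + (M + 1 : ℕ)) (by omega) ?_ ?_ ?_ ?_
    (mul_nonneg (carlesonConst_pos hr).le (Real.rpow_nonneg hB.le _)) ?_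
  · refine (AtomConst.sum fun n hn => ?_).comp (fun t : ℝ => t ^ r)
    have hn' := Finset.mem_range.1 hn
    exact ((hΦ n).mono (natCast_add_le N (by omega))).comp₂
      ((hβ n).mono (natCast_add_le N (by omega))) (fun a b => a * b)
  · exact ((hΦ M).mono (natCast_add_le N (by omega))).comp (fun t : ℝ => t ^ r)
  · exact fun x => Real.rpow_nonneg
      (Finset.sum_nonneg fun i _ => mul_nonneg (hΦ0 i x) (hβ0 i x)) r
  · exact fun x => Real.rpow_nonneg (hΦ0 M x) r
  · intro Q hQ _
    refine carleson (Ω := L.Cells Q (N + (M + 1 : ℕ))) (fun J => J.length_nonneg)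
      (fun n J J' => cellRel_of_succ n J J') hr (Φ := fun n J => Φ n J.pt)
      (β := fun n J => β n J.pt) hB (fun n => (hΦ n).adaptedTo) (fun n J => hΦ0 n _)
      (fun n J => hΦm n _) (fun n => (hβ n).adaptedTo) (fun n J => hβ0 n _) ?_
    intro n hn
    refine condLE_of_lintegral hQ (by omega) (natCast_add_le N (by omega))
      (g := fun x => (∑ i ∈ Finset.Ico n (M + 1), β i x) ^ r) (h := fun _ => B ^ r) ?_
      (fun _ _ _ _ _ _ => rfl) (fun x => Real.rpow_nonneg (hs n x) r)
      (fun _ => Real.rpow_nonneg hB.le r) ?_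
    · refine (AtomConst.sum fun i hi => ?_).comp (fun t : ℝ => t ^ r)
      exact (hβ i).mono (natCast_add_le N (by have := Finset.mem_Ico.1 hi; omega))
    · intro I hI _
      rw [setLIntegral_const]
      exact h n hn I hI

theorem lintegral_adapted_carleson {r : ℝ} (hr : 0 < r) {M : ℕ} {Φ β : ℕ → ℝ → ℝ} {B : ℝ}
    (hB : 0 < B) (hΦ : ∀ n : ℕ, L.AtomConst (N + n) (Φ n)) (hΦ0 : ∀ n x, 0 ≤ Φ n x)
    (hΦm : ∀ n x, Φ n x ≤ Φ (n + 1) x) (hβ : ∀ n : ℕ, L.AtomConst (N + n) (β n))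
    (hβ0 : ∀ n x, 0 ≤ β n x)
    (h : ∀ n ≤ M, ∀ I ∈ L.gen (N + n),
      ∫⁻ x in I, ENNReal.ofReal (∑ i ∈ Finset.Ico n (M + 1), β i x) ≤ ENNReal.ofReal B * volume I) :
    ∫⁻ x, ENNReal.ofReal ((∑ n ∈ Finset.range (M + 1), Φ n x * β n x) ^ r) ∂L.vol
      ≤ ENNReal.ofReal ((2 * (2 * r) ^ r + 2 * carlesonConst r) * B ^ r) *
        ∫⁻ x, ENNReal.ofReal (Φ M x ^ r) ∂L.vol := by
  have hs : ∀ n, ∀ x, 0 ≤ ∑ i ∈ Finset.Ico n (M + 1), β i x :=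
    fun n x => Finset.sum_nonneg fun i _ => hβ0 i x
  have hC := carlesonConst_pos hr
  refine lintegral_le_of_cells (N := N) (k := N + M) (by omega) ?_ ?_ ?_ ?_ (by positivity) ?_
  · refine (AtomConst.sum fun n hn => ?_).comp (fun t : ℝ => t ^ r)
    have hn' := Finset.mem_range.1 hn
    exact ((hΦ n).mono (natCast_add_le N (by omega))).comp₂
      ((hβ n).mono (natCast_add_le N (by omega))) (fun a b => a * b)
  · exact (hΦ M).comp (fun t : ℝ => t ^ r)
  · exact fun x => Real.rpow_nonneg
      (Finset.sum_nonneg fun i _ => mul_nonneg (hΦ0 i x) (hβ0 i x)) r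
  · exact fun x => Real.rpow_nonneg (hΦ0 M x) r
  · intro Q hQ _
    refine adapted_carleson (Ω := L.Cells Q (N + M)) (fun J => J.length_nonneg)
      (fun n J J' => cellRel_of_succ n J J') hr (Φ := fun n J => Φ n J.pt)
      (β := fun n J => β n J.pt) hB (fun n => (hΦ n).adaptedTo) (fun n J => hΦ0 n _)
      (fun n J => hΦm n _) (fun n => (hβ n).adaptedTo) (fun n J => hβ0 n _) ?_
    intro n hn
    refine condLE_of_lintegral hQ (by omega) (natCast_add_le N hn)
      (g := fun x => ∑ i ∈ Finset.Ico n (M + 1), β i x) (h := fun _ => B) ?_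
      (fun _ _ _ _ _ _ => rfl) (hs n) (fun _ => hB.le) ?_
    · refine AtomConst.sum fun i hi => ?_
      exact (hβ i).mono (natCast_add_le N (by have := Finset.mem_Ico.1 hi; omega))
    · intro I hI _
      rw [setLIntegral_const]
      exact h n hn I hI

theorem lintegral_sum_mul_rpow_le {p : ℝ} (hp : 1 < p) {M : ℕ} {b d : ℕ → ℝ → ℝ} {B : ℝ}
    (hB : 0 < B) (hb : ∀ n : ℕ, L.AtomConst (N + n) (b n)) (hb0 : ∀ n x, 0 ≤ b n x)
    (hd : ∀ n : ℕ, L.AtomConst (N + n) (d n)) (hd0 : ∀ n x, 0 ≤ d n x)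
    (h : ∀ n ≤ M, ∀ I ∈ L.gen (N + n),
      ∫⁻ x in I, ENNReal.ofReal (∑ i ∈ Finset.Ico n (M + 1), b i x ^ 2)
        ≤ ENNReal.ofReal (B ^ 2) * volume I) :
    ∫⁻ x, ENNReal.ofReal ((∑ n ∈ Finset.range (M + 1), b n x * d n x) ^ p) ∂L.vol
      ≤ ENNReal.ofReal (extConst p * B ^ p) *
        ∫⁻ x, ENNReal.ofReal (Real.sqrt (∑ n ∈ Finset.range (M + 1), d n x ^ 2) ^ p) ∂L.vol := by
  have hs : ∀ n, ∀ x, 0 ≤ ∑ i ∈ Finset.Ico n (M + 1), b i x ^ 2 :=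
    fun n x => Finset.sum_nonneg fun i _ => sq_nonneg _
  have hC : 0 ≤ extConst p := by
    have hp1 : 0 < p - 1 := by linarith
    have hp0 : 0 < p := by linarith
    have := carlesonConst_pos (by positivity : 0 < p / (p - 1) / 2)
    unfold extConst
    positivity
  refine lintegral_le_of_cells (N := N) (k := N + M) (by omega) ?_ ?_ ?_ ?_ (by positivity) ?_
  · refine (AtomConst.sum fun n hn => ?_).comp (fun t : ℝ => t ^ p)
    have hn' := Finset.mem_range.1 hn
    exact ((hb n).mono (natCast_add_le N (by omega))).comp₂
      ((hd n).mono (natCast_add_le N (by omega))) (fun a b => a * b)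
  · refine (AtomConst.sum fun n hn => ?_).comp (fun t : ℝ => Real.sqrt t ^ p)
    have hn' := Finset.mem_range.1 hn
    exact ((hd n).mono (natCast_add_le N (by omega))).comp (fun t : ℝ => t ^ 2)
  · exact fun x => Real.rpow_nonneg
      (Finset.sum_nonneg fun i _ => mul_nonneg (hb0 i x) (hd0 i x)) p
  · exact fun x => Real.rpow_nonneg (Real.sqrt_nonneg _) p
  · intro Q hQ _
    refine sum_mul_rpow_le (Ω := L.Cells Q (N + M)) (fun J => J.length_nonneg)
      (fun n J J' => cellRel_of_succ n J J') hp (b := fun n J => b n J.pt)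
      (d := fun n J => d n J.pt) hB (fun n => (hb n).adaptedTo) (fun n => (hd n).adaptedTo)
      (fun n J => hb0 n _) (fun n J => hd0 n _) ?_
    intro n hn
    refine condLE_of_lintegral hQ (by omega) (natCast_add_le N hn)
      (g := fun x => ∑ i ∈ Finset.Ico n (M + 1), b i x ^ 2) (h := fun _ => B ^ 2) ?_
      (fun _ _ _ _ _ _ => rfl) (hs n) (fun _ => by positivity) ?_
    · refine AtomConst.sum fun i hi => ?_
      exact ((hb i).mono (natCast_add_le N (by have := Finset.mem_Ico.1 hi; omega))).comp
        (fun t : ℝ => t ^ 2)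
    · intro I hI _
      rw [setLIntegral_const]
      exact h n hn I hI

theorem atomConst_runMax {u : ℕ → ℝ → ℝ} {M : ℕ} (hu : ∀ n ≤ M, L.AtomConst k (u n)) :
    L.AtomConst k (fun x => runMax (fun n => u n x) M) :=
  fun I hI x hx y hy => runMax_congr fun i hi => hu i hi I hI x hx y hy

theorem diff_eq (N : ℤ) (n : ℕ) (f : ℝ → 𝕜) (x : ℝ) :
    L.diff (N + n) f x = L.expect (N + (n + 1 : ℕ)) f x - L.expect (N + n) f x := by
  rw [diff]
  push_cast
  rw [add_assoc]

theorem atomConst_sqrt_window (N : ℤ) (M : ℕ) (f : ℝ → ℝ) (p : ℝ) :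
    L.AtomConst (N + M)
      (fun x => Real.sqrt (∑ i ∈ Finset.range M, L.diff (N + i) f x ^ 2) ^ p) := by
  refine (AtomConst.sum fun n hn => ?_).comp (fun t : ℝ => Real.sqrt t ^ p)
  have hn' : n + 1 ≤ M := Finset.mem_range.1 hn
  refine ((atomConst_diff (N + n) f).mono ?_).comp (fun t : ℝ => t ^ 2)
  have := natCast_add_le N hn'
  push_cast at this
  omega

theorem lintegral_runMax_rpow_le {p : ℝ} (hp : 1 ≤ p) {f : ℝ → ℝ}
    (hf : ∀ Q ∈ L.gen N, IntegrableOn f Q) (M : ℕ) :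
    ∫⁻ x, ENNReal.ofReal (runMax (fun n => L.expect (N + n) f x - L.expect N f x) M ^ p) ∂L.vol
      ≤ ENNReal.ofReal (2 * (2 * p) ^ p * 28 ^ p) * ∫⁻ x, ENNReal.ofReal
        (Real.sqrt (∑ i ∈ Finset.range M, L.diff (N + i) f x ^ 2) ^ p) ∂L.vol := by
  refine lintegral_le_of_cells (N := N) (k := N + M) (by omega) ?_ ?_ ?_ ?_ (by positivity) ?_
  · refine (atomConst_runMax fun n hn => ?_).comp (fun t : ℝ => t ^ p)
    exact ((atomConst_expect _ f).mono (natCast_add_le N hn)).comp₂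
      ((atomConst_expect N f).mono (by omega)) (fun a b => a - b)
  · exact atomConst_sqrt_window N M f p
  · exact fun x => Real.rpow_nonneg (runMax_nonneg _ _) p
  · exact fun x => Real.rpow_nonneg (Real.sqrt_nonneg _) p
  · intro Q hQ _
    have := sum_runMax_rpow_le (Ω := L.Cells Q (N + M)) (fun J => J.length_nonneg)
      (fun n J J' => cellRel_of_succ n J J') hp (isFinMartingale_expect hQ (hf Q hQ))
    simp_rw [diff_eq]
    simpa using this

theorem lintegral_sqrt_rpow_le {p : ℝ} (hp : 1 ≤ p) {f : ℝ → ℝ}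
    (hf : ∀ Q ∈ L.gen N, IntegrableOn f Q) (M : ℕ) :
    ∫⁻ x, ENNReal.ofReal
        (Real.sqrt (∑ i ∈ Finset.range M, L.diff (N + i) f x ^ 2) ^ p) ∂L.vol
      ≤ ENNReal.ofReal (2 * (2 * p) ^ p * 32 ^ p) * ∫⁻ x, ENNReal.ofReal
        (runMax (fun n => L.expect (N + n) f x) M ^ p) ∂L.vol := by
  refine lintegral_le_of_cells (N := N) (k := N + M) (by omega) ?_ ?_ ?_ ?_ (by positivity) ?_
  · exact atomConst_sqrt_window N M f p
  · refine (atomConst_runMax fun n hn => ?_).comp (fun t : ℝ => t ^ p)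
    exact (atomConst_expect _ f).mono (natCast_add_le N hn)
  · exact fun x => Real.rpow_nonneg (Real.sqrt_nonneg _) p
  · exact fun x => Real.rpow_nonneg (runMax_nonneg _ _) p
  · intro Q hQ _
    have := sum_sqrt_rpow_le (Ω := L.Cells Q (N + M)) (fun J => J.length_nonneg)
      (fun n J J' => cellRel_of_succ n J J') hp (isFinMartingale_expect hQ (hf Q hQ))
    simp_rw [diff_eq]
    exact this

theorem expect_nonneg {f : ℝ → ℝ} (hf : ∀ x, 0 ≤ f x) (k : ℤ) (x : ℝ) : 0 ≤ L.expect k f x := by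
  rw [expect, setAverage_eq, smul_eq_mul]
  exact mul_nonneg (inv_nonneg.2 measureReal_nonneg) (integral_nonneg hf)

theorem lintegral_doob {p : ℝ} (hp : 1 < p) {f : ℝ → ℝ} (hf0 : ∀ x, 0 ≤ f x)
    (hf : ∀ Q ∈ L.gen N, IntegrableOn f Q) (M : ℕ) :
    ∫⁻ x, ENNReal.ofReal (runMax (fun n => L.expect (N + n) f x) M ^ p) ∂L.vol
      ≤ ENNReal.ofReal (2 * (2 * (p / (p - 1))) ^ p) *
        ∫⁻ x, ENNReal.ofReal (L.expect (N + M) f x ^ p) ∂L.vol := by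
  have hp1 : 0 < p - 1 := by linarith
  have hp0 : 0 < p := by linarith
  refine lintegral_le_of_cells (N := N) (k := N + M) (by omega) ?_ ?_ ?_ ?_ (by positivity) ?_
  · refine (atomConst_runMax fun n hn => ?_).comp (fun t : ℝ => t ^ p)
    exact (atomConst_expect _ f).mono (natCast_add_le N hn)
  · exact (atomConst_expect _ f).comp (fun t : ℝ => t ^ p)
  · exact fun x => Real.rpow_nonneg (runMax_nonneg _ _) p
  · exact fun x => Real.rpow_nonneg (expect_nonneg hf0 _ _) p
  · intro Q hQ _
    exact doob_maximal (Ω := L.Cells Q (N + M)) (fun J => J.length_nonneg)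
      (fun n J J' => cellRel_of_succ n J J') hp (isFinMartingale_expect hQ (hf Q hQ))
      (fun n J => expect_nonneg hf0 _ _)

/-! ### Passage to all generations -/

/-- The generations `-m, …, m`. -/
def window (m : ℕ) : Finset ℤ := Finset.Icc (-(m : ℤ)) m

theorem sum_window {β : Type*} [AddCommMonoid β] (a : ℤ → β) (m : ℕ) :
    ∑ k ∈ window m, a k = ∑ i ∈ Finset.range (2 * m + 1), a (-(m : ℤ) + i) := by
  symm
  refine Finset.sum_bij (fun i _ => -(m : ℤ) + (i : ℤ)) ?_ ?_ ?_ ?_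
  · intro i hi
    have := Finset.mem_range.1 hi
    rw [window, Finset.mem_Icc]
    omega
  · intro i _ i' _ h
    omega
  · intro k hk
    rw [window, Finset.mem_Icc] at hk
    exact ⟨(k + m).toNat, by rw [Finset.mem_range]; omega, by omega⟩
  · intro i _
    rfl

theorem tendsto_sum_window (a : ℤ → ℝ≥0∞) :
    Tendsto (fun m => ∑ k ∈ window m, a k) atTop (𝓝 (∑' k, a k)) := by
  refine (ENNReal.summable.hasSum (f := a)).comp ?_
  refine tendsto_atTop_finset_of_monotone (fun m n h => ?_) fun k => ?_
  · intro k hk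
    rw [window, Finset.mem_Icc] at *
    omega
  · refine ⟨k.natAbs, ?_⟩
    rw [window, Finset.mem_Icc]
    omega

/-- Fatou's lemma, in the form that removes the restriction to finitely many generations. -/
theorem lintegral_le_of_le_liminf {F : ℕ → ℝ → ℝ≥0∞} {G : ℝ → ℝ≥0∞} {C : ℝ≥0∞}
    (hF : ∀ m, AEMeasurable (F m) L.vol) (hG : ∀ x ∈ L.carrier, G x ≤ liminf (F · x) atTop)
    (h : ∀ m, ∫⁻ x, F m x ∂L.vol ≤ C) : ∫⁻ x, G x ∂L.vol ≤ C := by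
  refine (lintegral_vol_mono hG).trans ((lintegral_liminf_le' hF).trans ?_)
  refine liminf_le_of_le (by isBoundedDefault) fun b hb => ?_
  obtain ⟨m, hm⟩ := hb.exists
  exact hm.trans (h m)

theorem lintegral_tsum_rpow_le {a : ℤ → ℝ → ℝ≥0∞} {r : ℝ} {C : ℝ≥0∞}
    (ha : ∀ k, AEMeasurable (a k) L.vol)
    (h : ∀ m, ∫⁻ x, (∑ k ∈ window m, a k x) ^ r ∂L.vol ≤ C) :
    ∫⁻ x, (∑' k, a k x) ^ r ∂L.vol ≤ C := by
  refine lintegral_le_of_le_liminf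
    (fun m => (Finset.aemeasurable_fun_sum _ fun k _ => ha k).pow_const r) (fun x _ => ?_) h
  refine (Tendsto.liminf_eq ?_).ge
  exact ((ENNReal.continuous_rpow_const (y := r)).tendsto _).comp (tendsto_sum_window _)

theorem integrableOn_of_memLp {p : ℝ} (hp : 1 ≤ p) {f : ℝ → 𝕜}
    (hf : MemLp f (ENNReal.ofReal p) L.vol) {S : Set ℝ} (hS : S ⊆ L.carrier)
    (hvol : volume S < ∞) : IntegrableOn f S := by
  have h1 : MemLp f (ENNReal.ofReal p) (volume.restrict S) :=
    hf.mono_measure (Measure.restrict_mono hS le_rfl)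
  have : IsFiniteMeasure (volume.restrict S) := ⟨by simpa using hvol⟩
  exact h1.integrable (by rw [← ENNReal.ofReal_one]; exact ENNReal.ofReal_le_ofReal hp)

/-- Jensen's inequality for the integral over a set of finite measure. -/
theorem lintegral_enorm_rpow_le {p : ℝ} (hp : 1 ≤ p) {f : ℝ → 𝕜} {μ : Measure ℝ}
    (hf : AEStronglyMeasurable f μ) :
    (∫⁻ x, ‖f x‖ₑ ∂μ) ^ p ≤ (∫⁻ x, ‖f x‖ₑ ^ p ∂μ) * μ Set.univ ^ (p - 1) := by
  have hp0 : 0 < p := by linarith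
  have h := eLpNorm'_le_eLpNorm'_mul_rpow_measure_univ (p := 1) (q := p) one_pos hp hf
  simp only [eLpNorm', ENNReal.rpow_one, div_one] at h
  refine (ENNReal.rpow_le_rpow h hp0.le).trans (le_of_eq ?_)
  rw [ENNReal.mul_rpow_of_nonneg _ _ hp0.le, ← ENNReal.rpow_mul, ← ENNReal.rpow_mul,
    one_div_mul_cancel hp0.ne', ENNReal.rpow_one, sub_mul, one_mul, one_div_mul_cancel hp0.ne']

theorem enorm_setAverage_rpow_le {p : ℝ} (hp : 1 ≤ p) {f : ℝ → 𝕜} {S : Set ℝ}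
    (hf : AEStronglyMeasurable f (volume.restrict S)) (h0 : volume S ≠ 0) (h1 : volume S ≠ ∞) :
    ‖⨍ x in S, f x‖ₑ ^ p ≤ (volume S)⁻¹ * ∫⁻ x in S, ‖f x‖ₑ ^ p := by
  have hp0 : 0 < p := by linarith
  have e : ‖(volume.real S)⁻¹‖ₑ = (volume S)⁻¹ := by
    rw [Real.enorm_eq_ofReal (inv_nonneg.2 measureReal_nonneg), Measure.real,
      ENNReal.ofReal_inv_of_pos (ENNReal.toReal_pos h0 h1), ENNReal.ofReal_toReal h1]
  rw [setAverage_eq, enorm_smul, e, ENNReal.mul_rpow_of_nonneg _ _ hp0.le]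
  have h2 : ‖∫ x in S, f x‖ₑ ^ p ≤ (∫⁻ x in S, ‖f x‖ₑ ^ p) * volume S ^ (p - 1) := by
    refine (ENNReal.rpow_le_rpow (enorm_integral_le_lintegral_enorm _) hp0.le).trans ?_
    simpa using lintegral_enorm_rpow_le hp hf
  refine (mul_le_mul_right h2 _).trans (le_of_eq ?_)
  rw [mul_comm (∫⁻ x in S, ‖f x‖ₑ ^ p), ← mul_assoc]
  congr 1
  rw [ENNReal.inv_rpow, ← ENNReal.rpow_neg, ← ENNReal.rpow_add _ _ h0 h1, ← ENNReal.rpow_neg_one]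
  congr 1
  ring

/-- The averages converge to the average over the whole chain, or to zero. -/
theorem tendsto_expect {p : ℝ} (hp : 1 ≤ p) {f : ℝ → 𝕜}
    (hf : MemLp f (ENNReal.ofReal p) L.vol) (hx : x ∈ L.carrier) :
    Tendsto (fun m : ℕ => L.expect (-(m : ℤ)) f x) atTop (𝓝 (L.topAvg f x)) := by
  have hmono : Monotone fun m : ℕ => L.atom (-(m : ℤ)) x :=
    fun m n h => atom_anti hx (by omega)
  have hU : ⋃ m : ℕ, L.atom (-(m : ℤ)) x = L.top x := by
    refine Set.Subset.antisymm (Set.iUnion_subset fun m => atom_subset_top _ _)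
      (Set.iUnion_subset fun k => ?_)
    exact (atom_anti hx (by omega : -(k.natAbs : ℤ) ≤ k)).trans
      (Set.subset_iUnion (fun m : ℕ => L.atom (-(m : ℤ)) x) k.natAbs)
  have hvol : Tendsto (fun m : ℕ => volume (L.atom (-(m : ℤ)) x)) atTop (𝓝 (volume (L.top x))) := by
    rw [← hU]
    exact tendsto_measure_iUnion_atTop hmono
  by_cases hv : volume (L.top x) < ∞
  · rw [topAvg, if_pos hv]
    have hint : IntegrableOn f (L.top x) :=
      integrableOn_of_memLp hp hf (top_subset_carrier hx) hv
    have h1 : Tendsto (fun m : ℕ => ∫ y in L.atom (-(m : ℤ)) x, f y) atTop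
        (𝓝 (∫ y in L.top x, f y)) := by
      rw [← hU] at hint ⊢
      exact tendsto_setIntegral_of_monotone
        (fun m => measurableSet_of_mem_gen (atom_mem_gen hx _)) hmono hint
    simp only [expect, setAverage_eq]
    refine Tendsto.smul ?_ h1
    refine Tendsto.inv₀ ((ENNReal.tendsto_toReal hv.ne).comp hvol) ?_
    rw [Measure.real, ENNReal.toReal_ne_zero]
    refine ⟨?_, hv.ne⟩
    exact ((volume_pos_of_mem_gen (atom_mem_gen hx 0)).trans_le
      (measure_mono (atom_subset_top 0 x))).ne'
  · rw [topAvg, if_neg hv]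
    have hv' : volume (L.top x) = ∞ := by simpa using hv
    rw [hv'] at hvol
    rw [tendsto_zero_iff_enorm_tendsto_zero]
    have hp0 : 0 < p := by linarith
    set C := ∫⁻ y, ‖f y‖ₑ ^ p ∂L.vol with hC
    have hCfin : C ≠ ∞ := by
      have := hf.eLpNorm_lt_top
      rw [eLpNorm_lt_top_iff_lintegral_rpow_enorm_lt_top (by simpa using hp0)
        ENNReal.ofReal_ne_top, ENNReal.toReal_ofReal hp0.le] at this
      exact this.ne
    -- Jensen's inequality: an average over an interval is at most the `L ^ p` norm times a negative
    -- power of the length, and the lengths tend to infinity in this case.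
    have hle : ∀ m : ℕ, ‖L.expect (-(m : ℤ)) f x‖ₑ
        ≤ ((volume (L.atom (-(m : ℤ)) x))⁻¹ * C) ^ (1 / p) := by
      intro m
      have hI := atom_mem_gen hx (-(m : ℤ))
      have h1 := enorm_setAverage_rpow_le hp (f := f)
        (by rw [← vol_restrict hI]; exact hf.1.restrict)
        (volume_pos_of_mem_gen hI).ne' (volume_lt_top_of_mem_gen hI).ne
      have h2 : ∫⁻ y in L.atom (-(m : ℤ)) x, ‖f y‖ₑ ^ p ≤ C := by
        rw [← vol_restrict hI]
        exact lintegral_mono' Measure.restrict_le_self le_rfl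
      have h3 := ENNReal.rpow_le_rpow (h1.trans (mul_le_mul_right h2 _))
        (by positivity : 0 ≤ 1 / p)
      rwa [← ENNReal.rpow_mul, mul_one_div_cancel hp0.ne', ENNReal.rpow_one] at h3
    refine tendsto_of_tendsto_of_tendsto_of_le_of_le tendsto_const_nhds ?_
      (fun m => zero_le) hle
    have h4 : Tendsto (fun m : ℕ => (volume (L.atom (-(m : ℤ)) x))⁻¹ * C) atTop (𝓝 0) := by
      have h5 := ENNReal.Tendsto.mul_const (b := C) (tendsto_inv_iff.2 hvol)
        (Or.inr hCfin)
      simpa using h5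
    have h6 := ((ENNReal.continuous_rpow_const (y := 1 / p)).tendsto 0).comp h4
    rwa [ENNReal.zero_rpow_of_pos (by positivity)] at h6

end IntervalLattice

end

noncomputable section

namespace IntervalLattice

variable {L : IntervalLattice} {I J Q : Set ℝ} {j k N : ℤ} {x y : ℝ} {α : Type*}
  {𝕜 : Type*} [RCLike 𝕜]

/-! ### The extended square function and the maximal function -/

variable (L) in
/-- The extended square function. -/
def sqFun (f : ℝ → 𝕜) (x : ℝ) : ℝ≥0∞ :=
  ((∑' k : ℤ, ‖L.diff k f x‖ₑ ^ (2 : ℝ)) + ‖L.topAvg f x‖ₑ ^ (2 : ℝ)) ^ (1 / 2 : ℝ)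

theorem hardyENormFun_rpow {p : ℝ} (hp : 0 < p) (f : ℝ → 𝕜) :
    L.hardyENormFun p f ^ p = ∫⁻ x, L.sqFun f x ^ p ∂L.vol := by
  rw [hardyENormFun_eq, ← ENNReal.rpow_mul, one_div_mul_cancel hp.ne', ENNReal.rpow_one]
  rfl

theorem topAvg_le_sqFun (f : ℝ → 𝕜) (x : ℝ) : ‖L.topAvg f x‖ₑ ≤ L.sqFun f x := by
  have h : ‖L.topAvg f x‖ₑ = (‖L.topAvg f x‖ₑ ^ (2 : ℝ)) ^ (1 / 2 : ℝ) := by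
    rw [← ENNReal.rpow_mul]
    norm_num
  rw [h]
  exact ENNReal.rpow_le_rpow le_add_self (by norm_num)

theorem tsum_diff_le_sqFun (f : ℝ → 𝕜) (x : ℝ) :
    (∑' k : ℤ, ‖L.diff k f x‖ₑ ^ (2 : ℝ)) ^ (1 / 2 : ℝ) ≤ L.sqFun f x :=
  ENNReal.rpow_le_rpow le_self_add (by norm_num)

theorem ofReal_sqrt_sum {ι E : Type*} [NormedAddCommGroup E] (s : Finset ι) (a : ι → E) :
    ENNReal.ofReal (Real.sqrt (∑ i ∈ s, ‖a i‖ ^ 2))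
      = (∑ i ∈ s, ‖a i‖ₑ ^ (2 : ℝ)) ^ (1 / 2 : ℝ) := by
  rw [Real.sqrt_eq_rpow, ← ENNReal.ofReal_rpow_of_nonneg
    (Finset.sum_nonneg fun i _ => sq_nonneg _) (by norm_num),
    ENNReal.ofReal_sum_of_nonneg fun i _ => sq_nonneg _]
  congr 1
  refine Finset.sum_congr rfl fun i _ => ?_
  rw [ENNReal.ofReal_pow (norm_nonneg _), ofReal_norm, ← ENNReal.rpow_natCast]
  norm_num

theorem norm_le_abs_re_add_abs_im {𝕜 : Type*} [RCLike 𝕜] (z : 𝕜) :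
    ‖z‖ ≤ |RCLike.re z| + |RCLike.im z| := by
  have ha := abs_nonneg (RCLike.re z)
  have hb := abs_nonneg (RCLike.im z)
  refine (sq_le_sq₀ (norm_nonneg _) (add_nonneg ha hb)).1 ?_
  rw [RCLike.norm_sq_eq_def]
  nlinarith [sq_abs (RCLike.re z), sq_abs (RCLike.im z), mul_nonneg ha hb]

theorem sum_range_le_tsum (a : ℤ → ℝ≥0∞) (N : ℤ) (M : ℕ) :
    ∑ i ∈ Finset.range M, a (N + i) ≤ ∑' k, a k :=
  (ENNReal.sum_le_tsum _).trans
    (ENNReal.tsum_comp_le_tsum_of_injective (f := fun i : ℕ => N + (i : ℤ))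
      (fun i i' h => by simpa using h) a)

/-- The square function over finitely many generations of a function whose differences are
dominated by those of `f`. -/
theorem ofReal_sqrt_window_le {p : ℝ} (hp : 0 ≤ p) {h : ℝ → ℝ} {f : ℝ → 𝕜} (N : ℤ) (M : ℕ)
    (H : ∀ k, |L.diff k h x| ≤ ‖L.diff k f x‖) :
    ENNReal.ofReal (Real.sqrt (∑ i ∈ Finset.range M, L.diff (N + i) h x ^ 2) ^ p)
      ≤ L.sqFun f x ^ p := by
  rw [← ENNReal.ofReal_rpow_of_nonneg (Real.sqrt_nonneg _) hp]
  refine ENNReal.rpow_le_rpow ?_ hp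
  refine le_trans ?_ (tsum_diff_le_sqFun f x)
  calc ENNReal.ofReal (Real.sqrt (∑ i ∈ Finset.range M, L.diff (N + i) h x ^ 2))
      ≤ ENNReal.ofReal (Real.sqrt (∑ i ∈ Finset.range M, ‖L.diff (N + i) f x‖ ^ 2)) := by
        refine ENNReal.ofReal_le_ofReal (Real.sqrt_le_sqrt (Finset.sum_le_sum fun i _ => ?_))
        rw [← sq_abs]
        exact pow_le_pow_left₀ (abs_nonneg _) (H _) 2
    _ = (∑ i ∈ Finset.range M, ‖L.diff (N + i) f x‖ₑ ^ (2 : ℝ)) ^ (1 / 2 : ℝ) :=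
        ofReal_sqrt_sum _ _
    _ ≤ _ := ENNReal.rpow_le_rpow
        (sum_range_le_tsum (fun k => ‖L.diff k f x‖ₑ ^ (2 : ℝ)) N M) (by norm_num)

theorem aemeasurable_topAvg {p : ℝ} (hp : 1 ≤ p) {f : ℝ → 𝕜}
    (hf : MemLp f (ENNReal.ofReal p) L.vol) : AEMeasurable (L.topAvg f) L.vol :=
  aemeasurable_of_tendsto_metrizable_ae atTop
    (fun m : ℕ => (atomConst_expect (-(m : ℤ)) f).aemeasurable)
    (ae_of_mem_carrier fun _ hx => tendsto_expect hp hf hx)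

theorem expect_re {f : ℝ → 𝕜} (hf : IntegrableOn f (L.atom k x)) :
    L.expect k (fun y => RCLike.re (f y)) x = RCLike.re (L.expect k f x) := by
  rw [expect, expect, setAverage_eq, setAverage_eq, RCLike.smul_re, smul_eq_mul, integral_re hf]

theorem expect_im {f : ℝ → 𝕜} (hf : IntegrableOn f (L.atom k x)) :
    L.expect k (fun y => RCLike.im (f y)) x = RCLike.im (L.expect k f x) := by
  rw [expect, expect, setAverage_eq, setAverage_eq, RCLike.smul_im, smul_eq_mul, integral_im hf]

theorem norm_expect_le (f : ℝ → 𝕜) (k : ℤ) (x : ℝ) :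
    ‖L.expect k f x‖ ≤ L.expect k (fun y => ‖f y‖) x := by
  rw [expect, expect, setAverage_eq, setAverage_eq, norm_smul, smul_eq_mul, Real.norm_eq_abs,
    abs_of_nonneg (inv_nonneg.2 measureReal_nonneg)]
  exact mul_le_mul_of_nonneg_left (norm_integral_le_integral_norm _)
    (inv_nonneg.2 measureReal_nonneg)

theorem integrableOn_gen {p : ℝ} (hp : 1 ≤ p) {f : ℝ → 𝕜}
    (hf : MemLp f (ENNReal.ofReal p) L.vol) (hI : I ∈ L.gen k) : IntegrableOn f I :=
  integrableOn_of_memLp hp hf (subset_carrier hI) (volume_lt_top_of_mem_gen hI)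

theorem rpow_add_three_le {a b c p : ℝ} (ha : 0 ≤ a) (hb : 0 ≤ b) (hc : 0 ≤ c) (hp : 0 ≤ p) :
    (a + b + c) ^ p ≤ 3 ^ p * (a ^ p + b ^ p + c ^ p) := by
  have h : a + b + c ≤ 3 * max a (max b c) := by
    have := le_max_left a (max b c)
    have := le_max_right a (max b c)
    have := le_max_left b c
    have := le_max_right b c
    linarith
  have h1 := Real.rpow_nonneg ha p
  have h2 := Real.rpow_nonneg hb p
  have h3 := Real.rpow_nonneg hc p
  calc (a + b + c) ^ p ≤ (3 * max a (max b c)) ^ p := Real.rpow_le_rpow (by positivity) h hp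
    _ = 3 ^ p * (max a (max b c)) ^ p := Real.mul_rpow (by norm_num) (le_max_of_le_left ha)
    _ ≤ _ := by
      gcongr
      rcases max_choice a (max b c) with h | h <;> rw [h]
      · linarith
      · rcases max_choice b c with h | h <;> rw [h] <;> linarith

theorem atomConst_max_sub {p : ℝ} (f : ℝ → ℝ) (N : ℤ) (M : ℕ) :
    L.AtomConst (N + M)
      (fun x => runMax (fun n => L.expect (N + n) f x - L.expect N f x) M ^ p) := by
  refine (atomConst_runMax fun n hn => ?_).comp (fun t : ℝ => t ^ p)
  exact ((atomConst_expect _ f).mono (natCast_add_le N hn)).comp₂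
    ((atomConst_expect N f).mono (by omega)) (fun a b => a - b)

theorem diff_re {f : ℝ → 𝕜} (hf : ∀ k, IntegrableOn f (L.atom k x)) (k : ℤ) :
    L.diff k (fun y => RCLike.re (f y)) x = RCLike.re (L.diff k f x) := by
  rw [diff, diff, expect_re (hf _), expect_re (hf _), map_sub]

theorem diff_im {f : ℝ → 𝕜} (hf : ∀ k, IntegrableOn f (L.atom k x)) (k : ℤ) :
    L.diff k (fun y => RCLike.im (f y)) x = RCLike.im (L.diff k f x) := by
  rw [diff, diff, expect_im (hf _), expect_im (hf _), map_sub]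

/-- Davis' inequality: for `p ≥ 1` the maximal function is controlled by the extended square
function. -/
theorem lintegral_iSup_expect_le {p : ℝ} (hp : 1 ≤ p) : ∃ C : ℝ≥0, 0 < C ∧
    ∀ (L : IntervalLattice) (f : ℝ → 𝕜), MemLp f (ENNReal.ofReal p) L.vol →
      ∫⁻ x, ⨆ k : ℤ, ‖L.expect k f x‖ₑ ^ p ∂L.vol ≤ C * ∫⁻ x, L.sqFun f x ^ p ∂L.vol := by
  have hp0 : 0 < p := by linarith
  set D : ℝ := 2 * (2 * p) ^ p * 28 ^ p with hD
  have hD0 : 0 < D := by positivity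
  set C₁ : ℝ≥0∞ := ENNReal.ofReal (2 ^ p) * (ENNReal.ofReal D + ENNReal.ofReal D) with hC₁
  have hC₁fin : C₁ ≠ ∞ := by
    rw [hC₁]
    exact ENNReal.mul_ne_top ENNReal.ofReal_ne_top (by simp)
  refine ⟨(2 ^ (p - 1) * (C₁ + 1)).toNNReal, ?_, ?_⟩
  · refine ENNReal.toNNReal_pos ?_ ?_
    · simp
    · exact ENNReal.mul_ne_top (by simp) (by simp [hC₁fin])
  intro L f hf
  rw [ENNReal.coe_toNNReal (ENNReal.mul_ne_top (by simp) (by simp [hC₁fin]))]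
  -- The finite martingale inequalities are for real martingales, so real and imaginary parts are
  -- treated separately.
  set u : ℝ → ℝ := fun y => RCLike.re (f y) with hu
  set v : ℝ → ℝ := fun y => RCLike.im (f y) with hv
  have hint : ∀ k, ∀ I ∈ L.gen k, IntegrableOn f I := fun k I hI => integrableOn_gen hp hf hI
  set F : ℕ → ℝ → ℝ≥0∞ := fun m x => ENNReal.ofReal (2 ^ p) *
    (ENNReal.ofReal (runMax (fun n => L.expect (-(m : ℤ) + n) u x - L.expect (-(m : ℤ)) u x)
        (2 * m + 1) ^ p)
      + ENNReal.ofReal (runMax (fun n => L.expect (-(m : ℤ) + n) v x - L.expect (-(m : ℤ)) v x)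
        (2 * m + 1) ^ p)) with hF
  have hmeas : ∀ (h : ℝ → ℝ) (m : ℕ), AEMeasurable (fun x => ENNReal.ofReal
      (runMax (fun n => L.expect (-(m : ℤ) + n) h x - L.expect (-(m : ℤ)) h x)
        (2 * m + 1) ^ p)) L.vol := fun h m =>
    ((atomConst_max_sub h (-(m : ℤ)) (2 * m + 1)).comp ENNReal.ofReal).aemeasurable
  have hFint : ∀ m, ∫⁻ x, F m x ∂L.vol ≤ C₁ * ∫⁻ x, L.sqFun f x ^ p ∂L.vol := by
    intro m
    have h1 := lintegral_runMax_rpow_le (L := L) (N := -(m : ℤ)) hp (f := u)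
      (fun Q hQ => (hint _ Q hQ).re) (2 * m + 1)
    have h2 := lintegral_runMax_rpow_le (L := L) (N := -(m : ℤ)) hp (f := v)
      (fun Q hQ => (hint _ Q hQ).im) (2 * m + 1)
    have h3 : ∀ h : ℝ → ℝ, (∀ x ∈ L.carrier, ∀ k, |L.diff k h x| ≤ ‖L.diff k f x‖) →
        ∫⁻ x, ENNReal.ofReal (Real.sqrt
          (∑ i ∈ Finset.range (2 * m + 1), L.diff (-(m : ℤ) + i) h x ^ 2) ^ p) ∂L.vol
        ≤ ∫⁻ x, L.sqFun f x ^ p ∂L.vol := fun h hh =>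
      lintegral_vol_mono fun x hx => ofReal_sqrt_window_le hp0.le _ _ (hh x hx)
    have hu' := h3 u fun x hx k => by
      rw [hu, diff_re fun k => hint k _ (atom_mem_gen hx k)]
      exact RCLike.abs_re_le_norm _
    have hv' := h3 v fun x hx k => by
      rw [hv, diff_im fun k => hint k _ (atom_mem_gen hx k)]
      exact RCLike.abs_im_le_norm _
    simp only [hF]
    rw [lintegral_const_mul' _ _ ENNReal.ofReal_ne_top, lintegral_add_left' (hmeas u m), hC₁,
      mul_assoc, add_mul]
    gcongr
    · exact h1.trans (mul_le_mul_right hu' _)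
    · exact h2.trans (mul_le_mul_right hv' _)
  have hkey : ∀ x ∈ L.carrier, ∀ (k : ℤ) (m : ℕ), k ∈ window m →
      ‖L.expect k f x - L.expect (-(m : ℤ)) f x‖ₑ ^ p ≤ F m x := by
    intro x hx k m hk
    rw [window, Finset.mem_Icc] at hk
    obtain ⟨n, hn, rfl⟩ : ∃ n : ℕ, n ≤ 2 * m + 1 ∧ k = -(m : ℤ) + n :=
      ⟨(k + m).toNat, by omega, by omega⟩
    have ha := abs_le_runMax (fun n => L.expect (-(m : ℤ) + n) u x - L.expect (-(m : ℤ)) u x) hn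
    have hb := abs_le_runMax (fun n => L.expect (-(m : ℤ) + n) v x - L.expect (-(m : ℤ)) v x) hn
    set a := runMax (fun n => L.expect (-(m : ℤ) + n) u x - L.expect (-(m : ℤ)) u x) (2 * m + 1)
    set b := runMax (fun n => L.expect (-(m : ℤ) + n) v x - L.expect (-(m : ℤ)) v x) (2 * m + 1)
    have hE : ∀ k, IntegrableOn f (L.atom k x) := fun k => hint k _ (atom_mem_gen hx k)
    simp only [hu, hv, expect_re (hE _), expect_im (hE _), ← map_sub] at ha hb
    have hz := norm_le_abs_re_add_abs_im
      (L.expect (-(m : ℤ) + n) f x - L.expect (-(m : ℤ)) f x)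
    have ha0 : 0 ≤ a := (abs_nonneg _).trans ha
    have hb0 : 0 ≤ b := (abs_nonneg _).trans hb
    rw [← ofReal_norm, ENNReal.ofReal_rpow_of_nonneg (norm_nonneg _) hp0.le]
    simp only [hF]
    rw [← ENNReal.ofReal_add (Real.rpow_nonneg ha0 p) (Real.rpow_nonneg hb0 p),
      ← ENNReal.ofReal_mul (by positivity)]
    refine ENNReal.ofReal_le_ofReal ?_
    exact (Real.rpow_le_rpow (norm_nonneg _) (hz.trans (add_le_add ha hb)) hp0.le).trans
      (Real.add_rpow_le_two_rpow_mul ha0 hb0 hp0.le)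
  -- The window inequality controls `E_k f - E_{-m} f` only. As `m → ∞` the starting value tends to
  -- the average over the whole chain; that average is restored at the end, from its own term in the
  -- extended square function.
  have hmain : ∫⁻ x, ⨆ k : ℤ, ‖L.expect k f x - L.topAvg f x‖ₑ ^ p ∂L.vol
      ≤ C₁ * ∫⁻ x, L.sqFun f x ^ p ∂L.vol := by
    refine lintegral_le_of_le_liminf (F := F) (fun m => ?_) (fun x hx => iSup_le fun k => ?_) hFint
    · exact ((hmeas u m).add (hmeas v m)).const_mul _
    · have h1 : Tendsto (fun m : ℕ => ‖L.expect k f x - L.expect (-(m : ℤ)) f x‖ₑ ^ p) atTop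
          (𝓝 (‖L.expect k f x - L.topAvg f x‖ₑ ^ p)) :=
        ((ENNReal.continuous_rpow_const (y := p)).tendsto _).comp
          ((continuous_enorm.tendsto _).comp ((tendsto_expect hp hf hx).const_sub _))
      rw [← h1.liminf_eq]
      refine liminf_le_liminf ?_
      filter_upwards [eventually_ge_atTop k.natAbs] with m hm
      refine hkey x hx k m ?_
      rw [window, Finset.mem_Icc]
      omega
  have hmeas2 : AEMeasurable (fun x => ⨆ k : ℤ, ‖L.expect k f x - L.topAvg f x‖ₑ ^ p) L.vol :=
    AEMeasurable.iSup fun k =>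
      (((atomConst_expect k f).aemeasurable.sub (aemeasurable_topAvg hp hf)).enorm).pow_const p
  calc ∫⁻ x, ⨆ k : ℤ, ‖L.expect k f x‖ₑ ^ p ∂L.vol
      ≤ ∫⁻ x, 2 ^ (p - 1) * ((⨆ k : ℤ, ‖L.expect k f x - L.topAvg f x‖ₑ ^ p)
          + L.sqFun f x ^ p) ∂L.vol := by
        refine lintegral_vol_mono fun x hx => iSup_le fun k => ?_
        calc ‖L.expect k f x‖ₑ ^ p
            ≤ (‖L.expect k f x - L.topAvg f x‖ₑ + ‖L.topAvg f x‖ₑ) ^ p := by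
              refine ENNReal.rpow_le_rpow ?_ hp0.le
              have := enorm_add_le (L.expect k f x - L.topAvg f x) (L.topAvg f x)
              rwa [sub_add_cancel] at this
          _ ≤ 2 ^ (p - 1) * (‖L.expect k f x - L.topAvg f x‖ₑ ^ p + ‖L.topAvg f x‖ₑ ^ p) :=
              ENNReal.rpow_add_le_mul_rpow_add_rpow _ _ hp
          _ ≤ _ := by
              gcongr
              · exact le_iSup (fun k : ℤ => ‖L.expect k f x - L.topAvg f x‖ₑ ^ p) k
              · exact topAvg_le_sqFun f x
    _ = 2 ^ (p - 1) * (∫⁻ x, ⨆ k : ℤ, ‖L.expect k f x - L.topAvg f x‖ₑ ^ p ∂L.vol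
          + ∫⁻ x, L.sqFun f x ^ p ∂L.vol) := by
        rw [lintegral_const_mul' _ _ (by simp), lintegral_add_left' hmeas2]
    _ ≤ 2 ^ (p - 1) * (C₁ * ∫⁻ x, L.sqFun f x ^ p ∂L.vol + ∫⁻ x, L.sqFun f x ^ p ∂L.vol) := by
        gcongr
    _ = _ := by ring

/-- Burkholder's inequality: for `p > 1` the extended square function is controlled by the
`L ^ p` norm. -/
theorem lintegral_sqFun_le {p : ℝ} (hp : 1 < p) : ∃ C : ℝ≥0, 0 < C ∧
    ∀ (L : IntervalLattice) (f : ℝ → 𝕜), MemLp f (ENNReal.ofReal p) L.vol →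
      ∫⁻ x, L.sqFun f x ^ p ∂L.vol ≤ C * ∫⁻ x, ‖f x‖ₑ ^ p ∂L.vol := by
  have hp0 : 0 < p := by linarith
  have hp1 : 0 < p - 1 := by linarith
  set D : ℝ := 2 * (2 * p) ^ p * 32 ^ p with hD
  have hD0 : 0 < D := by positivity
  set D' : ℝ := 2 * (2 * (p / (p - 1))) ^ p with hD'
  have hD'0 : 0 < D' := by positivity
  set C : ℝ := 3 ^ p * ((D + D + 1) * D') with hC
  have hC0 : 0 < C := by positivity
  refine ⟨C.toNNReal, Real.toNNReal_pos.2 hC0, ?_⟩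
  intro L f hf
  have hint : ∀ k, ∀ I ∈ L.gen k, IntegrableOn f I := fun k I hI => integrableOn_gen hp.le hf hI
  set u : ℝ → ℝ := fun y => RCLike.re (f y) with hu
  set v : ℝ → ℝ := fun y => RCLike.im (f y) with hv
  set n : ℝ → ℝ := fun y => ‖f y‖ with hn
  -- the maximal function of the modulus
  have hmax : ∀ m : ℕ, ∫⁻ x, ENNReal.ofReal
      (runMax (fun i => L.expect (-(m : ℤ) + i) n x) (2 * m + 1) ^ p) ∂L.vol
      ≤ ENNReal.ofReal D' * ∫⁻ x, ‖f x‖ₑ ^ p ∂L.vol := by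
    intro m
    refine (lintegral_doob hp (fun x => norm_nonneg _)
      (fun Q hQ => (hint _ Q hQ).norm) (2 * m + 1)).trans (mul_le_mul_right ?_ _)
    set K : ℤ := -(m : ℤ) + (2 * m + 1 : ℕ) with hK
    rw [lintegral_gen K, lintegral_gen K]
    refine ENNReal.tsum_le_tsum fun I => ?_
    have e : ∀ x ∈ (I : Set ℝ), ENNReal.ofReal (L.expect K n x ^ p)
        = ‖⨍ y in (I : Set ℝ), n y‖ₑ ^ p := by
      intro x hx
      rw [expect, atom_eq I.2 hx, ← ENNReal.ofReal_rpow_of_nonneg _ hp0.le,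
        Real.enorm_eq_ofReal] <;>
      · rw [setAverage_eq, smul_eq_mul]
        exact mul_nonneg (inv_nonneg.2 measureReal_nonneg)
          (integral_nonneg fun y => norm_nonneg _)
    rw [setLIntegral_congr_fun (measurableSet_of_mem_gen I.2) e, setLIntegral_const]
    have h1 := enorm_setAverage_rpow_le hp.le (f := n) (S := (I : Set ℝ))
      ((hint _ I I.2).1.norm) (volume_pos_of_mem_gen I.2).ne' (volume_lt_top_of_mem_gen I.2).ne
    refine (mul_le_mul_left h1 _).trans (le_of_eq ?_)
    rw [mul_right_comm, ENNReal.inv_mul_cancel (volume_pos_of_mem_gen I.2).ne'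
      (volume_lt_top_of_mem_gen I.2).ne, one_mul]
    simp only [hn, enorm_norm]
  have hsq : ∀ h : ℝ → ℝ, (∀ k, ∀ I ∈ L.gen k, IntegrableOn h I) →
      (∀ x ∈ L.carrier, ∀ k, |L.expect k h x| ≤ L.expect k n x) → ∀ m : ℕ,
      ∫⁻ x, ENNReal.ofReal (Real.sqrt
        (∑ i ∈ Finset.range (2 * m + 1), L.diff (-(m : ℤ) + i) h x ^ 2) ^ p) ∂L.vol
      ≤ ENNReal.ofReal D * (ENNReal.ofReal D' * ∫⁻ x, ‖f x‖ₑ ^ p ∂L.vol) := by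
    intro h hh hle m
    refine (lintegral_sqrt_rpow_le hp.le (fun Q hQ => hh _ Q hQ) (2 * m + 1)).trans
      (mul_le_mul_right (le_trans (lintegral_vol_mono fun x hx => ?_) (hmax m)) _)
    refine ENNReal.ofReal_le_ofReal (Real.rpow_le_rpow (runMax_nonneg _ _) ?_ hp0.le)
    refine runMax_le fun i hi => (hle x hx _).trans ((le_abs_self _).trans ?_)
    exact abs_le_runMax (fun i : ℕ => L.expect (-(m : ℤ) + i) n x) hi
  have hE : ∀ x ∈ L.carrier, ∀ k, IntegrableOn f (L.atom k x) :=
    fun x hx k => hint k _ (atom_mem_gen hx k)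
  have hsu := hsq u (fun k I hI => (hint k I hI).re) fun x hx k => by
    rw [hu, expect_re (hE x hx k)]
    exact (RCLike.abs_re_le_norm _).trans (norm_expect_le f k x)
  have hsv := hsq v (fun k I hI => (hint k I hI).im) fun x hx k => by
    rw [hv, expect_im (hE x hx k)]
    exact (RCLike.abs_im_le_norm _).trans (norm_expect_le f k x)
  set A : (ℝ → ℝ) → ℕ → ℝ → ℝ := fun h m x =>
    Real.sqrt (∑ i ∈ Finset.range (2 * m + 1), L.diff (-(m : ℤ) + i) h x ^ 2) with hA
  set E : ℕ → ℝ → ℝ := fun m x => runMax (fun i => L.expect (-(m : ℤ) + i) n x) (2 * m + 1) with hEd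
  have hA0 : ∀ h m x, 0 ≤ A h m x := fun h m x => Real.sqrt_nonneg _
  have hE0 : ∀ m x, 0 ≤ E m x := fun m x => runMax_nonneg _ _
  set F : ℕ → ℝ → ℝ≥0∞ := fun m x => ENNReal.ofReal (3 ^ p) *
    (ENNReal.ofReal (A u m x ^ p) + ENNReal.ofReal (A v m x ^ p) + ENNReal.ofReal (E m x ^ p))
    with hF
  have hAm : ∀ h m, AEMeasurable (fun x => ENNReal.ofReal (A h m x ^ p)) L.vol := fun h m =>
    ((atomConst_sqrt_window (-(m : ℤ)) (2 * m + 1) h p).comp ENNReal.ofReal).aemeasurable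
  have hEm : ∀ m, AEMeasurable (fun x => ENNReal.ofReal (E m x ^ p)) L.vol := by
    intro m
    refine AtomConst.aemeasurable (L := L) (k := -(m : ℤ) + (2 * m + 1 : ℕ)) ?_
    refine (atomConst_runMax fun i hi => ?_).comp (fun t : ℝ => ENNReal.ofReal (t ^ p))
    exact (atomConst_expect _ n).mono (natCast_add_le _ hi)
  refine lintegral_le_of_le_liminf (F := F)
    (fun m => (((hAm u m).add (hAm v m)).add (hEm m)).const_mul _) (fun x hx => ?_) (fun m => ?_)
  -- The extended square function is the limit of window square functions with `E_{-m} f` in place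
  -- of the average over the chain; this starting value is at most the maximal function of `|f|`,
  -- which Doob's inequality controls.
  · have h1 : Tendsto (fun m : ℕ => (((∑ k ∈ window m, ‖L.diff k f x‖ₑ ^ (2 : ℝ))
        + ‖L.expect (-(m : ℤ)) f x‖ₑ ^ (2 : ℝ)) ^ (1 / 2 : ℝ)) ^ p) atTop
        (𝓝 (L.sqFun f x ^ p)) := by
      refine ((ENNReal.continuous_rpow_const (y := p)).tendsto _).comp
        (((ENNReal.continuous_rpow_const (y := 1 / 2)).tendsto _).comp
          ((tendsto_sum_window _).add ?_))
      exact ((ENNReal.continuous_rpow_const (y := 2)).tendsto _).comp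
        ((continuous_enorm.tendsto _).comp (tendsto_expect hp.le hf hx))
    rw [← h1.liminf_eq]
    refine liminf_le_liminf (Eventually.of_forall fun m => ?_)
    set a := A u m x with ha
    set b := A v m x with hb
    have hre : ∑ i ∈ Finset.range (2 * m + 1), ‖L.diff (-(m : ℤ) + i) f x‖ ^ 2
        = a ^ 2 + b ^ 2 := by
      rw [ha, hb, hA]
      simp only
      rw [Real.sq_sqrt (Finset.sum_nonneg fun i _ => sq_nonneg _),
        Real.sq_sqrt (Finset.sum_nonneg fun i _ => sq_nonneg _), ← Finset.sum_add_distrib]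
      refine Finset.sum_congr rfl fun i _ => ?_
      rw [hu, hv, diff_re (hE x hx), diff_im (hE x hx), RCLike.norm_sq_eq_def]
      ring
    have hle : ((∑ k ∈ window m, ‖L.diff k f x‖ₑ ^ (2 : ℝ))
        + ‖L.expect (-(m : ℤ)) f x‖ₑ ^ (2 : ℝ)) ^ (1 / 2 : ℝ) ≤ ENNReal.ofReal (a + b + E m x) := by
      have e1 : ∑ k ∈ window m, ‖L.diff k f x‖ₑ ^ (2 : ℝ) = ENNReal.ofReal (a ^ 2 + b ^ 2) := by
        rw [sum_window, ← hre, ENNReal.ofReal_sum_of_nonneg fun i _ => sq_nonneg _]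
        refine Finset.sum_congr rfl fun i _ => ?_
        rw [ENNReal.ofReal_pow (norm_nonneg _), ofReal_norm, ← ENNReal.rpow_natCast]
        norm_num
      have e2 : ‖L.expect (-(m : ℤ)) f x‖ₑ ^ (2 : ℝ)
          ≤ ENNReal.ofReal (E m x ^ 2) := by
        rw [ENNReal.ofReal_pow (hE0 m x), ← ENNReal.rpow_natCast, ← ofReal_norm]
        refine ENNReal.rpow_le_rpow (ENNReal.ofReal_le_ofReal ?_) (by norm_num)
        have := abs_le_runMax (fun i : ℕ => L.expect (-(m : ℤ) + i) n x) (Nat.zero_le (2 * m + 1))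
        simp only [Nat.cast_zero, add_zero] at this
        exact (norm_expect_le f _ x).trans ((le_abs_self _).trans this)
      rw [e1]
      calc _ ≤ (ENNReal.ofReal ((a + b + E m x) ^ 2)) ^ (1 / 2 : ℝ) := by
            refine ENNReal.rpow_le_rpow ((add_le_add_right e2 _).trans ?_) (by norm_num)
            rw [← ENNReal.ofReal_add (by positivity) (by positivity)]
            refine ENNReal.ofReal_le_ofReal ?_
            have := hA0 u m x
            have := hA0 v m x
            have := hE0 m x
            nlinarith [mul_nonneg (hA0 u m x) (hA0 v m x), mul_nonneg (hA0 u m x) (hE0 m x),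
              mul_nonneg (hA0 v m x) (hE0 m x)]
        _ = _ := by
            rw [ENNReal.ofReal_rpow_of_nonneg (by positivity) (by norm_num), ← Real.sqrt_eq_rpow,
              Real.sqrt_sq (add_nonneg (add_nonneg (hA0 u m x) (hA0 v m x)) (hE0 m x))]
    refine (ENNReal.rpow_le_rpow hle hp0.le).trans ?_
    simp only [hF]
    rw [ENNReal.ofReal_rpow_of_nonneg (add_nonneg (add_nonneg (hA0 u m x) (hA0 v m x)) (hE0 m x))
      hp0.le, ← ENNReal.ofReal_add (Real.rpow_nonneg (hA0 _ _ _) p) (Real.rpow_nonneg (hA0 _ _ _) p),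
      ← ENNReal.ofReal_add (add_nonneg (Real.rpow_nonneg (hA0 _ _ _) p)
        (Real.rpow_nonneg (hA0 _ _ _) p)) (Real.rpow_nonneg (hE0 _ _) p),
      ← ENNReal.ofReal_mul (by positivity)]
    exact ENNReal.ofReal_le_ofReal
      (rpow_add_three_le (hA0 u m x) (hA0 v m x) (hE0 m x) hp0.le)
  · simp only [hF]
    rw [lintegral_const_mul' _ _ ENNReal.ofReal_ne_top, lintegral_add_left'
      (f := fun x => ENNReal.ofReal (A u m x ^ p) + ENNReal.ofReal (A v m x ^ p))
      ((hAm u m).add (hAm v m)),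
      lintegral_add_left' (hAm u m)]
    calc _ ≤ ENNReal.ofReal (3 ^ p) *
          (ENNReal.ofReal D * (ENNReal.ofReal D' * ∫⁻ x, ‖f x‖ₑ ^ p ∂L.vol)
          + ENNReal.ofReal D * (ENNReal.ofReal D' * ∫⁻ x, ‖f x‖ₑ ^ p ∂L.vol)
          + ENNReal.ofReal D' * ∫⁻ x, ‖f x‖ₑ ^ p ∂L.vol) := by
          gcongr
          · exact hsu m
          · exact hsv m
          · exact hmax m
      _ = (C.toNNReal : ℝ≥0∞) * ∫⁻ x, ‖f x‖ₑ ^ p ∂L.vol := by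
          have : (C.toNNReal : ℝ≥0∞) = ENNReal.ofReal (3 ^ p) *
              ((ENNReal.ofReal D + ENNReal.ofReal D + 1) * ENNReal.ofReal D') := by
            change ENNReal.ofReal C = _
            rw [hC, ENNReal.ofReal_mul (by positivity), ENNReal.ofReal_mul (by positivity),
              ENNReal.ofReal_add (by positivity) zero_le_one, ENNReal.ofReal_add hD0.le hD0.le,
              ENNReal.ofReal_one]
          rw [this]
          ring

end IntervalLattice

end

noncomputable section

/-! ### Running maxima, sums over generations and operator norms -/

theorem exists_runMax_eq (y : ℕ → ℝ) (n : ℕ) : ∃ i ≤ n, runMax y n = |y i| := by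
  induction n with
  | zero => exact ⟨0, le_rfl, runMax_zero y⟩
  | succ n ih =>
    obtain ⟨i, hi, h⟩ := ih
    rw [runMax_succ]
    rcases max_choice (runMax y n) |y (n + 1)| with h' | h'
    · exact ⟨i, by omega, h'.trans h⟩
    · exact ⟨n + 1, le_rfl, h'⟩

theorem ENNReal.sum_add_natCast_le_tsum (a : ℤ → ℝ≥0∞) (N : ℤ) (s : Finset ℕ) :
    ∑ i ∈ s, a (N + i) ≤ ∑' k, a k := by
  have : ∑ i ∈ s, a (N + i)
      = ∑ k ∈ s.map ⟨fun i : ℕ => N + i, fun i j h => by simpa using h⟩, a k := by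
    rw [Finset.sum_map]; rfl
  rw [this]
  exact ENNReal.sum_le_tsum _

/-- The embedding theorems need a strictly positive testing constant. An `ε` of room covers `K = 0`,
and `K = ∞` is trivial because `C > 0`. -/
theorem ENNReal.iInf_coe_le_mul {P : ℝ≥0 → Prop} {C : ℝ≥0} {K : ℝ≥0∞} (hC : 0 < C)
    (h : ∀ A : ℝ≥0, 0 < A → K ≤ A → P (C * A)) :
    ⨅ (A : ℝ≥0) (_ : P A), (A : ℝ≥0∞) ≤ C * K := by
  rcases eq_or_ne K ∞ with rfl | hK
  · rw [ENNReal.mul_top (by simpa using hC.ne')]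
    exact le_top
  lift K to ℝ≥0 using hK
  refine ENNReal.le_of_forall_pos_le_add fun ε hε _ => ?_
  refine (iInf₂_le _ (h (K + ε / C) (by positivity) (by simp))).trans ?_
  rw [mul_add, mul_div_cancel₀ _ hC.ne']
  simp

theorem ENNReal.le_mul_iInf_coe {P : ℝ≥0 → Prop} {c : ℝ≥0} {K : ℝ≥0∞} (hc : 0 < c)
    (h : ∀ A : ℝ≥0, P A → K ≤ c * A) :
    K ≤ c * ⨅ (A : ℝ≥0) (_ : P A), (A : ℝ≥0∞) := by
  rw [mul_comm, ← ENNReal.div_le_iff_le_mul (Or.inl (by simpa using hc.ne')) (by simp)]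
  exact le_iInf₂ fun A hA => ENNReal.div_le_of_le_mul' (h A hA)

namespace IntervalLattice

variable {L : IntervalLattice} {I J Q : Set ℝ} {j k N : ℤ} {x y : ℝ} {α : Type*}
  {𝕜 : Type*} [RCLike 𝕜]

/-! ### The testing condition is sufficient for the paraproduct -/

theorem setLAverage_le_iff {f : ℝ → ℝ≥0∞} {C : ℝ≥0∞} (hI : I ∈ L.gen k) :
    laverage (volume.restrict I) f ≤ C ↔ ∫⁻ x in I, f x ≤ C * volume I := by
  rw [setLAverage_eq, ENNReal.div_le_iff (volume_pos_of_mem_gen hI).ne'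
    (volume_lt_top_of_mem_gen hI).ne]

open Classical in
theorem testConst_le_iff {p q : ℝ} (hp : 0 < p) (hq : 0 < q) {b : L.intervals → ℝ → 𝕜}
    (hb : L.IsMartDiffSeq b) {A : ℝ≥0∞} :
    L.testConst p q b ≤ A ↔ ∀ k, ∀ I ∈ L.gen k,
      ∫⁻ x in I, (∑' j, if L.atom j x ⊆ I then ‖L.term b j x‖ₑ ^ q else 0) ^ (p / q)
        ≤ A ^ p * volume I := by
  have key : ∀ I : Set ℝ, ∀ x, (∑' J : L.intervals, if (J : Set ℝ) ⊆ I then ‖b J x‖ₑ ^ q else 0)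
      = ∑' j, if L.atom j x ⊆ I then ‖L.term b j x‖ₑ ^ q else 0 := fun I x =>
    tsum_term_subset hb (fun a => ‖a‖ₑ ^ q) (by simp [hq]) I
  rw [testConst, one_div, ENNReal.rpow_inv_le_iff hp, iSup_le_iff]
  constructor
  · intro h k I hI
    have := h ⟨I, mem_intervals hI⟩
    rw [setLAverage_le_iff hI] at this
    simpa only [key] using this
  · intro h I
    obtain ⟨k, hk⟩ := Set.mem_iUnion.1 I.2
    rw [setLAverage_le_iff hk]
    simpa only [key] using h k I hk

/-- Carleson embedding with exponent `p / q`, multiplier the `q`-th power of the running maximum of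
`|E_k f|`, and weights `|Δ_k b| ^ q`. The result is the maximal function of `f`, which Davis'
inequality bounds in `H̃^p`. -/
theorem exists_paraBoundedBy_of_testConst_le {p q : ℝ} (hp : 1 ≤ p) (hq : 1 < q) :
    ∃ C : ℝ≥0, 0 < C ∧ ∀ (L : IntervalLattice) (b : L.intervals → ℝ → 𝕜), L.IsMartDiffSeq b →
      ∀ A : ℝ≥0, 0 < A → L.testConst p q b ≤ A → L.ParaBoundedBy p q b (C * A) := by
  classical
  have hp0 : 0 < p := by linarith
  have hq0 : 0 < q := by linarith
  have hr : 0 < p / q := by positivity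
  obtain ⟨C, hC, hmax⟩ := lintegral_iSup_expect_le (𝕜 := 𝕜) hp
  have hD := carlesonConst_pos hr
  set D := carlesonConst (p / q)
  refine ⟨(D.toNNReal * C) ^ (1 / p), NNReal.rpow_pos (by positivity), ?_⟩
  intro L b hb A hA hK f hf
  rw [testConst_le_iff hp0 hq0 hb] at hK
  have hArp : ((A : ℝ) ^ q) ^ (p / q) = (A : ℝ) ^ p := by
    rw [← Real.rpow_mul A.coe_nonneg, mul_div_cancel₀ _ hq0.ne']
  have hmain : ∀ m : ℕ, ∫⁻ x, (∑ k ∈ window m, (‖L.expect k f x‖ₑ * ‖L.term b k x‖ₑ) ^ q) ^ (p / q)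
      ∂L.vol ≤ ((D.toNNReal * A ^ p : ℝ≥0) : ℝ≥0∞) * ∫⁻ x, ⨆ k : ℤ, ‖L.expect k f x‖ₑ ^ p ∂L.vol := by
    intro m
    set N : ℤ := -(m : ℤ)
    have hΦc : ∀ n : ℕ, L.AtomConst (N + n)
        (fun x => runMax (fun i => ‖L.expect (N + i) f x‖) n ^ q) := fun n =>
      (atomConst_runMax (u := fun i x => ‖L.expect (N + i) f x‖) fun i hi =>
        ((atomConst_expect (N + i) f).comp norm).mono (natCast_add_le N hi)).comp (· ^ q)
    have hβc : ∀ n : ℕ, L.AtomConst (N + (n + 1 : ℕ)) (fun x => ‖L.term b (N + n) x‖ ^ q) := by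
      intro n
      refine ((atomConst_term hb (N + n)).mono ?_).comp fun z => ‖z‖ ^ q
      push_cast; omega
    have hβe : ∀ (n : ℕ) x, ENNReal.ofReal (‖L.term b (N + n) x‖ ^ q) = ‖L.term b (N + n) x‖ₑ ^ q := by
      intro n x
      rw [← ENNReal.ofReal_rpow_of_nonneg (norm_nonneg _) hq0.le, ofReal_norm]
    -- The weight `Δ_k b` is constant on the children only, one generation later than `E_k f`, so
    -- the version for non-adapted weights is required. Its test, the moment of order `p / q` of the
    -- tails, is the testing condition.
    have h1 := lintegral_carleson (L := L) (N := N) (M := 2 * m) hr (Real.rpow_pos_of_pos (NNReal.coe_pos.2 hA) q)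
      hΦc (fun n x => Real.rpow_nonneg (runMax_nonneg _ _) q)
      (fun n x => Real.rpow_le_rpow (runMax_nonneg _ _) (runMax_mono _ n.le_succ) hq0.le)
      hβc (fun n x => by positivity) ?_
    · refine (lintegral_mono fun x => ?_).trans (h1.trans ?_)
      · rw [sum_window, ← ENNReal.ofReal_rpow_of_nonneg (Finset.sum_nonneg fun n _ => mul_nonneg
          (Real.rpow_nonneg (runMax_nonneg _ _) q) (by positivity)) hr.le]
        refine ENNReal.rpow_le_rpow ?_ hr.le
        rw [ENNReal.ofReal_sum_of_nonneg fun n _ => mul_nonneg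
          (Real.rpow_nonneg (runMax_nonneg _ _) q) (by positivity)]
        refine Finset.sum_le_sum fun n _ => ?_
        rw [ENNReal.mul_rpow_of_nonneg _ _ hq0.le, ENNReal.ofReal_mul
          (Real.rpow_nonneg (runMax_nonneg _ _) q), hβe]
        refine mul_le_mul_left ?_ _
        rw [← ofReal_norm, ENNReal.ofReal_rpow_of_nonneg (norm_nonneg _) hq0.le]
        refine ENNReal.ofReal_le_ofReal (Real.rpow_le_rpow (norm_nonneg _) ?_ hq0.le)
        exact (le_abs_self _).trans (abs_le_runMax (fun i : ℕ => ‖L.expect (N + i) f x‖) le_rfl)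
      · refine mul_le_mul' (le_of_eq ?_) (lintegral_mono fun x => ?_)
        · rw [hArp, ENNReal.ofReal_mul hD.le, ENNReal.coe_mul,
            ← ENNReal.ofReal_rpow_of_nonneg A.coe_nonneg hp0.le, ENNReal.ofReal_coe_nnreal,
            ENNReal.coe_rpow_of_nonneg _ hp0.le]
          rfl
        · obtain ⟨i, -, hi⟩ := exists_runMax_eq (fun i : ℕ => ‖L.expect (N + i) f x‖) (2 * m)
          rw [hi, abs_norm, ← Real.rpow_mul (norm_nonneg _), mul_div_cancel₀ _ hq0.ne',
            ← ENNReal.ofReal_rpow_of_nonneg (norm_nonneg _) hp0.le, ofReal_norm]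
          exact le_iSup (fun k : ℤ => ‖L.expect k f x‖ₑ ^ p) (N + i)
    · intro n _ I hI
      refine (setLIntegral_mono' (measurableSet_of_mem_gen hI) fun x hx => ?_).trans
        ((hK _ I hI).trans_eq ?_)
      · rw [← ENNReal.ofReal_rpow_of_nonneg (Finset.sum_nonneg fun n _ => by positivity) hr.le]
        refine ENNReal.rpow_le_rpow ?_ hr.le
        rw [ENNReal.ofReal_sum_of_nonneg fun n _ => by positivity]
        refine le_trans (Finset.sum_le_sum fun i hi => ?_) (ENNReal.sum_add_natCast_le_tsum
          (fun j => if L.atom j x ⊆ I then ‖L.term b j x‖ₑ ^ q else 0) N _)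
        rw [if_pos (atom_subset hI (natCast_add_le N (Finset.mem_Ico.1 hi).1) hx), hβe]
      · rw [hArp, ← ENNReal.ofReal_rpow_of_nonneg A.coe_nonneg hp0.le, ENNReal.ofReal_coe_nnreal]
  have hS : ∫⁻ x, L.sqFun f x ^ p ∂L.vol ≠ ∞ := by
    rw [← hardyENormFun_rpow hp0]
    exact ENNReal.rpow_ne_top_of_nonneg hp0.le hf.2.ne
  have hmax' := hmax L f hf.1.2
  have hfin : ((D.toNNReal * A ^ p : ℝ≥0) : ℝ≥0∞) * ∫⁻ x, ⨆ k : ℤ, ‖L.expect k f x‖ₑ ^ p ∂L.vol ≠ ∞ :=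
    ENNReal.mul_ne_top ENNReal.coe_ne_top
      (ne_top_of_le_ne_top (ENNReal.mul_ne_top ENNReal.coe_ne_top hS) hmax')
  have h2 := lintegral_tsum_rpow_le (L := L)
    (a := fun k x => (‖L.expect k f x‖ₑ * ‖L.term b k x‖ₑ) ^ q) (r := p / q)
    (C := ((D.toNNReal * A ^ p : ℝ≥0) : ℝ≥0∞) * ∫⁻ x, ⨆ k : ℤ, ‖L.expect k f x‖ₑ ^ p ∂L.vol)
    (fun k => (((atomConst_expect k f).aemeasurable.enorm.mul
      (atomConst_term hb k).aemeasurable.enorm).pow_const q)) hmain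
  rw [paraENorm_eq hq0 hb, one_div p, ENNReal.rpow_inv_le_iff hp0,
    ENNReal.mul_rpow_of_nonneg _ _ hp0.le, hardyENormFun_rpow hp0]
  simp only [← ENNReal.rpow_mul, one_div_mul_eq_div]
  refine h2.trans ((mul_le_mul_right hmax' _).trans_eq ?_)
  rw [← mul_assoc]
  congr 1
  rw [← ENNReal.coe_rpow_of_nonneg _ hp0.le, ← ENNReal.coe_mul, NNReal.mul_rpow, ← NNReal.rpow_mul,
    inv_mul_cancel₀ hp0.ne', NNReal.rpow_one]
  congr 1
  ring

end IntervalLattice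

end

noncomputable section

namespace IntervalLattice

variable {L : IntervalLattice} {I J Q : Set ℝ} {j k N : ℤ} {x x₀ y : ℝ} {α : Type*}
  {𝕜 : Type*} [RCLike 𝕜]

/-! ### The testing condition is necessary for the paraproduct -/

theorem setAverage_const_add_indicator (hI : MeasurableSet I) (hJ : MeasurableSet J)
    (h0 : volume J ≠ 0) (h1 : volume J ≠ ∞) {f : ℝ → 𝕜} {c d : 𝕜}
    (h : ∀ y ∈ J, f y = c + I.indicator (fun _ => d) y) :
    ⨍ y in J, f y = c + d * ((volume.real (I ∩ J) / volume.real J : ℝ) : 𝕜) := by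
  have h2 : volume.real J ≠ 0 := ENNReal.toReal_ne_zero.2 ⟨h0, h1⟩
  have h3 : ((volume.real J : ℝ) : 𝕜) ≠ 0 := by exact_mod_cast h2
  rw [setAverage_eq, setIntegral_congr_fun hJ h, integral_add, setIntegral_indicator hI,
    setIntegral_const, setIntegral_const, Set.inter_comm, RCLike.real_smul_eq_coe_mul,
    RCLike.real_smul_eq_coe_mul, RCLike.real_smul_eq_coe_mul]
  · push_cast
    field_simp
  · exact integrableOn_const h1
  · exact (integrableOn_const h1).indicator hI

variable (L) in
/-- The density of the set `I` in the interval of generation `k` that contains `x`. -/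
def density (I : Set ℝ) (k : ℤ) (x : ℝ) : ℝ := volume.real (I ∩ L.atom k x) / volume.real (L.atom k x)

theorem density_nonneg (I : Set ℝ) (k : ℤ) (x : ℝ) : 0 ≤ L.density I k x :=
  div_nonneg measureReal_nonneg measureReal_nonneg

theorem density_le_one (hx : x ∈ L.carrier) (I : Set ℝ) (k : ℤ) : L.density I k x ≤ 1 :=
  div_le_one_of_le₀ (measureReal_mono Set.inter_subset_right
    (volume_lt_top_of_mem_gen (atom_mem_gen hx k)).ne) measureReal_nonneg

theorem expect_eq_density (hI : MeasurableSet I) (hx : x ∈ L.carrier) {f : ℝ → 𝕜} {c d : 𝕜}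
    (h : ∀ y ∈ L.atom k x, f y = c + I.indicator (fun _ => d) y) :
    L.expect k f x = c + d * (L.density I k x : 𝕜) :=
  setAverage_const_add_indicator hI (measurableSet_of_mem_gen (atom_mem_gen hx k))
    (volume_pos_of_mem_gen (atom_mem_gen hx k)).ne'
    (volume_lt_top_of_mem_gen (atom_mem_gen hx k)).ne h

theorem realVolume_pos_of_mem_gen (hI : I ∈ L.gen k) : 0 < volume.real I :=
  ENNReal.toReal_pos (volume_pos_of_mem_gen hI).ne' (volume_lt_top_of_mem_gen hI).ne

/-- Before generation `j` the density is positive only on the ancestors of `I`; from generation `j`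
on it is the indicator of `I`. The minimum of `k` and `j` treats both regimes at once. -/
theorem density_eq (hI : I ∈ L.gen j) (hx₀ : x₀ ∈ I) (hx : x ∈ L.carrier) (k : ℤ) :
    L.density I k x = (L.atom (min k j) x₀).indicator
      (fun _ => volume.real I / volume.real (L.atom (min k j) x₀)) x := by
  have hx₀c := subset_carrier hI hx₀
  by_cases hm : x ∈ L.atom (min k j) x₀
  · rw [Set.indicator_of_mem hm, density]
    rcases le_total k j with h | h
    · rw [min_eq_left h] at hm ⊢
      rw [atom_eq (atom_mem_gen hx₀c k) hm, Set.inter_eq_left.2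
        (subset_of_mem_inter (atom_mem_gen hx₀c k) hI h (mem_atom hx₀c k) hx₀)]
    · rw [min_eq_right h, atom_eq hI hx₀] at hm ⊢
      rw [Set.inter_eq_right.2 (atom_subset hI h hm),
        div_self (realVolume_pos_of_mem_gen (atom_mem_gen hx k)).ne',
        div_self (realVolume_pos_of_mem_gen hI).ne']
  · rw [Set.indicator_of_notMem hm, density]
    have : I ∩ L.atom k x = ∅ := by
      refine Set.eq_empty_of_forall_notMem fun y hy => hm ?_
      rcases le_total k j with h | h
      · rw [min_eq_left h]
        have h1 := subset_of_mem_inter (atom_mem_gen hx k) hI h hy.2 hy.1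
        rw [atom_eq (atom_mem_gen hx k) (h1 hx₀)]
        exact mem_atom hx k
      · rw [min_eq_right h, atom_eq hI hx₀]
        exact subset_of_mem_inter hI (atom_mem_gen hx k) h hy.1 hy.2 (mem_atom hx k)
    rw [this, measureReal_empty, zero_div]

/-- Along the ancestors the density `u` increases to at most `1`, and the indicator `χ` of the
ancestor containing `x` drops at most once, where the density falls to zero. Each squared difference
is bounded by the growth of `u - χ`, whose values lie in `[-1, 1]`; hence the bound two. -/
theorem sum_sq_density_sub_le (hI : I ∈ L.gen j) (hx : x ∈ L.carrier) (K : ℤ) (n : ℕ) :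
    ∑ i ∈ Finset.range n, (L.density I (K + (i + 1 : ℕ)) x - L.density I (K + i) x) ^ 2 ≤ 2 := by
  obtain ⟨x₀, hx₀⟩ := nonempty_of_mem_gen hI
  have hx₀c := subset_carrier hI hx₀
  set S : ℤ → Set ℝ := fun k => L.atom (min k j) x₀ with hS
  set u : ℤ → ℝ := fun k => volume.real I / volume.real (S k) with hu
  set χ : ℤ → ℝ := fun k => (S k).indicator (fun _ => 1) x with hχ
  have hSsub : ∀ k, S (k + 1) ⊆ S k := fun k => atom_anti hx₀c (by omega)
  have hSpos : ∀ k, 0 < volume.real (S k) := fun k =>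
    realVolume_pos_of_mem_gen (atom_mem_gen hx₀c _)
  have hIpos := realVolume_pos_of_mem_gen hI
  have hu0 : ∀ k, 0 ≤ u k := fun k => by positivity
  have hu1 : ∀ k, u k ≤ 1 := fun k => by
    refine div_le_one_of_le₀ (measureReal_mono ?_
      (volume_lt_top_of_mem_gen (atom_mem_gen hx₀c _)).ne) (hSpos k).le
    exact subset_of_mem_inter (atom_mem_gen hx₀c _) hI (min_le_right _ _) (mem_atom hx₀c _) hx₀
  have hum : ∀ k, u k ≤ u (k + 1) := fun k =>
    div_le_div_of_nonneg_left hIpos.le (hSpos _) (measureReal_mono (hSsub k)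
      (volume_lt_top_of_mem_gen (atom_mem_gen hx₀c _)).ne)
  have hχ01 : ∀ k, 0 ≤ χ k ∧ χ k ≤ 1 := fun k =>
    ⟨Set.indicator_nonneg (fun _ _ => zero_le_one) _, Set.indicator_le_self' (by simp) x |>.trans le_rfl⟩
  have hstep : ∀ k, (L.density I (k + 1) x - L.density I k x) ^ 2
      ≤ (u (k + 1) - χ (k + 1)) - (u k - χ k) := by
    intro k
    rw [density_eq hI hx₀ hx, density_eq hI hx₀ hx]
    have h1 := hu0 k
    have h2 := hu1 (k + 1)
    have h3 := hum k
    change ((S (k + 1)).indicator (fun _ => u (k + 1)) x - (S k).indicator (fun _ => u k) x) ^ 2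
      ≤ (u (k + 1) - (S (k + 1)).indicator (fun _ => 1) x) - (u k - (S k).indicator (fun _ => 1) x)
    by_cases ha : x ∈ S (k + 1)
    · rw [Set.indicator_of_mem ha, Set.indicator_of_mem ha, Set.indicator_of_mem (hSsub k ha),
        Set.indicator_of_mem (hSsub k ha)]
      nlinarith
    · rw [Set.indicator_of_notMem ha, Set.indicator_of_notMem ha]
      by_cases hb : x ∈ S k
      · rw [Set.indicator_of_mem hb, Set.indicator_of_mem hb]
        nlinarith
      · rw [Set.indicator_of_notMem hb, Set.indicator_of_notMem hb]
        linarith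
  have htel : ∑ i ∈ Finset.range n, (L.density I (K + (i + 1 : ℕ)) x - L.density I (K + i) x) ^ 2
      ≤ (u (K + n) - χ (K + n)) - (u K - χ K) := by
    induction n with
    | zero => simp
    | succ n ih =>
      rw [Finset.sum_range_succ]
      have := hstep (K + n)
      have e : K + ((n + 1 : ℕ) : ℤ) = K + n + 1 := by push_cast; ring
      rw [e]
      linarith
  have := hu1 (K + n)
  have := hu0 K
  have := (hχ01 (K + n)).1
  have := (hχ01 K).2
  linarith

theorem tsum_int_eq_tsum_nat {a : ℤ → ℝ≥0∞} (K : ℤ) (h : ∀ k < K, a k = 0) :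
    ∑' k, a k = ∑' i : ℕ, a (K + i) := by
  have hinj : Function.Injective fun i : ℕ => K + (i : ℤ) := fun i j h => by simpa using h
  refine (hinj.tsum_eq (f := a) fun k hk => ?_).symm
  have : K ≤ k := not_lt.1 fun hlt => hk (h k hlt)
  exact ⟨(k - K).toNat, by simp only; omega⟩

theorem tsum_sq_density_sub_le (hI : I ∈ L.gen j) (hx : x ∈ L.carrier) (K : ℤ) :
    ∑' i : ℕ, ‖L.density I (K + (i + 1 : ℕ)) x - L.density I (K + i) x‖ₑ ^ (2 : ℝ) ≤ 2 := by
  refine ENNReal.tsum_le_of_sum_range_le fun n => ?_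
  have e : ∀ i : ℕ, ‖L.density I (K + (i + 1 : ℕ)) x - L.density I (K + i) x‖ₑ ^ (2 : ℝ)
      = ENNReal.ofReal ((L.density I (K + (i + 1 : ℕ)) x - L.density I (K + i) x) ^ 2) := by
    intro i
    rw [← ofReal_norm, ENNReal.ofReal_rpow_of_nonneg (norm_nonneg _) (by norm_num)]
    congr 1
    rw [Real.rpow_two, Real.norm_eq_abs, sq_abs]
  simp only [e]
  rw [← ENNReal.ofReal_sum_of_nonneg fun i _ => sq_nonneg _]
  exact (ENNReal.ofReal_le_ofReal (sum_sq_density_sub_le hI hx K n)).trans_eq (by simp)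

theorem topAvg_mem_of_isClosed {p : ℝ} (hp : 1 ≤ p) {f : ℝ → 𝕜}
    (hf : MemLp f (ENNReal.ofReal p) L.vol) (hx : x ∈ L.carrier) {s : Set 𝕜} (hs : IsClosed s) (K : ℤ)
    (h : ∀ k ≤ K, L.expect k f x ∈ s) : L.topAvg f x ∈ s := by
  refine hs.mem_of_tendsto (tendsto_expect hp hf hx) ?_
  filter_upwards [eventually_ge_atTop (-K).toNat] with m hm
  exact h _ (by omega)

theorem sqFun_eq_zero {p : ℝ} (hp : 1 ≤ p) {f : ℝ → 𝕜}
    (hf : MemLp f (ENNReal.ofReal p) L.vol) (hx : x ∈ L.carrier) (h : ∀ k, L.expect k f x = 0) :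
    L.sqFun f x = 0 := by
  have h0 := topAvg_mem_of_isClosed hp hf hx (isClosed_singleton (x := (0 : 𝕜))) 0 fun k _ => h k
  rw [Set.mem_singleton_iff] at h0
  simp [sqFun, diff, h, h0]

theorem memLp_indicator_gen {p : ℝ} (hI : I ∈ L.gen k) (c : 𝕜) :
    MemLp (I.indicator fun _ => c) (ENNReal.ofReal p) L.vol :=
  memLp_indicator_const _ (measurableSet_of_mem_gen hI) c
    (Or.inr (vol_apply hI ▸ (volume_lt_top_of_mem_gen hI).ne))

theorem memLpLattice_indicator {p : ℝ} (hI : I ∈ L.gen k) (c : 𝕜) :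
    L.MemLpLattice p (I.indicator fun _ => c) :=
  ⟨(atomConst_indicator hI le_rfl fun _ _ _ _ _ _ => rfl).aestronglyMeasurable,
    memLp_indicator_gen hI c⟩

theorem memHardy_of_lintegral {p : ℝ} (hp : 0 < p) {f : ℝ → 𝕜} (hf : L.MemLpLattice p f)
    (h : ∫⁻ x, L.sqFun f x ^ p ∂L.vol < ∞) : L.MemHardy p f := by
  refine ⟨hf, ?_⟩
  rw [← hardyENormFun_rpow hp] at h
  exact (ENNReal.rpow_lt_top_iff_of_pos hp).1 h

end IntervalLattice

end

noncomputable section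

namespace IntervalLattice

variable {L : IntervalLattice} {I J Q : Set ℝ} {j k l N : ℤ} {x x₀ y : ℝ} {α : Type*}
  {𝕜 : Type*} [RCLike 𝕜]

/-! ### Test functions that equal one on a given interval -/

theorem enorm_sub_sq_density (c d : 𝕜) (a b : ℝ) :
    ‖c + d * (a : 𝕜) - (c + d * (b : 𝕜))‖ₑ ^ (2 : ℝ) = ‖d‖ₑ ^ (2 : ℝ) * ‖a - b‖ₑ ^ (2 : ℝ) := by
  have : c + d * (a : 𝕜) - (c + d * (b : 𝕜)) = d * ((a - b : ℝ) : 𝕜) := by push_cast; ring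
  rw [this, enorm_mul, ENNReal.mul_rpow_of_nonneg _ _ (by norm_num)]
  congr 2
  rw [← ofReal_norm, RCLike.norm_ofReal, ← Real.norm_eq_abs, ofReal_norm]

theorem volume_top_le (hx₀ : x₀ ∈ L.carrier) {C : ℝ≥0∞} (h : ∀ k, volume (L.atom k x₀) ≤ C) :
    volume (L.top x₀) ≤ C := by
  rw [top, Directed.measure_iUnion]
  · exact iSup_le h
  · intro a b
    exact ⟨min a b, atom_anti hx₀ (min_le_left a b), atom_anti hx₀ (min_le_right a b)⟩

/-- When no interval of the chain is longer than `2 |I|`, the indicator of `I` itself is cheap. Its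
square function lives on the top of the chain, of length at most `2 |I|`, and is at most `3` there:
the differences contribute `2` and the average over the top `1` to its square. -/
theorem exists_testFun_of_volume_le {p : ℝ} (hp : 1 ≤ p) (hI : I ∈ L.gen j) (hx₀ : x₀ ∈ I)
    (h : ∀ k, volume (L.atom k x₀) ≤ 2 * volume I) :
    ∃ f : ℝ → 𝕜, L.MemHardy p f ∧ (∀ y ∈ I, f y = 1) ∧
      ∫⁻ x, L.sqFun f x ^ p ∂L.vol ≤ ENNReal.ofReal (2 * 3 ^ p + 1) * volume I := by
  have hp0 : 0 < p := by linarith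
  have hx₀c := subset_carrier hI hx₀
  have hIm := measurableSet_of_mem_gen hI
  set f : ℝ → 𝕜 := I.indicator fun _ => 1 with hf
  have hfL : L.MemLpLattice p f := memLpLattice_indicator hI 1
  have hE : ∀ k, ∀ x ∈ L.carrier, L.expect k f x = 0 + 1 * (L.density I k x : 𝕜) := fun k x hx =>
    expect_eq_density hIm hx fun y _ => by rw [zero_add]
  have hsq : ∀ x ∈ L.carrier,
      L.sqFun f x ^ p ≤ (L.top x₀).indicator (fun _ => ENNReal.ofReal (3 ^ p)) x := by
    intro x hx
    by_cases hxT : x ∈ L.top x₀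
    · rw [Set.indicator_of_mem hxT, ← ENNReal.ofReal_rpow_of_nonneg (by norm_num) hp0.le]
      refine ENNReal.rpow_le_rpow ?_ hp0.le
      have h1 : ∑' k, ‖L.diff k f x‖ₑ ^ (2 : ℝ) ≤ 2 := by
        refine le_of_tendsto' (tendsto_sum_window _) fun m => ?_
        rw [sum_window]
        refine le_trans ?_ (tsum_sq_density_sub_le hI hx (-(m : ℤ)))
        refine le_trans (le_of_eq ?_) (ENNReal.sum_le_tsum (Finset.range (2 * m + 1)))
        refine Finset.sum_congr rfl fun i _ => ?_
        rw [diff_eq, hE _ _ hx, hE _ _ hx, enorm_sub_sq_density]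
        simp
      have h2 : ‖L.topAvg f x‖ₑ ^ (2 : ℝ) ≤ 1 := by
        have := topAvg_mem_of_isClosed hp hfL.2 hx (Metric.isClosed_closedBall (x := (0 : 𝕜)) (ε := 1)) 0
          fun k _ => by
            rw [hE k x hx, mem_closedBall_zero_iff, zero_add, one_mul, RCLike.norm_ofReal,
              abs_of_nonneg (density_nonneg _ _ _)]
            exact density_le_one hx I k
        rw [mem_closedBall_zero_iff] at this
        refine (ENNReal.rpow_le_rpow (z := 2) (y := 1) ?_ (by norm_num)).trans (by simp)
        rw [← ofReal_norm]
        exact (ENNReal.ofReal_le_ofReal this).trans (by simp)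
      rw [sqFun]
      calc _ ≤ ((2 : ℝ≥0∞) + 1) ^ (1 / 2 : ℝ) := by gcongr
        _ ≤ (9 : ℝ≥0∞) ^ (1 / 2 : ℝ) := by gcongr; norm_num
        _ = ((3 : ℝ≥0∞) ^ (2 : ℝ)) ^ (1 / 2 : ℝ) := by norm_num
        _ = ENNReal.ofReal 3 := by rw [← ENNReal.rpow_mul]; norm_num
    · rw [Set.indicator_of_notMem hxT, sqFun_eq_zero hp hfL.2 hx, ENNReal.zero_rpow_of_pos hp0]
      intro k
      rw [hE k x hx, density_eq hI hx₀ hx, Set.indicator_of_notMem fun hm => hxT (atom_subset_top _ _ hm)]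
      simp
  have hint : ∫⁻ x, L.sqFun f x ^ p ∂L.vol ≤ ENNReal.ofReal (2 * 3 ^ p + 1) * volume I := by
    refine (lintegral_vol_mono hsq).trans ?_
    rw [lintegral_indicator_const (measurableSet_top hx₀c), vol,
      Measure.restrict_apply (measurableSet_top hx₀c), Set.inter_eq_left.2 (top_subset_carrier hx₀c)]
    calc _ ≤ ENNReal.ofReal (3 ^ p) * (2 * volume I) := by
          gcongr
          exact volume_top_le hx₀c h
      _ = ENNReal.ofReal (3 ^ p * 2) * volume I := by
          rw [ENNReal.ofReal_mul (by positivity), mul_assoc]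
          simp
      _ ≤ _ := by
          gcongr
          linarith
  refine ⟨f, memHardy_of_lintegral hp0 hfL (hint.trans_lt ?_), fun y hy => Set.indicator_of_mem hy _, hint⟩
  exact ENNReal.mul_lt_top ENNReal.ofReal_lt_top (volume_lt_top_of_mem_gen hI)

/-- The function equal to `1` on `I` and to `-t` on the rest of `P`. -/
def testFun (𝕜 : Type*) [RCLike 𝕜] (P I : Set ℝ) (t : ℝ) : ℝ → 𝕜 :=
  P.indicator (fun _ => -(t : 𝕜)) + I.indicator (fun _ => 1 + (t : 𝕜))

theorem testFun_of_mem {P : Set ℝ} {t : ℝ} (hIP : I ⊆ P) (hy : y ∈ I) : testFun 𝕜 P I t y = 1 := by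
  rw [testFun, Pi.add_apply, Set.indicator_of_mem (hIP hy), Set.indicator_of_mem hy]
  ring

theorem atomConst_testFun {P : Set ℝ} {t : ℝ} (hI : I ∈ L.gen j) (hP : P ∈ L.gen l)
    (hlj : l ≤ j) : L.AtomConst j (testFun 𝕜 P I t) := by
  have h1 : L.AtomConst j (P.indicator fun _ => -(t : 𝕜)) :=
    atomConst_indicator hP hlj fun _ _ _ _ _ _ => rfl
  have h2 : L.AtomConst j (I.indicator fun _ => 1 + (t : 𝕜)) :=
    atomConst_indicator hI le_rfl fun _ _ _ _ _ _ => rfl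
  exact h1.comp₂ h2 (· + ·)

theorem memLpLattice_testFun {P : Set ℝ} {p t : ℝ} (hI : I ∈ L.gen j) (hP : P ∈ L.gen l)
    (hlj : l ≤ j) : L.MemLpLattice p (testFun 𝕜 P I t) := by
  refine ⟨(atomConst_testFun hI hP hlj).aestronglyMeasurable, ?_⟩
  exact MemLp.add (memLp_indicator_gen hP _) (memLp_indicator_gen hI _)

theorem expect_testFun {P : Set ℝ} {t : ℝ} (hI : I ∈ L.gen j) (hP : P ∈ L.gen l) (hk : l < k)
    (hx : x ∈ P) :
    L.expect k (testFun 𝕜 P I t) x = -(t : 𝕜) + (1 + (t : 𝕜)) * (L.density I k x : 𝕜) :=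
  expect_eq_density (measurableSet_of_mem_gen hI) (subset_carrier hP hx) fun y hy => by
    have hyP : y ∈ P := atom_subset hP hk.le hx hy
    rw [testFun, Pi.add_apply, Set.indicator_of_mem hyP]

theorem expect_testFun_eq_zero {P : Set ℝ} {t : ℝ} (hI : I ∈ L.gen j) (hP : P ∈ L.gen l)
    (hIP : I ⊆ P) (ht : t * (volume.real P - volume.real I) = volume.real I) (hk : k ≤ l)
    (hx : x ∈ L.carrier) : L.expect k (testFun 𝕜 P I t) x = 0 := by
  have hIm := measurableSet_of_mem_gen hI
  have hPm := measurableSet_of_mem_gen hP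
  have hJ := atom_mem_gen hx k
  have hJm := measurableSet_of_mem_gen hJ
  have hJtop := (volume_lt_top_of_mem_gen hJ).ne
  rw [expect, setAverage_eq]
  refine smul_eq_zero_of_right _ ?_
  have hi : ∀ {A : Set ℝ} (c : 𝕜), MeasurableSet A →
      ∫ y in L.atom k x, A.indicator (fun _ => c) y = volume.real (L.atom k x ∩ A) • c := by
    intro A c hA
    rw [setIntegral_indicator hA, setIntegral_const]
  have hint : ∀ {A : Set ℝ} (c : 𝕜), MeasurableSet A →
      Integrable (A.indicator fun _ => c) (volume.restrict (L.atom k x)) :=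
    fun c hA => (integrableOn_const hJtop).indicator hA
  rw [testFun, integral_add' (hint _ hPm) (hint _ hIm), hi _ hPm, hi _ hIm]
  by_cases hd : (L.atom k x ∩ P).Nonempty
  · obtain ⟨y, hy1, hy2⟩ := hd
    have hsub : P ⊆ L.atom k x := subset_of_mem_inter hJ hP hk hy1 hy2
    rw [Set.inter_eq_right.2 hsub, Set.inter_eq_right.2 (hIP.trans hsub),
      RCLike.real_smul_eq_coe_mul, RCLike.real_smul_eq_coe_mul]
    have : (t : 𝕜) * ((volume.real P : ℝ) - (volume.real I : ℝ)) = (volume.real I : ℝ) := by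
      exact_mod_cast congrArg (fun s : ℝ => (s : 𝕜)) ht
    linear_combination -this
  · rw [Set.not_nonempty_iff_eq_empty] at hd
    have hd' : L.atom k x ∩ I = ∅ :=
      Set.subset_eq_empty (Set.inter_subset_inter_right _ hIP) hd
    simp [hd, hd']

theorem expect_testFun_of_notMem {P : Set ℝ} {t : ℝ} (hI : I ∈ L.gen j) (hP : P ∈ L.gen l)
    (hIP : I ⊆ P) (ht : t * (volume.real P - volume.real I) = volume.real I)
    (hx : x ∈ L.carrier) (hxP : x ∉ P) : L.expect k (testFun 𝕜 P I t) x = 0 := by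
  rcases le_or_gt k l with hk | hk
  · exact expect_testFun_eq_zero hI hP hIP ht hk hx
  · have h0 : ∀ y ∈ L.atom k x, testFun 𝕜 P I t y = 0 + I.indicator (fun _ => 0) y := by
      intro y hy
      have hyP : y ∉ P := fun hyP =>
        hxP (subset_of_mem_inter hP (atom_mem_gen hx k) hk.le hyP hy (mem_atom hx k))
      rw [testFun, Pi.add_apply, Set.indicator_of_notMem hyP,
        Set.indicator_of_notMem fun hyI => hyP (hIP hyI)]
      simp
    rw [expect_eq_density (measurableSet_of_mem_gen hI) hx h0]
    simp

/-- Here `P` is the shortest ancestor longer than `2 |I|`, and `S` is the next interval of the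
chain. The function `1` on `I` and `-t` on `P \ I` has integral zero, so nothing coarser than `P`
sees it. On `S`, of length at most `2 |I|`, the squared square function is at most `1 + 4 * 2 = 9`;
on `P \ S` the square function equals `t`, and `t ^ p |P \ I| ≤ t |P \ I| = |I|`. -/
theorem exists_testFun_of_lt_volume {p : ℝ} (hp : 1 ≤ p) (hI : I ∈ L.gen j) (hx₀ : x₀ ∈ I)
    (hl : l < j) (h1 : 2 * volume I < volume (L.atom l x₀))
    (h2 : volume (L.atom (l + 1) x₀) ≤ 2 * volume I) :
    ∃ f : ℝ → 𝕜, L.MemHardy p f ∧ (∀ y ∈ I, f y = 1) ∧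
      ∫⁻ x, L.sqFun f x ^ p ∂L.vol ≤ ENNReal.ofReal (2 * 3 ^ p + 1) * volume I := by
  have hp0 : 0 < p := by linarith
  have hx₀c := subset_carrier hI hx₀
  have hIm := measurableSet_of_mem_gen hI
  obtain ⟨P, hP⟩ : ∃ P, P = L.atom l x₀ := ⟨_, rfl⟩
  obtain ⟨S, hS⟩ : ∃ S, S = L.atom (l + 1) x₀ := ⟨_, rfl⟩
  rw [← hP] at h1
  rw [← hS] at h2
  have hPg : P ∈ L.gen l := hP ▸ atom_mem_gen hx₀c l
  have hSg : S ∈ L.gen (l + 1) := hS ▸ atom_mem_gen hx₀c _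
  have hPm := measurableSet_of_mem_gen hPg
  have hSm := measurableSet_of_mem_gen hSg
  have hIS : I ⊆ S := subset_of_mem_inter hSg hI (by omega)
    (hS ▸ mem_atom hx₀c _) hx₀
  have hSP : S ⊆ P := hS ▸ hP ▸ atom_succ_subset hx₀c l
  have hIP := hIS.trans hSP
  have hIpos := realVolume_pos_of_mem_gen hI
  have hItop := (volume_lt_top_of_mem_gen hI).ne
  have hPtop := (volume_lt_top_of_mem_gen hPg).ne
  have hlt : 2 * volume.real I < volume.real P := by
    have := ENNReal.toReal_strict_mono hPtop h1
    rwa [ENNReal.toReal_mul] at this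
  obtain ⟨t, ht⟩ : ∃ t : ℝ, t = volume.real I / (volume.real P - volume.real I) := ⟨_, rfl⟩
  have hden : 0 < volume.real P - volume.real I := by linarith
  have ht0 : 0 ≤ t := by rw [ht]; positivity
  have ht1 : t ≤ 1 := by rw [ht, div_le_one hden]; linarith
  have htmul : t * (volume.real P - volume.real I) = volume.real I := by
    rw [ht, div_mul_cancel₀ _ hden.ne']
  have hfL : L.MemLpLattice p (testFun 𝕜 P I t) := memLpLattice_testFun hI hPg hl.le
  have htop : ∀ x ∈ L.carrier, L.topAvg (testFun 𝕜 P I t) x = 0 := fun x hx =>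
    topAvg_mem_of_isClosed hp hfL.2 hx (isClosed_singleton (x := (0 : 𝕜))) l fun k hk => expect_testFun_eq_zero hI hPg hIP htmul hk hx
  have hdiffs : ∀ x ∈ P, ∑' k, ‖L.diff k (testFun 𝕜 P I t) x‖ₑ ^ (2 : ℝ)
      = ‖L.expect (l + 1) (testFun 𝕜 P I t) x‖ₑ ^ (2 : ℝ)
      + ∑' i : ℕ, ‖1 + (t : 𝕜)‖ₑ ^ (2 : ℝ) *
        ‖L.density I (l + 1 + (i + 1 : ℕ)) x - L.density I (l + 1 + i) x‖ₑ ^ (2 : ℝ) := by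
    intro x hx
    have hxc := subset_carrier hPg hx
    rw [tsum_int_eq_tsum_nat l, tsum_eq_zero_add' ENNReal.summable]
    · congr 1
      · rw [Nat.cast_zero, add_zero, diff, expect_testFun_eq_zero hI hPg hIP htmul le_rfl hxc, sub_zero]
      · refine tsum_congr fun i => ?_
        have e : l + ((i + 1 : ℕ) : ℤ) = l + 1 + i := by push_cast; ring
        rw [e, diff_eq, expect_testFun hI hPg (by omega) hx, expect_testFun hI hPg (by omega) hx, enorm_sub_sq_density]
    · intro k hk
      rw [diff, expect_testFun_eq_zero hI hPg hIP htmul hk.le hxc, expect_testFun_eq_zero hI hPg hIP htmul (Int.add_one_le_iff.2 hk) hxc]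
      simp
  have hsq : ∀ x ∈ L.carrier, L.sqFun (testFun 𝕜 P I t) x ^ p
      ≤ S.indicator (fun _ => ENNReal.ofReal (3 ^ p)) x
        + (P \ I).indicator (fun _ => ENNReal.ofReal t) x := by
    intro x hx
    by_cases hxP : x ∈ P
    · by_cases hxS : x ∈ S
      · refine le_trans ?_ le_self_add
        rw [Set.indicator_of_mem hxS, ← ENNReal.ofReal_rpow_of_nonneg (by norm_num) hp0.le]
        refine ENNReal.rpow_le_rpow ?_ hp0.le
        have hd0 := density_nonneg (L := L) I (l + 1) x
        have hd1 := density_le_one hx I (l + 1)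
        have e1 : ‖L.expect (l + 1) (testFun 𝕜 P I t) x‖ₑ ^ (2 : ℝ) ≤ 1 := by
          refine (ENNReal.rpow_le_rpow (z := 2) (y := 1) ?_ (by norm_num)).trans (by simp)
          rw [← ofReal_norm, expect_testFun hI hPg (by omega) hxP]
          have : -(t : 𝕜) + (1 + (t : 𝕜)) * (L.density I (l + 1) x : 𝕜)
              = ((-t + (1 + t) * L.density I (l + 1) x : ℝ) : 𝕜) := by push_cast; ring
          rw [this, RCLike.norm_ofReal]
          refine (ENNReal.ofReal_le_ofReal (q := 1) (abs_le.2 ⟨?_, ?_⟩)).trans (by simp)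
          · nlinarith
          · nlinarith
        have e2 : ‖1 + (t : 𝕜)‖ₑ ^ (2 : ℝ) ≤ 4 := by
          have : (1 + (t : 𝕜)) = ((1 + t : ℝ) : 𝕜) := by push_cast; ring
          rw [this, ← ofReal_norm, RCLike.norm_ofReal, abs_of_nonneg (by linarith)]
          calc _ ≤ (ENNReal.ofReal 2) ^ (2 : ℝ) := by
                gcongr
                linarith
            _ = 4 := by rw [ENNReal.ofReal_rpow_of_nonneg (by norm_num) (by norm_num)]; norm_num
        rw [sqFun, hdiffs x hxP, htop x hx, ENNReal.tsum_mul_left]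
        calc _ ≤ ((1 : ℝ≥0∞) + 4 * 2 + 0) ^ (1 / 2 : ℝ) := by
              gcongr
              · exact tsum_sq_density_sub_le hI hx (l + 1)
              · simp
          _ = ((3 : ℝ≥0∞) ^ (2 : ℝ)) ^ (1 / 2 : ℝ) := by norm_num
          _ = ENNReal.ofReal 3 := by rw [← ENNReal.rpow_mul]; norm_num
      · refine le_trans ?_ le_add_self
        have hxm : x ∈ P \ I := ⟨hxP, fun hxI => hxS (hIS hxI)⟩
        rw [Set.indicator_of_mem hxm]
        have hz : ∀ k ≥ l + 1, L.density I k x = 0 := by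
          intro k hk
          rw [density_eq hI hx₀ hx, Set.indicator_of_notMem fun hm => hxS ?_]
          exact hS ▸ atom_anti hx₀c (by omega) hm
        have hs : L.sqFun (testFun 𝕜 P I t) x = ENNReal.ofReal t := by
          rw [sqFun, hdiffs x hxP, htop x hx, expect_testFun hI hPg (by omega) hxP, hz _ le_rfl]
          have : ∀ i : ℕ, ‖1 + (t : 𝕜)‖ₑ ^ (2 : ℝ) *
              ‖L.density I (l + 1 + (i + 1 : ℕ)) x - L.density I (l + 1 + i) x‖ₑ ^ (2 : ℝ) = 0 := by
            intro i
            rw [hz _ (by omega), hz _ (by omega)]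
            simp
          simp only [this]
          rw [tsum_zero, add_zero, enorm_zero, ENNReal.zero_rpow_of_pos (by norm_num), add_zero,
            ← ENNReal.rpow_mul]
          norm_num
          rw [← ofReal_norm, RCLike.norm_ofReal, abs_of_nonneg ht0]
        rw [hs, ENNReal.ofReal_rpow_of_nonneg ht0 hp0.le]
        refine ENNReal.ofReal_le_ofReal ?_
        exact (Real.rpow_le_rpow_of_exponent_ge' ht0 ht1 zero_le_one hp).trans_eq (Real.rpow_one t)
    · rw [sqFun_eq_zero hp hfL.2 hx fun k => expect_testFun_of_notMem hI hPg hIP htmul hx hxP, ENNReal.zero_rpow_of_pos hp0]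
      exact zero_le
  have hint : ∫⁻ x, L.sqFun (testFun 𝕜 P I t) x ^ p ∂L.vol ≤ ENNReal.ofReal (2 * 3 ^ p + 1) * volume I := by
    refine (lintegral_vol_mono hsq).trans ?_
    rw [lintegral_add_left (measurable_const.indicator hSm), lintegral_indicator_const hSm,
      lintegral_indicator_const (hPm.diff hIm), vol_apply hSg, vol,
      Measure.restrict_apply (hPm.diff hIm),
      Set.inter_eq_left.2 (Set.sdiff_subset.trans (subset_carrier hPg))]
    have e1 : ENNReal.ofReal t * volume (P \ I) = volume I := by
      have : volume.real (P \ I) = volume.real P - volume.real I :=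
        measureReal_sdiff hIP hIm
      rw [← ENNReal.ofReal_toReal (measure_ne_top_of_subset Set.sdiff_subset hPtop), ← measureReal_def,
        this, ← ENNReal.ofReal_mul ht0, htmul, measureReal_def, ENNReal.ofReal_toReal hItop]
    rw [e1]
    calc _ ≤ ENNReal.ofReal (3 ^ p) * (2 * volume I) + volume I := by gcongr
      _ = _ := by
          rw [ENNReal.ofReal_add (by positivity) zero_le_one, ENNReal.ofReal_mul (by norm_num),
            ENNReal.ofReal_one]
          simp
          ring
  refine ⟨_, memHardy_of_lintegral hp0 hfL (hint.trans_lt ?_), fun y hy => testFun_of_mem hIP hy, hint⟩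
  exact ENNReal.mul_lt_top ENNReal.ofReal_lt_top (volume_lt_top_of_mem_gen hI)

/-- The indicator alone would not do for `p = 1`: in a dyadic lattice every ancestor adds an amount
of order `|I|` to the integral of its square function. A compensating tail of height `-t` stops this
at the first ancestor longer than `2 |I|`. -/
theorem exists_testFun {p : ℝ} (hp : 1 ≤ p) (hI : I ∈ L.gen j) :
    ∃ f : ℝ → 𝕜, L.MemHardy p f ∧ (∀ y ∈ I, f y = 1) ∧
      ∫⁻ x, L.sqFun f x ^ p ∂L.vol ≤ ENNReal.ofReal (2 * 3 ^ p + 1) * volume I := by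
  obtain ⟨x₀, hx₀⟩ := nonempty_of_mem_gen hI
  have hx₀c := subset_carrier hI hx₀
  by_cases h : ∀ k, volume (L.atom k x₀) ≤ 2 * volume I
  · exact exists_testFun_of_volume_le hp hI hx₀ h
  · push Not at h
    obtain ⟨k, hk⟩ := h
    have hI2 : volume I ≤ 2 * volume I := le_mul_of_one_le_left' one_le_two
    have hbd : ∀ i, 2 * volume I < volume (L.atom i x₀) → i ≤ j := by
      intro i hi
      by_contra! hlt
      exact absurd ((measure_mono (atom_subset hI hlt.le hx₀)).trans hI2) (not_le.2 hi)
    -- The finest generation in which the ancestor is still longer than `2 |I|`.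
    obtain ⟨l, hl, hmax⟩ := Int.exists_greatest_of_bdd ⟨j, hbd⟩ ⟨k, hk⟩
    have hlj : l < j := by
      refine (hbd l hl).lt_of_ne ?_
      rintro rfl
      rw [atom_eq hI hx₀] at hl
      exact absurd hI2 (not_le.2 hl)
    refine exists_testFun_of_lt_volume hp hI hx₀ hlj hl ?_
    by_contra! hlt
    have := hmax _ hlt
    omega

/-- All averages of `f` over intervals inside `I` equal one, so below `I` the paraproduct reproduces
the differences of `b`. -/
theorem lintegral_le_paraENorm {p q : ℝ} (hp : 1 ≤ p) (hq : 1 < q) {b : L.intervals → ℝ → 𝕜}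
    (hb : L.IsMartDiffSeq b) (hI : I ∈ L.gen k) {f : ℝ → 𝕜} (hf : ∀ y ∈ I, f y = 1) :
    ∫⁻ x in I, (∑' j, open Classical in if L.atom j x ⊆ I then ‖L.term b j x‖ₑ ^ q else 0) ^ (p / q)
      ≤ L.paraENorm p q b f ^ p := by
  classical
  have hp0 : 0 < p := by linarith
  have hq0 : 0 < q := by linarith
  rw [paraENorm_eq hq0 hb, ← ENNReal.rpow_mul, one_div_mul_cancel hp0.ne', ENNReal.rpow_one]
  refine le_trans ?_ (setLIntegral_le_lintegral I _)
  rw [vol_restrict hI]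
  refine setLIntegral_mono' (measurableSet_of_mem_gen hI) fun x hx => ?_
  have hxc := subset_carrier hI hx
  rw [← ENNReal.rpow_mul, one_div_mul_eq_div]
  refine ENNReal.rpow_le_rpow (ENNReal.tsum_le_tsum fun j => ?_) (by positivity)
  split_ifs with hj
  · have hJ := atom_mem_gen hxc j
    have : L.expect j f x = 1 := by
      rw [expect, setAverage_congr_fun (measurableSet_of_mem_gen hJ)
        (g := fun _ => 1) (ae_of_all _ fun y hy => hf y (hj hy)),
        setAverage_const (volume_pos_of_mem_gen hJ).ne' (volume_lt_top_of_mem_gen hJ).ne]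
    rw [this]
    simp
  · exact zero_le

theorem testConst_le_of_paraBoundedBy {p q : ℝ} (hp : 1 ≤ p) (hq : 1 < q)
    {b : L.intervals → ℝ → 𝕜} (hb : L.IsMartDiffSeq b) {A : ℝ≥0} (hA : L.ParaBoundedBy p q b A) :
    L.testConst p q b ≤ ((2 * 3 ^ p + 1) ^ (1 / p) : ℝ).toNNReal * A := by
  have hp0 : 0 < p := by linarith
  rw [testConst_le_iff hp0 (by linarith) hb]
  intro k I hI
  obtain ⟨f, hfH, hf1, hf⟩ := exists_testFun (𝕜 := 𝕜) hp hI
  refine (lintegral_le_paraENorm hp hq hb hI hf1).trans ?_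
  refine (ENNReal.rpow_le_rpow (hA f hfH) hp0.le).trans ?_
  rw [ENNReal.mul_rpow_of_nonneg _ _ hp0.le, hardyENormFun_rpow hp0,
    ENNReal.mul_rpow_of_nonneg _ _ hp0.le]
  have : ((((2 * 3 ^ p + 1) ^ (1 / p) : ℝ).toNNReal : ℝ≥0∞)) ^ p = ENNReal.ofReal (2 * 3 ^ p + 1) := by
    change (ENNReal.ofReal _) ^ p = _
    rw [ENNReal.ofReal_rpow_of_nonneg (by positivity) hp0.le, ← Real.rpow_mul (by positivity),
      one_div_mul_cancel hp0.ne', Real.rpow_one]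
  rw [this]
  calc _ ≤ (A : ℝ≥0∞) ^ p * (ENNReal.ofReal (2 * 3 ^ p + 1) * volume I) := by gcongr
    _ = _ := by ring

/-- The indicator of `I` has `L ^ p` norm exactly `|I| ^ (1 / p)`, hence no constant is lost. -/
theorem testConst_le_of_paraLpBoundedBy {p q : ℝ} (hp : 1 ≤ p) (hq : 1 < q)
    {b : L.intervals → ℝ → 𝕜} (hb : L.IsMartDiffSeq b) {A : ℝ≥0} (hA : L.ParaLpBoundedBy p q b A) :
    L.testConst p q b ≤ A := by
  have hp0 : 0 < p := by linarith
  rw [testConst_le_iff hp0 (by linarith) hb]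
  intro k I hI
  refine (lintegral_le_paraENorm hp hq hb hI (f := I.indicator fun _ => 1)
    fun y hy => Set.indicator_of_mem hy _).trans ?_
  refine (ENNReal.rpow_le_rpow (hA _ (memLpLattice_indicator hI 1)) hp0.le).trans ?_
  rw [ENNReal.mul_rpow_of_nonneg _ _ hp0.le, eLpNorm_indicator_const (measurableSet_of_mem_gen hI)
    (by simpa using hp0) ENNReal.ofReal_ne_top, vol_apply hI, ENNReal.toReal_ofReal hp0.le,
    enorm_one, one_mul, ← ENNReal.rpow_mul, one_div_mul_cancel hp0.ne', ENNReal.rpow_one]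

end IntervalLattice

end

noncomputable section

namespace IntervalLattice

variable {L : IntervalLattice} {I J Q : Set ℝ} {j k l N : ℤ} {x x₀ y : ℝ} {α : Type*}
  {𝕜 : Type*} [RCLike 𝕜]

/-! ### BMO is sufficient for the extended paraproduct -/

-- A point lies in exactly one child of its atom when the atom has rank `k`, namely its atom of
-- generation `k + 1`. The shift to `k + 1` distinguishes BMO from the testing condition: it admits
-- the jump from the parent of `J`.
open Classical in
theorem tsum_child_indicator {b : L.intervals → ℝ → 𝕜} (J : Set ℝ) (φ : 𝕜 → ℝ≥0∞) (hφ : φ 0 = 0)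
    (hx : x ∈ L.carrier) :
    ∑' P : L.intervals, ∑' I : L.child P,
        (if (I : Set ℝ) ⊆ J then (I : Set ℝ).indicator (fun y => φ (b P y)) x else 0)
      = ∑' k : ℤ, if L.atom (k + 1) x ⊆ J then φ (L.term b k x) else 0 := by
  refine tsum_intervals (x := x) _ (fun P hP => ?_) _ (fun k h => ?_) (fun k h => ?_)
  · obtain ⟨I, hI⟩ : ∃ I : L.child P,
        (if (I : Set ℝ) ⊆ J then (I : Set ℝ).indicator (fun y => φ (b P y)) x else 0) ≠ 0 := by
      by_contra! h
      exact hP (ENNReal.tsum_eq_zero.2 h)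
    have hxI : x ∈ (I : Set ℝ) := by
      by_contra hxI
      rw [Set.indicator_of_notMem hxI, ite_self] at hI
      exact hI rfl
    exact ⟨sUnion_child_subset _ (Set.mem_sUnion_of_mem hxI I.2), ⟨I, I.2⟩⟩
  · have hxP : x ∈ L.atom k x := mem_atom hx k
    rw [tsum_eq_single (⟨L.atom (k + 1) x, h.atom_mem_child hxP⟩ : L.child (L.atom k x)), term,
      dif_pos h, Set.indicator_of_mem (mem_atom hx _)]
    intro I hne
    have hI : (I : Set ℝ) ∈ L.gen (k + 1) := (h.child_eq.subset I.2).1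
    rw [Set.indicator_of_notMem, ite_self]
    intro hxI
    exact hne (Subtype.ext (atom_eq hI hxI).symm)
  · rw [term, dif_neg h, hφ, ite_self]

open Classical in
theorem bmoENorm_le_iff {b : L.intervals → ℝ → 𝕜} {A : ℝ≥0∞} :
    L.bmoENorm 2 b ≤ A ↔ ∀ k, ∀ J ∈ L.gen k,
      ∫⁻ x in J, (∑' j, if L.atom (j + 1) x ⊆ J then ‖L.term b j x‖ₑ ^ (2 : ℝ) else 0)
        ≤ A ^ (2 : ℝ) * volume J := by
  have key : ∀ k, ∀ J ∈ L.gen k, (laverage (volume.restrict (J : Set ℝ)) fun x =>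
      ∑' P : L.intervals, ∑' I : L.child P,
        if (I : Set ℝ) ⊆ J then (I : Set ℝ).indicator (fun y => ‖b P y‖ₑ ^ (2 : ℝ)) x else 0)
          ^ (1 / (2 : ℝ)) ≤ A ↔
      ∫⁻ x in J, (∑' j, if L.atom (j + 1) x ⊆ J then ‖L.term b j x‖ₑ ^ (2 : ℝ) else 0)
        ≤ A ^ (2 : ℝ) * volume J := by
    intro k J hJ
    rw [one_div, ENNReal.rpow_inv_le_iff (by norm_num), setLAverage_le_iff hJ]
    rw [setLIntegral_congr_fun (measurableSet_of_mem_gen hJ) fun x hx =>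
      tsum_child_indicator J (fun a => ‖a‖ₑ ^ (2 : ℝ)) (by simp) (subset_carrier hJ hx)]
  rw [bmoENorm, iSup_le_iff]
  constructor
  · intro h k J hJ
    exact (key k J hJ).1 (h ⟨J, mem_intervals hJ⟩)
  · intro h J
    obtain ⟨k, hk⟩ := Set.mem_iUnion.1 J.2
    exact (key k J hk).2 (h k J hk)

theorem lintegral_extPara_le {p : ℝ} (hp : 1 < p) {b : L.intervals → ℝ → 𝕜}
    (hb : L.IsMartDiffSeq b) {A : ℝ≥0} (hA : 0 < A) (h : L.bmoENorm 2 b ≤ A) (f : ℝ → 𝕜) :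
    ∫⁻ x, (∑' k, ‖L.term b k x‖ₑ * ‖L.diff k f x‖ₑ) ^ p ∂L.vol
      ≤ ENNReal.ofReal (extConst p) * (A : ℝ≥0∞) ^ p * ∫⁻ x, L.sqFun f x ^ p ∂L.vol := by
  classical
  have hp0 : 0 < p := by linarith
  have hA' : 0 < (A : ℝ) := NNReal.coe_pos.2 hA
  rw [bmoENorm_le_iff] at h
  refine lintegral_tsum_rpow_le (fun k => (atomConst_term hb k).aemeasurable.enorm.mul
    (atomConst_diff k f).aemeasurable.enorm) fun m => ?_
  -- Both `|Δ_k b|` and `|Δ_k f|` are constant on generation `k + 1`. Starting the filtration one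
  -- generation later makes them adapted, and the BMO condition is the matching test.
  have hc : ∀ n : ℕ, -(m : ℤ) + n + 1 = (-(m : ℤ) + 1) + n := fun n => by ring
  have hbc : ∀ n : ℕ, L.AtomConst ((-(m : ℤ) + 1) + n) fun x => ‖L.term b (-(m : ℤ) + n) x‖ :=
    fun n => hc n ▸ (atomConst_term hb _).comp norm
  have hdc : ∀ n : ℕ, L.AtomConst ((-(m : ℤ) + 1) + n) fun x => ‖L.diff (-(m : ℤ) + n) f x‖ :=
    fun n => hc n ▸ (atomConst_diff _ f).comp norm
  have h1 := lintegral_sum_mul_rpow_le (M := 2 * m) hp hA' hbc (fun _ _ => norm_nonneg _) hdc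
    (fun _ _ => norm_nonneg _) ?_
  · refine (lintegral_mono fun x => ?_).trans (h1.trans ?_)
    · rw [sum_window, ← ENNReal.ofReal_rpow_of_nonneg (Finset.sum_nonneg fun n _ =>
        mul_nonneg (norm_nonneg _) (norm_nonneg _)) hp0.le]
      refine ENNReal.rpow_le_rpow (le_of_eq ?_) hp0.le
      rw [ENNReal.ofReal_sum_of_nonneg fun n _ => mul_nonneg (norm_nonneg _) (norm_nonneg _)]
      refine Finset.sum_congr rfl fun n _ => ?_
      rw [ENNReal.ofReal_mul (norm_nonneg _), ofReal_norm, ofReal_norm]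
    · refine mul_le_mul' (le_of_eq ?_) (lintegral_mono fun x => ?_)
      · rw [ENNReal.ofReal_mul' (Real.rpow_nonneg A.coe_nonneg p),
          ← ENNReal.ofReal_rpow_of_nonneg A.coe_nonneg hp0.le, ENNReal.ofReal_coe_nnreal]
      · rw [← ENNReal.ofReal_rpow_of_nonneg (Real.sqrt_nonneg _) hp0.le, ofReal_sqrt_sum]
        refine ENNReal.rpow_le_rpow (le_trans ?_ (tsum_diff_le_sqFun f x)) hp0.le
        exact ENNReal.rpow_le_rpow
          (sum_range_le_tsum (fun k => ‖L.diff k f x‖ₑ ^ (2 : ℝ)) _ _) (by norm_num)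
  · intro n _ I hI
    refine (setLIntegral_mono' (measurableSet_of_mem_gen hI) fun x hx => ?_).trans
      ((h _ I hI).trans_eq ?_)
    · rw [ENNReal.ofReal_sum_of_nonneg fun n _ => sq_nonneg _]
      refine le_trans (Finset.sum_le_sum fun i hi => ?_) (ENNReal.sum_add_natCast_le_tsum
        (fun j => if L.atom (j + 1) x ⊆ I then ‖L.term b j x‖ₑ ^ (2 : ℝ) else 0) (-(m : ℤ)) _)
      rw [if_pos (atom_subset hI (by have := (Finset.mem_Ico.1 hi).1; omega) hx),
        ENNReal.ofReal_pow (norm_nonneg _), ofReal_norm, ← ENNReal.rpow_natCast]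
      norm_num
    · rw [ENNReal.ofReal_pow A.coe_nonneg, ENNReal.ofReal_coe_nnreal, ← ENNReal.rpow_natCast]
      norm_num

theorem IsMartDiffSeq.eq_indicator_term {b : L.intervals → ℝ → 𝕜} (hb : L.IsMartDiffSeq b)
    {P : L.intervals} (h : L.IsRank P k) : b P = (P : Set ℝ).indicator (L.term b k) := by
  classical
  ext x
  by_cases hx : x ∈ (P : Set ℝ)
  · have e : L.atom k x = P := atom_eq h.1 hx
    rw [Set.indicator_of_mem hx, term, dif_pos (e ▸ h)]
    exact congrFun (congrArg b (Subtype.ext e.symm)) x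
  · rw [Set.indicator_of_notMem hx]
    by_contra hne
    exact hx (hb.eq_zero hne).1

theorem exists_isRank_of_child_nonempty (h : (L.child I).Nonempty) : ∃ k, L.IsRank I k := by
  obtain ⟨J, k, hk, -⟩ := h
  exact ⟨k, hk⟩

theorem IsMartDiffSeq.exists_atomConst {b : L.intervals → ℝ → 𝕜} (hb : L.IsMartDiffSeq b)
    (P : L.intervals) : ∃ k, L.AtomConst k (b P) := by
  by_cases h : (L.child P).Nonempty
  · obtain ⟨k, hk⟩ := exists_isRank_of_child_nonempty h
    refine ⟨k + 1, ?_⟩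
    rw [hb.eq_indicator_term hk]
    exact atomConst_indicator hk.1 (by omega) (atomConst_term hb k)
  · refine ⟨0, fun I hI x hx y hy => ?_⟩
    rw [not_not.1 (mt hb.eq_zero fun h' => h h'.2), not_not.1 (mt hb.eq_zero fun h' => h h'.2)]

theorem IsRank.mdiff_eq_indicator (h : L.IsRank I k) (f : ℝ → 𝕜) :
    L.mdiff I f = I.indicator (L.diff k f) := by
  ext x
  by_cases hx : x ∈ I
  · rw [Set.indicator_of_mem hx, h.mdiff_eq hx]
  · rw [Set.indicator_of_notMem hx, mdiff_of_notMem hx]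

theorem exists_atomConst_mdiff (I : Set ℝ) (f : ℝ → 𝕜) : ∃ k, L.AtomConst k (L.mdiff I f) := by
  by_cases h : (L.child I).Nonempty
  · obtain ⟨k, hk⟩ := exists_isRank_of_child_nonempty h
    refine ⟨k + 1, ?_⟩
    rw [hk.mdiff_eq_indicator f]
    exact atomConst_indicator hk.1 (by omega) (atomConst_diff k f)
  · refine ⟨0, fun J hJ x hx y hy => ?_⟩
    rw [mdiff_of_child_eq_empty h, mdiff_of_child_eq_empty h]

variable (L) in
/-- A term of the extended paraproduct. -/
def extTerm (b : L.intervals → ℝ → 𝕜) (f : ℝ → 𝕜) (P : L.intervals) (x : ℝ) : 𝕜 :=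
  b P x * L.mdiff P f x

theorem exists_atomConst_sum_extTerm {b : L.intervals → ℝ → 𝕜} (hb : L.IsMartDiffSeq b)
    (f : ℝ → 𝕜) (F : Finset L.intervals) :
    ∃ k, L.AtomConst k fun x => ∑ P ∈ F, L.extTerm b f P x := by
  classical
  induction F using Finset.induction_on with
  | empty => exact ⟨0, fun I hI x hx y hy => rfl⟩
  | insert P F hP ih =>
    obtain ⟨i, hi⟩ := ih
    obtain ⟨j, hj⟩ := hb.exists_atomConst P
    obtain ⟨k, hk⟩ := exists_atomConst_mdiff (L := L) P f
    refine ⟨max i (max j k), ?_⟩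
    simp only [Finset.sum_insert hP]
    exact AtomConst.comp₂ (((hj.mono (by omega)).comp₂ (hk.mono (by omega)) (· * ·)))
      (hi.mono (by omega)) (· + ·)

theorem sum_extTerm_eq_zero (b : L.intervals → ℝ → 𝕜) (f : ℝ → 𝕜)
    (F : Finset L.intervals) (hx : x ∉ L.carrier) : ∑ P ∈ F, L.extTerm b f P x = 0 := by
  refine Finset.sum_eq_zero fun P _ => ?_
  obtain ⟨k, hk⟩ := Set.mem_iUnion.1 P.2
  rw [extTerm, mdiff_of_notMem fun h => hx (subset_carrier hk h), mul_zero]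

theorem measurable_sum_extTerm {b : L.intervals → ℝ → 𝕜} (hb : L.IsMartDiffSeq b) (f : ℝ → 𝕜)
    (F : Finset L.intervals) : Measurable[L.sigmaInf] fun x => ∑ P ∈ F, L.extTerm b f P x := by
  obtain ⟨k, hk⟩ := exists_atomConst_sum_extTerm hb f F
  have := hk.measurable_indicator
  rwa [Set.indicator_eq_self.2] at this
  intro x hx
  by_contra hxc
  exact hx (sum_extTerm_eq_zero b f F hxc)

variable (L) in
/-- The extended paraproduct, as a pointwise sum. -/
def extPara (b : L.intervals → ℝ → 𝕜) (f : ℝ → 𝕜) (x : ℝ) : 𝕜 :=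
  limUnder atTop fun F : Finset L.intervals => ∑ P ∈ F, L.extTerm b f P x

theorem stronglyMeasurable_extPara {b : L.intervals → ℝ → 𝕜} (hb : L.IsMartDiffSeq b)
    (f : ℝ → 𝕜) : StronglyMeasurable[L.sigmaInf] (L.extPara b f) :=
  @StronglyMeasurable.limUnder _ _ _ L.sigmaInf _ _ atTop _ _ _ _ fun F =>
    (measurable_sum_extTerm hb f F).stronglyMeasurable

theorem tendsto_extPara {b : L.intervals → ℝ → 𝕜} {f : ℝ → 𝕜}
    (h : ∑' P : L.intervals, ‖L.extTerm b f P x‖ₑ ≠ ∞) :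
    Tendsto (fun F : Finset L.intervals => ∑ P ∈ F, L.extTerm b f P x) atTop
      (𝓝 (L.extPara b f x)) := by
  have hs : Summable fun P : L.intervals => L.extTerm b f P x := by
    refine Summable.of_enorm h
  have := hs.hasSum
  rw [HasSum, SummationFilter.unconditional_filter] at this
  exact tendsto_nhds_limUnder ⟨_, this⟩

theorem enorm_extPara_sub_le {b : L.intervals → ℝ → 𝕜} {f : ℝ → 𝕜}
    (h : ∑' P : L.intervals, ‖L.extTerm b f P x‖ₑ ≠ ∞) (F : Finset L.intervals) :
    ‖L.extPara b f x - ∑ P ∈ F, L.extTerm b f P x‖ₑ ≤ ∑' P : L.intervals, ‖L.extTerm b f P x‖ₑ := by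
  classical
  refine le_of_tendsto (((tendsto_extPara h).sub_const _).enorm) ?_
  filter_upwards [eventually_ge_atTop F] with F' hF'
  rw [← Finset.sum_sdiff hF', add_sub_cancel_right]
  exact (enorm_sum_le _ _).trans (ENNReal.sum_le_tsum _)

theorem tsum_extTerm {b : L.intervals → ℝ → 𝕜} (hb : L.IsMartDiffSeq b) (f : ℝ → 𝕜)
    (hx : x ∈ L.carrier) :
    ∑' P : L.intervals, ‖L.extTerm b f P x‖ₑ = ∑' k, ‖L.term b k x‖ₑ * ‖L.diff k f x‖ₑ := by
  simp only [extTerm, enorm_mul]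
  exact tsum_term hb f hx (fun _ d c => ‖c‖ₑ * ‖d‖ₑ) (by simp)

/-- The sum `Z` of the absolute values of all terms is in `L ^ p`. So the series converges
absolutely almost everywhere, and in `L ^ p` by dominated convergence with majorant `Z ^ p`, along
the net of all finite sets. Burkholder's inequality turns `L ^ p` convergence and bounds into those
of `H̃^p`. -/
theorem exists_extParaBoundedBy_of_bmoENorm_le {p : ℝ} (hp : 1 < p) :
    ∃ C : ℝ≥0, 0 < C ∧ ∀ (L : IntervalLattice) (b : L.intervals → ℝ → 𝕜), L.IsMartDiffSeq b →
      ∀ A : ℝ≥0, 0 < A → L.bmoENorm 2 b ≤ A → L.ExtParaBoundedBy p b (C * A) := by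
  have hp0 : 0 < p := by linarith
  obtain ⟨D, hD, hsq⟩ := lintegral_sqFun_le (𝕜 := 𝕜) hp
  refine ⟨(D * ((extConst p).toNNReal + 1)) ^ (1 / p), NNReal.rpow_pos (by positivity), ?_⟩
  intro L b hb A hA hbmo f hf
  set Z : ℝ → ℝ≥0∞ := fun x => ∑' P : L.intervals, ‖L.extTerm b f P x‖ₑ with hZ
  have hZint : ∫⁻ x, Z x ^ p ∂L.vol
      ≤ ENNReal.ofReal (extConst p) * (A : ℝ≥0∞) ^ p * ∫⁻ x, L.sqFun f x ^ p ∂L.vol := by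
    refine le_trans (lintegral_vol_mono fun x hx => ?_) (lintegral_extPara_le hp hb hA hbmo f)
    simp only [hZ, tsum_extTerm hb f hx, le_refl]
  have hS : ∫⁻ x, L.sqFun f x ^ p ∂L.vol ≠ ∞ := by
    rw [← hardyENormFun_rpow hp0]
    exact ENNReal.rpow_ne_top_of_nonneg hp0.le hf.2.ne
  have hZfin : ∫⁻ x, Z x ^ p ∂L.vol ≠ ∞ := ne_top_of_le_ne_top (ENNReal.mul_ne_top
    (ENNReal.mul_ne_top ENNReal.ofReal_ne_top (ENNReal.rpow_ne_top_of_nonneg hp0.le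
      ENNReal.coe_ne_top)) hS) hZint
  have hFm : ∀ F : Finset L.intervals, Measurable fun x => ∑ P ∈ F, L.extTerm b f P x :=
    fun F => by
      have := (measurable_sum_extTerm hb f F).mono sigmaInf_le le_rfl
      rwa [← BorelSpace.measurable_eq (α := ℝ)] at this
  have hTm : ∀ P : L.intervals, Measurable (L.extTerm b f P) := fun P => by
    simpa using hFm {P}
  have hZm : Measurable Z := Measurable.tsum fun P => (hTm P).enorm
  have hae : ∀ᵐ x ∂L.vol, Z x ≠ ∞ := by
    filter_upwards [ae_lt_top (hZm.pow_const p) hZfin] with x hx htop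
    rw [htop, ENNReal.top_rpow_of_pos hp0] at hx
    exact lt_irrefl _ hx
  have hgm := stronglyMeasurable_extPara hb f
  have hgm' : Measurable (L.extPara b f) := by
    have := (hgm.mono sigmaInf_le).measurable
    rwa [← BorelSpace.measurable_eq (α := ℝ)] at this
  have hdom : ∀ F : Finset L.intervals, ∀ᵐ x ∂L.vol,
      ‖L.extPara b f x - ∑ P ∈ F, L.extTerm b f P x‖ₑ ^ p ≤ Z x ^ p := fun F => by
    filter_upwards [hae] with x hx
    exact ENNReal.rpow_le_rpow (enorm_extPara_sub_le hx F) hp0.le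
  have hmem : ∀ F : Finset L.intervals,
      MemLp (fun x => L.extPara b f x - ∑ P ∈ F, L.extTerm b f P x) (ENNReal.ofReal p) L.vol := by
    intro F
    refine ⟨(hgm'.sub (hFm F)).aestronglyMeasurable, ?_⟩
    rw [eLpNorm_lt_top_iff_lintegral_rpow_enorm_lt_top (by simpa using hp0) ENNReal.ofReal_ne_top,
      ENNReal.toReal_ofReal hp0.le]
    exact (lintegral_mono_ae (hdom F)).trans_lt hZfin.lt_top
  have hmem0 : MemLp (L.extPara b f) (ENNReal.ofReal p) L.vol := by simpa using hmem ∅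
  have hnorm : L.hardyENormFun p (L.extPara b f) ^ p ≤ D * ∫⁻ x, Z x ^ p ∂L.vol := by
    rw [hardyENormFun_rpow hp0]
    refine (hsq L _ hmem0).trans (mul_le_mul_right (lintegral_mono_ae ?_) _)
    simpa using hdom ∅
  refine ⟨L.extPara b f, ⟨⟨⟨hgm.aestronglyMeasurable, hmem0⟩, ?_⟩, ?_⟩, ?_⟩
  · exact (ENNReal.rpow_lt_top_iff_of_pos hp0).1
      (hnorm.trans_lt (ENNReal.mul_lt_top ENNReal.coe_lt_top hZfin.lt_top))
  · have h0 : Tendsto (fun F : Finset L.intervals => ∫⁻ x,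
        ‖L.extPara b f x - ∑ P ∈ F, L.extTerm b f P x‖ₑ ^ p ∂L.vol) atTop (𝓝 (∫⁻ x, 0 ∂L.vol)) := by
      refine tendsto_lintegral_filter_of_dominated_convergence _ (Eventually.of_forall fun F => ?_)
        (Eventually.of_forall hdom) hZfin ?_
      · exact (hgm'.sub (hFm F)).enorm.pow_const p
      · filter_upwards [hae] with x hx
        have := (ENNReal.continuous_rpow_const (y := p)).tendsto _ |>.comp
          (((tendsto_extPara hx).const_sub (L.extPara b f x)).enorm)
        simpa [hp0, Function.comp_def] using this
    rw [lintegral_zero] at h0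
    have h1 : Tendsto (fun F : Finset L.intervals => L.hardyENormFun p
        (fun x => L.extPara b f x - ∑ P ∈ F, L.extTerm b f P x) ^ p) atTop (𝓝 0) := by
      refine tendsto_of_tendsto_of_tendsto_of_le_of_le tendsto_const_nhds
        (by simpa using ENNReal.Tendsto.const_mul (a := (D : ℝ≥0∞)) h0 (Or.inr ENNReal.coe_ne_top))
        (fun F => zero_le) fun F => ?_
      rw [hardyENormFun_rpow hp0]
      exact hsq L _ (hmem F)
    have h2 := (ENNReal.continuous_rpow_const (y := 1 / p)).tendsto _ |>.comp h1
    simpa [Function.comp_def, ← ENNReal.rpow_mul, hp0.ne', hp0, extTerm] using h2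
  · rw [← ENNReal.rpow_le_rpow_iff hp0]
    refine hnorm.trans ((mul_le_mul_right hZint _).trans ?_)
    rw [ENNReal.mul_rpow_of_nonneg _ _ hp0.le, hardyENormFun_rpow hp0, ← mul_assoc]
    refine mul_le_mul_left ?_ _
    rw [← ENNReal.coe_rpow_of_nonneg _ hp0.le, ← ENNReal.coe_rpow_of_nonneg _ hp0.le, NNReal.mul_rpow,
      ← NNReal.rpow_mul, one_div_mul_cancel hp0.ne', NNReal.rpow_one, ← mul_assoc, ENNReal.ofReal,
      ← ENNReal.coe_mul, ← ENNReal.coe_mul]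
    gcongr
    simp

end IntervalLattice

end

noncomputable section

namespace IntervalLattice

variable {L : IntervalLattice} {I J Q : Set ℝ} {j k l N : ℤ} {x x₀ y : ℝ} {α : Type*}
  {𝕜 : Type*} [RCLike 𝕜]

/-! ### Finite martingale difference sequences -/

theorem AtomConst.memLp {φ : ℝ → 𝕜} (hφ : L.AtomConst k φ) (hI : I ∈ L.gen j)
    (h0 : ∀ x ∉ I, φ x = 0) (r : ℝ≥0∞) : MemLp φ r L.vol := by
  obtain ⟨i, hji, hki⟩ : ∃ i, j ≤ i ∧ k ≤ i := ⟨max j k, le_max_left _ _, le_max_right _ _⟩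
  have hφ' := hφ.mono hki
  have hfin : (φ '' I).Finite := by
    have h1 := finite_cells hI hji
    have h2 : φ '' I ⊆ ⋃ J ∈ {J | J ∈ L.gen i ∧ J ⊆ I}, φ '' J := by
      rintro _ ⟨x, hx, rfl⟩
      have hxc := subset_carrier hI hx
      exact Set.mem_biUnion (x := L.atom i x) ⟨atom_mem_gen hxc i, atom_subset hI hji hx⟩
        ⟨x, mem_atom hxc i, rfl⟩
    refine (h1.biUnion fun J hJ => Set.Subsingleton.finite ?_).subset h2
    rintro _ ⟨x, hx, rfl⟩ _ ⟨y, hy, rfl⟩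
    exact hφ' J hJ.1 x hx y hy
  obtain ⟨B, hB⟩ := hfin.isBounded.exists_norm_le
  have he : φ = I.indicator φ := (Set.indicator_eq_self.2 fun x hx => by
    by_contra hxI
    exact hx (h0 x hxI)).symm
  rw [he, memLp_indicator_iff_restrict (measurableSet_of_mem_gen hI), vol_restrict hI]
  have : IsFiniteMeasure (volume.restrict I) :=
    ⟨by rw [Measure.restrict_apply_univ]; exact volume_lt_top_of_mem_gen hI⟩
  refine MemLp.of_bound ?_ B ?_
  · have h := hφ.aestronglyMeasurable.mono sigmaInf_le
    rw [← BorelSpace.measurable_eq (α := ℝ)] at h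
    have := h.restrict (s := I)
    rwa [vol_restrict hI] at this
  · filter_upwards [ae_restrict_mem (measurableSet_of_mem_gen hI)] with x hx
    exact hB _ ⟨x, hx, rfl⟩

theorem AtomConst.expect_eq {φ : ℝ → 𝕜} (hφ : L.AtomConst k φ) (hx : x ∈ L.carrier) :
    L.expect k φ x = φ x := by
  have hJ := atom_mem_gen hx k
  rw [expect, setAverage_congr_fun (measurableSet_of_mem_gen hJ)
    (g := fun _ => φ x) (ae_of_all _ fun y hy => hφ _ hJ y hy x (mem_atom hx k)),
    setAverage_const (volume_pos_of_mem_gen hJ).ne' (volume_lt_top_of_mem_gen hJ).ne]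

theorem expect_sum {ι : Type*} {F : Finset ι} {u : ι → ℝ → 𝕜} (hx : x ∈ L.carrier)
    (hu : ∀ i ∈ F, MemLp (u i) (ENNReal.ofReal 1) L.vol) :
    L.expect k (fun y => ∑ i ∈ F, u i y) x = ∑ i ∈ F, L.expect k (u i) x := by
  simp only [expect, setAverage_eq]
  rw [integral_finsetSum _ fun i hi => integrableOn_gen le_rfl (hu i hi) (atom_mem_gen hx k),
    Finset.smul_sum]

theorem expect_sub {p : ℝ} (hp : 1 ≤ p) {u v : ℝ → 𝕜} (hx : x ∈ L.carrier)
    (hu : MemLp u (ENNReal.ofReal p) L.vol) (hv : MemLp v (ENNReal.ofReal p) L.vol) :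
    L.expect k (fun y => u y - v y) x = L.expect k u x - L.expect k v x := by
  simp only [expect, setAverage_eq]
  rw [integral_sub (integrableOn_gen hp hu (atom_mem_gen hx k))
    (integrableOn_gen hp hv (atom_mem_gen hx k)), smul_sub]

namespace IsMartDiffSeq

variable {c : L.intervals → ℝ → 𝕜} {P : L.intervals}

theorem eq_zero_of_notMem (hc : L.IsMartDiffSeq c) (hx : x ∉ (P : Set ℝ)) : c P x = 0 := by
  by_contra h
  exact hx (hc.eq_zero h).1

theorem memLp (hc : L.IsMartDiffSeq c) (P : L.intervals) (r : ℝ≥0∞) : MemLp (c P) r L.vol := by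
  obtain ⟨k, hk⟩ := hc.exists_atomConst P
  obtain ⟨j, hj⟩ := Set.mem_iUnion.1 P.2
  exact hk.memLp hj (fun x hx => hc.eq_zero_of_notMem hx) r

theorem expect_eq_zero (hc : L.IsMartDiffSeq c) (hP : L.IsRank P l) (hk : k ≤ l)
    (hx : x ∈ L.carrier) : L.expect k (c P) x = 0 := by
  have hJ := atom_mem_gen hx k
  have hPm := measurableSet_of_mem_gen hP.1
  have h0 : c P = (P : Set ℝ).indicator (c P) :=
    (Set.indicator_eq_self.2 fun y hy => (hc.eq_zero hy).1).symm
  rw [expect, setAverage_eq]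
  refine smul_eq_zero_of_right _ ?_
  rw [h0, setIntegral_indicator hPm]
  by_cases hd : (L.atom k x ∩ P).Nonempty
  · obtain ⟨y, hy1, hy2⟩ := hd
    rw [Set.inter_eq_right.2 (subset_of_mem_inter hJ hP.1 hk hy1 hy2), ← integral_indicator hPm, ← h0]
    exact (hc P).2.2
  · rw [Set.not_nonempty_iff_eq_empty] at hd
    rw [hd, setIntegral_empty]

theorem expect_eq_self (hc : L.IsMartDiffSeq c) (hP : L.IsRank P l) (hk : l < k)
    (hx : x ∈ L.carrier) : L.expect k (c P) x = c P x := by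
  refine AtomConst.expect_eq ?_ hx
  rw [hc.eq_indicator_term hP]
  exact atomConst_indicator hP.1 hk.le ((atomConst_term hc l).mono hk)

theorem eq_zero_of_not_isRank (hc : L.IsMartDiffSeq c) (hP : ¬ ∃ k, L.IsRank P k) : c P = 0 := by
  ext x
  by_contra h
  exact hP (exists_isRank_of_child_nonempty (hc.eq_zero h).2)

open Classical in
theorem diff_eq_ite (hc : L.IsMartDiffSeq c) (P : L.intervals) (hx : x ∈ L.carrier) :
    L.diff k (c P) x = if L.IsRank P k then c P x else 0 := by
  by_cases hP : ∃ l, L.IsRank P l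
  · obtain ⟨l, hl⟩ := hP
    split_ifs with h
    · rw [diff, hc.expect_eq_zero h le_rfl hx, hc.expect_eq_self h (lt_add_one k) hx, sub_zero]
    · have hlk : l ≠ k := fun e => h (e ▸ hl)
      rcases lt_or_gt_of_ne hlk with h' | h'
      · rw [diff, hc.expect_eq_self hl h' hx, hc.expect_eq_self hl (by omega) hx, sub_self]
      · rw [diff, hc.expect_eq_zero hl h'.le hx, hc.expect_eq_zero hl (by omega) hx, sub_self]
  · rw [hc.eq_zero_of_not_isRank hP, if_neg fun h => hP ⟨k, h⟩]
    simp [diff, expect]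

variable {F : Finset L.intervals}

/-- A finite family of formal differences is the family of differences of its sum: `Δ_P` recovers `c
P` and annihilates the other terms. -/
theorem mdiff_sum (hc : L.IsMartDiffSeq c) (hF : ∀ P ∉ F, c P = 0) (P : L.intervals) :
    L.mdiff P (fun y => ∑ I ∈ F, c I y) = c P := by
  classical
  by_cases hP : ∃ k, L.IsRank P k
  · obtain ⟨k, hk⟩ := hP
    ext x
    by_cases hx : x ∈ (P : Set ℝ)
    · have hxc := subset_carrier hk.1 hx
      have h1 : ∀ k, L.expect k (fun y => ∑ I ∈ F, c I y) x = ∑ I ∈ F, L.expect k (c I) x :=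
        fun k => expect_sum hxc fun I _ => hc.memLp I _
      rw [hk.mdiff_eq hx, diff, h1, h1, ← Finset.sum_sub_distrib]
      have h2 : ∀ I : L.intervals, L.expect (k + 1) (c I) x - L.expect k (c I) x
          = if I = P then c P x else 0 := by
        intro I
        have := hc.diff_eq_ite (k := k) I hxc
        rw [diff] at this
        rw [this]
        by_cases e : I = P
        · rw [if_pos e, if_pos (e ▸ hk), e]
        · rw [if_neg e]
          split_ifs with h
          · refine hc.eq_zero_of_notMem fun hxI => e (Subtype.ext ?_)
            rw [← atom_eq h.1 hxI, atom_eq hk.1 hx]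
          · rfl
      simp only [h2, Finset.sum_ite_eq']
      split_ifs with h
      · rfl
      · rw [hF P h]; rfl
    · rw [mdiff_of_notMem hx, hc.eq_zero_of_notMem hx]
  · ext x
    rw [hc.eq_zero_of_not_isRank hP, mdiff_of_child_eq_empty fun h =>
      hP (exists_isRank_of_child_nonempty h)]
    rfl

theorem memLpLattice_sum (hc : L.IsMartDiffSeq c) (F : Finset L.intervals) (p : ℝ) :
    L.MemLpLattice p fun y => ∑ I ∈ F, c I y := by
  refine ⟨?_, memLp_finsetSum F fun I _ => hc.memLp I _⟩
  choose k hk using hc.exists_atomConst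
  obtain ⟨M, hM⟩ : ∃ M, ∀ I ∈ F, k I ≤ M := by
    obtain ⟨M, hM⟩ := (F.image k).exists_le
    exact ⟨M, fun I hI => hM _ (Finset.mem_image_of_mem k hI)⟩
  refine AtomConst.aestronglyMeasurable (k := M) fun I hI x hx y hy =>
    Finset.sum_congr rfl fun J hJ => ((hk J).mono (hM J hJ)) I hI x hx y hy

theorem topAvg_sum (hc : L.IsMartDiffSeq c) (F : Finset L.intervals) (hx : x ∈ L.carrier) :
    L.topAvg (fun y => ∑ I ∈ F, c I y) x = 0 := by
  have h : ∀ I : L.intervals, ∃ K, ∀ k ≤ K, L.expect k (c I) x = 0 := by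
    intro I
    by_cases hI : ∃ k, L.IsRank I k
    · obtain ⟨K, hK⟩ := hI
      exact ⟨K, fun k hk => hc.expect_eq_zero hK hk hx⟩
    · refine ⟨0, fun k _ => ?_⟩
      rw [hc.eq_zero_of_not_isRank hI]
      simp [expect]
  choose K hK using h
  obtain ⟨M, hM⟩ : ∃ M, ∀ I ∈ F, M ≤ K I := by
    obtain ⟨M, hM⟩ := (F.image fun I => -K I).exists_le
    exact ⟨-M, fun I hI => neg_le.1 (hM _ (Finset.mem_image_of_mem _ hI))⟩
  refine topAvg_mem_of_isClosed (p := 1) le_rfl (hc.memLpLattice_sum F 1).2 hx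
    (isClosed_singleton (x := (0 : 𝕜))) M fun k hk => ?_
  rw [expect_sum hx fun I _ => hc.memLp I _, Set.mem_singleton_iff]
  exact Finset.sum_eq_zero fun I hI => hK I k (hk.trans (hM I hI))

theorem sqFun_sum (hc : L.IsMartDiffSeq c) (hF : ∀ P ∉ F, c P = 0) (hx : x ∈ L.carrier) :
    L.sqFun (fun y => ∑ I ∈ F, c I y) x = (∑ I ∈ F, ‖c I x‖ₑ ^ (2 : ℝ)) ^ (1 / 2 : ℝ) := by
  rw [sqFun, hc.topAvg_sum F hx, ← tsum_mdiff _ hx (fun a => ‖a‖ₑ ^ (2 : ℝ)) (by simp)]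
  simp only [hc.mdiff_sum hF]
  rw [tsum_eq_sum (s := F) fun P hP => by rw [hF P hP]; simp]
  simp

end IsMartDiffSeq

/-! ### BMO is necessary for the extended paraproduct -/

/-- For a finite sum `f` of differences `c P`, the partial sums of the extended paraproduct are
eventually the constant function `X = ∑ b P * c P`. Hence boundedness in `H̃^p` bounds `X`, and
Davis' inequality descends from `H̃^p` to `L ^ p`. -/
theorem exists_lintegral_sum_mul_le {p : ℝ} (hp : 1 < p) : ∃ C : ℝ≥0, 0 < C ∧
    ∀ (L : IntervalLattice) (b : L.intervals → ℝ → 𝕜), L.IsMartDiffSeq b →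
      ∀ A : ℝ≥0, L.ExtParaBoundedBy p b A → ∀ c : L.intervals → ℝ → 𝕜, L.IsMartDiffSeq c →
      ∀ F : Finset L.intervals, (∀ P ∉ F, c P = 0) →
        ∫⁻ x, ‖∑ P ∈ F, b P x * c P x‖ₑ ^ p ∂L.vol
          ≤ C * (A : ℝ≥0∞) ^ p * ∫⁻ x, (∑ P ∈ F, ‖c P x‖ₑ ^ (2 : ℝ)) ^ (p / 2) ∂L.vol := by
  have hp0 : 0 < p := by linarith
  obtain ⟨C, hC, hmax⟩ := lintegral_iSup_expect_le (𝕜 := 𝕜) hp.le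
  obtain ⟨D, -, hsq⟩ := lintegral_sqFun_le (𝕜 := 𝕜) hp
  refine ⟨C, hC, ?_⟩
  intro L b hb A hA c hc F hF
  set f : ℝ → 𝕜 := fun y => ∑ I ∈ F, c I y with hf
  set X : ℝ → 𝕜 := fun x => ∑ P ∈ F, b P x * c P x with hX
  have hsqf : ∀ x ∈ L.carrier, L.sqFun f x ^ p = (∑ P ∈ F, ‖c P x‖ₑ ^ (2 : ℝ)) ^ (p / 2) :=
    fun x hx => by
      rw [hc.sqFun_sum hF hx, ← ENNReal.rpow_mul, one_div_mul_eq_div]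
  choose kb hkb using hb.exists_atomConst
  choose kc hkc using hc.exists_atomConst
  have hbc : ∀ P, L.AtomConst (max (kb P) (kc P)) fun x => b P x * c P x := fun P =>
    ((hkb P).mono (le_max_left _ _)).comp₂ ((hkc P).mono (le_max_right _ _)) (· * ·)
  obtain ⟨M, hM⟩ : ∃ M, ∀ P ∈ F, max (kb P) (kc P) ≤ M := by
    obtain ⟨M, hM⟩ := (F.image fun P => max (kb P) (kc P)).exists_le
    exact ⟨M, fun I hI => hM _ (Finset.mem_image_of_mem _ hI)⟩
  have hXc : L.AtomConst M X := fun I hI x hx y hy =>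
    Finset.sum_congr rfl fun J hJ => ((hbc J).mono (hM J hJ)) I hI x hx y hy
  have hXm : MemLp X (ENNReal.ofReal p) L.vol := memLp_finsetSum F fun P _ => by
    obtain ⟨j, hj⟩ := Set.mem_iUnion.1 P.2
    exact (hbc P).memLp hj (fun x hx => by rw [hc.eq_zero_of_notMem hx, mul_zero]) _
  have hXF : ∀ F' : Finset L.intervals, F ≤ F' → (fun x => ∑ P ∈ F', b P x * L.mdiff P f x) = X := by
    intro F' hFF'
    ext x
    simp only [hf, hc.mdiff_sum hF, hX]
    refine (Finset.sum_subset hFF' fun P _ hP => ?_).symm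
    rw [hF P hP]
    simp
  have hfin : ∫⁻ x, L.sqFun f x ^ p ∂L.vol < ∞ := by
    have hfp := (hc.memLpLattice_sum F p).2
    refine (hsq L f hfp).trans_lt (ENNReal.mul_lt_top ENNReal.coe_lt_top ?_)
    have := hfp.2
    rwa [eLpNorm_lt_top_iff_lintegral_rpow_enorm_lt_top (by simpa using hp0) ENNReal.ofReal_ne_top,
      ENNReal.toReal_ofReal hp0.le] at this
  obtain ⟨g, ⟨hgH, hg⟩, hgA⟩ := hA f (memHardy_of_lintegral hp0 (hc.memLpLattice_sum F p) hfin)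
  -- The limit of an eventually constant net.
  have h0 : L.hardyENormFun p (fun x => g x - X x) = 0 := by
    refine tendsto_nhds_unique (tendsto_const_nhds.congr' ?_) hg
    filter_upwards [eventually_ge_atTop F] with F' hF'
    rw [← hXF F' hF']
  have hz : ∀ᵐ x ∂L.vol, ⨆ k : ℤ, ‖L.expect k (fun x => g x - X x) x‖ₑ ^ p = 0 := by
    have h1 := hmax L _ (hgH.1.2.sub hXm)
    rw [show (g - X) = fun x => g x - X x from rfl, ← hardyENormFun_rpow hp0, h0,
      ENNReal.zero_rpow_of_pos hp0, mul_zero, nonpos_iff_eq_zero] at h1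
    refine (lintegral_eq_zero_iff' ?_).1 h1
    exact AEMeasurable.iSup fun k => (atomConst_expect k _).aemeasurable.enorm.pow_const p
  -- `X` is constant on generation `M`, so `X = E_M X`, and `E_M X = E_M g` because the maximal
  -- function of `g - X` vanishes. Thus `X` is dominated by the maximal function of `g`.
  have hle : ∀ᵐ x ∂L.vol, ‖X x‖ₑ ^ p ≤ ⨆ k : ℤ, ‖L.expect k g x‖ₑ ^ p := by
    filter_upwards [hz, ae_of_mem_carrier fun x (hx : x ∈ L.carrier) => hx] with x hx hxc
    have h1 : ‖L.expect M (fun x => g x - X x) x‖ₑ ^ p = 0 := by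
      rw [← nonpos_iff_eq_zero, ← hx]
      exact le_iSup (fun k : ℤ => ‖L.expect k (fun x => g x - X x) x‖ₑ ^ p) M
    rw [ENNReal.rpow_eq_zero_iff_of_pos hp0, enorm_eq_zero, expect_sub hp.le hxc hgH.1.2 hXm,
      hXc.expect_eq hxc, sub_eq_zero] at h1
    rw [← h1]
    exact le_iSup (fun k : ℤ => ‖L.expect k g x‖ₑ ^ p) M
  calc _ ≤ ∫⁻ x, ⨆ k : ℤ, ‖L.expect k g x‖ₑ ^ p ∂L.vol := lintegral_mono_ae hle
    _ ≤ C * ∫⁻ x, L.sqFun g x ^ p ∂L.vol := hmax L g hgH.1.2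
    _ ≤ C * ((A : ℝ≥0∞) ^ p * ∫⁻ x, L.sqFun f x ^ p ∂L.vol) := by
        rw [← hardyENormFun_rpow hp0, ← hardyENormFun_rpow hp0, ← ENNReal.mul_rpow_of_nonneg _ _ hp0.le]
        gcongr
    _ ≤ _ := by
        rw [← mul_assoc]
        exact mul_le_mul_right (lintegral_vol_mono fun x hx => (hsqf x hx).le) _

end IntervalLattice

end

noncomputable section

/-! ### Testing the extended paraproduct on the conjugate sequence -/

theorem ENNReal.le_sq_mul_of_le_mul {U V K T : ℝ≥0∞} (hU : U ≠ ∞) (h1 : U ≤ K * V) (h2 : V ^ (2 : ℝ) ≤ U * T) :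
    U ≤ K ^ (2 : ℝ) * T := by
  rcases eq_or_ne U 0 with h0 | h0
  · rw [h0]; exact zero_le
  refine (ENNReal.mul_le_mul_iff_right h0 hU).1 ?_
  calc U * U = U ^ (2 : ℝ) := by rw [ENNReal.rpow_two, sq]
    _ ≤ (K * V) ^ (2 : ℝ) := ENNReal.rpow_le_rpow h1 (by norm_num)
    _ = K ^ (2 : ℝ) * V ^ (2 : ℝ) := ENNReal.mul_rpow_of_nonneg _ _ (by norm_num)
    _ ≤ K ^ (2 : ℝ) * (U * T) := by gcongr
    _ = _ := by ring

theorem ENNReal.tsum_le_of_unique {ι : Type*} {a : ι → ℝ≥0∞} {B : ℝ≥0∞} (h : ∀ i, a i ≤ B)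
    (hu : ∀ i j, a i ≠ 0 → a j ≠ 0 → i = j) : ∑' i, a i ≤ B := by
  by_cases h0 : ∃ i, a i ≠ 0
  · obtain ⟨i, hi⟩ := h0
    rw [tsum_eq_single i fun j hj => by
      by_contra hne
      exact hj (hu j i hne hi)]
    exact h i
  · push Not at h0
    simp [h0]

namespace IntervalLattice

variable {L : IntervalLattice} {I J Q : Set ℝ} {j k l N : ℤ} {x x₀ y : ℝ} {α : Type*}
  {𝕜 : Type*} [RCLike 𝕜]

theorem lintegral_vol_eq_setLIntegral (hJ : J ∈ L.gen k) {g : ℝ → ℝ≥0∞} (h : ∀ x ∉ J, g x = 0) :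
    ∫⁻ x, g x ∂L.vol = ∫⁻ x in J, g x := by
  rw [← vol_restrict hJ, ← lintegral_indicator (measurableSet_of_mem_gen hJ),
    Set.indicator_eq_self.2 fun x hx => by
      by_contra hxJ
      exact hx (h x hxJ)]

theorem setLIntegral_rpow_le {r : ℝ} (hr : 1 < r) {g : ℝ → ℝ≥0∞}
    (hg : AEMeasurable g (volume.restrict J)) :
    (∫⁻ x in J, g x) ^ r ≤ (∫⁻ x in J, g x ^ r) * volume J ^ (r - 1) := by
  have hr0 : 0 < r := by linarith
  have hc := Real.HolderConjugate.conjExponent hr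
  have h := ENNReal.lintegral_mul_le_Lp_mul_Lq (volume.restrict J) hc hg
    (aemeasurable_const (b := (1 : ℝ≥0∞)))
  simp only [Pi.mul_apply, mul_one, ENNReal.one_rpow, lintegral_const, one_mul,
    Measure.restrict_apply_univ] at h
  refine (ENNReal.rpow_le_rpow h hr0.le).trans_eq ?_
  rw [ENNReal.mul_rpow_of_nonneg _ _ hr0.le, ← ENNReal.rpow_mul, ← ENNReal.rpow_mul,
    one_div_mul_cancel hr0.ne', ENNReal.rpow_one]
  congr 2
  have := hc.symm.one_div_eq
  rw [Real.conjExponent]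
  have : r - 1 ≠ 0 := by linarith
  field_simp

theorem IsMartDiffSeq.conj_ite {b : L.intervals → ℝ → 𝕜} (hb : L.IsMartDiffSeq b)
    (s : Set L.intervals) [DecidablePred (· ∈ s)] :
    L.IsMartDiffSeq fun P x => if P ∈ s then starRingEnd 𝕜 (b P x) else 0 := by
  intro P
  obtain ⟨h1, h2, h3⟩ := hb P
  by_cases h : P ∈ s
  · simp only [if_pos h]
    refine ⟨fun x hx => by rw [h1 x hx, map_zero], fun J hJ x hx y hy => by rw [h2 J hJ x hx y hy], ?_⟩
    rw [integral_conj, h3, map_zero]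
  · simp [h]

/-- Taking for `c` the conjugates of the terms of `b` with index in `F` makes both sides functions
of `S = ∑ |b P| ^ 2`: the output has norm `S`, and the input has square function `√S`. -/
theorem exists_setLIntegral_sum_sq_le {p : ℝ} (hp : 1 < p) : ∃ C : ℝ≥0, 0 < C ∧
    ∀ (L : IntervalLattice) (b : L.intervals → ℝ → 𝕜), L.IsMartDiffSeq b →
      ∀ A : ℝ≥0, L.ExtParaBoundedBy p b A → ∀ k, ∀ J ∈ L.gen k, ∀ F : Finset L.intervals,
        (∀ P ∈ F, (P : Set ℝ) ⊆ J) →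
        ∫⁻ x in J, ∑ P ∈ F, ‖b P x‖ₑ ^ (2 : ℝ) ≤ C * (A : ℝ≥0∞) ^ (2 : ℝ) * volume J := by
  classical
  have hp0 : 0 < p := by linarith
  obtain ⟨C, hC, hmain⟩ := exists_lintegral_sum_mul_le (𝕜 := 𝕜) hp
  refine ⟨C ^ (2 / p), NNReal.rpow_pos hC, ?_⟩
  intro L b hb A hA k J hJ F hF
  set S : ℝ → ℝ≥0∞ := fun x => ∑ P ∈ F, ‖b P x‖ₑ ^ (2 : ℝ) with hS
  set c : L.intervals → ℝ → 𝕜 := fun P x => if P ∈ (F : Set L.intervals) then starRingEnd 𝕜 (b P x) else 0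
    with hc
  have hcm : L.IsMartDiffSeq c := hb.conj_ite _
  have h := hmain L b hb A hA c hcm F fun P hP => by
    ext x
    simp [hc, hP]
  have e1 : ∀ x, ‖∑ P ∈ F, b P x * c P x‖ₑ = S x := by
    intro x
    have : ∑ P ∈ F, b P x * c P x = ((∑ P ∈ F, ‖b P x‖ ^ 2 : ℝ) : 𝕜) := by
      push_cast
      refine Finset.sum_congr rfl fun P hP => ?_
      simp [hc, hP, RCLike.mul_conj]
    rw [this, ← ofReal_norm, RCLike.norm_ofReal, abs_of_nonneg (Finset.sum_nonneg fun P _ => sq_nonneg _),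
      ENNReal.ofReal_sum_of_nonneg fun P _ => sq_nonneg _, hS]
    refine Finset.sum_congr rfl fun P _ => ?_
    rw [ENNReal.ofReal_pow (norm_nonneg _), ofReal_norm, ENNReal.rpow_two]
  have e2 : ∀ x, ∑ P ∈ F, ‖c P x‖ₑ ^ (2 : ℝ) = S x := fun x =>
    Finset.sum_congr rfl fun P hP => by
      have : ‖c P x‖ₑ = ‖b P x‖ₑ := by
        rw [← ofReal_norm, ← ofReal_norm]
        simp [hc, hP]
      rw [this]
  have hS0 : ∀ x ∉ J, S x = 0 := fun x hx => Finset.sum_eq_zero fun P hP => by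
    rw [hb.eq_zero_of_notMem fun h => hx (hF P hP h)]
    simp
  simp only [e1, e2] at h
  have hXm : MemLp (fun x => ∑ P ∈ F, b P x * c P x) (ENNReal.ofReal p) L.vol :=
    memLp_finsetSum F fun P _ => by
      obtain ⟨i, hi⟩ := hb.exists_atomConst P
      obtain ⟨i', hi'⟩ := hcm.exists_atomConst P
      obtain ⟨j, hj⟩ := Set.mem_iUnion.1 P.2
      exact ((hi.mono (le_max_left i i')).comp₂ (hi'.mono (le_max_right i i')) (· * ·)).memLp hj
        (fun x hx => by rw [hcm.eq_zero_of_notMem hx, mul_zero]) _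
  have hUfin : ∫⁻ x, S x ^ p ∂L.vol ≠ ∞ := by
    have := hXm.2
    rw [eLpNorm_lt_top_iff_lintegral_rpow_enorm_lt_top (by simpa using hp0) ENNReal.ofReal_ne_top,
      ENNReal.toReal_ofReal hp0.le] at this
    simpa only [e1] using this.ne
  have hSm : AEMeasurable S (volume.restrict J) := by
    have := hXm.1.enorm.restrict (s := J)
    rw [vol_restrict hJ] at this
    simpa only [e1] using this
  rw [lintegral_vol_eq_setLIntegral hJ fun x hx => by rw [hS0 x hx, ENNReal.zero_rpow_of_pos hp0]]
    at h hUfin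
  rw [lintegral_vol_eq_setLIntegral hJ fun x hx => by
    rw [hS0 x hx, ENNReal.zero_rpow_of_pos (by positivity)]] at h
  have hcs := setLIntegral_rpow_le (r := 2) (by norm_num) (hSm.pow_const (p / 2))
  simp only [← ENNReal.rpow_mul, div_mul_cancel₀ p (two_ne_zero' ℝ)] at hcs
  rw [show (2 : ℝ) - 1 = 1 by norm_num, ENNReal.rpow_one] at hcs
  -- The test gives `∫ S ^ p ≤ K ∫ S ^ (p / 2)`, Cauchy–Schwarz bounds the square of the last
  -- integral by `|J| ∫ S ^ p`, and dividing by the finite `∫ S ^ p` leaves `K ^ 2 |J|`. Hölder's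
  -- inequality then returns to the first moment of `S`.
  have hU := ENNReal.le_sq_mul_of_le_mul hUfin h hcs
  have hV := setLIntegral_rpow_le hp hSm
  have h0 := (volume_pos_of_mem_gen hJ).ne'
  have htop := (volume_lt_top_of_mem_gen hJ).ne
  rw [← ENNReal.rpow_le_rpow_iff hp0]
  refine hV.trans ((mul_le_mul_left hU _).trans_eq ?_)
  have e3 : (((C ^ (2 / p) : ℝ≥0)) : ℝ≥0∞) ^ p = (C : ℝ≥0∞) ^ (2 : ℝ) := by
    rw [ENNReal.coe_rpow_of_nonneg _ (by positivity), ← ENNReal.rpow_mul, div_mul_cancel₀ _ hp0.ne']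
  have e4 : volume J * volume J ^ (p - 1) = volume J ^ p := by
    rw [ENNReal.rpow_sub _ _ h0 htop, ENNReal.rpow_one, ENNReal.mul_div_cancel h0 htop]
  rw [ENNReal.mul_rpow_of_nonneg _ _ hp0.le, ENNReal.mul_rpow_of_nonneg _ _ hp0.le, e3, ← e4,
    ENNReal.mul_rpow_of_nonneg _ _ (by norm_num), ← ENNReal.rpow_mul, ← ENNReal.rpow_mul, mul_comm p 2]
  ring

/-! #### Bounds for the jumps -/

theorem IsRank.realVolume_child_lt {P : Set ℝ} (hP : L.IsRank P k) (hJ : J ∈ L.child P) :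
    volume.real J < volume.real P := by
  rw [hP.child_eq] at hJ
  obtain ⟨hJg, hJP⟩ := hJ
  obtain ⟨y, hyP, hyJ⟩ : ∃ y ∈ P, y ∉ J := by
    by_contra! h
    have : J = P := hJP.antisymm h
    exact (isRank_iff.1 hP).2 (this ▸ hJg)
  have hyc := subset_carrier hP.1 hyP
  have hK := atom_mem_gen hyc (k + 1)
  have hd : Disjoint (L.atom (k + 1) y) J := by
    refine L.disjoint (k + 1) hK hJg fun e => hyJ ?_
    rw [← e]
    exact mem_atom hyc _
  have h1 : volume.real (L.atom (k + 1) y ∪ J) = volume.real (L.atom (k + 1) y) + volume.real J :=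
    measureReal_union hd (measurableSet_of_mem_gen hJg) (volume_lt_top_of_mem_gen hK).ne
      (volume_lt_top_of_mem_gen hJg).ne
  have h2 : volume.real (L.atom (k + 1) y ∪ J) ≤ volume.real P :=
    measureReal_mono (Set.union_subset (atom_subset hP.1 (by omega) hyP) hJP)
      (volume_lt_top_of_mem_gen hP.1).ne
  have h3 := realVolume_pos_of_mem_gen hK
  linarith

/-- The value `-t` with `t = ratio P J` on `P \ J` compensates the value `1` on `J`. -/
def ratio (P J : Set ℝ) : ℝ := volume.real J / (volume.real P - volume.real J)

theorem IsRank.ratio_mul {P : Set ℝ} (hP : L.IsRank P k) (hJ : J ∈ L.child P) :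
    ratio P J * (volume.real P - volume.real J) = volume.real J :=
  div_mul_cancel₀ _ (sub_pos.2 (hP.realVolume_child_lt hJ)).ne'

theorem IsRank.ratio_nonneg {P : Set ℝ} (hP : L.IsRank P k) (hJ : J ∈ L.child P) : 0 ≤ ratio P J :=
  div_nonneg measureReal_nonneg (sub_pos.2 (hP.realVolume_child_lt hJ)).le

theorem IsRank.integral_testFun {P : Set ℝ} (hP : L.IsRank P k) (hJ : J ∈ L.child P) :
    ∫ x, testFun 𝕜 P J (ratio P J) x = 0 := by
  have hJ' := hJ
  rw [hP.child_eq] at hJ'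
  have hPm := measurableSet_of_mem_gen hP.1
  have hJm := measurableSet_of_mem_gen hJ'.1
  have hPt := (volume_lt_top_of_mem_gen hP.1).ne
  have hJt := (volume_lt_top_of_mem_gen hJ'.1).ne
  have hi : ∀ {S : Set ℝ} (a : 𝕜), MeasurableSet S → volume S ≠ ∞ →
      Integrable (S.indicator fun _ => a) volume := fun a hS hSt =>
    (integrable_indicator_iff hS).2 (integrableOn_const hSt)
  rw [testFun, integral_add' (hi _ hPm hPt) (hi _ hJm hJt), integral_indicator_const _ hPm,
    integral_indicator_const _ hJm, RCLike.real_smul_eq_coe_mul, RCLike.real_smul_eq_coe_mul]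
  have : (ratio P J : 𝕜) * ((volume.real P : ℝ) - (volume.real J : ℝ)) = (volume.real J : ℝ) := by
    exact_mod_cast congrArg (fun s : ℝ => (s : 𝕜)) (hP.ratio_mul hJ)
  linear_combination -this

theorem testFun_of_notMem {P : Set ℝ} {t : ℝ} (hJP : J ⊆ P) (hx : x ∉ P) : testFun 𝕜 P J t x = 0 := by
  rw [testFun, Pi.add_apply, Set.indicator_of_notMem hx, Set.indicator_of_notMem fun h => hx (hJP h),
    add_zero]

theorem testFun_of_mem_diff {P : Set ℝ} {t : ℝ} (hx : x ∈ P) (hxJ : x ∉ J) :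
    testFun 𝕜 P J t x = -(t : 𝕜) := by
  rw [testFun, Pi.add_apply, Set.indicator_of_mem hx, Set.indicator_of_notMem hxJ, add_zero]

theorem isMartDiffSeq_of_testFun {c : L.intervals → ℝ → 𝕜}
    (h : ∀ P, c P = 0 ∨ ∃ k, L.IsRank P k ∧ ∃ J ∈ L.child P, ∃ a : 𝕜,
      c P = fun x => a * testFun 𝕜 P J (ratio P J) x) : L.IsMartDiffSeq c := by
  intro P
  rcases h P with h | ⟨k, hk, J, hJ, a, h⟩
  · rw [h]
    simp
  · have hJ' := hJ
    rw [hk.child_eq] at hJ'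
    rw [h, hk.sUnion_child]
    beta_reduce
    refine ⟨fun x hx => by rw [testFun_of_notMem hJ'.2 hx, mul_zero], fun I hI x hx y hy => ?_, ?_⟩
    · rw [hk.child_eq] at hI
      rw [atomConst_testFun hJ'.1 hk.1 (by omega) I hI.1 x hx y hy]
    · rw [integral_const_mul, hk.integral_testFun hJ, mul_zero]

/-- The part on `J` and the part on `P \ J` contribute at most `|J|` each. On `P \ J` this uses `t ≤
1`, which holds for children of at most half the length, so that `t ^ p ≤ t`. -/
theorem lintegral_testFun_le {P : Set ℝ} {p : ℝ} (hp : 1 ≤ p) (hP : L.IsRank P k)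
    (hJ : J ∈ L.child P) (h : 2 * volume.real J ≤ volume.real P) :
    ∫⁻ x, ‖testFun 𝕜 P J (ratio P J) x‖ₑ ^ p ∂L.vol ≤ 2 * volume J := by
  have hp0 : 0 < p := by linarith
  have hJ' := hJ
  rw [hP.child_eq] at hJ'
  have hPm := measurableSet_of_mem_gen hP.1
  have hJm := measurableSet_of_mem_gen hJ'.1
  have hPt := (volume_lt_top_of_mem_gen hP.1).ne
  have ht0 := hP.ratio_nonneg hJ
  have ht1 : ratio P J ≤ 1 := div_le_one_of_le₀ (by linarith)
    (sub_pos.2 (hP.realVolume_child_lt hJ)).le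
  have hle : ∀ x, ‖testFun 𝕜 P J (ratio P J) x‖ₑ ^ p
      ≤ J.indicator (fun _ => 1) x + (P \ J).indicator (fun _ => ENNReal.ofReal (ratio P J)) x := by
    intro x
    by_cases hxP : x ∈ P
    · by_cases hxJ : x ∈ J
      · rw [testFun_of_mem hJ'.2 hxJ, Set.indicator_of_mem hxJ]
        simp
      · have hxm : x ∈ P \ J := ⟨hxP, hxJ⟩
        rw [testFun_of_mem_diff hxP hxJ, Set.indicator_of_mem hxm, enorm_neg, ← ofReal_norm,
          RCLike.norm_ofReal, abs_of_nonneg ht0, ENNReal.ofReal_rpow_of_nonneg ht0 hp0.le]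
        refine le_trans (ENNReal.ofReal_le_ofReal ?_) le_add_self
        exact (Real.rpow_le_rpow_of_exponent_ge' ht0 ht1 zero_le_one hp).trans_eq (Real.rpow_one _)
    · rw [testFun_of_notMem hJ'.2 hxP]
      simp [hp0]
  refine (lintegral_mono hle).trans ?_
  rw [lintegral_add_left (measurable_const.indicator hJm), lintegral_indicator_const hJm,
    lintegral_indicator_const (hPm.diff hJm), vol_apply hJ'.1, vol,
    Measure.restrict_apply (hPm.diff hJm),
    Set.inter_eq_left.2 (Set.sdiff_subset.trans (subset_carrier hP.1))]
  have : volume.real (P \ J) = volume.real P - volume.real J := measureReal_sdiff hJ'.2 hJm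
  rw [← ENNReal.ofReal_toReal (measure_ne_top_of_subset Set.sdiff_subset hPt), ← measureReal_def,
    this, ← ENNReal.ofReal_mul ht0, hP.ratio_mul hJ, measureReal_def,
    ENNReal.ofReal_toReal (volume_lt_top_of_mem_gen hJ'.1).ne]
  rw [one_mul, two_mul]

/-- The test sequence has one nonzero difference, equal to `1` on `J`. The output is `b P` on `J`,
while the input costs only a multiple of `|J|`, so the value of `b P` on `J` is bounded. -/
theorem exists_norm_le_of_small_child {p : ℝ} (hp : 1 < p) : ∃ C : ℝ≥0, 0 < C ∧
    ∀ (L : IntervalLattice) (b : L.intervals → ℝ → 𝕜), L.IsMartDiffSeq b →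
      ∀ A : ℝ≥0, L.ExtParaBoundedBy p b A → ∀ (P : L.intervals) (k : ℤ), L.IsRank P k →
        ∀ J ∈ L.child P, 2 * volume.real J ≤ volume.real (P : Set ℝ) → ∀ x ∈ J,
          ‖b P x‖ ≤ C * A := by
  classical
  have hp0 : 0 < p := by linarith
  obtain ⟨C, hC, hmain⟩ := exists_lintegral_sum_mul_le (𝕜 := 𝕜) hp
  refine ⟨(C * 2) ^ (1 / p), NNReal.rpow_pos (by positivity), ?_⟩
  intro L b hb A hA P k hP J hJ hJP x hx
  have hJ' := hJ
  rw [hP.child_eq] at hJ'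
  set c : L.intervals → ℝ → 𝕜 := fun Q => if Q = P then testFun 𝕜 P J (ratio P J) else 0 with hc
  have hcP : c P = testFun 𝕜 P J (ratio P J) := if_pos rfl
  have hcm : L.IsMartDiffSeq c := isMartDiffSeq_of_testFun fun Q => by
    by_cases h : Q = P
    · subst h
      exact Or.inr ⟨k, hP, J, hJ, 1, by rw [hcP]; simp⟩
    · exact Or.inl (if_neg h)
  have h := hmain L b hb A hA c hcm {P} fun Q hQ => if_neg (by simpa using hQ)
  simp only [Finset.sum_singleton, hcP] at h
  have e : ∀ x, (‖testFun 𝕜 P J (ratio P J) x‖ₑ ^ (2 : ℝ)) ^ (p / 2)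
      = ‖testFun 𝕜 P J (ratio P J) x‖ₑ ^ p := fun x => by
    rw [← ENNReal.rpow_mul, mul_div_cancel₀ p (two_ne_zero' ℝ)]
  simp only [e] at h
  have h1 : ‖b P x‖ₑ ^ p * volume J ≤ C * (A : ℝ≥0∞) ^ p * (2 * volume J) := by
    refine le_trans ?_ (h.trans (mul_le_mul_right (lintegral_testFun_le hp.le hP hJ hJP) _))
    refine le_trans ?_ (setLIntegral_le_lintegral J _)
    rw [vol_restrict hJ'.1, setLIntegral_congr_fun (measurableSet_of_mem_gen hJ'.1)
      (g := fun _ => ‖b P x‖ₑ ^ p) fun y hy => by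
        simp only
        rw [testFun_of_mem hJ'.2 hy, mul_one, (hb P).2.1 J hJ y hy x hx], setLIntegral_const]
  rw [← mul_assoc, ENNReal.mul_le_mul_iff_left (volume_pos_of_mem_gen hJ'.1).ne'
    (volume_lt_top_of_mem_gen hJ'.1).ne] at h1
  have h2 : ‖b P x‖₊ ^ p ≤ C * A ^ p * 2 := by
    rw [enorm_eq_nnnorm, ← ENNReal.coe_rpow_of_nonneg _ hp0.le, ← ENNReal.coe_rpow_of_nonneg _ hp0.le] at h1
    exact_mod_cast h1
  have h3 : ‖b P x‖₊ ≤ (C * 2) ^ (1 / p) * A := by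
    rw [← NNReal.rpow_le_rpow_iff hp0, NNReal.mul_rpow, ← NNReal.rpow_mul, one_div_mul_cancel hp0.ne',
      NNReal.rpow_one]
    exact h2.trans_eq (by ring)
  exact_mod_cast h3

/-- At most one child can be longer than half of `P`. On that child the value is determined by the
others, because the integral of `b P` is zero. -/
theorem norm_le_of_small_child {b : L.intervals → ℝ → 𝕜} (hb : L.IsMartDiffSeq b) {P : L.intervals}
    (hP : L.IsRank P k) {B : ℝ} (hB : 0 ≤ B)
    (h : ∀ J ∈ L.child P, 2 * volume.real J ≤ volume.real (P : Set ℝ) → ∀ x ∈ J, ‖b P x‖ ≤ B)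
    (x : ℝ) : ‖b P x‖ ≤ B := by
  by_cases hx : x ∈ (P : Set ℝ)
  swap
  · rw [hb.eq_zero_of_notMem hx, norm_zero]
    exact hB
  have hxc := subset_carrier hP.1 hx
  obtain ⟨J, hJe⟩ : ∃ J, J = L.atom (k + 1) x := ⟨_, rfl⟩
  have hJ : J ∈ L.child P := hJe ▸ hP.atom_mem_child hx
  have hxJ : x ∈ J := hJe ▸ mem_atom hxc _
  by_cases hJP : 2 * volume.real J ≤ volume.real (P : Set ℝ)
  · exact h J hJ hJP x hxJ
  · have hJ' := hJ
    rw [hP.child_eq] at hJ'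
    have hJm := measurableSet_of_mem_gen hJ'.1
    have hPm := measurableSet_of_mem_gen hP.1
    have hPt := (volume_lt_top_of_mem_gen hP.1).ne
    have hJpos := realVolume_pos_of_mem_gen hJ'.1
    have hother : ∀ y ∈ (P : Set ℝ) \ J, ‖b P y‖ ≤ B := by
      intro y hy
      have hyc := subset_carrier hP.1 hy.1
      refine h _ (hP.atom_mem_child hy.1) ?_ y (mem_atom hyc _)
      have hd : Disjoint (L.atom (k + 1) y) J :=
        L.disjoint (k + 1) (atom_mem_gen hyc _) hJ'.1 fun e => hy.2 (e ▸ mem_atom hyc _)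
      have h1 : volume.real (L.atom (k + 1) y ∪ J) = volume.real (L.atom (k + 1) y) + volume.real J :=
        measureReal_union hd hJm (volume_lt_top_of_mem_gen (atom_mem_gen hyc _)).ne
          (volume_lt_top_of_mem_gen hJ'.1).ne
      have h2 : volume.real (L.atom (k + 1) y ∪ J) ≤ volume.real (P : Set ℝ) :=
        measureReal_mono (Set.union_subset (atom_subset hP.1 (by omega) hy.1) hJ'.2) hPt
      linarith
    have hint : IntegrableOn (b P) P := integrableOn_gen le_rfl (hb.memLp P _) hP.1
    have h0 : ∫ y in (P : Set ℝ), b P y = 0 := by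
      rw [← integral_indicator hPm, Set.indicator_eq_self.2 fun y hy => (hb.eq_zero hy).1]
      exact (hb P).2.2
    have hsplit : ∫ y in J, b P y = -∫ y in (P : Set ℝ) \ J, b P y := by
      rw [eq_neg_iff_add_eq_zero, ← h0, add_comm, setIntegral_sdiff hJm hint hJ'.2, sub_add_cancel]
    have e1 : ∫ y in J, b P y = (volume.real J : 𝕜) * b P x := by
      rw [setIntegral_congr_fun hJm (g := fun _ => b P x) fun y hy => (hb P).2.1 J hJ y hy x hxJ,
        setIntegral_const, RCLike.real_smul_eq_coe_mul]
    have e2 : ‖∫ y in (P : Set ℝ) \ J, b P y‖ ≤ B * volume.real ((P : Set ℝ) \ J) :=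
      norm_setIntegral_le_of_norm_le_const
        (measure_ne_top_of_subset Set.sdiff_subset hPt).lt_top hother
    rw [← norm_neg, ← hsplit, e1, norm_mul, RCLike.norm_ofReal, abs_of_pos hJpos,
      measureReal_sdiff hJ'.2 hJm] at e2
    -- The rest of `P` is shorter than `J`.
    have : volume.real J * ‖b P x‖ ≤ volume.real J * B := by nlinarith
    exact le_of_mul_le_mul_left this hJpos

/-- A child `I ⊆ J` that contributes has a parent inside `J`, or it is `J` itself with a larger
parent. The first kind is the square sum tested on conjugates; for the second there is at most one
generation, and its contribution is a bounded jump. -/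
theorem exists_bmoENorm_le_of_extParaBoundedBy {p : ℝ} (hp : 1 < p) : ∃ C : ℝ≥0, 0 < C ∧
    ∀ (L : IntervalLattice) (b : L.intervals → ℝ → 𝕜), L.IsMartDiffSeq b →
      ∀ A : ℝ≥0, L.ExtParaBoundedBy p b A → L.bmoENorm 2 b ≤ C * A := by
  classical
  obtain ⟨C, hC, hmain⟩ := exists_setLIntegral_sum_sq_le (𝕜 := 𝕜) hp
  obtain ⟨D, hD, hjump⟩ := exists_norm_le_of_small_child (𝕜 := 𝕜) hp
  refine ⟨(C + D ^ (2 : ℝ)) ^ (1 / 2 : ℝ), NNReal.rpow_pos (by positivity), ?_⟩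
  intro L b hb A hA
  rw [bmoENorm_le_iff]
  intro k J hJ
  have hterm : ∀ j x, ‖L.term b j x‖ₑ ≤ D * A := by
    intro j x
    rw [term]
    split_ifs with h
    · have := norm_le_of_small_child hb (P := ⟨L.atom j x, mem_intervals h.1⟩) h (B := D * A)
        (by positivity) (hjump L b hb A hA _ j h) x
      rw [enorm_eq_nnnorm]
      exact_mod_cast this
    · simp
  have hle : ∀ x ∈ J, (∑' j, if L.atom (j + 1) x ⊆ J then ‖L.term b j x‖ₑ ^ (2 : ℝ) else 0)
      ≤ (∑' P : L.intervals, if (P : Set ℝ) ⊆ J then ‖b P x‖ₑ ^ (2 : ℝ) else 0)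
        + ((D : ℝ≥0∞) * A) ^ (2 : ℝ) := by
    intro x hx
    have hxc := subset_carrier hJ hx
    rw [tsum_term_subset hb (fun a => ‖a‖ₑ ^ (2 : ℝ)) (by simp)]
    calc _ ≤ ∑' j, ((if L.atom j x ⊆ J then ‖L.term b j x‖ₑ ^ (2 : ℝ) else 0)
          + if L.atom (j + 1) x ⊆ J ∧ ¬ L.atom j x ⊆ J then ‖L.term b j x‖ₑ ^ (2 : ℝ) else 0) := by
          refine ENNReal.tsum_le_tsum fun j => ?_
          by_cases h1 : L.atom (j + 1) x ⊆ J <;> by_cases h2 : L.atom j x ⊆ J <;> simp [h1, h2]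
      _ = _ := ENNReal.tsum_add
      _ ≤ _ := by
          refine add_le_add_right (ENNReal.tsum_le_of_unique (fun j => ?_) fun i j hi hj => ?_) _
          · split_ifs
            · exact ENNReal.rpow_le_rpow (hterm j x) (by norm_num)
            · exact zero_le
          · have hi' := (ite_ne_right_iff.1 hi).1
            have hj' := (ite_ne_right_iff.1 hj).1
            by_contra hne
            rcases lt_or_gt_of_ne hne with h | h
            · exact hj'.2 ((atom_anti hxc (Int.add_one_le_iff.2 h)).trans hi'.1)
            · exact hi'.2 ((atom_anti hxc (Int.add_one_le_iff.2 h)).trans hj'.1)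
  have hsum : ∫⁻ x in J, ∑' P : L.intervals, (if (P : Set ℝ) ⊆ J then ‖b P x‖ₑ ^ (2 : ℝ) else 0)
      ≤ C * (A : ℝ≥0∞) ^ (2 : ℝ) * volume J := by
    have hm : ∀ P : L.intervals, AEMeasurable (fun x => ‖b P x‖ₑ ^ (2 : ℝ)) (volume.restrict J) := by
      intro P
      obtain ⟨i, hi⟩ := hb.exists_atomConst P
      have := (hi.aemeasurable.enorm.pow_const (2 : ℝ)).restrict (s := J)
      rwa [vol_restrict hJ] at this
    rw [lintegral_tsum fun P => by split_ifs; exacts [hm P, aemeasurable_const]]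
    rw [ENNReal.tsum_eq_iSup_sum]
    refine iSup_le fun F => ?_
    refine le_trans (le_of_eq ?_) (hmain L b hb A hA k J hJ (F.filter fun P => (P : Set ℝ) ⊆ J)
      fun P hP => (Finset.mem_filter.1 hP).2)
    rw [lintegral_finsetSum' _ fun P _ => hm P, Finset.sum_filter]
    refine Finset.sum_congr rfl fun P _ => ?_
    split_ifs <;> simp
  refine (setLIntegral_mono' (measurableSet_of_mem_gen hJ) hle).trans ?_
  rw [lintegral_add_right _ measurable_const, setLIntegral_const]
  refine (add_le_add_left hsum _).trans_eq ?_
  rw [ENNReal.mul_rpow_of_nonneg _ _ (by norm_num), ENNReal.mul_rpow_of_nonneg _ _ (by norm_num),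
    ← ENNReal.coe_rpow_of_nonneg _ (by norm_num : (0 : ℝ) ≤ 2), ← ENNReal.coe_rpow_of_nonneg _ (by norm_num : (0 : ℝ) ≤ 2),
    ← ENNReal.coe_rpow_of_nonneg _ (by norm_num : (0 : ℝ) ≤ 2), ← NNReal.rpow_mul, ← add_mul]
  congr 1
  norm_cast
  norm_num
  ring

end IntervalLattice

end

noncomputable section

/-- The geometric weights have sum one, so the series is at most the supremum of the weighted terms,
and the `r`-th power of a supremum is at most the sum of the powers. The loss `2 ^ (n + 1)` is
harmless here and allows every `r > 0`. -/
theorem ENNReal.tsum_rpow_le_tsum {r : ℝ} (hr : 0 < r) (y : ℕ → ℝ≥0∞) :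
    (∑' n, y n) ^ r ≤ ∑' n, (2 ^ (n + 1) * y n) ^ r := by
  have h1 : ∀ n, y n ≤ (2⁻¹ : ℝ≥0∞) ^ (n + 1) * ⨆ m, 2 ^ (m + 1) * y m := by
    intro n
    calc y n = (2⁻¹ : ℝ≥0∞) ^ (n + 1) * (2 ^ (n + 1) * y n) := by
          rw [← mul_assoc, ← mul_pow, ENNReal.inv_mul_cancel (by norm_num) (by norm_num), one_pow,
            one_mul]
      _ ≤ _ := mul_le_mul_right (le_iSup (fun m => (2 : ℝ≥0∞) ^ (m + 1) * y m) n) _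
  have h2 : ∑' n, y n ≤ ⨆ m, 2 ^ (m + 1) * y m := by
    refine (ENNReal.tsum_le_tsum h1).trans_eq ?_
    rw [ENNReal.tsum_mul_right, ENNReal.tsum_geometric_add_one, ENNReal.one_sub_inv_two, inv_inv,
      ENNReal.inv_mul_cancel (by norm_num) (by norm_num), one_mul]
  rw [← ENNReal.le_rpow_inv_iff hr]
  refine h2.trans (iSup_le fun m => ?_)
  rw [ENNReal.le_rpow_inv_iff hr]
  exact ENNReal.le_tsum m

namespace IntervalLattice

variable {L : IntervalLattice} {I J Q : Set ℝ} {j k l N : ℤ} {x x₀ y : ℝ} {α : Type*}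
  {𝕜 : Type*} [RCLike 𝕜]

/-! ### BMO is sufficient for the paraproduct -/

/-- The testing condition sums over all `J ⊆ I`, while the process starts at a generation `k`
containing `I`. An atom of an earlier generation inside `I` is `I` itself, which recurs in the next
generation and therefore has no difference there. -/
theorem term_eq_zero_of_lt {b : L.intervals → ℝ → 𝕜} (hI : I ∈ L.gen k) (hx : x ∈ I) (hj : j < k)
    (hs : L.atom j x ⊆ I) : L.term b j x = 0 := by
  have hxc := subset_carrier hI hx
  have e : L.atom j x = I := hs.antisymm (atom_eq hI hx ▸ atom_anti hxc hj.le)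
  have e' : L.atom (j + 1) x = I :=
    ((atom_anti hxc (by omega)).trans hs).antisymm
      (atom_eq hI hx ▸ atom_anti hxc (by omega : j + 1 ≤ k))
  rw [term, dif_neg]
  intro h
  refine (isRank_iff.1 h).2 ?_
  rw [e, ← e']
  exact atom_mem_gen hxc _

/-- A John–Nirenberg phenomenon: for weights known on the children, the first moment of `∑ |Δ b| ^
2` over every interval, jumps included, controls the moment of order `p / 2`. It is
`lintegral_adapted_carleson` with the indicator of `I` as constant multiplier. -/
theorem testConst_lt_top_of_bmoENorm_lt_top {p : ℝ} (hp : 1 ≤ p) {b : L.intervals → ℝ → 𝕜}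
    (hb : L.IsMartDiffSeq b) (h : L.bmoENorm 2 b < ∞) : L.testConst p 2 b < ∞ := by
  classical
  have hp0 : 0 < p := by linarith
  have hr : 0 < p / 2 := by positivity
  obtain ⟨A, hA, hbmo⟩ : ∃ A : ℝ≥0, 0 < A ∧ L.bmoENorm 2 b ≤ A := by
    lift L.bmoENorm 2 b to ℝ≥0 using h.ne with K
    exact ⟨K + 1, by positivity, by simp⟩
  rw [bmoENorm_le_iff] at hbmo
  have hA' : 0 < (A : ℝ) ^ 2 := by positivity
  obtain ⟨D, hD⟩ : ∃ D : ℝ, D = (2 * (2 * (p / 2)) ^ (p / 2) + 2 * carlesonConst (p / 2))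
    * ((A : ℝ) ^ 2) ^ (p / 2) := ⟨_, rfl⟩
  have key : ∀ k, ∀ I ∈ L.gen k,
      ∫⁻ x in I, (∑' j, if L.atom j x ⊆ I then ‖L.term b j x‖ₑ ^ (2 : ℝ) else 0) ^ (p / 2)
        ≤ ENNReal.ofReal D * volume I := by
    intro k I hI
    have hIm := measurableSet_of_mem_gen hI
    set β : ℕ → ℝ → ℝ := fun n x => ‖L.term b (k + n) x‖ ^ 2 with hβ
    set Φ : ℝ → ℝ := I.indicator fun _ => 1 with hΦ
    have hβc : ∀ n : ℕ, L.AtomConst (k + 1 + n) (β n) := fun n =>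
      ((atomConst_term hb (k + n)).mono (by omega)).comp fun z => ‖z‖ ^ 2
    have hΦc : ∀ n : ℕ, L.AtomConst (k + 1 + n) Φ := fun n =>
      atomConst_indicator hI (by omega) fun _ _ _ _ _ _ => rfl
    have hΦ0 : ∀ x, 0 ≤ Φ x := fun x => Set.indicator_nonneg (fun _ _ => zero_le_one) x
    have hβ0 : ∀ n x, 0 ≤ β n x := fun n x => sq_nonneg _
    have hβe : ∀ n x, ENNReal.ofReal (β n x) = ‖L.term b (k + n) x‖ₑ ^ (2 : ℝ) := fun n x => by
      rw [ENNReal.ofReal_pow (norm_nonneg _), ofReal_norm, ENNReal.rpow_two]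
    have h1 : ∀ M : ℕ, ∫⁻ x, ENNReal.ofReal ((∑ n ∈ Finset.range (M + 1), Φ x * β n x) ^ (p / 2))
        ∂L.vol ≤ ENNReal.ofReal D * volume I := by
      intro M
      -- The filtration starts at `k + 1`, where the first weight `|Δ_k b| ^ 2` is already adapted;
      -- the BMO test at these generations includes the jump of the parent.
      have := lintegral_adapted_carleson (L := L) (N := k + 1) (M := M) (Φ := fun _ => Φ) hr hA'
        hΦc (fun _ => hΦ0) (fun _ _ => le_rfl) hβc hβ0 ?_
      · refine this.trans_eq ?_
        rw [hD]
        congr 1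
        have e : ∀ x, ENNReal.ofReal (Φ x ^ (p / 2)) = I.indicator (fun _ => 1) x := by
          intro x
          by_cases hx : x ∈ I
          · simp [hΦ, hx]
          · simp [hΦ, hx, hr.ne']
        simp only [e]
        rw [lintegral_indicator_const hIm, one_mul, vol_apply hI]
      · intro n _ I' hI'
        refine (setLIntegral_mono' (measurableSet_of_mem_gen hI') fun x hx => ?_).trans
          ((hbmo _ I' hI').trans_eq ?_)
        · rw [ENNReal.ofReal_sum_of_nonneg fun n _ => hβ0 n x]
          refine le_trans (Finset.sum_le_sum fun i hi => ?_) (ENNReal.sum_add_natCast_le_tsum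
            (fun j => if L.atom (j + 1) x ⊆ I' then ‖L.term b j x‖ₑ ^ (2 : ℝ) else 0) k _)
          rw [if_pos (atom_subset hI' (by have := (Finset.mem_Ico.1 hi).1; omega) hx), hβe]
        · rw [ENNReal.ofReal_pow A.coe_nonneg, ENNReal.ofReal_coe_nnreal, ENNReal.rpow_two]
    have h2 : ∫⁻ x, (∑' n : ℕ, ENNReal.ofReal (Φ x * β n x)) ^ (p / 2) ∂L.vol
        ≤ ENNReal.ofReal D * volume I := by
      have hne : ENNReal.ofReal D * volume I ≠ ∞ :=
        ENNReal.mul_ne_top ENNReal.ofReal_ne_top (volume_lt_top_of_mem_gen hI).ne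
      refine lintegral_le_of_le_liminf (fun M => ?_) (fun x _ => ?_) h1
      · have : L.AtomConst (k + 1 + M)
            fun x => ENNReal.ofReal ((∑ n ∈ Finset.range (M + 1), Φ x * β n x) ^ (p / 2)) :=
          (AtomConst.sum fun n hn => (hΦc M).comp₂
            ((hβc n).mono (by have := Finset.mem_range.1 hn; omega)) (· * ·)).comp
              fun t => ENNReal.ofReal (t ^ (p / 2))
        exact this.aemeasurable
      · have ht : Tendsto (fun M : ℕ => ENNReal.ofReal
            ((∑ n ∈ Finset.range (M + 1), Φ x * β n x) ^ (p / 2))) atTop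
            (𝓝 ((∑' n : ℕ, ENNReal.ofReal (Φ x * β n x)) ^ (p / 2))) := by
          have h3 := (ENNReal.continuous_rpow_const (y := p / 2)).tendsto _ |>.comp
            ((ENNReal.tendsto_nat_tsum fun n => ENNReal.ofReal (Φ x * β n x)).comp
              (tendsto_add_atTop_nat 1))
          refine h3.congr fun M => ?_
          simp only [Function.comp]
          rw [← ENNReal.ofReal_sum_of_nonneg fun n _ => mul_nonneg (hΦ0 x) (hβ0 n x),
            ENNReal.ofReal_rpow_of_nonneg (Finset.sum_nonneg fun n _ =>
              mul_nonneg (hΦ0 x) (hβ0 n x)) hr.le]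
        rw [ht.liminf_eq]
    refine le_trans ?_ ((setLIntegral_le_lintegral I _).trans h2)
    rw [vol_restrict hI]
    refine setLIntegral_mono' hIm fun x hx => ENNReal.rpow_le_rpow (le_of_eq ?_) hr.le
    rw [tsum_int_eq_tsum_nat k]
    · refine tsum_congr fun n => ?_
      rw [if_pos (atom_subset hI (by omega) hx), hΦ, Set.indicator_of_mem hx, one_mul, hβe]
    · intro j hj
      split_ifs with hs
      · rw [term_eq_zero_of_lt hI hx hj hs]
        simp
      · rfl
  have : L.testConst p 2 b ≤ ENNReal.ofReal D ^ (1 / p) := by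
    rw [testConst_le_iff hp0 two_pos hb]
    intro k I hI
    rw [← ENNReal.rpow_mul, one_div_mul_cancel hp0.ne', ENNReal.rpow_one]
    exact key k I hI
  exact this.trans_lt (ENNReal.rpow_lt_top_of_nonneg (by positivity) ENNReal.ofReal_ne_top)

/-! ### Non-homogeneous lattices -/

/-- Disjoint subintervals of length at least `|I| / C` number at most `C`. So comparability of
lengths alone is homogeneity, and its failure always produces short children. -/
theorem encard_children_le {C : ℝ≥0} (h : ∀ k, ∀ I ∈ L.gen k, ∀ J ∈ L.gen (k + 1), J ⊆ I →
    volume I ≤ C * volume J) (hI : I ∈ L.gen k) :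
    {J | J ∈ L.gen (k + 1) ∧ J ⊆ I}.encard ≤ ⌈C⌉₊ := by
  have hfin := finite_cells hI (show k ≤ k + 1 by omega)
  have hpos := volume_pos_of_mem_gen hI
  have htop := (volume_lt_top_of_mem_gen hI).ne
  have hsum : ∑ J ∈ hfin.toFinset, volume J ≤ volume I := by
    rw [← measure_biUnion_finset]
    · exact measure_mono (Set.iUnion₂_subset fun J hJ => ((hfin.mem_toFinset).1 hJ).2)
    · intro J hJ J' hJ' hne
      exact L.disjoint (k + 1) ((hfin.mem_toFinset).1 hJ).1 ((hfin.mem_toFinset).1 hJ').1 hne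
    · exact fun J hJ => measurableSet_of_mem_gen ((hfin.mem_toFinset).1 hJ).1
  have h1 : hfin.toFinset.card * volume I ≤ C * volume I := by
    calc _ = ∑ _J ∈ hfin.toFinset, volume I := by rw [Finset.sum_const, nsmul_eq_mul]
      _ ≤ ∑ J ∈ hfin.toFinset, C * volume J := Finset.sum_le_sum fun J hJ =>
          h k I hI J ((hfin.mem_toFinset).1 hJ).1 ((hfin.mem_toFinset).1 hJ).2
      _ = C * ∑ J ∈ hfin.toFinset, volume J := by rw [Finset.mul_sum]
      _ ≤ _ := mul_le_mul_right hsum _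
  rw [ENNReal.mul_le_mul_iff_left hpos.ne' htop] at h1
  have h2 : (hfin.toFinset.card : ℝ≥0) ≤ C := by exact_mod_cast h1
  rw [hfin.encard_eq_coe_toFinset_card]
  exact_mod_cast h2.trans (Nat.le_ceil C)

theorem exists_small_child (hL : ¬ L.IsHomogeneous) {w : ℝ} (hw : 1 ≤ w) :
    ∃ k P J, L.IsRank P k ∧ J ∈ L.child P ∧ w * volume.real J < volume.real P := by
  by_contra! hcon
  refine hL ⟨?_, ?_⟩
  on_goal 1 => refine ⟨⌈w.toNNReal⌉₊, fun k I hI => encard_children_le (C := w.toNNReal) ?_ hI⟩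
  on_goal 2 => refine ⟨w.toNNReal, ?_⟩
  all_goals
    intro k I hI J hJ hJI
    have hIt := (volume_lt_top_of_mem_gen hI).ne
    have hJt := (volume_lt_top_of_mem_gen hJ).ne
    have : volume.real I ≤ w * volume.real J := by
      by_cases hr : L.IsRank I k
      · exact hcon k I J hr (by rw [hr.child_eq]; exact ⟨hJ, hJI⟩)
      · have hI1 : I ∈ L.gen (k + 1) := by
          by_contra h
          exact hr (isRank_iff.2 ⟨hI, h⟩)
        obtain ⟨y, hy⟩ := nonempty_of_mem_gen hJ
        have e : I = J := by rw [← atom_eq hI1 (hJI hy), ← atom_eq hJ hy]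
        rw [e]
        exact le_mul_of_one_le_left measureReal_nonneg hw
    rw [← ENNReal.ofReal_toReal hIt, ← ENNReal.ofReal_toReal hJt]
    change _ ≤ ENNReal.ofReal w * _
    rw [← ENNReal.ofReal_mul (by linarith)]
    exact ENNReal.ofReal_le_ofReal this

variable (L) in
/-- A sequence of intervals `P n`, each with a child `J n` that is very short compared to `P n`. -/
structure ShortChildSeq where
  P : ℕ → Set ℝ
  J : ℕ → Set ℝ
  rank : ℕ → ℤ
  isRank : ∀ n, L.IsRank (P n) (rank n)
  mem_child : ∀ n, J n ∈ L.child (P n)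
  lt : ∀ n, 2 * (n.factorial : ℝ) * volume.real (J n) < volume.real (P n)

theorem exists_shortChildSeq (hL : ¬ L.IsHomogeneous) : Nonempty (ShortChildSeq L) := by
  have h : ∀ n : ℕ, (1 : ℝ) ≤ 2 * (n.factorial : ℝ) := fun n => by
    have : (1 : ℝ) ≤ n.factorial := by exact_mod_cast n.factorial_pos
    linarith
  choose k P J h1 h2 h3 using fun n => exists_small_child hL (h n)
  exact ⟨⟨P, J, k, h1, h2, h3⟩⟩

namespace ShortChildSeq

variable (s : ShortChildSeq L)

open Classical in
/-- An index of an interval of the sequence. -/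
def idx (Q : Set ℝ) : ℕ := if h : ∃ n, s.P n = Q then h.choose else 0

theorem P_idx {Q : Set ℝ} (h : ∃ n, s.P n = Q) : s.P (s.idx Q) = Q := by
  rw [idx, dif_pos h]
  exact h.choose_spec

/-- The term of index `n`, without its coefficient. -/
def base (𝕜 : Type*) [RCLike 𝕜] (n : ℕ) : ℝ → 𝕜 :=
  testFun 𝕜 (s.P n) (s.J n) (ratio (s.P n) (s.J n))

open Classical in
/-- The martingale difference sequence with the terms `2 ^ n (1_J - t 1_{P \ J})`. -/
def seq (𝕜 : Type*) [RCLike 𝕜] (Q : L.intervals) : ℝ → 𝕜 :=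
  if ∃ n, s.P n = Q then fun x => 2 ^ s.idx Q * s.base 𝕜 (s.idx Q) x else 0

theorem isMartDiffSeq : L.IsMartDiffSeq (s.seq 𝕜) := by
  refine isMartDiffSeq_of_testFun fun Q => ?_
  by_cases h : ∃ n, s.P n = Q
  · have e := s.P_idx h
    have h1 := s.isRank (s.idx Q)
    have h2 := s.mem_child (s.idx Q)
    rw [e] at h1 h2
    refine Or.inr ⟨s.rank (s.idx Q), h1, s.J (s.idx Q), h2, 2 ^ s.idx Q, ?_⟩
    rw [seq, if_pos h, base, e]
  · exact Or.inl (if_neg h)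

theorem mem_gen_J (n : ℕ) : s.J n ∈ L.gen (s.rank n + 1) := ((s.isRank n).child_eq.subset (s.mem_child n)).1

theorem J_subset (n : ℕ) : s.J n ⊆ s.P n := ((s.isRank n).child_eq.subset (s.mem_child n)).2

/-- The intervals of the sequence may repeat, and a repeated interval carries the coefficient of its
chosen index only. Those indices are unbounded: finitely many intervals have finitely many children,
so their length ratios are bounded, whereas the ratios in the sequence are not. -/
theorem exists_le_idx (N : ℕ) : ∃ n, s.idx (s.P n) = n ∧ N ≤ n := by
  by_contra! hcon
  have hidx : ∀ n, s.idx (s.P n) < N := fun n =>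
    hcon _ (by rw [s.P_idx ⟨n, rfl⟩])
  have hfin : (⋃ i ∈ Set.Iio N, (fun J => volume.real (s.P i) / volume.real J) '' L.child (s.P i)).Finite :=
    (Set.finite_Iio N).biUnion fun i _ => (s.isRank i).finite_child.image _
  obtain ⟨R, hR⟩ := hfin.bddAbove
  obtain ⟨n, hn⟩ := exists_nat_gt R
  have h1 : volume.real (s.P n) / volume.real (s.J n) ≤ R := by
    refine hR (Set.mem_biUnion (x := s.idx (s.P n)) (hidx n) ⟨s.J n, ?_, ?_⟩)
    · rw [s.P_idx ⟨n, rfl⟩]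
      exact s.mem_child n
    · simp only
      rw [s.P_idx ⟨n, rfl⟩]
  have hJ := realVolume_pos_of_mem_gen (s.mem_gen_J n)
  rw [div_le_iff₀ hJ] at h1
  have h2 := s.lt n
  have h3 : (n : ℝ) ≤ n.factorial := by exact_mod_cast n.self_le_factorial
  have h4 : (0 : ℝ) ≤ n.factorial := Nat.cast_nonneg _
  nlinarith

/-- On the child `J n` the jump is `2 ^ n`, and the average over `J n` itself sees it however short
`J n` is. -/
theorem bmoENorm_eq_top : L.bmoENorm 2 (s.seq 𝕜) = ∞ := by
  classical
  by_contra h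
  lift L.bmoENorm 2 (s.seq 𝕜) to ℝ≥0 using h with A hA
  have hbmo := bmoENorm_le_iff.1 hA.ge
  obtain ⟨N, hN⟩ := exists_nat_gt A
  obtain ⟨n, hn, hNn⟩ := s.exists_le_idx N
  have hJ := s.mem_gen_J n
  have h1 : (2 ^ n : ℝ≥0∞) ^ (2 : ℝ) * volume (s.J n) ≤ (A : ℝ≥0∞) ^ (2 : ℝ) * volume (s.J n) := by
    refine le_trans ?_ (hbmo _ _ hJ)
    rw [← setLIntegral_const]
    refine setLIntegral_mono' (measurableSet_of_mem_gen hJ) fun x hx => ?_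
    refine le_trans (le_of_eq ?_) (ENNReal.le_tsum (s.rank n))
    have e : L.atom (s.rank n) x = s.P n := atom_eq (s.isRank n).1 (s.J_subset n hx)
    have e2 : L.term (s.seq 𝕜) (s.rank n) x = 2 ^ n := by
      have : ∀ Q : L.intervals, (Q : Set ℝ) = s.P n → s.seq 𝕜 Q x = 2 ^ n := by
        intro Q hQ
        rw [seq, if_pos ⟨n, hQ.symm⟩, hQ, hn, base, testFun_of_mem (s.J_subset n) hx, mul_one]
      rw [term, dif_pos (e ▸ s.isRank n)]
      exact this _ e
    rw [atom_eq hJ hx, if_pos subset_rfl, e2]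
    congr 1
    rw [← ofReal_norm, norm_pow, RCLike.norm_two, ENNReal.ofReal_pow (by norm_num)]
    simp
  rw [ENNReal.mul_le_mul_iff_left (volume_pos_of_mem_gen hJ).ne' (volume_lt_top_of_mem_gen hJ).ne,
    ENNReal.rpow_le_rpow_iff (by norm_num)] at h1
  have h2 : (2 ^ n : ℝ≥0) ≤ A := by exact_mod_cast h1
  have h3 : ((n : ℕ) : ℝ≥0) < 2 ^ n := by exact_mod_cast n.lt_two_pow_self
  have h4 : (N : ℝ≥0) ≤ n := by exact_mod_cast hNn
  exact absurd (h2.trans_lt hN) (not_lt.2 (h4.trans h3.le))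

theorem lintegral_base_le {p : ℝ} (hp : 1 ≤ p) (n : ℕ) :
    ∫⁻ x, ‖s.base 𝕜 n x‖ₑ ^ p ∂L.vol ≤ (n.factorial : ℝ≥0∞)⁻¹ * volume (s.P n) := by
  have hf : (1 : ℝ) ≤ n.factorial := by exact_mod_cast n.factorial_pos
  have hl := s.lt n
  have hJ0 : 0 ≤ volume.real (s.J n) := measureReal_nonneg
  refine (lintegral_testFun_le hp (s.isRank n) (s.mem_child n) (by nlinarith)).trans ?_
  rw [mul_comm (_⁻¹), ← div_eq_mul_inv, ENNReal.le_div_iff_mul_le (Or.inl (by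
    exact_mod_cast n.factorial_ne_zero)) (Or.inl (by simp))]
  rw [← ENNReal.ofReal_toReal (volume_lt_top_of_mem_gen (s.isRank n).1).ne,
    ← ENNReal.ofReal_toReal (volume_lt_top_of_mem_gen (s.mem_gen_J n)).ne,
    ← measureReal_def, ← measureReal_def, ← ENNReal.ofReal_ofNat, ← ENNReal.ofReal_natCast,
    ← ENNReal.ofReal_mul (by norm_num), ← ENNReal.ofReal_mul (by positivity)]
  exact ENNReal.ofReal_le_ofReal (by linarith)

/-- In the testing condition the `n`-th difference counts only inside intervals containing `P n`,
where its `p`-th power integral has the factor `1 / n!` relative to `|P n|`. The factorial beats the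
exponential growth of the coefficients for every `p` at once, which is why one sequence serves all
exponents. -/
theorem testConst_lt_top {p : ℝ} (hp : 1 ≤ p) : L.testConst p 2 (s.seq 𝕜) < ∞ := by
  classical
  have hp0 : 0 < p := by linarith
  have hr : 0 < p / 2 := by positivity
  obtain ⟨S, hS⟩ : ∃ S : ℝ≥0∞, S = ∑' n : ℕ, ((2 : ℝ≥0∞) ^ (n + 1) * 4 ^ n) ^ (p / 2)
    * (n.factorial : ℝ≥0∞)⁻¹ := ⟨_, rfl⟩
  have hStop : S ≠ ∞ := by
    -- Since `2 ^ (n + 1) * 4 ^ n = 2 * 8 ^ n`, this is an exponential series at the point `8 ^ (p /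
    -- 2)`.
    have e : ∀ n : ℕ, ((2 : ℝ≥0∞) ^ (n + 1) * 4 ^ n) ^ (p / 2) * (n.factorial : ℝ≥0∞)⁻¹
        = ENNReal.ofReal (2 ^ (p / 2) * ((8 ^ (p / 2)) ^ n / n.factorial)) := by
      intro n
      have h8 : (2 : ℝ≥0∞) ^ (n + 1) * 4 ^ n = ENNReal.ofReal (2 * 8 ^ n) := by
        rw [ENNReal.ofReal_mul (by norm_num), ENNReal.ofReal_pow (by norm_num), pow_succ', mul_assoc,
          ← mul_pow, ENNReal.ofReal_ofNat, ENNReal.ofReal_ofNat]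
        norm_num
      rw [h8, ENNReal.ofReal_rpow_of_nonneg (by positivity) hr.le, ← ENNReal.ofReal_natCast,
        ← ENNReal.ofReal_inv_of_pos (by positivity), ← ENNReal.ofReal_mul (by positivity)]
      congr 1
      rw [Real.mul_rpow (by norm_num) (by positivity), ← Real.rpow_natCast_mul (by norm_num),
        mul_comm (n : ℝ), Real.rpow_mul_natCast (by norm_num), mul_assoc, ← div_eq_mul_inv]
    rw [hS]
    simp only [e]
    rw [← ENNReal.ofReal_tsum_of_nonneg (fun n => by positivity)
      ((Real.summable_pow_div_factorial _).mul_left _)]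
    exact ENNReal.ofReal_ne_top
  have hbase : ∀ n, ∃ k, L.AtomConst k (s.base 𝕜 n) := fun n =>
    ⟨_, atomConst_testFun (s.mem_gen_J n) (s.isRank n).1 (by omega)⟩
  have : L.testConst p 2 (s.seq 𝕜) ≤ S ^ (1 / p) := by
    rw [testConst_le_iff hp0 two_pos s.isMartDiffSeq]
    intro k I hI
    rw [← ENNReal.rpow_mul, one_div_mul_cancel hp0.ne', ENNReal.rpow_one]
    have hle : ∀ x, (∑' j, if L.atom j x ⊆ I then ‖L.term (s.seq 𝕜) j x‖ₑ ^ (2 : ℝ) else 0) ^ (p / 2)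
        ≤ ∑' n : ℕ, ((2 : ℝ≥0∞) ^ (n + 1) * 4 ^ n) ^ (p / 2) *
          (if s.P n ⊆ I then ‖s.base 𝕜 n x‖ₑ ^ p else 0) := by
      intro x
      rw [← tsum_term_subset s.isMartDiffSeq (fun a => ‖a‖ₑ ^ (2 : ℝ)) (by simp)]
      set y : ℕ → ℝ≥0∞ := fun n => if s.P n ⊆ I then 4 ^ n * ‖s.base 𝕜 n x‖ₑ ^ (2 : ℝ) else 0 with hy
      have h1 : (∑' Q : L.intervals, if (Q : Set ℝ) ⊆ I then ‖s.seq 𝕜 Q x‖ₑ ^ (2 : ℝ) else 0)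
          ≤ ∑' n, y n := by
        -- Each interval is counted at its chosen index; further indices of the same interval only
        -- enlarge the right-hand side.
        calc _ ≤ ∑' Q : L.intervals, ∑' n, if Q = ⟨s.P n, mem_intervals (s.isRank n).1⟩ then y n else 0 := by
              refine ENNReal.tsum_le_tsum fun Q => ?_
              by_cases h : ∃ n, s.P n = Q
              · have e := s.P_idx h
                refine le_trans (le_of_eq ?_) (ENNReal.le_tsum (s.idx Q))
                rw [if_pos (Subtype.ext e.symm)]
                simp only [hy, e]
                split_ifs
                · rw [seq, if_pos h, enorm_mul, ENNReal.mul_rpow_of_nonneg _ _ (by norm_num)]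
                  congr 1
                  rw [← ofReal_norm, norm_pow, RCLike.norm_two, ENNReal.ofReal_pow (by norm_num),
                    ENNReal.ofReal_ofNat, ENNReal.rpow_two, ← pow_mul, mul_comm, pow_mul]
                  norm_num
                · rfl
              · rw [seq, if_neg h]
                simp
          _ = ∑' n, ∑' Q : L.intervals, if Q = ⟨s.P n, mem_intervals (s.isRank n).1⟩ then y n else 0 :=
              ENNReal.tsum_comm
          _ = _ := tsum_congr fun n => tsum_ite_eq _ _
      refine (ENNReal.rpow_le_rpow h1 hr.le).trans ((ENNReal.tsum_rpow_le_tsum hr y).trans_eq ?_)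
      refine tsum_congr fun n => ?_
      simp only [hy]
      split_ifs
      · rw [← mul_assoc, ENNReal.mul_rpow_of_nonneg _ _ hr.le, ← ENNReal.rpow_mul,
          mul_div_cancel₀ p (two_ne_zero' ℝ)]
      · simp [hr]
    have hm : ∀ n, AEMeasurable (fun x => ‖s.base 𝕜 n x‖ₑ ^ p) (volume.restrict I) := by
      intro n
      obtain ⟨i, hi⟩ := hbase n
      have := (hi.aemeasurable.enorm.pow_const p).restrict (s := I)
      rwa [vol_restrict hI] at this
    have hm' : ∀ n, AEMeasurable (fun x => if s.P n ⊆ I then ‖s.base 𝕜 n x‖ₑ ^ p else 0)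
        (volume.restrict I) := by
      intro n
      split_ifs
      exacts [hm n, aemeasurable_const]
    refine (lintegral_mono hle).trans ?_
    rw [lintegral_tsum fun n => (hm' n).const_mul _, hS, ← ENNReal.tsum_mul_right]
    refine ENNReal.tsum_le_tsum fun n => ?_
    rw [lintegral_const_mul'' _ (hm' n), mul_assoc]
    refine mul_le_mul_right ?_ _
    split_ifs with h
    · refine le_trans ?_ ((s.lintegral_base_le (𝕜 := 𝕜) hp n).trans
        (mul_le_mul_right (measure_mono h) _))
      rw [← vol_restrict hI]
      exact setLIntegral_le_lintegral _ _
    · simp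
  exact this.trans_lt (ENNReal.rpow_lt_top_of_nonneg (by positivity) hStop)

end ShortChildSeq

end IntervalLattice

end

/-! ### The theorem -/

theorem theorem4 {𝕜 : Type*} [RCLike 𝕜] :
    -- the paraproduct and the testing condition
    (∀ p : ℝ, 1 ≤ p → ∃ c : ℝ≥0, 0 < c ∧ ∀ q : ℝ, 1 < q → ∃ C : ℝ≥0, 0 < C ∧
      ∀ (L : IntervalLattice) (b : L.intervals → ℝ → 𝕜), L.IsMartDiffSeq b →
        ((∃ A : ℝ≥0, L.ParaBoundedBy p q b A) ↔ L.testConst p q b < ∞) ∧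
        L.testConst p q b ≤ c * L.paraOpNorm p q b ∧
        L.paraOpNorm p q b ≤ C * L.testConst p q b ∧
        (1 < p → L.testConst p q b ≤ L.paraLpOpNorm p q b)) ∧
    -- the extended paraproduct and BMO
    (∀ p : ℝ, 1 < p → ∃ C : ℝ≥0, 0 < C ∧
      ∀ (L : IntervalLattice) (b : L.intervals → ℝ → 𝕜), L.IsMartDiffSeq b →
        ((∃ A : ℝ≥0, L.ExtParaBoundedBy p b A) ↔ L.bmoENorm 2 b < ∞) ∧
        L.bmoENorm 2 b ≤ C * L.extParaOpNorm p b ∧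
        L.extParaOpNorm p b ≤ C * L.bmoENorm 2 b) ∧
    -- BMO is sufficient for the boundedness of the paraproduct
    (∀ (L : IntervalLattice) (b : L.intervals → ℝ → 𝕜), L.IsMartDiffSeq b →
      L.bmoENorm 2 b < ∞ → ∀ p : ℝ, 1 ≤ p → ∃ A : ℝ≥0, L.ParaBoundedBy p 2 b A) ∧
    -- but not necessary, in every non-homogeneous lattice
    (∀ L : IntervalLattice, ¬ L.IsHomogeneous →
      ∃ b : L.intervals → ℝ → 𝕜, L.IsMartDiffSeq b ∧
        (∀ p : ℝ, 1 ≤ p → ∃ A : ℝ≥0, L.ParaBoundedBy p 2 b A) ∧ L.bmoENorm 2 b = ∞) := by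
  refine ⟨fun p hp => ?_, fun p hp => ?_, fun L b hb h p hp => ?_, fun L hL => ?_⟩
  -- The price of the test functions in `exists_testFun`, chosen before `q`.
  · refine ⟨((2 * 3 ^ p + 1) ^ (1 / p) : ℝ).toNNReal, by positivity, fun q hq => ?_⟩
    obtain ⟨C, hC, hbdd⟩ := IntervalLattice.exists_paraBoundedBy_of_testConst_le (𝕜 := 𝕜) hp hq
    refine ⟨C, hC, fun L b hb => ⟨⟨?_, ?_⟩, ?_, ?_, ?_⟩⟩
    · rintro ⟨A, hA⟩
      exact (IntervalLattice.testConst_le_of_paraBoundedBy hp hq hb hA).trans_lt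
        (ENNReal.mul_lt_top ENNReal.coe_lt_top ENNReal.coe_lt_top)
    · intro h
      lift L.testConst p q b to ℝ≥0 using h.ne with K hK
      -- The embedding needs a positive constant, and `K` may be zero.
      exact ⟨C * (K + 1), hbdd L b hb (K + 1) (by positivity) (hK ▸ by simp)⟩
    · exact ENNReal.le_mul_iInf_coe (by positivity) fun A hA =>
        IntervalLattice.testConst_le_of_paraBoundedBy hp hq hb hA
    · exact ENNReal.iInf_coe_le_mul hC (hbdd L b hb)
    · exact fun _ => le_iInf₂ fun A hA => IntervalLattice.testConst_le_of_paraLpBoundedBy hp hq hb hA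
  · obtain ⟨C, hC, hbdd⟩ := IntervalLattice.exists_extParaBoundedBy_of_bmoENorm_le (𝕜 := 𝕜) hp
    obtain ⟨D, hD, hbmo⟩ := IntervalLattice.exists_bmoENorm_le_of_extParaBoundedBy (𝕜 := 𝕜) hp
    refine ⟨max C D, by positivity, fun L b hb => ⟨⟨?_, ?_⟩, ?_, ?_⟩⟩
    · rintro ⟨A, hA⟩
      exact (hbmo L b hb A hA).trans_lt (ENNReal.mul_lt_top ENNReal.coe_lt_top ENNReal.coe_lt_top)
    · intro h
      lift L.bmoENorm 2 b to ℝ≥0 using h.ne with K hK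
      exact ⟨C * (K + 1), hbdd L b hb (K + 1) (by positivity) (hK ▸ by simp)⟩
    · refine (ENNReal.le_mul_iInf_coe hD (hbmo L b hb)).trans ?_
      exact mul_le_mul_left (by exact_mod_cast le_max_right C D) _
    · refine (ENNReal.iInf_coe_le_mul hC (hbdd L b hb)).trans ?_
      exact mul_le_mul_left (by exact_mod_cast le_max_left C D) _
  · obtain ⟨C, -, hbdd⟩ :=
      IntervalLattice.exists_paraBoundedBy_of_testConst_le (𝕜 := 𝕜) hp one_lt_two
    have h' := IntervalLattice.testConst_lt_top_of_bmoENorm_lt_top hp hb h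
    lift L.testConst p 2 b to ℝ≥0 using h'.ne with K hK
    exact ⟨C * (K + 1), hbdd L b hb (K + 1) (by positivity) (hK ▸ by simp)⟩
  · obtain ⟨s⟩ := IntervalLattice.exists_shortChildSeq hL
    refine ⟨s.seq 𝕜, s.isMartDiffSeq, fun p hp => ?_, s.bmoENorm_eq_top⟩
    obtain ⟨C, -, hbdd⟩ :=
      IntervalLattice.exists_paraBoundedBy_of_testConst_le (𝕜 := 𝕜) hp one_lt_two
    have h' := s.testConst_lt_top (𝕜 := 𝕜) hp
    lift L.testConst p 2 (s.seq 𝕜) to ℝ≥0 using h'.ne with K hK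
    exact ⟨C * (K + 1), hbdd L _ s.isMartDiffSeq (K + 1) (by positivity) (hK ▸ by simp)⟩
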